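/- **Setting.** Let $\Lambda>0$, $0<K\le\frac13$, $\rho_H(1)>0$, $T_0\in(0,1]$, and let $s>\frac32+1$ be an integer. For $\epsilon\in\mathbb R$ let $a(t)$, $t\in(0,1]$, be the FLRW scale factor, i.e. $-t a'=a\sqrt{3/\Lambda}\sqrt{\Lambda/3+\rho_H/3}$, $a(1)=1$, with $\rho_H(t)=\rho_H(1)\,a(t)^{-3(1+\epsilon^2K)}$; put $E=ta$, $\Omega=1-\sqrt{3/\Lambda}\sqrt{\Lambda/3+\rho_H/3}$ and $\bar h^{\mu\nu}=\mathrm{diag}(-\Lambda/3,E^{-2},E^{-2},E^{-2})$ (all depending on $\epsilon$ and $t$). Latin indices run over $1,2,3$, Greek ones over $0,\dots,3$. On $\mathbb T^3=\mathbb R^3/\mathbb Z^3$ let $H^k$ be the Sobolev spaces with $\|u\|_{H^k}^2=\sum_{|\alpha|\le k}\|D^\alpha u\|_{L^2}^2$, $\bar H^k$ the subspace of maps with mean zero, $\mathbb S_3$ the symmetric $3\times3$ matrices, and $\Delta^{-1}$ the mean zero inverse of $\Delta=\delta^{ij}\partial_i\partial_j$ on mean zero functions. For $\epsilon\ne0$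 and a field $\mathfrak u^{\mu\nu}(t,x)$ near $t=T_0$, define the conformal metric $\bar g$ by $\theta\bar g^{\mu\nu}=E^3(\bar h^{\mu\nu}+\epsilon^2\mathfrak u^{\mu\nu})$, $\theta=\sqrt{\tfrac\Lambda3|\det\bar g_{\mu\nu}|}$; the geometric coordinates are $\bar x^0=t$, $\bar x^i=\epsilon x^i$, so $\hat\partial_0=\partial_t$, $\hat\partial_i=\epsilon^{-1}\partial_i$. With a density $\rho$, a conformal four-velocity $\bar v^\mu$, $\Psi=-\ln t$, $\tilde g^{\mu\nu}=e^{-2\Psi}\bar g^{\mu\nu}$, $\tilde v^\mu=e^{-\Psi}\bar v^\mu$ and $\tilde T^{\mu\nu}=(1+\epsilon^2K)\rho\tilde v^\mu\tilde v^\nu+\epsilon^2K\rho\tilde g^{\mu\nu}$, let $$\bar T^{\mu\nu}=e^{4\Psi}\tilde T^{\mu\nu}-e^{2\Psi}\Lambda\bar g^{\mu\nu}+2(\bar\nabla^\mu\bar\nabla^\nu\Psi-\bar\nabla^\mu\Psi\bar\nabla^\nu\Psi)-(2\bar\Box\Psi+|\bar\nabla\Psi|^2_{\bar g})\bar g^{\mu\nu},$$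 and let $\bar G^{\mu\nu}$ be the Einstein tensor of $\bar g$. The constraints on the slice $t=T_0$ are $$\bar G^{0\mu}=\bar T^{0\mu}\quad\text{(gravitational)},\qquad \bar g_{\mu\nu}\bar v^\mu\bar v^\nu=-1\quad\text{(velocity normalization)},$$ $$\hat\partial_\nu(E^3\mathfrak u^{\mu\nu})-\tfrac2tE^3\mathfrak u^{\mu0}-\tfrac{2\Lambda}{3t}\tfrac{\theta-E^3}{\epsilon^2}\delta^\mu_0+\tfrac{\theta-E^3}{\epsilon^2}\tfrac\Lambda t\Omega\,\delta^\mu_0=0\quad\text{(gauge)}.$$ They only involve $\rho$, $\bar v^\mu$, $\mathfrak u^{\mu\nu}$ and $\partial_t\mathfrak u^{\mu\nu}$ on the slice. Fix a sign $\tau\in\{1,-1\}$ for $\bar v^0$. For $\epsilon_0,r,R>0$ let $$X=(-\epsilon_0,\epsilon_0)\times B_r(H^{s+1}(\mathbb T^3,\mathbb S_3))\times B_R(H^{s}(\mathbb T^3,\mathbb S_3))\times B_r(\bar H^s(\mathbb T^3))\times B_R(\bar H^s(\mathbb T^3,\mathbb R^3)),$$ $B_\varrho$ denoting open balls about $0$,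 with points $(\epsilon,\mathring u^{ij},\mathring u^{ij}_0,\breve\rho_0,\breve\nu^i)$; the last four entries are the free data. **Theorem.** There is $r_0>0$ such that for all $0<r\le r_0$ and all $R>0$ there exist $\epsilon_0>0$ and real analytic maps $$\breve\phi:X\to\mathbb R,\quad\breve\psi^i:X\to\mathbb R^3,\quad \mathring u^{0\mu}:X\to\bar H^{s+1}(\mathbb T^3,\mathbb R^4),\quad \mathring u^{0\mu}_0:X\to H^{s}(\mathbb T^3,\mathbb R^4),$$ all vanishing at $(\epsilon,0,0,0,0)$ for every $|\epsilon|<\epsilon_0$, with the following properties. 1. For every point of $X$ with $\epsilon\neq0$, the data on $t=T_0$ $$\rho=\rho_H(T_0)+\breve\rho_0+\epsilon\breve\phi,\quad \bar v^i=\epsilon z^i,\quad z^i=\frac{\breve\nu^i+\breve\psi^i}{\rho_H(T_0)+\breve\rho_0+\epsilon\breve\phi},$$ $$\mathfrak u^{\mu\nu}=\begin{pmatrix}\mathring u^{00}&\mathring u^{0j}\\ \mathring u^{0i}&\epsilon\mathring u^{ij}\end{pmatrix},\quad \partial_t\mathfrak u^{\mu\nu}=\begin{pmatrix}\mathring u^{00}_0&\mathring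 u^{0j}_0\\ \mathring u^{0i}_0&\mathring u^{ij}_0\end{pmatrix}$$ satisfy $\rho>0$, $\bar g^{00}<0$, $(\bar g^{ij})$ positive definite, and, with a suitable value of $\bar v^0$ of the sign $\tau$, all the gravitational, gauge and velocity normalization constraints. 2. There is a constant $C$ with $$|\breve\phi|+|\breve\psi^i|+\|\mathring u^{0\mu}\|_{H^{s+1}}+\|\mathring u^{0\mu}_0\|_{H^s}\le C\left(\|\mathring u^{ij}\|_{H^{s+1}}+\|\mathring u^{ij}_0\|_{H^s}+\|\breve\rho_0\|_{H^s}+\|\breve\nu^i\|_{H^s}\right)\quad\text{on }X.$$ 3. On $X$, $$\breve\phi=\epsilon\mathscr S,\qquad\breve\psi^i=\epsilon\mathscr S^i,\qquad \mathring u^{00}=\frac{2\Lambda}{3T_0^2}E^2(T_0)\,\Delta^{-1}\breve\rho_0+\epsilon\,\mathscr U,\qquad \mathring u^{0i}=\epsilon\,\mathscr U^i$$ with real analytic maps $\mathscr S,\mathscr S^i,\mathscr U,\mathscr U^i$ on $X$, with values in $\mathbb R$, $\mathbb R^3$, $\bar H^{s+1}(\mathbb T^3)$, $\bar H^{s+1}(\mathbb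 T^3,\mathbb R^3)$, vanishing at $(\epsilon,0,0,0,0)$. -/

import Mathlib

open MeasureTheory
open scoped ContDiff ENNReal

namespace NewtonCosmo

noncomputable section

/-! ### Sobolev spaces on the unit torus -/

/-- The torus `ℝ³/ℤ³`. -/
abbrev T3 : Type := UnitAddTorus (Fin 3)

/-- The Lebesgue measure on the torus, of total mass one. -/
abbrev torusMeasure : Measure T3 := Measure.pi fun _ => AddCircle.haarAddCircle

/-- The projection `ℝ³ → ℝ³/ℤ³`. -/
def toTorus (y : Fin 3 → ℝ) : T3 := fun i => (y i : UnitAddCircle)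

/-- Smooth real functions on the torus: those whose periodic lift to `ℝ³` is `C^∞`. -/
def IsSmooth (φ : T3 → ℝ) : Prop := ContDiff ℝ ∞ (fun y : Fin 3 → ℝ => φ (toTorus y))

/-- Classical partial derivative on the torus in the `i`-th coordinate direction. -/
def torusPartial (i : Fin 3) (φ : T3 → ℝ) (x : T3) : ℝ :=
  deriv (fun h : ℝ => φ (x + toTorus (Pi.single i h))) 0

/-- Classical derivative `D^α = ∂₁^{α₁} ∂₂^{α₂} ∂₃^{α₃}` on the torus. -/
def torusDeriv (α : Fin 3 → ℕ) (φ : T3 → ℝ) : T3 → ℝ :=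
  (torusPartial 0)^[α 0] ((torusPartial 1)^[α 1] ((torusPartial 2)^[α 2] φ))

theorem isOpenQuotientMap_toTorus : IsOpenQuotientMap toTorus := by
  have h : ∀ _ : Fin 3, IsOpenQuotientMap (fun t : ℝ => (t : UnitAddCircle)) :=
    fun _ => QuotientAddGroup.isOpenQuotientMap_mk
  exact IsOpenQuotientMap.piMap h

theorem IsSmooth.continuous {φ : T3 → ℝ} (h : IsSmooth φ) : Continuous φ := by
  rw [isOpenQuotientMap_toTorus.isQuotientMap.continuous_iff]
  exact ContDiff.continuous h

theorem IsSmooth.torusPartial {φ : T3 → ℝ} (h : IsSmooth φ) (i : Fin 3) :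
    IsSmooth (torusPartial i φ) := by
  have key : (fun y : Fin 3 → ℝ => NewtonCosmo.torusPartial i φ (toTorus y)) =
      fun y => fderiv ℝ (fun y : Fin 3 → ℝ => φ (toTorus y)) y (Pi.single i 1) := by
    funext y
    have h1 : (fun t : ℝ => φ (toTorus y + toTorus (Pi.single i t))) =
        fun t : ℝ => (fun y : Fin 3 → ℝ => φ (toTorus y)) (y + t • (Pi.single i 1)) := by
      funext t
      congr 1
      funext j
      by_cases hj : j = i
      · subst hj; simp [toTorus]
      · simp [toTorus, Pi.single_eq_of_ne hj]
    unfold NewtonCosmo.torusPartial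
    rw [h1]
    have hd : DifferentiableAt ℝ (fun y : Fin 3 → ℝ => φ (toTorus y)) y :=
      (ContDiff.differentiable h (by simp)).differentiableAt
    exact hd.lineDeriv_eq_fderiv
  unfold IsSmooth
  rw [key]
  exact (ContDiff.fderiv_right (m := ∞) h (by simp)).clm_apply contDiff_const

theorem IsSmooth.torusDeriv {φ : T3 → ℝ} (h : IsSmooth φ) (α : Fin 3 → ℕ) :
    IsSmooth (torusDeriv α φ) := by
  have it : ∀ (i : Fin 3) (n : ℕ) (ψ : T3 → ℝ), IsSmooth ψ →
      IsSmooth ((NewtonCosmo.torusPartial i)^[n] ψ) := by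
    intro i n
    induction n with
    | zero => intro ψ hψ; exact hψ
    | succ k ih => intro ψ hψ; exact ih _ (hψ.torusPartial i)
  exact it _ _ _ (it _ _ _ (it _ _ _ h))

theorem integrable_smul {V : Type*} [NormedAddCommGroup V] [InnerProductSpace ℝ V]
    {φ : T3 → ℝ} (h : IsSmooth φ) (u : Lp V 2 torusMeasure) :
    Integrable (fun x => φ x • u x) torusMeasure := by
  have hc := h.continuous
  obtain ⟨C, hC⟩ := (isCompact_univ (X := T3)).exists_bound_of_continuousOn hc.continuousOn
  have hu : Integrable (fun x => u x) torusMeasure :=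
    (Lp.memLp u).integrable (by norm_num)
  exact hu.bdd_smul C hc.aestronglyMeasurable
    (Filter.Eventually.of_forall fun x => hC x (Set.mem_univ x))

/-- `v` is the weak derivative `D^α u`, tested against all smooth functions on the torus. -/
def IsWeakDeriv {V : Type*} [NormedAddCommGroup V] [InnerProductSpace ℝ V]
    (α : Fin 3 → ℕ) (u v : Lp V 2 torusMeasure) : Prop :=
  ∀ φ : T3 → ℝ, IsSmooth φ →
    ∫ x, torusDeriv α φ x • u x ∂torusMeasure =
      (-1 : ℝ) ^ (∑ i, α i) • ∫ x, φ x • v x ∂torusMeasure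

/-- Multi-indices with `|α| ≤ s`. -/
def multiIdx (s : ℕ) : Finset (Fin 3 → ℕ) :=
  (Fintype.piFinset fun _ => Finset.range (s + 1)).filter fun α => ∑ i, α i ≤ s

theorem mem_multiIdx {s : ℕ} {α : Fin 3 → ℕ} : α ∈ multiIdx s ↔ ∑ i, α i ≤ s := by
  simp only [multiIdx, Finset.mem_filter, Fintype.mem_piFinset, Finset.mem_range,
    and_iff_right_iff_imp]
  intro h i
  have := Finset.single_le_sum (f := α) (fun _ _ => Nat.zero_le _) (Finset.mem_univ i)
  omega

/-- The Sobolev space `H^s(T³, V)` as a subspace of a finite product of `L²` spaces. An element is an `L²` map `u` together with its weak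
derivatives `D^α u ∈ L²`, `|α| ≤ s`; the latter are determined by `u`. The norm is
`‖u‖² = ∑_{|α| ≤ s} ‖D^α u‖²_{L²}`. -/
def sobolevSubmodule (s : ℕ) (V : Type*) [NormedAddCommGroup V] [InnerProductSpace ℝ V] :
    Submodule ℝ (PiLp 2 fun _ : {α : Fin 3 → ℕ // α ∈ multiIdx s} => Lp V 2 torusMeasure) where
  carrier := {w | ∀ α, IsWeakDeriv α.1 (w ⟨0, mem_multiIdx.2 (by simp)⟩) (w α)}
  zero_mem' := by
    intro α φ _
    have h0 : (fun x => torusDeriv α.1 φ x • (0 : Lp V 2 torusMeasure) x) =ᵐ[torusMeasure] 0 := by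
      filter_upwards [Lp.coeFn_zero V 2 torusMeasure] with x hx
      rw [hx]
      simp
    have h1 : (fun x => φ x • (0 : Lp V 2 torusMeasure) x) =ᵐ[torusMeasure] 0 := by
      filter_upwards [Lp.coeFn_zero V 2 torusMeasure] with x hx
      rw [hx]
      simp
    simp only [PiLp.zero_apply]
    rw [integral_congr_ae h0, integral_congr_ae h1]
    simp
  add_mem' := by
    intro a b ha hb α φ hφ
    have hadd : ∀ (ψ : T3 → ℝ), IsSmooth ψ → ∀ f g : Lp V 2 torusMeasure,
        ∫ x, ψ x • (f + g) x ∂torusMeasure =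
          ∫ x, ψ x • f x ∂torusMeasure + ∫ x, ψ x • g x ∂torusMeasure := by
      intro ψ hψ f g
      rw [← integral_add (integrable_smul hψ f) (integrable_smul hψ g)]
      refine integral_congr_ae ?_
      filter_upwards [Lp.coeFn_add f g] with x hx
      rw [hx, Pi.add_apply, smul_add]
    simp only [PiLp.add_apply]
    rw [hadd _ (hφ.torusDeriv _), hadd _ hφ, ha α φ hφ, hb α φ hφ, smul_add]
  smul_mem' := by
    intro c a ha α φ hφ
    have hsm : ∀ (ψ : T3 → ℝ), ∀ f : Lp V 2 torusMeasure,
        ∫ x, ψ x • (c • f) x ∂torusMeasure = c • ∫ x, ψ x • f x ∂torusMeasure := by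
      intro ψ f
      rw [← integral_smul]
      refine integral_congr_ae ?_
      filter_upwards [Lp.coeFn_smul c f] with x hx
      rw [hx, Pi.smul_apply, smul_comm]
    simp only [PiLp.smul_apply]
    rw [hsm, hsm, ha α φ hφ, smul_comm]

/-- The Sobolev space `H^s(T³, V)`. -/
def Hs (s : ℕ) (V : Type*) [NormedAddCommGroup V] [InnerProductSpace ℝ V] : Type _ :=
  sobolevSubmodule s V

instance instNormedAddCommGroupHs (s : ℕ) (V : Type*) [NormedAddCommGroup V]
    [InnerProductSpace ℝ V] : NormedAddCommGroup (Hs s V) :=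
  inferInstanceAs (NormedAddCommGroup (sobolevSubmodule s V))

instance instNormedSpaceHs (s : ℕ) (V : Type*) [NormedAddCommGroup V]
    [InnerProductSpace ℝ V] : NormedSpace ℝ (Hs s V) :=
  inferInstanceAs (NormedSpace ℝ (sobolevSubmodule s V))

/-- The weak derivative `D^α u` of `u ∈ H^s` (set to `0` for `|α| > s`). -/
def weakD {V : Type*} [NormedAddCommGroup V] [InnerProductSpace ℝ V] {s : ℕ}
    (u : Hs s V) (α : Fin 3 → ℕ) : T3 → V :=
  if h : α ∈ multiIdx s then
    (u.1 ⟨α, h⟩ : Lp V 2 torusMeasure)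
  else 0

theorem weakD_of_mem {V : Type*} [NormedAddCommGroup V] [InnerProductSpace ℝ V] {s : ℕ}
    (u : Hs s V) {α : Fin 3 → ℕ} (h : α ∈ multiIdx s) :
    weakD u α = ⇑(u.1 ⟨α, h⟩ : Lp V 2 torusMeasure) := dif_pos h

/-- The subspace of `H^s(T³, V)` of maps all of whose components have mean zero. -/
def meanZeroSubmodule (s : ℕ) (V : Type*) [NormedAddCommGroup V] [InnerProductSpace ℝ V] :
    Submodule ℝ (Hs s V) where
  carrier := {u | ∫ x, weakD u 0 x ∂torusMeasure = 0}
  zero_mem' := by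
    have hm : (0 : Fin 3 → ℕ) ∈ multiIdx s := mem_multiIdx.2 (by simp)
    simp only [Set.mem_ofPred_eq, weakD_of_mem _ hm]
    have h0 : (fun x => (0 : Lp V 2 torusMeasure) x) =ᵐ[torusMeasure] 0 :=
      Lp.coeFn_zero V 2 torusMeasure
    exact (integral_congr_ae h0).trans (by simp)
  add_mem' := by
    intro a b ha hb
    have hm : (0 : Fin 3 → ℕ) ∈ multiIdx s := mem_multiIdx.2 (by simp)
    simp only [Set.mem_ofPred_eq, weakD_of_mem _ hm] at ha hb ⊢
    have hi : ∀ f : Lp V 2 torusMeasure, Integrable (fun x => f x) torusMeasure :=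
      fun f => (Lp.memLp f).integrable (by norm_num)
    have h0 : (fun x => (a.1 ⟨0, hm⟩ + b.1 ⟨0, hm⟩ : Lp V 2 torusMeasure) x) =ᵐ[torusMeasure]
        fun x => (a.1 ⟨0, hm⟩ : Lp V 2 torusMeasure) x + (b.1 ⟨0, hm⟩ : Lp V 2 torusMeasure) x :=
      Lp.coeFn_add _ _
    refine (integral_congr_ae h0).trans ?_
    rw [integral_add (hi _) (hi _), ha, hb, add_zero]
  smul_mem' := by
    intro c a ha
    have hm : (0 : Fin 3 → ℕ) ∈ multiIdx s := mem_multiIdx.2 (by simp)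
    simp only [Set.mem_ofPred_eq, weakD_of_mem _ hm] at ha ⊢
    have h0 : (fun x => (c • a.1 ⟨0, hm⟩ : Lp V 2 torusMeasure) x) =ᵐ[torusMeasure]
        fun x => c • (a.1 ⟨0, hm⟩ : Lp V 2 torusMeasure) x :=
      Lp.coeFn_smul _ _
    refine (integral_congr_ae h0).trans ?_
    rw [integral_smul, ha, smul_zero]

/-- The space `H̄^s(T³, V)` of mean zero elements of `H^s(T³, V)`. -/
def HsBar (s : ℕ) (V : Type*) [NormedAddCommGroup V] [InnerProductSpace ℝ V] : Type _ :=
  meanZeroSubmodule s V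

instance instNormedAddCommGroupHsBar (s : ℕ) (V : Type*) [NormedAddCommGroup V]
    [InnerProductSpace ℝ V] : NormedAddCommGroup (HsBar s V) :=
  inferInstanceAs (NormedAddCommGroup (meanZeroSubmodule s V))

instance instNormedSpaceHsBar (s : ℕ) (V : Type*) [NormedAddCommGroup V]
    [InnerProductSpace ℝ V] : NormedSpace ℝ (HsBar s V) :=
  inferInstanceAs (NormedSpace ℝ (meanZeroSubmodule s V))

/-- The `i`-th unit multi-index. -/
def unitIdx (i : Fin 3) : Fin 3 → ℕ := Pi.single i 1

/-- `w = Δ⁻¹ f`: `w` has mean zero and `Δ w = f`, with `Δ = δ^{ij} ∂_i ∂_j`. -/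
def IsInvLaplacian {V : Type*} [NormedAddCommGroup V] [InnerProductSpace ℝ V] {m s : ℕ}
    (w : HsBar m V) (f : HsBar s V) : Prop :=
  ∀ᵐ x ∂torusMeasure,
    ∑ i : Fin 3, weakD w.1 (unitIdx i + unitIdx i) x = weakD f.1 0 x

/-- `ℝ³`. -/
abbrev R3 : Type := EuclideanSpace ℝ (Fin 3)

/-- Symmetric `3 × 3` matrices, as a subspace of `ℝ^{3 × 3}`. -/
def symSubmodule : Submodule ℝ (EuclideanSpace ℝ (Fin 3 × Fin 3)) where
  carrier := {A | ∀ i j, A (i, j) = A (j, i)}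
  zero_mem' := by intro i j; simp
  add_mem' := by intro a b ha hb i j; simp [ha i j, hb i j]
  smul_mem' := by intro c a ha i j; simp [ha i j]

/-- Symmetric `3 × 3` matrices, with the Frobenius inner product. -/
def Sym3 : Type := symSubmodule

instance instNormedAddCommGroupSym3 : NormedAddCommGroup Sym3 :=
  inferInstanceAs (NormedAddCommGroup symSubmodule)

instance instInnerProductSpaceSym3 : InnerProductSpace ℝ Sym3 :=
  inferInstanceAs (InnerProductSpace ℝ symSubmodule)

/-- The free data `(ů^{ij}, ů₀^{ij}, ρ̆₀, ν̆^i)`. -/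
abbrev FreeData (s : ℕ) : Type :=
  Hs (s + 1) Sym3 × Hs s Sym3 × HsBar s ℝ × HsBar s R3

/-- The size of the free data. -/
def freeSize {s : ℕ} (d : FreeData s) : ℝ := ‖d.1‖ + ‖d.2.1‖ + ‖d.2.2.1‖ + ‖d.2.2.2‖

/-- Pairs `(ε, free data)` with `|ε| < ε₀`, `‖ů^{ij}‖ < r`, `‖ů₀^{ij}‖ < R`, `‖ρ̆₀‖ < r`,
`‖ν̆^i‖ < R`. -/
def dataDomain (s : ℕ) (ε₀ r R : ℝ) : Set (ℝ × FreeData s) :=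
  {q | |q.1| < ε₀ ∧ ‖q.2.1‖ < r ∧ ‖q.2.2.1‖ < R ∧ ‖q.2.2.2.1‖ < r ∧ ‖q.2.2.2.2‖ < R}

/-- `f` is a real analytic map on the domain of data. -/
def AnalyticMap {F : Type*} [NormedAddCommGroup F] [NormedSpace ℝ F] {s : ℕ} (ε₀ r R : ℝ)
    (f : ℝ × FreeData s → F) : Prop :=
  AnalyticOnNhd ℝ f (dataDomain s ε₀ r R)

/-! ### The FLRW background -/

/-- The cosmological constant, the constant `K` of the equation of state `p = ε² K ρ`, and the
homogeneous density `ρ_H(1)`. -/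
structure Params where
  Lam : ℝ
  K : ℝ
  rho1 : ℝ

def C0 (P : Params) : ℝ :=
  (√(P.Lam + P.rho1) + √P.Lam) / (√(P.Lam + P.rho1) - √P.Lam)

/-- The exponent `3 (1 + ε² K)`. -/
def expo (P : Params) (ε : ℝ) : ℝ := 3 * (1 + ε ^ 2 * P.K)

/-- The FLRW scale factor `a(t)`, in closed form. -/
def scaleFactor (P : Params) (ε t : ℝ) : ℝ :=
  ((C0 P - t ^ expo P ε) / (C0 P - 1)) ^ (2 / expo P ε) / t

/-- The FLRW density `ρ_H(t) = ρ_H(1) / a(t)^{3(1 + ε² K)}`. -/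
def rhoH (P : Params) (ε t : ℝ) : ℝ := P.rho1 / scaleFactor P ε t ^ expo P ε

/-- `E(t) = a(t) t`. -/
def Efac (P : Params) (ε t : ℝ) : ℝ := scaleFactor P ε t * t

def Omega (P : Params) (ε t : ℝ) : ℝ :=
  1 - √(3 / P.Lam) * √(P.Lam / 3 + rhoH P ε t / 3)

theorem C0_facts (P : Params) (hL : 0 < P.Lam) (hr : 0 < P.rho1) :
    1 < C0 P ∧ P.rho1 * (C0 P - 1) ^ 2 = 4 * C0 P * P.Lam := by
  have hA : √(P.Lam + P.rho1) ^ 2 = P.Lam + P.rho1 := Real.sq_sqrt (by linarith)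
  have hB : √P.Lam ^ 2 = P.Lam := Real.sq_sqrt hL.le
  have hBp : 0 < √P.Lam := Real.sqrt_pos.2 hL
  have hlt : √P.Lam < √(P.Lam + P.rho1) := Real.sqrt_lt_sqrt hL.le (by linarith)
  have hd : 0 < √(P.Lam + P.rho1) - √P.Lam := by linarith
  have e1 : C0 P - 1 = 2 * √P.Lam / (√(P.Lam + P.rho1) - √P.Lam) := by
    unfold C0; field_simp; ring
  refine ⟨?_, ?_⟩
  · have : 0 < C0 P - 1 := by rw [e1]; positivity
    linarith
  · rw [e1]
    unfold C0
    have hrho : P.rho1 = √(P.Lam + P.rho1) ^ 2 - √P.Lam ^ 2 := by rw [hA, hB]; ring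
    generalize √(P.Lam + P.rho1) = A at *
    rw [hrho, ← hB]
    rw [Real.sqrt_sq hBp.le]
    field_simp
    ring

/-- The closed form solves the Friedmann equation
`-t a' = a √(3/Λ) √(Λ/3 + ρ_H/3)`, `a(1) = 1`, on `(0, 1]`. -/
theorem scaleFactor_spec (P : Params) (hL : 0 < P.Lam) (hK : 0 ≤ P.K) (hr : 0 < P.rho1) (ε : ℝ) :
    scaleFactor P ε 1 = 1 ∧ ∀ t, 0 < t → t ≤ 1 →
      HasDerivAt (scaleFactor P ε)
        (-(scaleFactor P ε t * (√(3 / P.Lam) * √(P.Lam / 3 + rhoH P ε t / 3))) / t) t := by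
  obtain ⟨hC, hC2⟩ := C0_facts P hL hr
  have hp : 0 < expo P ε := by unfold expo; positivity
  have hC1 : 0 < C0 P - 1 := by linarith
  refine ⟨?_, ?_⟩
  · simp [scaleFactor, div_self hC1.ne']
  intro t ht ht1
  have htp : 0 < t ^ expo P ε := Real.rpow_pos_of_pos ht _
  have htp1 : t ^ expo P ε ≤ 1 := Real.rpow_le_one ht.le ht1 hp.le
  have hCt : 0 < C0 P - t ^ expo P ε := by linarith
  have hb : 0 < (C0 P - t ^ expo P ε) / (C0 P - 1) := by positivity
  have hrho : rhoH P ε t = 4 * C0 P * P.Lam * t ^ expo P ε / (C0 P - t ^ expo P ε) ^ 2 := by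
    unfold rhoH scaleFactor
    rw [Real.div_rpow (Real.rpow_nonneg hb.le _) ht.le, ← Real.rpow_mul hb.le,
      div_mul_cancel₀ _ hp.ne', Real.rpow_two, ← hC2]
    field_simp
  have hroot : √(3 / P.Lam) * √(P.Lam / 3 + rhoH P ε t / 3) =
      (C0 P + t ^ expo P ε) / (C0 P - t ^ expo P ε) := by
    rw [← Real.sqrt_mul (by positivity), hrho]
    have : 3 / P.Lam * (P.Lam / 3 +
        4 * C0 P * P.Lam * t ^ expo P ε / (C0 P - t ^ expo P ε) ^ 2 / 3) =
        ((C0 P + t ^ expo P ε) / (C0 P - t ^ expo P ε)) ^ 2 := by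
      field_simp
      ring
    rw [this, Real.sqrt_sq]
    have : 0 < C0 P := by linarith
    positivity
  rw [hroot]
  have hd1 : HasDerivAt (fun t : ℝ => (C0 P - t ^ expo P ε) / (C0 P - 1))
      (-(expo P ε * t ^ (expo P ε - 1)) / (C0 P - 1)) t :=
    ((Real.hasDerivAt_rpow_const (Or.inl ht.ne')).const_sub _).div_const _
  have hd2 := (hd1.rpow_const (p := 2 / expo P ε) (Or.inl hb.ne')).div (hasDerivAt_id t) ht.ne'
  refine HasDerivAt.congr_deriv hd2 ?_
  rw [Real.rpow_sub_one hb.ne', Real.rpow_sub_one ht.ne']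
  unfold scaleFactor
  simp only [id]
  generalize ((C0 P - t ^ expo P ε) / (C0 P - 1)) ^ (2 / expo P ε) = B
  field_simp
  ring

/-! ### Geometry in a coordinate chart of `ℝ⁴` -/

abbrev Pt : Type := Fin 4 → ℝ

abbrev Mat4 : Type := Matrix (Fin 4) (Fin 4) ℝ

/-- Partial derivative `∂̄_μ`. -/
def pd (μ : Fin 4) (f : Pt → ℝ) (y : Pt) : ℝ := fderiv ℝ f y (Pi.single μ 1)

/-- Christoffel symbols `Γ^l_{mn}` of the metric with contravariant components `g^{μν}`. -/
def christoffel (g : Pt → Mat4) (l m n : Fin 4) (y : Pt) : ℝ :=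
  1 / 2 * ∑ k, g y l k * (pd m (fun y => (g y)⁻¹ n k) y + pd n (fun y => (g y)⁻¹ m k) y
    - pd k (fun y => (g y)⁻¹ m n) y)

/-- Ricci tensor `R_{mn}`. -/
def ricci (g : Pt → Mat4) (m n : Fin 4) (y : Pt) : ℝ :=
  ∑ l, (pd l (christoffel g l m n) y - pd n (christoffel g l l m) y)
    + ∑ l, ∑ k, (christoffel g l l k y * christoffel g k m n y
      - christoffel g l n k y * christoffel g k l m y)

/-- Raising both indices of a covariant 2-tensor. -/
def raise (g : Mat4) (T : Fin 4 → Fin 4 → ℝ) (μ ν : Fin 4) : ℝ :=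
  ∑ a, ∑ b, g μ a * g ν b * T a b

/-- Trace of a covariant 2-tensor. -/
def trace (g : Mat4) (T : Fin 4 → Fin 4 → ℝ) : ℝ := ∑ a, ∑ b, g a b * T a b

/-- Einstein tensor `G^{μν} = R^{μν} - ½ R g^{μν}`. -/
def einstein (g : Pt → Mat4) (μ ν : Fin 4) (y : Pt) : ℝ :=
  raise (g y) (fun a b => ricci g a b y) μ ν
    - 1 / 2 * trace (g y) (fun a b => ricci g a b y) * g y μ ν

/-- Covariant Hessian `∇_m ∇_n f`. -/
def hess (g : Pt → Mat4) (f : Pt → ℝ) (m n : Fin 4) (y : Pt) : ℝ :=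
  pd m (pd n f) y - ∑ l, christoffel g l m n y * pd l f y

/-! ### The conformal Einstein-Euler system -/

/-- The conformal factor `Ψ = -ln t`. -/
def Psi (y : Pt) : ℝ := -Real.log (y 0)

/-- The tensor `T̄^{μν}` at a point `y` for a conformal metric field `ḡ^{μν}`, density `ρ` and
conformal four-velocity `v̄^μ` at `y`: here `ṽ^μ = e^{-Ψ} v̄^μ`, `g̃^{μν} = e^{-2Ψ} ḡ^{μν}` and
`T̃^{μν} = (ρ + p) ṽ^μ ṽ^ν + p g̃^{μν}` with `p = ε² K ρ`. -/
def stress (P : Params) (ε : ℝ) (g : Pt → Mat4) (ρ : ℝ) (v : Fin 4 → ℝ) (y : Pt)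
    (μ ν : Fin 4) : ℝ :=
  Real.exp (4 * Psi y) *
      ((ρ + ε ^ 2 * P.K * ρ) * (Real.exp (-Psi y) * v μ) * (Real.exp (-Psi y) * v ν)
        + ε ^ 2 * P.K * ρ * (Real.exp (-2 * Psi y) * g y μ ν))
    - Real.exp (2 * Psi y) * P.Lam * g y μ ν
    + 2 * (raise (g y) (fun a b => hess g Psi a b y) μ ν
        - raise (g y) (fun a b => pd a Psi y * pd b Psi y) μ ν)
    - (2 * trace (g y) (fun a b => hess g Psi a b y)
        + trace (g y) (fun a b => pd a Psi y * pd b Psi y)) * g y μ ν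

/-- The conformal background metric `h̄^{μν} = diag(-Λ/3, E⁻², E⁻², E⁻²)` at time `t`. -/
def hbar (P : Params) (ε t : ℝ) : Mat4 :=
  Matrix.diagonal (Fin.cons (-P.Lam / 3) fun _ : Fin 3 => (Efac P ε t ^ 2)⁻¹)

/-- `ĝ^{μν} = θ ḡ^{μν} = E³ (h̄^{μν} + ε² 𝔲^{μν})`. -/
def ghat (P : Params) (ε : ℝ) (U : Pt → Mat4) (y : Pt) : Mat4 :=
  Efac P ε (y 0) ^ 3 • (hbar P ε (y 0) + ε ^ 2 • U y)

/-- `θ = √(Λ/3 |ḡ|)`, expressed through `ĝ^{μν} = θ ḡ^{μν}`, see `theta_eq`. -/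
def theta (P : Params) (ε : ℝ) (U : Pt → Mat4) (y : Pt) : ℝ :=
  √(-(3 / P.Lam) * (ghat P ε U y).det)

/-- The conformal metric `ḡ^{μν}`. -/
def gbar (P : Params) (ε : ℝ) (U : Pt → Mat4) (y : Pt) : Mat4 :=
  (theta P ε U y)⁻¹ • ghat P ε U y

theorem theta_eq (P : Params) (hL : 0 < P.Lam) (ε : ℝ) (U : Pt → Mat4) (y : Pt)
    (h : (ghat P ε U y).det < 0) :
    theta P ε U y = √(P.Lam / 3 * (-((gbar P ε U y)⁻¹).det)) := by
  have hpos : 0 < -(3 / P.Lam) * (ghat P ε U y).det := by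
    have : 0 < 3 / P.Lam := by positivity
    nlinarith
  have hth : 0 < theta P ε U y := Real.sqrt_pos.2 hpos
  have hsq : theta P ε U y ^ 2 = -(3 / P.Lam) * (ghat P ε U y).det := Real.sq_sqrt hpos.le
  have key : P.Lam / 3 * (-((gbar P ε U y)⁻¹).det) = theta P ε U y ^ 2 := by
    rw [Matrix.det_nonsing_inv, Ring.inverse_eq_inv', gbar, Matrix.det_smul]
    have hdet : (ghat P ε U y).det = -(P.Lam / 3) * theta P ε U y ^ 2 := by
      rw [hsq]; field_simp
    rw [hdet, Fintype.card_fin]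
    field_simp
  rw [key, Real.sqrt_sq hth.le]

/-! ### The constraints -/

/-- The symmetric matrix with `00`-entry `a`, `0j`-entries `b` and `ij`-entries `c`. -/
def symMat (a : ℝ) (b : R3) (c : Sym3) : Mat4 :=
  Matrix.of fun μ ν => Fin.cases (Fin.cases a (fun j => b j) ν)
    (fun i => Fin.cases (b i) (fun j => c.1 (i, j)) ν) μ

/-- The point `(t, x̄) = (T₀, 0)`. -/
def basePt (T₀ : ℝ) : Pt := Fin.cons T₀ fun _ => 0

/-- The second order Taylor polynomial, in relativistic coordinates centred at a point of the
initial slice `t = T₀`, of a field `𝔲^{μν}(t, x)`, where `A α` is the value of the spatial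
derivative `D^α 𝔲` and `B α` that of `D^α ∂_t 𝔲` at that point (derivatives in the Newtonian
coordinate `x = x̄/ε`), and `W` that of `∂_t² 𝔲`. Curvature and first derivatives at the point only
depend on this polynomial. -/
def localField (T₀ ε : ℝ) (A B : (Fin 3 → ℕ) → Mat4) (W : Mat4) (y : Pt) : Mat4 :=
  A 0 + ∑ i : Fin 3, (y i.succ / ε) • A (unitIdx i)
    + (1 / 2 : ℝ) • ∑ i : Fin 3, ∑ j : Fin 3,
        (y i.succ / ε * (y j.succ / ε)) • A (unitIdx i + unitIdx j)
    + (y 0 - T₀) • (B 0 + ∑ i : Fin 3, (y i.succ / ε) • B (unitIdx i))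
    + ((y 0 - T₀) ^ 2 / 2) • W

/-- `ḡ^{00} < 0` and `(ḡ^{ij})` is positive definite at the point; in particular `ḡ` is a Lorentz
metric and `θ > 0`. -/
def IsLorentz (P : Params) (T₀ ε : ℝ) (U : Pt → Mat4) : Prop :=
  gbar P ε U (basePt T₀) 0 0 < 0 ∧
    ((gbar P ε U (basePt T₀)).submatrix (Fin.succ : Fin 3 → Fin 4) Fin.succ).PosDef

/-- `Ḡ^{0μ} = T̄^{0μ}`. -/
def GravConstraint (P : Params) (T₀ ε : ℝ) (U : Pt → Mat4) (ρ : ℝ) (v : Fin 4 → ℝ) : Prop :=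
  ∀ μ : Fin 4, einstein (gbar P ε U) 0 μ (basePt T₀) =
    stress P ε (gbar P ε U) ρ v (basePt T₀) 0 μ

/-- The gauge constraint. -/
def GaugeConstraint (P : Params) (T₀ ε : ℝ) (U : Pt → Mat4) : Prop :=
  ∀ μ : Fin 4,
    ∑ ν, pd ν (fun y => Efac P ε (y 0) ^ 3 * U y μ ν) (basePt T₀)
      - 2 / T₀ * Efac P ε T₀ ^ 3 * U (basePt T₀) μ 0
      - 2 * P.Lam / (3 * T₀) * ((theta P ε U (basePt T₀) - Efac P ε T₀ ^ 3) / ε ^ 2)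
          * (if μ = 0 then 1 else 0)
      + (theta P ε U (basePt T₀) - Efac P ε T₀ ^ 3) / ε ^ 2 * (P.Lam / T₀) * Omega P ε T₀
          * (if μ = 0 then 1 else 0) = 0

/-- `v̄^μ v̄_μ + 1 = 0`. -/
def VelNormalized (P : Params) (T₀ ε : ℝ) (U : Pt → Mat4) (v : Fin 4 → ℝ) : Prop :=
  ∑ μ, ∑ ν, (gbar P ε U (basePt T₀))⁻¹ μ ν * v μ * v ν + 1 = 0

/-- The fields on the initial slice, apart from `v̄⁰`: `u00, u0, uij` give
`𝔲|_{T₀} = (u00, u0; u0, ε uij)`, `v00, v0, vij` give `∂_t 𝔲|_{T₀} = (v00, v0; v0, vij)`, `ρ` is the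
density and `z` gives the spatial velocity `v̄^i = ε z^i`. They solve the three sets of constraints:
at almost every point there is a value of `v̄⁰`, with the sign of `τ`, for which all of them hold.
The second time derivative `W` of `𝔲` is not part of the data and drops out of `Ḡ^{0μ}`. -/
def SolvesConstraints (P : Params) (T₀ ε τ : ℝ) {s : ℕ}
    (u00 : Hs (s + 1) ℝ) (u0 : Hs (s + 1) R3) (uij : Hs (s + 1) Sym3)
    (v00 : Hs s ℝ) (v0 : Hs s R3) (vij : Hs s Sym3) (ρ : T3 → ℝ) (z : T3 → R3) : Prop :=
  ∀ᵐ x ∂torusMeasure, 0 < ρ x ∧ ∃ vt : ℝ, 0 < τ * vt ∧ ∀ W : Mat4, W.IsSymm →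
    let U := localField T₀ ε
      (fun α => symMat (weakD u00 α x) (weakD u0 α x) (ε • weakD uij α x))
      (fun α => symMat (weakD v00 α x) (weakD v0 α x) (weakD vij α x)) W
    let v : Fin 4 → ℝ := Fin.cons vt fun i : Fin 3 => ε * z x i
    IsLorentz P T₀ ε U ∧ GravConstraint P T₀ ε U (ρ x) v ∧ GaugeConstraint P T₀ ε U ∧
      VelNormalized P T₀ ε U v

end

end NewtonCosmo

open NewtonCosmo

open NewtonCosmo

/-! Scaling. The unknowns are u^{00}, w^i = u^{0i}/ε, φ and ψ^i. Together with the free data they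
form a vector (z, x), and the fields are expressed through ζ = ε(z, x). Multiplied by θ² and written
in the jets of θ ḡ^{μν}, the constraints become analytic functions of (ε, ρ̆₀, ζ) with values in
H^{s-1}. This space is a Banach algebra, because s-1 ≥ 2 > 3/2 (`exists_mul`). There is one
exception: the second spatial derivatives of u^{00} carry a factor 1/ε. They enter the energy
constraint only (`jetSp_single`), so that constraint is multiplied by ε. The gauge conditions give
∂_t u^{0μ} explicitly, and the normalization is a quadratic equation for v̄⁰
(`Background.exists_velocity`).

Linearization. Let Z be the ideal of functions T(ε,p,ζ)ζ and I the ideal of functions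
S(ε,p,ζ)(ε,ζ)ζ, with T and S analytic. Then εZ and ZZ lie in I. Modulo I the metric and its time
derivative are those of the FLRW background. The only first order perturbation left is the gradient
of u^{00}, and products of its components vanish. Hence the curvature can be computed for a diagonal
metric over the quotient ring (`jetEqn_zero_bg`, `jetEqn_succ_bg`). The Friedmann equation cancels
the background, and the differentiated gauge condition turns the momentum constraint into an
elliptic equation. With e = E(T₀), y = Ω/T₀ and v the background value of v̄⁰, the equations have
the leading form ½ e⁴ Δu^{00} = (Λ/3) T₀⁻² e⁶ ρ̆₀, ½ e⁴ Δw^i + ¼ e⁴ y ∂_i u^{00} + (Λ/6) e⁶ ∂_l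
u₀^{il} = T₀⁻² v e⁶ (ν̆^i + ψ^i).

Solution. The mean zero parts of the equations are solved for u^{00} and w^i by Δ⁻¹, and the mean
values fix φ and ψ^i. The result is a fixed point equation x = L(ε)(z,x) + S(ε,p,ζ)(ε,ζ)(z,x) in
which the x-part of L(0) squares to zero, since w depends on u^{00} and on no other unknown. The
equation is solved for a linear operator Y with x = Y(ε,p,εz)z by the analytic implicit function
theorem (`exists_implicit`).

Consequences. Since x is a bounded analytic operator applied to the data, the vanishing at zero data
and the linear estimate are immediate. At ζ = ε(z,x) the remainder is ε times an analytic family,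
and L has no φ and ψ rows; this gives the expansions. The density ρ̆₀ also enters as the unscaled
parameter p, whence the radius r₀. The rest of the dependence is through ζ, which is small when ε is
small compared with 1/(r+R). -/

namespace NewtonCosmo

noncomputable section

section

/-! ### Curvature of a conformal metric as a polynomial in formal jets. -/

section JetAlgebra

variable {𝔸 : Type*} [CommRing 𝔸] [Algebra ℝ 𝔸]

abbrev M4 (𝔸 : Type*) : Type _ := Matrix (Fin 4) (Fin 4) 𝔸

/-- With θ² a multiple of det G, Jacobi's formula gives ∂_k(θH) = θ · `jetK H (∂_k G)` for the
covariant metric θH. The factor θ cancels against θ⁻¹ when an index is raised, so θ does not occur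
in the connection or in the Ricci tensor. -/
def jetK (H Dk : M4 𝔸) : M4 𝔸 := (1 / 2 : ℝ) • ((H * Dk).trace • H) - H * Dk * H

/-- Christoffel symbols of `θ⁻¹ G`, `θ² ∝ det G`, in terms of `G`, `H = G⁻¹` and `D k = ∂_k G`. -/
def jetGam (G H : M4 𝔸) (D : Fin 4 → M4 𝔸) (l m n : Fin 4) : 𝔸 :=
  (1 / 2 : ℝ) • ∑ k, G l k * (jetK H (D m) n k + jetK H (D n) m k - jetK H (D k) m n)

def jetDH (H Dp : M4 𝔸) : M4 𝔸 := -(H * Dp * H)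

/-- The derivative `∂_p` of `jetK H (D k)`, where `Spk = ∂_p ∂_k G`. -/
def jetDK (H Dp Dk Spk : M4 𝔸) : M4 𝔸 :=
  (1 / 2 : ℝ) • (((jetDH H Dp * Dk).trace + (H * Spk).trace) • H + (H * Dk).trace • jetDH H Dp)
    - (jetDH H Dp * Dk * H + H * Spk * H + H * Dk * jetDH H Dp)

def jetDGam (G H : M4 𝔸) (D : Fin 4 → M4 𝔸) (S : Fin 4 → Fin 4 → M4 𝔸) (p l m n : Fin 4) : 𝔸 :=
  (1 / 2 : ℝ) • ∑ k, (D p l k * (jetK H (D m) n k + jetK H (D n) m k - jetK H (D k) m n)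
    + G l k * (jetDK H (D p) (D m) (S p m) n k + jetDK H (D p) (D n) (S p n) m k
      - jetDK H (D p) (D k) (S p k) m n))

def jetRic (G H : M4 𝔸) (D : Fin 4 → M4 𝔸) (S : Fin 4 → Fin 4 → M4 𝔸) : M4 𝔸 :=
  Matrix.of fun m n => ∑ l, (jetDGam G H D S l l m n - jetDGam G H D S n l l m)
    + ∑ l, ∑ k, (jetGam G H D l l k * jetGam G H D k m n
      - jetGam G H D l n k * jetGam G H D k l m)

def jetRaise (G T : M4 𝔸) : M4 𝔸 := G * T * G.transpose

def jetTrace (G T : M4 𝔸) : 𝔸 := (G * T.transpose).trace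

/-- `θ²` times the Einstein tensor of `θ⁻¹ G`. -/
def jetEin (G H : M4 𝔸) (D : Fin 4 → M4 𝔸) (S : Fin 4 → Fin 4 → M4 𝔸) : M4 𝔸 :=
  jetRaise G (jetRic G H D S) - (1 / 2 : ℝ) • (jetTrace G (jetRic G H D S) • G)

def jetQ (G : M4 𝔸) (S : Fin 4 → Fin 4 → M4 𝔸) : M4 𝔸 := ∑ l, ∑ k, G l k • S l k

/-- The gradient of the divergence of G: the entry (n, m) stands for ∂_m ∂_l G^{nl}. -/
def jetV (S : Fin 4 → Fin 4 → M4 𝔸) : M4 𝔸 := Matrix.of fun n m => ∑ l, S l m n l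

/-- Twice the part of `jetEin` that contains second derivatives. -/
def jetSp (G : M4 𝔸) (S : Fin 4 → Fin 4 → M4 𝔸) : M4 𝔸 :=
  jetQ G S + (jetV S).trace • G - jetV S * G - G * (jetV S).transpose

/-- The part of `jetDK` linear in second derivatives. Curvature is affine in the second derivatives,
so the Einstein tensor is its value at S = 0 plus a contribution built from this expression. -/
def jetHatS (H : M4 𝔸) (S : M4 𝔸) : M4 𝔸 := (1 / 2 : ℝ) • ((H * S).trace • H) - H * S * H

theorem jetDK_eq (H Dp Dk Spk : M4 𝔸) :
    jetDK H Dp Dk Spk = jetDK H Dp Dk 0 + jetHatS H Spk := by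
  simp only [jetDK, jetHatS, add_smul, smul_add, Matrix.mul_zero, Matrix.zero_mul,
    Matrix.trace_zero, add_zero]
  abel

def jetRicS (G H : M4 𝔸) (S : Fin 4 → Fin 4 → M4 𝔸) : M4 𝔸 := Matrix.of fun m n =>
  (1 / 2 : ℝ) • ∑ l, ((∑ k, G l k * (jetHatS H (S l m) n k + jetHatS H (S l n) m k
      - jetHatS H (S l k) m n))
    - ∑ k, G l k * (jetHatS H (S n l) m k + jetHatS H (S n m) l k
      - jetHatS H (S n k) l m))

theorem jetDGam_eq (G H : M4 𝔸) (D : Fin 4 → M4 𝔸) (S : Fin 4 → Fin 4 → M4 𝔸) (p l m n : Fin 4) :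
    jetDGam G H D S p l m n = jetDGam G H D 0 p l m n + (1 / 2 : ℝ) • ∑ k, G l k *
      (jetHatS H (S p m) n k + jetHatS H (S p n) m k - jetHatS H (S p k) m n) := by
  simp only [jetDGam, jetDK_eq H _ _ (S _ _), ← smul_add, ← Finset.sum_add_distrib, Matrix.add_apply,
    Pi.zero_apply]
  congr 1
  refine Finset.sum_congr rfl fun k _ => ?_
  ring

theorem jetRic_eq (G H : M4 𝔸) (D : Fin 4 → M4 𝔸) (S : Fin 4 → Fin 4 → M4 𝔸) :
    jetRic G H D S = jetRic G H D 0 + jetRicS G H S := by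
  ext m n
  simp only [jetRic, jetRicS, Matrix.add_apply, Matrix.of_apply]
  simp only [jetDGam_eq G H D S, Finset.smul_sum, smul_sub, Finset.sum_sub_distrib,
    Finset.sum_add_distrib]
  abel

/-- Contraction with G undoes one factor H in each of the contractions `e1`, `e3`, `e4`. The trace
terms of `e1` occur twice with weight one half and cancel against `e4`, which leaves the wave-type
term and two gradients of the divergence. -/
theorem jetRicS_eq (G H : M4 𝔸) (S : Fin 4 → Fin 4 → M4 𝔸) (hHG : H * G = 1)
    (hG : G.transpose = G) (hS : ∀ p k, S p k = S k p)
    (hS' : ∀ p k, (S p k).transpose = S p k) :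
    jetRicS G H S = (1 / 2 : ℝ) • (H * jetQ G S * H - H * jetV S - (H * jetV S).transpose
      - (1 / 2 : ℝ) • ((H * jetQ G S).trace • H)) := by
  have hH : H.transpose = H := by
    have h1 : H.transpose = G⁻¹.transpose := by rw [Matrix.inv_eq_left_inv hHG]
    rw [h1, Matrix.transpose_nonsing_inv, hG, Matrix.inv_eq_left_inv hHG]
  have hGH : G * H = 1 := mul_eq_one_comm.1 hHG
  have hat : ∀ p k, (jetHatS H (S p k)).transpose = jetHatS H (S p k) := fun p k => by
    simp [jetHatS, Matrix.transpose_mul, hH, hS', Matrix.mul_assoc]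
  -- the traces
  have e1 : ∀ m n, ∑ l, ∑ k, G l k * jetHatS H (S l m) n k =
      (1 / 2 : ℝ) • (H * S n m).trace - (H * jetV S) n m := by
    intro m n
    have : ∀ l, ∑ k, G l k * jetHatS H (S l m) n k =
        (1 / 2 : ℝ) • ((H * S l m).trace * (1 : M4 𝔸) n l) - (H * S l m) n l := by
      intro l
      have h1 : jetHatS H (S l m) * G = (1 / 2 : ℝ) • ((H * S l m).trace • 1) - H * S l m := by
        rw [jetHatS, Matrix.sub_mul, Matrix.smul_mul, Matrix.smul_mul, hHG, Matrix.mul_assoc,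
          hHG, Matrix.mul_one]
      have h2 := congrFun (congrFun h1 n) l
      rw [Matrix.mul_apply] at h2
      simp only [Matrix.sub_apply, Matrix.smul_apply, smul_eq_mul] at h2
      rw [← h2]
      refine Finset.sum_congr rfl fun k _ => ?_
      rw [mul_comm]
      congr 1
      exact congrFun (congrFun hG k) l
    simp only [this, Finset.sum_sub_distrib, ← Finset.smul_sum]
    congr 1
    · congr 1
      rw [Finset.sum_eq_single n]
      · simp
      · intro b _ hb; rw [Matrix.one_apply_ne hb.symm, mul_zero]
      · simp
    · simp only [Matrix.mul_apply, jetV, Matrix.of_apply, Finset.mul_sum]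
      rw [Finset.sum_comm]
  have e3 : ∀ m n, ∑ l, ∑ k, G l k * jetHatS H (S l k) m n =
      (1 / 2 : ℝ) • ((H * jetQ G S).trace * H m n) - (H * jetQ G S * H) m n := by
    intro m n
    have : (∑ l, ∑ k, G l k • jetHatS H (S l k)) =
        (1 / 2 : ℝ) • ((H * jetQ G S).trace • H) - H * jetQ G S * H := by
      simp only [jetHatS, jetQ, Matrix.mul_sum, Matrix.sum_mul, Matrix.trace_sum, smul_sub,
        Finset.sum_sub_distrib, Finset.sum_smul, Finset.smul_sum, Matrix.mul_smul,
        Matrix.smul_mul, Matrix.trace_smul]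
      congr 1
      refine Finset.sum_congr rfl fun l _ => Finset.sum_congr rfl fun k _ => ?_
      rw [smul_comm, smul_assoc]
    have := congrFun (congrFun this m) n
    simpa [Matrix.sum_apply] using this
  have e4 : ∀ m n, ∑ l, ∑ k, G l k * jetHatS H (S n m) l k = (H * S n m).trace := by
    intro m n
    have h1 : G * jetHatS H (S n m) = (1 / 2 : ℝ) • ((H * S n m).trace • 1) - S n m * H := by
      rw [jetHatS, Matrix.mul_sub, Matrix.mul_smul, Matrix.mul_smul, hGH, Matrix.mul_assoc,
        ← Matrix.mul_assoc G H, hGH, Matrix.one_mul]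
    have h2 := congrArg Matrix.trace h1
    have h3 : (G * jetHatS H (S n m)).trace = ∑ l, ∑ k, G l k * jetHatS H (S n m) l k := by
      simp only [Matrix.trace, Matrix.diag_apply, Matrix.mul_apply]
      refine Finset.sum_congr rfl fun l _ => Finset.sum_congr rfl fun k _ => ?_
      congr 1
      exact congrFun (congrFun (hat n m) l) k
    rw [← h3, h2, Matrix.trace_sub, Matrix.trace_smul, Matrix.trace_smul, Matrix.trace_one,
      Matrix.trace_mul_comm (S n m) H]
    generalize (H * S n m).trace = x
    simp only [Fintype.card_fin, smul_eq_mul]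
    -- The 4 is the trace of the identity, that is, the dimension of spacetime.
    have : (1 / 2 : ℝ) • (x * ((4 : ℕ) : 𝔸)) = (2 : ℝ) • x := by
      rw [mul_comm, ← nsmul_eq_mul, ← Nat.cast_smul_eq_nsmul ℝ, smul_smul]; norm_num
    rw [this, two_smul]; abel
  -- The bracket is antisymmetric under exchange of l and k, and it is contracted with the symmetric
  -- G.
  have e5 : ∀ m n, ∑ l, ∑ k, G l k * (jetHatS H (S n l) m k - jetHatS H (S n k) l m) = 0 := by
    intro m n
    simp only [mul_sub, Finset.sum_sub_distrib]
    rw [sub_eq_zero]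
    conv_rhs => rw [Finset.sum_comm]
    refine Finset.sum_congr rfl fun l _ => Finset.sum_congr rfl fun k _ => ?_
    congr 1
    · exact congrFun (congrFun hG k) l
    · exact congrFun (congrFun (hat n l) k) m
  ext m n
  have split : jetRicS G H S m n = (1 / 2 : ℝ) • (
      (∑ l, ∑ k, G l k * jetHatS H (S l m) n k) + (∑ l, ∑ k, G l k * jetHatS H (S l n) m k)
      - (∑ l, ∑ k, G l k * jetHatS H (S l k) m n) - (∑ l, ∑ k, G l k * jetHatS H (S n m) l k)
      - ∑ l, ∑ k, G l k * (jetHatS H (S n l) m k - jetHatS H (S n k) l m)) := by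
    simp only [jetRicS, Matrix.of_apply, ← Finset.sum_add_distrib, ← Finset.sum_sub_distrib]
    congr 1
    refine Finset.sum_congr rfl fun l _ => Finset.sum_congr rfl fun k _ => ?_
    ring
  rw [split, e1, e1, e3, e4, e5, hS m n]
  simp only [Matrix.smul_apply, Matrix.sub_apply, Matrix.transpose_apply, smul_eq_mul, sub_zero]
  congr 1
  have : ∀ x : 𝔸, (1 / 2 : ℝ) • x + (1 / 2 : ℝ) • x = x := fun x => by
    rw [← add_smul]; norm_num
  have h := this (H * S n m).trace
  linear_combination h

/-- Raising indices removes all factors H from the principal part: H Q H becomes Q, and the term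
tr(HQ) G of the Ricci tensor cancels against the same term of the scalar curvature. Thus the second
derivatives enter with coefficients that are linear in G. -/
theorem jetEin_eq (G H : M4 𝔸) (D : Fin 4 → M4 𝔸) (S : Fin 4 → Fin 4 → M4 𝔸) (hHG : H * G = 1)
    (hG : G.transpose = G) (hS : ∀ p k, S p k = S k p)
    (hS' : ∀ p k, (S p k).transpose = S p k) :
    jetEin G H D S = jetEin G H D 0 + (1 / 2 : ℝ) • jetSp G S := by
  have hGH : G * H = 1 := mul_eq_one_comm.1 hHG
  have hH : H.transpose = H := by
    have h1 : H.transpose = G⁻¹.transpose := by rw [Matrix.inv_eq_left_inv hHG]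
    rw [h1, Matrix.transpose_nonsing_inv, hG, Matrix.inv_eq_left_inv hHG]
  have hQ : (jetQ G S).transpose = jetQ G S := by
    simp only [jetQ, Matrix.transpose_sum, Matrix.transpose_smul, hS']
  have key : jetRaise G (jetRicS G H S) - (1 / 2 : ℝ) • (jetTrace G (jetRicS G H S) • G)
      = (1 / 2 : ℝ) • jetSp G S := by
    rw [jetRicS_eq G H S hHG hG hS hS']
    have r : jetRaise G ((1 / 2 : ℝ) • (H * jetQ G S * H - H * jetV S - (H * jetV S).transpose
        - (1 / 2 : ℝ) • ((H * jetQ G S).trace • H))) =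
        (1 / 2 : ℝ) • (jetQ G S - jetV S * G - G * (jetV S).transpose
          - (1 / 2 : ℝ) • ((H * jetQ G S).trace • G)) := by
      simp only [jetRaise, hG, Matrix.transpose_mul, hH, Matrix.mul_smul, Matrix.smul_mul,
        Matrix.mul_sub, Matrix.sub_mul]
      have a1 : G * (H * jetQ G S * H) * G = jetQ G S := by
        simp only [Matrix.mul_assoc, hHG, Matrix.mul_one]
        rw [← Matrix.mul_assoc, hGH, Matrix.one_mul]
      have a2 : G * (H * jetV S) * G = jetV S * G := by
        rw [← Matrix.mul_assoc, hGH, Matrix.one_mul]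
      have a3 : G * ((jetV S).transpose * H) * G = G * (jetV S).transpose := by
        simp only [Matrix.mul_assoc, hHG, Matrix.mul_one]
      have a4 : G * H * G = G := by rw [hGH, Matrix.one_mul]
      rw [a1, a2, a3, a4]
    have t : jetTrace G ((1 / 2 : ℝ) • (H * jetQ G S * H - H * jetV S - (H * jetV S).transpose
        - (1 / 2 : ℝ) • ((H * jetQ G S).trace • H))) =
        -((1 / 2 : ℝ) • (H * jetQ G S).trace) - (jetV S).trace := by
      simp only [jetTrace, Matrix.transpose_smul, Matrix.transpose_sub, Matrix.transpose_mul,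
        Matrix.transpose_transpose, hH, hQ, Matrix.mul_smul, Matrix.mul_sub, Matrix.trace_smul,
        Matrix.trace_sub]
      have a1 : (G * (H * (jetQ G S * H))).trace = (H * jetQ G S).trace := by
        rw [← Matrix.mul_assoc, hGH, Matrix.one_mul, Matrix.trace_mul_comm]
      have a2 : (G * ((jetV S).transpose * H)).trace = (jetV S).trace := by
        rw [Matrix.trace_mul_comm, Matrix.mul_assoc, hHG, Matrix.mul_one, Matrix.trace_transpose]
      have a3 : (G * (H * jetV S)).trace = (jetV S).trace := by
        rw [← Matrix.mul_assoc, hGH, Matrix.one_mul]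
      rw [a1, a2, a3, hGH, Matrix.trace_one]
      generalize (H * jetQ G S).trace = x
      simp only [Fintype.card_fin, smul_eq_mul]
      have : (1 / 2 : ℝ) • (x * ((4 : ℕ) : 𝔸)) = (2 : ℝ) • x := by
        rw [mul_comm, ← nsmul_eq_mul, ← Nat.cast_smul_eq_nsmul ℝ, smul_smul]; norm_num
      rw [this]
      simp only [smul_sub, smul_smul]
      module
    -- The two multiples ∓¼ tr(HQ) G, one from the raised Ricci tensor and one from its trace,
    -- cancel here.
    rw [r, t, jetSp]
    generalize (H * jetQ G S).trace = x
    generalize (jetV S).trace = y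
    simp only [smul_sub, smul_add, sub_smul, neg_smul, smul_neg, smul_assoc]
    abel
  have ht : jetTrace G (jetRic G H D 0 + jetRicS G H S) =
      jetTrace G (jetRic G H D 0) + jetTrace G (jetRicS G H S) := by
    simp [jetTrace, Matrix.mul_add, Matrix.transpose_add]
  have hr : jetRaise G (jetRic G H D 0 + jetRicS G H S) =
      jetRaise G (jetRic G H D 0) + jetRaise G (jetRicS G H S) := by
    simp [jetRaise, Matrix.mul_add, Matrix.add_mul]
  rw [← key]
  simp only [jetEin]
  rw [jetRic_eq G H D S, ht, hr, add_smul, smul_add]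
  abel

end JetAlgebra

end

section

/-! ### Differentiation of matrix fields and the geometric meaning of the jets. -/

section PointJets

open Filter Topology

def mpd (k : Fin 4) (M : Pt → Mat4) (y : Pt) : Mat4 :=
  Matrix.of fun a b => pd k (fun y => M y a b) y

/-- Differentiability is taken entry by entry, so that no norm on matrices has to be chosen. -/
def MDiff (M : Pt → Mat4) (y : Pt) : Prop := ∀ a b, DifferentiableAt ℝ (fun y => M y a b) y

theorem pd_mul {f g : Pt → ℝ} {y : Pt} (hf : DifferentiableAt ℝ f y) (hg : DifferentiableAt ℝ g y)
    (k : Fin 4) : pd k (fun y => f y * g y) y = pd k f y * g y + f y * pd k g y := by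
  unfold pd
  rw [fderiv_fun_mul hf hg]
  simp only [add_apply, smul_apply, smul_eq_mul]
  ring

theorem pd_add {f g : Pt → ℝ} {y : Pt} (hf : DifferentiableAt ℝ f y) (hg : DifferentiableAt ℝ g y)
    (k : Fin 4) : pd k (fun y => f y + g y) y = pd k f y + pd k g y := by
  unfold pd
  rw [fderiv_fun_add hf hg]; rfl

theorem pd_sub {f g : Pt → ℝ} {y : Pt} (hf : DifferentiableAt ℝ f y) (hg : DifferentiableAt ℝ g y)
    (k : Fin 4) : pd k (fun y => f y - g y) y = pd k f y - pd k g y := by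
  unfold pd
  rw [fderiv_fun_sub hf hg]; rfl

theorem pd_const (c : ℝ) (y : Pt) (k : Fin 4) : pd k (fun _ => c) y = 0 := by
  unfold pd
  rw [fderiv_const_apply]; rfl

theorem pd_const_mul {f : Pt → ℝ} {y : Pt} (hf : DifferentiableAt ℝ f y) (c : ℝ)
    (k : Fin 4) : pd k (fun y => c * f y) y = c * pd k f y := by
  unfold pd
  rw [fderiv_const_mul hf]; rfl

theorem pd_sum {ι : Type*} (s : Finset ι) {f : ι → Pt → ℝ} {y : Pt}
    (hf : ∀ i, DifferentiableAt ℝ (f i) y) (k : Fin 4) :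
    pd k (fun y => ∑ i ∈ s, f i y) y = ∑ i ∈ s, pd k (f i) y := by
  unfold pd
  rw [fderiv_fun_sum fun i _ => hf i]
  simp

theorem pd_congr {f g : Pt → ℝ} {y : Pt} (h : f =ᶠ[𝓝 y] g) (k : Fin 4) : pd k f y = pd k g y := by
  unfold pd
  rw [h.fderiv_eq]

theorem mpd_congr {M N : Pt → Mat4} {y : Pt} (h : M =ᶠ[𝓝 y] N) (k : Fin 4) :
    mpd k M y = mpd k N y := by
  ext a b
  exact pd_congr (h.mono fun z hz => by simp only [hz]) k

theorem MDiff.mul {M N : Pt → Mat4} {y : Pt} (hM : MDiff M y) (hN : MDiff N y) :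
    MDiff (fun y => M y * N y) y := fun a b => by
  simp only [Matrix.mul_apply]
  exact DifferentiableAt.fun_sum fun i _ => (hM a i).mul (hN i b)

theorem mpd_mul {M N : Pt → Mat4} {y : Pt} (hM : MDiff M y) (hN : MDiff N y) (k : Fin 4) :
    mpd k (fun y => M y * N y) y = mpd k M y * N y + M y * mpd k N y := by
  ext a b
  simp only [mpd, Matrix.mul_apply, Matrix.of_apply, Matrix.add_apply]
  rw [pd_sum _ fun i => (hM a i).fun_mul (hN i b), ← Finset.sum_add_distrib]
  exact Finset.sum_congr rfl fun i _ => pd_mul (hM a i) (hN i b) k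

theorem MDiff.trace {M : Pt → Mat4} {y : Pt} (hM : MDiff M y) :
    DifferentiableAt ℝ (fun y => (M y).trace) y := by
  simp only [Matrix.trace, Matrix.diag_apply]
  exact DifferentiableAt.fun_sum fun i _ => hM i i

theorem pd_trace {M : Pt → Mat4} {y : Pt} (hM : MDiff M y) (k : Fin 4) :
    pd k (fun y => (M y).trace) y = (mpd k M y).trace := by
  simp only [Matrix.trace, Matrix.diag_apply]
  rw [pd_sum _ fun i => hM i i]
  rfl

theorem MDiff.smul {f : Pt → ℝ} {M : Pt → Mat4} {y : Pt} (hf : DifferentiableAt ℝ f y)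
    (hM : MDiff M y) : MDiff (fun y => f y • M y) y := fun a b => by
  simp only [Matrix.smul_apply, smul_eq_mul]
  exact hf.mul (hM a b)

theorem mpd_smul {f : Pt → ℝ} {M : Pt → Mat4} {y : Pt} (hf : DifferentiableAt ℝ f y)
    (hM : MDiff M y) (k : Fin 4) :
    mpd k (fun y => f y • M y) y = pd k f y • M y + f y • mpd k M y := by
  ext a b
  simp only [mpd, Matrix.smul_apply, Matrix.of_apply, Matrix.add_apply, smul_eq_mul]
  exact pd_mul hf (hM a b) k

theorem MDiff.sub {M N : Pt → Mat4} {y : Pt} (hM : MDiff M y) (hN : MDiff N y) :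
    MDiff (fun y => M y - N y) y := fun a b => (hM a b).sub (hN a b)

theorem mpd_sub {M N : Pt → Mat4} {y : Pt} (hM : MDiff M y) (hN : MDiff N y) (k : Fin 4) :
    mpd k (fun y => M y - N y) y = mpd k M y - mpd k N y := by
  ext a b
  exact pd_sub (hM a b) (hN a b) k

theorem differentiable_det : Differentiable ℝ fun A : Fin 4 → Fin 4 → ℝ => (Matrix.of A).det := by
  simp only [Matrix.det_apply]
  intro A
  refine DifferentiableAt.fun_sum fun σ _ => DifferentiableAt.const_smul ?_ _
  simp only [Matrix.of_apply]
  have h : ∀ i ∈ (Finset.univ : Finset (Fin 4)),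
      ContDiff ℝ 1 (fun A : Fin 4 → Fin 4 → ℝ => A (σ i) i) := fun i _ => by fun_prop
  exact (contDiff_prod h).differentiable (by simp) A

theorem MDiff.pi {M : Pt → Mat4} {y : Pt} (hM : MDiff M y) :
    DifferentiableAt ℝ (fun y => (fun a b => M y a b : Fin 4 → Fin 4 → ℝ)) y :=
  differentiableAt_pi.2 fun a => differentiableAt_pi.2 fun b => hM a b

theorem MDiff.det {M : Pt → Mat4} {y : Pt} (hM : MDiff M y) :
    DifferentiableAt ℝ (fun y => (M y).det) y :=
  (differentiable_det _).comp y hM.pi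

/-- Jacobi's formula. It is read off along lines from det(A + tX) = det A · det(1 + tA⁻¹X), a
polynomial in t with linear coefficient tr(A⁻¹X). -/
theorem fderiv_det {A : Mat4} (hA : A.det ≠ 0) (X : Mat4) :
    fderiv ℝ (fun A : Fin 4 → Fin 4 → ℝ => (Matrix.of A).det) A X = A.det * (A⁻¹ * X).trace := by
  have hu : IsUnit A.det := isUnit_iff_ne_zero.2 hA
  have h1 : HasDerivAt (fun t : ℝ => (Matrix.of (A + t • X)).det)
      (fderiv ℝ (fun A : Fin 4 → Fin 4 → ℝ => (Matrix.of A).det) A X) 0 :=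
    (differentiable_det A).hasFDerivAt.hasLineDerivAt X
  have h2 : (fun t : ℝ => (Matrix.of (A + t • X)).det) = fun t => A.det *
      (1 + (A⁻¹ * X).trace * t +
        (Matrix.det (1 + (Polynomial.X : Polynomial ℝ) • (A⁻¹ * X).map Polynomial.C)).divX.divX.eval t
          * t ^ 2) := by
    funext t
    rw [← Matrix.det_one_add_smul, ← Matrix.det_mul, Matrix.mul_add, Matrix.mul_one,
      Matrix.mul_smul, ← Matrix.mul_assoc, Matrix.mul_nonsing_inv _ hu, Matrix.one_mul]
    rfl
  rw [h2] at h1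
  generalize
    (Matrix.det (1 + (Polynomial.X : Polynomial ℝ) • (A⁻¹ * X).map Polynomial.C)).divX.divX = p at h1
  have h3 : HasDerivAt (fun t : ℝ => A.det * (1 + (A⁻¹ * X).trace * t + p.eval t * t ^ 2))
      (A.det * (A⁻¹ * X).trace) 0 := by
    have := ((((hasDerivAt_id (0 : ℝ)).const_mul (A⁻¹ * X).trace).const_add 1).add
      ((p.hasDerivAt 0).mul ((hasDerivAt_id (0 : ℝ)).pow 2))).const_mul A.det
    refine HasDerivAt.congr_deriv this ?_
    simp
  exact h1.unique h3

theorem pd_det {M : Pt → Mat4} {y : Pt} (hM : MDiff M y) (hdet : (M y).det ≠ 0) (k : Fin 4) :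
    pd k (fun y => (M y).det) y = (M y).det * ((M y)⁻¹ * mpd k M y).trace := by
  rw [← fderiv_det hdet]
  have h := ((differentiable_det (fun a b => M y a b)).hasFDerivAt.comp y hM.pi.hasFDerivAt).fderiv
  unfold pd
  refine (congrFun (congrArg DFunLike.coe h) _).trans ?_
  rw [ContinuousLinearMap.comp_apply]
  congr 1
  ext a b
  have h2 := hasFDerivAt_pi'.1 (hasFDerivAt_pi'.1 hM.pi.hasFDerivAt a) b
  exact (congrFun (congrArg DFunLike.coe h2.fderiv) _).symm

theorem MDiff.inv {M : Pt → Mat4} {y : Pt} (hM : MDiff M y) (hdet : (M y).det ≠ 0) :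
    MDiff (fun y => (M y)⁻¹) y := fun a b => by
  simp only [Matrix.inv_def, Ring.inverse_eq_inv', Matrix.smul_apply, smul_eq_mul,
    Matrix.adjugate_apply]
  refine (hM.det.inv hdet).mul ?_
  refine MDiff.det fun c d => ?_
  simp only [Matrix.updateRow_apply]
  split_ifs
  · exact differentiableAt_const _
  · exact hM c d

theorem mpd_inv {M : Pt → Mat4} {y : Pt} (hM : MDiff M y) (hdet : (M y).det ≠ 0) (k : Fin 4) :
    mpd k (fun y => (M y)⁻¹) y = -((M y)⁻¹ * mpd k M y * (M y)⁻¹) := by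
  have hu : IsUnit (M y).det := isUnit_iff_ne_zero.2 hdet
  have hev : (fun y => M y * (M y)⁻¹) =ᶠ[𝓝 y] fun _ => 1 := by
    filter_upwards [hM.det.continuousAt.eventually_ne hdet] with z hz
    exact Matrix.mul_nonsing_inv _ (isUnit_iff_ne_zero.2 hz)
  have h := mpd_congr hev k
  rw [mpd_mul hM (hM.inv hdet)] at h
  have h0 : mpd k (fun _ => (1 : Mat4)) y = 0 := by ext a b; exact pd_const _ _ _
  rw [h0] at h
  have h2 : (M y)⁻¹ * (mpd k M y * (M y)⁻¹ + M y * mpd k (fun y => (M y)⁻¹) y) = 0 := by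
    rw [h, Matrix.mul_zero]
  rw [Matrix.mul_add, ← Matrix.mul_assoc (M y)⁻¹ (M y), Matrix.nonsing_inv_mul _ hu,
    Matrix.one_mul, ← Matrix.mul_assoc] at h2
  exact eq_neg_of_add_eq_zero_right h2

def jetsD (M : Pt → Mat4) (y : Pt) (k : Fin 4) : Mat4 := mpd k M y

def jetsS (M : Pt → Mat4) (y : Pt) (p k : Fin 4) : Mat4 := mpd p (fun y => mpd k M y) y

/-- The metric `θ⁻¹ G` with `θ = √(-c det G)`. -/
def confMetric (c : ℝ) (M : Pt → Mat4) (y : Pt) : Mat4 := (√(-c * (M y).det))⁻¹ • M y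

/-- The covariant metric is θM⁻¹; Jacobi's formula gives ∂θ = ½ θ tr(M⁻¹∂M), and the derivative of
the inverse supplies the rest. -/
theorem pd_confMetric_inv {c : ℝ} (hc : 0 < c) {M : Pt → Mat4} {y : Pt}
    (hM : ∀ᶠ z in 𝓝 y, MDiff M z) (hdet : (M y).det < 0) (k m n : Fin 4) :
    pd k (fun y => (confMetric c M y)⁻¹ m n) y =
      √(-c * (M y).det) * jetK (M y)⁻¹ (mpd k M y) m n := by
  have hM0 := hM.self_of_nhds
  have hpos : 0 < -c * (M y).det := by nlinarith
  have hev : (fun y => (confMetric c M y)⁻¹) =ᶠ[𝓝 y] fun y => √(-c * (M y).det) • (M y)⁻¹ := by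
    filter_upwards [hM0.det.continuousAt.eventually_lt_const hdet] with z hz
    have hz' : 0 < -c * (M z).det := by nlinarith
    have hs := Real.sqrt_pos.2 hz'
    have hu : IsUnit (M z).det := isUnit_iff_ne_zero.2 hz.ne
    refine Matrix.inv_eq_left_inv ?_
    rw [confMetric, Matrix.smul_mul, Matrix.mul_smul, Matrix.nonsing_inv_mul _ hu, smul_smul,
      mul_inv_cancel₀ hs.ne', one_smul]
  have hθ : DifferentiableAt ℝ (fun y => √(-c * (M y).det)) y :=
    (hM0.det.const_mul _).sqrt hpos.ne'
  have hi := hM0.inv hdet.ne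
  have h1 := congrFun (congrFun (mpd_congr hev k) m) n
  rw [mpd_smul hθ hi, mpd_inv hM0 hdet.ne] at h1
  refine h1.trans ?_
  have h2 : pd k (fun y => √(-c * (M y).det)) y =
      1 / 2 * √(-c * (M y).det) * ((M y)⁻¹ * mpd k M y).trace := by
    unfold pd
    rw [fderiv_sqrt (hM0.det.const_mul _) hpos.ne', fderiv_const_mul hM0.det]
    have h3 := pd_det hM0 hdet.ne k
    unfold pd at h3
    simp only [smul_apply, smul_eq_mul, h3]
    have hs := Real.sqrt_pos.2 hpos
    have hsq : √(-c * (M y).det) ^ 2 = -c * (M y).det := Real.sq_sqrt hpos.le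
    have hcd : c * (M y).det = -√(-c * (M y).det) ^ 2 := by rw [hsq]; ring
    generalize √(-c * (M y).det) = t at hs hcd
    field_simp
    linear_combination (-((M y)⁻¹ * mpd k M y).trace) * hcd
  rw [h2]
  simp only [jetK, Matrix.add_apply, Matrix.sub_apply, Matrix.smul_apply, Matrix.neg_apply,
    smul_eq_mul]
  ring

/-- The factor θ of the differentiated covariant metric meets the factor θ⁻¹ of the contravariant
one. -/
theorem christoffel_confMetric {c : ℝ} (hc : 0 < c) {M : Pt → Mat4} {y : Pt}
    (hM : ∀ᶠ z in 𝓝 y, MDiff M z) (hdet : (M y).det < 0) (l m n : Fin 4) :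
    christoffel (confMetric c M) l m n y = jetGam (M y) (M y)⁻¹ (jetsD M y) l m n := by
  have hs : 0 < √(-c * (M y).det) := Real.sqrt_pos.2 (by nlinarith)
  simp only [christoffel, jetGam, pd_confMetric_inv hc hM hdet, smul_eq_mul, jetsD]
  congr 1
  refine Finset.sum_congr rfl fun k _ => ?_
  simp only [confMetric, Matrix.smul_apply, smul_eq_mul]
  generalize √(-c * (M y).det) = t at hs
  field_simp

/-- The regularity used for curvature at a single point: first derivatives near the point, which are
differentiable at the point itself. -/
structure C2At (M : Pt → Mat4) (y : Pt) : Prop where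
  ev : ∀ᶠ z in 𝓝 y, MDiff M z
  d2 : ∀ k, MDiff (fun y => mpd k M y) y

theorem mdiff_jetK {M : Pt → Mat4} {y : Pt} (hM : C2At M y) (hdet : (M y).det ≠ 0) (k : Fin 4) :
    MDiff (fun y => jetK (M y)⁻¹ (mpd k M y)) y := by
  have h0 := hM.ev.self_of_nhds
  have hi := h0.inv hdet
  unfold jetK
  refine MDiff.sub (MDiff.smul (differentiableAt_const _) (MDiff.smul (hi.mul (hM.d2 k)).trace hi)) ?_
  exact (hi.mul (hM.d2 k)).mul hi

theorem mpd_jetK {M : Pt → Mat4} {y : Pt} (hM : C2At M y) (hdet : (M y).det ≠ 0) (p k : Fin 4) :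
    mpd p (fun y => jetK (M y)⁻¹ (mpd k M y)) y =
      jetDK (M y)⁻¹ (jetsD M y p) (jetsD M y k) (jetsS M y p k) := by
  have h0 := hM.ev.self_of_nhds
  have hi := h0.inv hdet
  unfold jetK jetDK
  have hHD := hi.mul (hM.d2 k)
  rw [mpd_sub (MDiff.smul (differentiableAt_const _) (MDiff.smul hHD.trace hi)) (hHD.mul hi),
    mpd_smul (differentiableAt_const _) (MDiff.smul hHD.trace hi), pd_const, zero_smul, zero_add,
    mpd_smul hHD.trace hi, pd_trace hHD, mpd_mul hHD hi, mpd_mul hi (hM.d2 k), mpd_inv h0 hdet,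
    Matrix.trace_add, Matrix.add_mul]
  rfl

theorem pd_jetGam {M : Pt → Mat4} {y : Pt} (hM : C2At M y) (hdet : (M y).det ≠ 0)
    (p l m n : Fin 4) :
    pd p (fun y => jetGam (M y) (M y)⁻¹ (jetsD M y) l m n) y =
      jetDGam (M y) (M y)⁻¹ (jetsD M y) (jetsS M y) p l m n := by
  have h0 := hM.ev.self_of_nhds
  unfold jetGam jetDGam
  simp only [smul_eq_mul, jetsD]
  have hK := fun a b c => mdiff_jetK hM hdet a b c
  have hC : ∀ k, DifferentiableAt ℝ (fun y => jetK (M y)⁻¹ (mpd m M y) n k +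
      jetK (M y)⁻¹ (mpd n M y) m k - jetK (M y)⁻¹ (mpd k M y) m n) y := fun k =>
    ((hK m n k).add (hK n m k)).sub (hK k m n)
  rw [pd_const_mul (DifferentiableAt.fun_sum fun k _ => (h0 l k).fun_mul (hC k)),
    pd_sum _ fun k => (h0 l k).fun_mul (hC k)]
  congr 1
  refine Finset.sum_congr rfl fun k _ => ?_
  rw [pd_mul (h0 l k) (hC k), pd_sub ((hK m n k).fun_add (hK n m k)) (hK k m n),
    pd_add (hK m n k) (hK n m k)]
  have e : ∀ a b c, pd p (fun y => jetK (M y)⁻¹ (mpd a M y) b c) y =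
      jetDK (M y)⁻¹ (jetsD M y p) (jetsD M y a) (jetsS M y p a) b c := fun a b c =>
    congrFun (congrFun (mpd_jetK hM hdet p a) b) c
  rw [e, e, e]
  rfl

theorem eventually_eventually_mdiff {M : Pt → Mat4} {y : Pt} (hM : C2At M y) :
    ∀ᶠ x in 𝓝 y, ∀ᶠ z in 𝓝 x, MDiff M z := eventually_eventually_nhds.2 hM.ev

theorem ricci_confMetric {c : ℝ} (hc : 0 < c) {M : Pt → Mat4} {y : Pt} (hM : C2At M y)
    (hdet : (M y).det < 0) (m n : Fin 4) :
    ricci (confMetric c M) m n y =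
      jetRic (M y) (M y)⁻¹ (jetsD M y) (jetsS M y) m n := by
  have hev : ∀ l m n, christoffel (confMetric c M) l m n =ᶠ[𝓝 y]
      fun y => jetGam (M y) (M y)⁻¹ (jetsD M y) l m n := fun l m n => by
    filter_upwards [eventually_eventually_mdiff hM,
      hM.ev.self_of_nhds.det.continuousAt.eventually_lt_const hdet] with z h1 h2
    exact christoffel_confMetric hc h1 h2 l m n
  simp only [ricci, jetRic, Matrix.of_apply, pd_congr (hev _ _ _), pd_jetGam hM hdet.ne,
    christoffel_confMetric hc hM.ev hdet]

theorem raise_smul (a : ℝ) (G T : Mat4) (μ ν : Fin 4) :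
    raise (a • G) (fun m n => T m n) μ ν = a ^ 2 * jetRaise G T μ ν := by
  simp only [raise, jetRaise, Matrix.mul_apply, Matrix.smul_apply, smul_eq_mul,
    Matrix.transpose_apply, Finset.mul_sum, Finset.sum_mul]
  rw [Finset.sum_comm]
  refine Finset.sum_congr rfl fun i _ => Finset.sum_congr rfl fun j _ => ?_
  ring

theorem trace_smul_eq (a : ℝ) (G T : Mat4) :
    trace (a • G) (fun m n => T m n) = a * jetTrace G T := by
  simp only [trace, jetTrace, Matrix.trace, Matrix.diag_apply, Matrix.mul_apply, Matrix.smul_apply,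
    smul_eq_mul, Matrix.transpose_apply, Finset.mul_sum, mul_assoc]

/-- The Ricci tensor of θ⁻¹M is free of θ, so raising two indices produces exactly θ⁻². -/
theorem einstein_confMetric {c : ℝ} (hc : 0 < c) {M : Pt → Mat4} {y : Pt} (hM : C2At M y)
    (hdet : (M y).det < 0) (μ ν : Fin 4) :
    √(-c * (M y).det) ^ 2 * einstein (confMetric c M) μ ν y =
      jetEin (M y) (M y)⁻¹ (jetsD M y) (jetsS M y) μ ν := by
  have hs : 0 < √(-c * (M y).det) := Real.sqrt_pos.2 (by nlinarith)
  simp only [einstein, ricci_confMetric hc hM hdet]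
  rw [show confMetric c M y = (√(-c * (M y).det))⁻¹ • M y from rfl, raise_smul, trace_smul_eq]
  simp only [jetEin, Matrix.sub_apply, Matrix.smul_apply, smul_eq_mul]
  generalize √(-c * (M y).det) = t at hs
  field_simp

end PointJets

/-! ### The stress tensor in terms of jets. -/

section JetStress

variable {𝔸 : Type*} [CommRing 𝔸] [Algebra ℝ 𝔸]

/-- Covariant Hessian of `-ln t`, with `τ = 1/t`. -/
def jetHess (τ : ℝ) (G H : M4 𝔸) (D : Fin 4 → M4 𝔸) : M4 𝔸 :=
  Matrix.of fun m n => τ • jetGam G H D 0 m n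

/-- `θ²` times the tensor `T̄^{μν}`; `κ = ε² K`, `τ = 1/t`. -/
def jetStress (τ κ Λ : ℝ) (G H : M4 𝔸) (D : Fin 4 → M4 𝔸) (θ ρ : 𝔸) (v : Fin 4 → 𝔸) : M4 𝔸 :=
  (τ ^ 2 * (1 + κ)) • (θ ^ 2 * ρ) • Matrix.of (fun μ ν => v μ * v ν)
    + τ ^ 2 • (θ * (κ • ρ - algebraMap ℝ 𝔸 Λ)) • G
    + (2 : ℝ) • jetRaise G (jetHess τ G H D)
    - (2 : ℝ) • jetTrace G (jetHess τ G H D) • G - (3 * τ ^ 2) • G 0 0 • G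

end JetStress

theorem pd_Psi {y : Pt} (hy : 0 < y 0) (n : Fin 4) :
    pd n Psi y = if n = 0 then -(y 0)⁻¹ else 0 := by
  have h0 : HasFDerivAt (fun y : Pt => y 0) (ContinuousLinearMap.proj 0) y :=
    (ContinuousLinearMap.proj (R := ℝ) (φ := fun _ : Fin 4 => ℝ) 0).hasFDerivAt
  have h : HasFDerivAt Psi (-((y 0)⁻¹ • ContinuousLinearMap.proj (R := ℝ) (φ := fun _ : Fin 4 => ℝ) 0)) y :=
    (h0.log hy.ne').neg
  unfold pd
  rw [h.fderiv]
  by_cases hn : n = 0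
  · subst hn; simp
  · simp [hn]

theorem pd_pd_Psi {y : Pt} (hy : 0 < y 0) (m n : Fin 4) :
    pd m (pd n Psi) y = if m = 0 ∧ n = 0 then ((y 0)⁻¹) ^ 2 else 0 := by
  have hc : Continuous fun z : Pt => z 0 := continuous_apply 0
  have hev : pd n Psi =ᶠ[nhds y] fun z => if n = 0 then -(z 0)⁻¹ else 0 := by
    filter_upwards [hc.continuousAt.eventually_const_lt hy] with z hz
    exact pd_Psi hz n
  rw [pd_congr hev]
  by_cases hn : n = 0
  · subst hn
    simp only [if_true, and_true]
    have h0 : HasFDerivAt (fun y : Pt => y 0) (ContinuousLinearMap.proj 0) y :=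
      (ContinuousLinearMap.proj (R := ℝ) (φ := fun _ : Fin 4 => ℝ) 0).hasFDerivAt
    have h := ((hasDerivAt_inv hy.ne').comp_hasFDerivAt y h0).neg
    unfold pd
    have h' := h.fderiv
    simp only [Function.comp_def] at h'
    refine (congrFun (congrArg DFunLike.coe h') _).trans ?_
    by_cases hm : m = 0
    · subst hm; simp
    · simp [hm]
  · simp only [hn, if_false, and_false]
    exact pd_const _ _ _

/-- For Ψ = -ln t the second partial derivatives coincide with the products of the first ones: both
equal t⁻² in the 00 slot and vanish elsewhere. What remains of the Hessian is the connection term.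
-/
theorem hess_confMetric {c : ℝ} (hc : 0 < c) {M : Pt → Mat4} {y : Pt} (hM : C2At M y)
    (hdet : (M y).det < 0) (hy : 0 < y 0) (m n : Fin 4) :
    hess (confMetric c M) Psi m n y = pd m Psi y * pd n Psi y
      + jetHess (y 0)⁻¹ (M y) (M y)⁻¹ (jetsD M y) m n := by
  rw [hess, pd_pd_Psi hy]
  simp only [pd_Psi hy, christoffel_confMetric hc hM.ev hdet, jetHess, Matrix.of_apply, smul_eq_mul]
  rw [Finset.sum_eq_single 0]
  · by_cases h0 : m = 0 <;> by_cases h1 : n = 0 <;> simp [h0, h1] <;> ring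
  · intro b _ hb; simp [hb]
  · simp

/-- The terms ∂Ψ∂Ψ cancel between the Hessian and the subtracted square of the gradient. In the
trace part they add up, twice from the Hessian and once from the norm, to the coefficient 3 of t⁻²
G^{00}. -/
theorem stress_confMetric (P : Params) (ε : ℝ) {c : ℝ} (hc : 0 < c) {M : Pt → Mat4} {y : Pt}
    (hM : C2At M y) (hdet : (M y).det < 0) (hy : 0 < y 0) (ρ : ℝ) (v : Fin 4 → ℝ) (μ ν : Fin 4) :
    √(-c * (M y).det) ^ 2 * stress P ε (confMetric c M) ρ v y μ ν =
      jetStress (y 0)⁻¹ (ε ^ 2 * P.K) P.Lam (M y) (M y)⁻¹ (jetsD M y) (√(-c * (M y).det)) ρ v μ ν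
      := by
  have hs : 0 < √(-c * (M y).det) := Real.sqrt_pos.2 (by nlinarith)
  have hexp : ∀ a : ℝ, Real.exp (a * Psi y) = (y 0) ^ (-a) := fun a => by
    rw [Real.rpow_def_of_pos hy, Psi]; congr 1; ring
  have e4 : Real.exp (4 * Psi y) = ((y 0)⁻¹) ^ 4 := by
    rw [hexp, Real.rpow_neg hy.le, inv_pow]; norm_cast
  have e2 : Real.exp (2 * Psi y) = ((y 0)⁻¹) ^ 2 := by
    rw [hexp, Real.rpow_neg hy.le, inv_pow]; norm_cast
  have e2' : Real.exp (-2 * Psi y) = (y 0) ^ 2 := by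
    rw [hexp, neg_neg]; norm_cast
  have e1 : Real.exp (-Psi y) = y 0 := by
    rw [Psi, neg_neg, Real.exp_log hy]
  have hh : (fun a b => hess (confMetric c M) Psi a b y) = fun a b =>
      (Matrix.of (fun a b => pd a Psi y * pd b Psi y) +
        jetHess (y 0)⁻¹ (M y) (M y)⁻¹ (jetsD M y) : Mat4) a b := by
    funext a b; exact hess_confMetric hc hM hdet hy a b
  have hΨ' : (fun a b => pd a Psi y * pd b Psi y) = fun a b =>
      (Matrix.of (fun a b => pd a Psi y * pd b Psi y) : Mat4) a b := rfl
  unfold stress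
  rw [hh, hΨ']
  rw [e4, e2, e2', e1, show confMetric c M y = (√(-c * (M y).det))⁻¹ • M y from rfl, raise_smul,
    trace_smul_eq, raise_smul, trace_smul_eq]
  have hof : ∀ A : Mat4, (Matrix.of fun a b => A a b) = A := fun _ => rfl
  set N : Mat4 := Matrix.of (fun a b => pd a Psi y * pd b Psi y) with hN
  set J := jetHess (y 0)⁻¹ (M y) (M y)⁻¹ (jetsD M y)
  have hr : jetRaise (M y) (N + J) = jetRaise (M y) N + jetRaise (M y) J := by
    simp [jetRaise, Matrix.mul_add, Matrix.add_mul]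
  have ht : jetTrace (M y) (N + J) = jetTrace (M y) N + jetTrace (M y) J := by
    simp [jetTrace, Matrix.mul_add, Matrix.transpose_add]
  have htN : jetTrace (M y) N = ((y 0)⁻¹) ^ 2 * M y 0 0 := by
    simp only [jetTrace, hN, pd_Psi hy, Matrix.trace, Matrix.diag_apply, Matrix.mul_apply,
      Matrix.transpose_apply, Matrix.of_apply]
    rw [Finset.sum_eq_single 0, Finset.sum_eq_single 0]
    · simp; ring
    · intro b _ hb; simp [hb]
    · simp
    · intro b _ hb; simp [hb]
    · simp
  rw [hof N, hr, ht, htN]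
  simp only [jetStress, Matrix.add_apply, Matrix.sub_apply, Matrix.smul_apply, smul_eq_mul,
    Matrix.of_apply, Algebra.algebraMap_self, RingHom.id_apply]
  rw [← show J = jetHess (y 0)⁻¹ (M y) (M y)⁻¹ (jetsD M y) from rfl]
  generalize jetRaise (M y) N μ ν = a
  generalize jetRaise (M y) J μ ν = b
  generalize √(-c * (M y).det) = t at hs
  field_simp
  ring

end

section

/-! ### Taylor polynomials at a point of the initial slice. -/

section LocalJets

open Filter Topology

theorem pd_coord (k j : Fin 4) (y : Pt) : pd k (fun y : Pt => y j) y = if j = k then 1 else 0 := by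
  have h : HasFDerivAt (fun y : Pt => y j)
      (ContinuousLinearMap.proj (R := ℝ) (φ := fun _ : Fin 4 => ℝ) j) y :=
    (ContinuousLinearMap.proj (R := ℝ) (φ := fun _ : Fin 4 => ℝ) j).hasFDerivAt
  unfold pd
  rw [h.fderiv]
  simp [Pi.single_apply]

theorem pd_time {φ : ℝ → ℝ} {y : Pt} (h : DifferentiableAt ℝ φ (y 0)) (k : Fin 4) :
    pd k (fun y => φ (y 0)) y = if k = 0 then deriv φ (y 0) else 0 := by
  have h0 : HasFDerivAt (fun y : Pt => y 0)
      (ContinuousLinearMap.proj (R := ℝ) (φ := fun _ : Fin 4 => ℝ) 0) y :=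
    (ContinuousLinearMap.proj (R := ℝ) (φ := fun _ : Fin 4 => ℝ) 0).hasFDerivAt
  have h1 := (h.hasDerivAt.comp_hasFDerivAt y h0).fderiv
  unfold pd
  refine (congrFun (congrArg DFunLike.coe h1) _).trans ?_
  by_cases hk : k = 0
  · subst hk; simp
  · simp [hk]

/-- Second order Taylor polynomial in one time variable and three rescaled space variables. -/
def taylor2 (T₀ ε a : ℝ) (a1 : Fin 3 → ℝ) (a2 : Fin 3 → Fin 3 → ℝ) (b : ℝ) (b1 : Fin 3 → ℝ)
    (w : ℝ) (y : Pt) : ℝ :=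
  a + ∑ i : Fin 3, (y i.succ / ε) * a1 i
    + (1 / 2 : ℝ) * ∑ i : Fin 3, ∑ j : Fin 3, (y i.succ / ε * (y j.succ / ε)) * a2 i j
    + (y 0 - T₀) * (b + ∑ i : Fin 3, (y i.succ / ε) * b1 i)
    + ((y 0 - T₀) ^ 2 / 2) * w

theorem localField_apply (T₀ ε : ℝ) (A B : (Fin 3 → ℕ) → Mat4) (W : Mat4) (y : Pt) (μ ν : Fin 4) :
    localField T₀ ε A B W y μ ν = taylor2 T₀ ε (A 0 μ ν) (fun i => A (unitIdx i) μ ν)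
      (fun i j => A (unitIdx i + unitIdx j) μ ν) (B 0 μ ν) (fun i => B (unitIdx i) μ ν) (W μ ν) y := by
  simp [localField, taylor2, Matrix.sum_apply, mul_add]

theorem differentiable_taylor2 (T₀ ε a : ℝ) (a1 : Fin 3 → ℝ) (a2 : Fin 3 → Fin 3 → ℝ) (b : ℝ)
    (b1 : Fin 3 → ℝ) (w : ℝ) : Differentiable ℝ (taylor2 T₀ ε a a1 a2 b b1 w) := by
  unfold taylor2; fun_prop

theorem taylor2_eq (T₀ ε a : ℝ) (a1 : Fin 3 → ℝ) (a2 : Fin 3 → Fin 3 → ℝ) (b : ℝ)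
    (b1 : Fin 3 → ℝ) (w : ℝ) : taylor2 T₀ ε a a1 a2 b b1 w = fun y =>
    a + (y 1 / ε * a1 0 + y 2 / ε * a1 1 + y 3 / ε * a1 2)
    + 1 / 2 * (y 1 / ε * (y 1 / ε) * a2 0 0 + y 1 / ε * (y 2 / ε) * a2 0 1
        + y 1 / ε * (y 3 / ε) * a2 0 2
      + (y 2 / ε * (y 1 / ε) * a2 1 0 + y 2 / ε * (y 2 / ε) * a2 1 1 + y 2 / ε * (y 3 / ε) * a2 1 2)
      + (y 3 / ε * (y 1 / ε) * a2 2 0 + y 3 / ε * (y 2 / ε) * a2 2 1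
        + y 3 / ε * (y 3 / ε) * a2 2 2))
    + (y 0 - T₀) * (b + (y 1 / ε * b1 0 + y 2 / ε * b1 1 + y 3 / ε * b1 2))
    + (y 0 - T₀) * (y 0 - T₀) * (w / 2) := by
  funext y
  simp only [taylor2, Fin.sum_univ_three]
  have e1 : (0 : Fin 3).succ = (1 : Fin 4) := rfl
  have e2 : (1 : Fin 3).succ = (2 : Fin 4) := rfl
  have e3 : (2 : Fin 3).succ = (3 : Fin 4) := rfl
  rw [e1, e2, e3]
  ring

/-- Partial derivatives of these polynomials are again of the form `taylor2`, so second derivatives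
are obtained by applying this lemma and `pd_taylor2_succ` repeatedly. -/
theorem pd_taylor2_zero (T₀ ε a : ℝ) (a1 : Fin 3 → ℝ) (a2 : Fin 3 → Fin 3 → ℝ) (b : ℝ)
    (b1 : Fin 3 → ℝ) (w : ℝ) :
    pd 0 (taylor2 T₀ ε a a1 a2 b b1 w) = taylor2 T₀ ε b b1 0 w 0 0 := by
  funext y
  rw [taylor2_eq, taylor2_eq]
  simp (disch := fun_prop) only [pd_add, pd_mul, pd_const, pd_coord, pd_sub, div_eq_mul_inv]
  simp
  ring

theorem pd_taylor2_succ (T₀ ε a : ℝ) (a1 : Fin 3 → ℝ) (a2 : Fin 3 → Fin 3 → ℝ) (b : ℝ)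
    (b1 : Fin 3 → ℝ) (w : ℝ) (k : Fin 3) (ha : ∀ i j, a2 i j = a2 j i) :
    pd k.succ (taylor2 T₀ ε a a1 a2 b b1 w) =
      taylor2 T₀ ε (a1 k / ε) (fun j => a2 k j / ε) 0 (b1 k / ε) 0 0 := by
  funext y
  rw [taylor2_eq, taylor2_eq]
  simp (disch := fun_prop) only [pd_add, pd_mul, pd_const, pd_coord, pd_sub, div_eq_mul_inv]
  fin_cases k
  · simp [ha 1 0, ha 2 0]; ring
  · simp [ha 1 0, ha 2 1]; ring
  · simp [ha 2 0, ha 2 1]; ring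

theorem taylor2_base (T₀ ε a : ℝ) (a1 : Fin 3 → ℝ) (a2 : Fin 3 → Fin 3 → ℝ) (b : ℝ)
    (b1 : Fin 3 → ℝ) (w : ℝ) : taylor2 T₀ ε a a1 a2 b b1 w (basePt T₀) = a := by
  simp [taylor2, basePt]

theorem Efac_pos (P : Params) (hL : 0 < P.Lam) (hK : 0 ≤ P.K) (hr : 0 < P.rho1) (ε : ℝ) {t : ℝ}
    (ht : 0 < t) (ht1 : t ≤ 1) : 0 < Efac P ε t := by
  have hC := (C0_facts P hL hr).1
  have hp : 0 < expo P ε := by unfold expo; positivity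
  have htp1 : t ^ expo P ε ≤ 1 := Real.rpow_le_one ht.le ht1 hp.le
  have hb : 0 < (C0 P - t ^ expo P ε) / (C0 P - 1) := div_pos (by linarith) (by linarith)
  unfold Efac scaleFactor
  have := Real.rpow_pos_of_pos hb (2 / expo P ε)
  positivity

theorem contDiffAt_Efac (P : Params) (hL : 0 < P.Lam) (hK : 0 ≤ P.K) (hr : 0 < P.rho1) (ε : ℝ)
    {t : ℝ} (ht : 0 < t) (ht1 : t ≤ 1) : ContDiffAt ℝ 2 (Efac P ε) t := by
  have hC := (C0_facts P hL hr).1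
  have hp : 0 < expo P ε := by unfold expo; positivity
  have htp1 : t ^ expo P ε ≤ 1 := Real.rpow_le_one ht.le ht1 hp.le
  have hb : 0 < (C0 P - t ^ expo P ε) / (C0 P - 1) := div_pos (by linarith) (by linarith)
  unfold Efac scaleFactor
  have h1 : ContDiffAt ℝ 2 (fun t : ℝ => (C0 P - t ^ expo P ε) / (C0 P - 1)) t :=
    (contDiffAt_const.sub (Real.contDiffAt_rpow_const_of_ne ht.ne')).div_const _
  exact ((h1.rpow_const_of_ne hb.ne').div contDiffAt_id ht.ne').mul contDiffAt_id

/-- From (ta)' = a + ta' and the Friedmann equation for a. -/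
theorem deriv_Efac (P : Params) (hL : 0 < P.Lam) (hK : 0 ≤ P.K) (hr : 0 < P.rho1) (ε : ℝ)
    {t : ℝ} (ht : 0 < t) (ht1 : t ≤ 1) : deriv (Efac P ε) t = Efac P ε t * Omega P ε t / t := by
  have h := ((scaleFactor_spec P hL hK hr ε).2 t ht ht1).mul (hasDerivAt_id t)
  have h2 : deriv (Efac P ε) t = _ := h.deriv
  rw [h2]
  simp only [id, Efac, Omega]
  field_simp
  ring

theorem pd_zero_field {β γ : ℝ → ℝ} {u : Pt → ℝ} {y : Pt} (hβ : DifferentiableAt ℝ β (y 0))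
    (hγ : DifferentiableAt ℝ γ (y 0)) (hu : Differentiable ℝ u) (c : ℝ) :
    pd 0 (fun y => β (y 0) + c * (γ (y 0) * u y)) y =
      deriv β (y 0) + c * (deriv γ (y 0) * u y + γ (y 0) * pd 0 u y) := by
  have h1 : DifferentiableAt ℝ (fun y : Pt => β (y 0)) y := hβ.comp y (differentiableAt_apply 0 y)
  have h2 : DifferentiableAt ℝ (fun y : Pt => γ (y 0)) y := hγ.comp y (differentiableAt_apply 0 y)
  rw [pd_add h1 ((h2.fun_mul (hu y)).const_mul c), pd_const_mul (h2.fun_mul (hu y)),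
    pd_mul h2 (hu y), pd_time hβ, pd_time hγ]
  simp

theorem pd_succ_field {β γ : ℝ → ℝ} {u : Pt → ℝ} {y : Pt} (hβ : DifferentiableAt ℝ β (y 0))
    (hγ : DifferentiableAt ℝ γ (y 0)) (hu : Differentiable ℝ u) (c : ℝ) (k : Fin 3) :
    pd k.succ (fun y => β (y 0) + c * (γ (y 0) * u y)) y = c * (γ (y 0) * pd k.succ u y) := by
  have h1 : DifferentiableAt ℝ (fun y : Pt => β (y 0)) y := hβ.comp y (differentiableAt_apply 0 y)
  have h2 : DifferentiableAt ℝ (fun y : Pt => γ (y 0)) y := hγ.comp y (differentiableAt_apply 0 y)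
  rw [pd_add h1 ((h2.fun_mul (hu y)).const_mul c), pd_const_mul (h2.fun_mul (hu y)),
    pd_mul h2 (hu y), pd_time hβ, pd_time hγ]
  simp

theorem tendsto_time (T₀ : ℝ) : Filter.Tendsto (fun y : Pt => y 0) (𝓝 (basePt T₀)) (𝓝 T₀) := by
  have : Continuous fun y : Pt => y 0 := continuous_apply 0
  simpa [basePt] using this.tendsto (basePt T₀)

/-- A matrix field of the form `β(t) + c γ(t) u`. -/
structure FieldData where
  β : Fin 4 → Fin 4 → ℝ → ℝ
  γ : ℝ → ℝ
  T₀ : ℝ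
  ε : ℝ
  A : (Fin 3 → ℕ) → Mat4
  B : (Fin 3 → ℕ) → Mat4
  W : Mat4

namespace FieldData

variable (F : FieldData)

def tay (a b : Fin 4) : Pt → ℝ := taylor2 F.T₀ F.ε (F.A 0 a b) (fun i => F.A (unitIdx i) a b)
      (fun i j => F.A (unitIdx i + unitIdx j) a b) (F.B 0 a b) (fun i => F.B (unitIdx i) a b) (F.W a b)

def field (y : Pt) : Mat4 := Matrix.of fun a b =>
  F.β a b (y 0) + F.ε ^ 2 * (F.γ (y 0) * F.tay a b y)

structure Reg : Prop where
  hβ : ∀ a b, ∀ᶠ t in 𝓝 F.T₀, DifferentiableAt ℝ (F.β a b) t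
  hγ : ∀ᶠ t in 𝓝 F.T₀, DifferentiableAt ℝ F.γ t
  hβ' : ∀ a b, DifferentiableAt ℝ (deriv (F.β a b)) F.T₀
  hγ' : DifferentiableAt ℝ (deriv F.γ) F.T₀

end FieldData

end LocalJets

end

section

/-! ### Jets of the perturbed metric density at the base point, with their powers of ε. -/

section LocalJets

open Filter Topology

namespace FieldData

theorem tay_differentiable (F : FieldData) (a b : Fin 4) : Differentiable ℝ (F.tay a b) :=
  differentiable_taylor2 _ _ _ _ _ _ _ _

theorem pd_succ_tay (F : FieldData) (a b : Fin 4) (k : Fin 3) : pd k.succ (F.tay a b) =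
    taylor2 F.T₀ F.ε (F.A (unitIdx k) a b / F.ε) (fun j => F.A (unitIdx k + unitIdx j) a b / F.ε) 0
      (F.B (unitIdx k) a b / F.ε) 0 0 :=
  pd_taylor2_succ _ _ _ _ _ _ _ _ _ fun i j => by rw [add_comm]

theorem mpd_zero (F : FieldData) (h : F.Reg) : mpd 0 F.field =ᶠ[𝓝 (basePt F.T₀)] fun y =>
    Matrix.of fun a b => deriv (F.β a b) (y 0) + F.ε ^ 2 * (deriv F.γ (y 0) * F.tay a b y
      + F.γ (y 0) * pd 0 (F.tay a b) y) := by
  have h1 := (tendsto_time F.T₀).eventually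
    (eventually_all.2 fun a => eventually_all.2 fun b => h.hβ a b)
  filter_upwards [h1, (tendsto_time F.T₀).eventually h.hγ] with y h1 h2
  ext a b
  exact pd_zero_field (h1 a b) h2 (F.tay_differentiable a b) _

theorem mpd_succ (F : FieldData) (h : F.Reg) (k : Fin 3) :
    mpd k.succ F.field =ᶠ[𝓝 (basePt F.T₀)] fun y =>
    Matrix.of fun a b => F.ε ^ 2 * (F.γ (y 0) * pd k.succ (F.tay a b) y) := by
  have h1 := (tendsto_time F.T₀).eventually
    (eventually_all.2 fun a => eventually_all.2 fun b => h.hβ a b)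
  filter_upwards [h1, (tendsto_time F.T₀).eventually h.hγ] with y h1 h2
  ext a b
  exact pd_succ_field (h1 a b) h2 (F.tay_differentiable a b) _ k

theorem mdiff_congr {M N : Pt → Mat4} {y : Pt} (h : M =ᶠ[𝓝 y] N) (hN : MDiff N y) : MDiff M y :=
  fun a b => (hN a b).congr_of_eventuallyEq (h.mono fun z hz => by simp only [hz])

theorem differentiableAt_time {T₀ : ℝ} (φ : ℝ → ℝ) (hφ : DifferentiableAt ℝ φ T₀) :
    DifferentiableAt ℝ (fun y : Pt => φ (y 0)) (basePt T₀) :=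
  DifferentiableAt.comp (g := φ) (f := fun y : Pt => y 0) (basePt T₀)
    (by simpa [basePt] using hφ) (differentiableAt_apply 0 _)

theorem c2At (F : FieldData) (h : F.Reg) : C2At F.field (basePt F.T₀) := by
  constructor
  · have h1 := (tendsto_time F.T₀).eventually
      (eventually_all.2 fun a => eventually_all.2 fun b => h.hβ a b)
    filter_upwards [h1, (tendsto_time F.T₀).eventually h.hγ] with y h1 h2
    intro a b
    exact ((h1 a b).comp y (differentiableAt_apply 0 y)).add
      (((h2.comp y (differentiableAt_apply 0 y)).mul (F.tay_differentiable a b y)).const_mul _)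
  · have e0 := differentiableAt_time (T₀ := F.T₀)
    intro k
    refine Fin.cases ?_ (fun k => ?_) k
    · refine mdiff_congr (F.mpd_zero h) fun a b => ?_
      simp only [Matrix.of_apply]
      have hu : Differentiable ℝ (pd 0 (F.tay a b)) := by
        rw [tay, pd_taylor2_zero]; exact differentiable_taylor2 _ _ _ _ _ _ _ _
      exact (e0 _ (h.hβ' a b)).add ((((e0 _ h.hγ').mul (F.tay_differentiable a b _)).add
        ((e0 _ h.hγ.self_of_nhds).mul (hu _))).const_mul _)
    · refine mdiff_congr (F.mpd_succ h k) fun a b => ?_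
      simp only [Matrix.of_apply]
      have hu : Differentiable ℝ (pd k.succ (F.tay a b)) := by
        rw [pd_succ_tay]; exact differentiable_taylor2 _ _ _ _ _ _ _ _
      exact ((e0 _ h.hγ.self_of_nhds).mul (hu _)).const_mul _

theorem field_base (F : FieldData) : F.field (basePt F.T₀) =
    (Matrix.of fun a b => F.β a b F.T₀) + (F.ε ^ 2 * F.γ F.T₀) • F.A 0 := by
  ext a b
  simp [field, tay, taylor2_base]
  simp [basePt]
  ring

theorem jetsD_zero (F : FieldData) (h : F.Reg) : jetsD F.field (basePt F.T₀) 0 =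
    (Matrix.of fun a b => deriv (F.β a b) F.T₀)
      + F.ε ^ 2 • (deriv F.γ F.T₀ • F.A 0 + F.γ F.T₀ • F.B 0) := by
  rw [jetsD, (F.mpd_zero h).self_of_nhds]
  ext a b
  simp [tay, pd_taylor2_zero, taylor2_base]
  simp [basePt, mul_add]

/-- Power counting: each spatial derivative costs ε⁻¹ against the prefactor ε² of the perturbation.
First spatial derivatives are therefore of order ε, mixed second derivatives of order ε, and second
spatial derivatives of order one (`jetsS_succ_succ`). -/
theorem jetsD_succ (F : FieldData) (h : F.Reg) (hε : F.ε ≠ 0) (k : Fin 3) :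
    jetsD F.field (basePt F.T₀) k.succ = (F.ε * F.γ F.T₀) • F.A (unitIdx k) := by
  rw [jetsD, (F.mpd_succ h k).self_of_nhds]
  ext a b
  simp only [pd_succ_tay, taylor2_base, Matrix.of_apply, Matrix.smul_apply, smul_eq_mul]
  simp only [basePt, Fin.cons_zero]
  field_simp

theorem jetsS_zero_succ (F : FieldData) (h : F.Reg) (hε : F.ε ≠ 0) (k : Fin 3) :
    jetsS F.field (basePt F.T₀) 0 k.succ =
      F.ε • (deriv F.γ F.T₀ • F.A (unitIdx k) + F.γ F.T₀ • F.B (unitIdx k)) := by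
  rw [jetsS, mpd_congr (F.mpd_succ h k)]
  ext a b
  have hu : Differentiable ℝ (pd k.succ (F.tay a b)) := by
    rw [pd_succ_tay]; exact differentiable_taylor2 _ _ _ _ _ _ _ _
  have hγ : DifferentiableAt ℝ F.γ (basePt F.T₀ 0) := by
    simpa [basePt] using h.hγ.self_of_nhds
  have := pd_zero_field (β := fun _ => 0) (differentiableAt_const _) hγ hu (F.ε ^ 2)
  simp only [zero_add, deriv_const] at this
  simp only [mpd, Matrix.of_apply]
  rw [this]
  simp only [pd_succ_tay, pd_taylor2_zero, taylor2_base, Matrix.smul_apply, smul_eq_mul,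
    Matrix.add_apply]
  simp only [basePt, Fin.cons_zero]
  field_simp

theorem jetsS_succ_succ (F : FieldData) (h : F.Reg) (hε : F.ε ≠ 0) (k l : Fin 3) :
    jetsS F.field (basePt F.T₀) k.succ l.succ = F.γ F.T₀ • F.A (unitIdx k + unitIdx l) := by
  rw [jetsS, mpd_congr (F.mpd_succ h l)]
  ext a b
  have hu : Differentiable ℝ (pd l.succ (F.tay a b)) := by
    rw [pd_succ_tay]; exact differentiable_taylor2 _ _ _ _ _ _ _ _
  have hγ : DifferentiableAt ℝ F.γ (basePt F.T₀ 0) := by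
    simpa [basePt] using h.hγ.self_of_nhds
  have := pd_succ_field (β := fun _ => 0) (differentiableAt_const _) hγ hu (F.ε ^ 2) k
  simp only [zero_add] at this
  simp only [mpd, Matrix.of_apply]
  rw [this, pd_succ_tay, pd_taylor2_succ _ _ _ _ _ _ _ _ _ (fun i j => rfl)]
  simp only [taylor2_base, Matrix.smul_apply, smul_eq_mul]
  simp only [basePt, Fin.cons_zero, add_comm (unitIdx l)]
  field_simp

theorem jetsS_succ_zero (F : FieldData) (h : F.Reg) (hε : F.ε ≠ 0) (k : Fin 3) :
    jetsS F.field (basePt F.T₀) k.succ 0 =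
      F.ε • (deriv F.γ F.T₀ • F.A (unitIdx k) + F.γ F.T₀ • F.B (unitIdx k)) := by
  rw [jetsS, mpd_congr (F.mpd_zero h)]
  ext a b
  have hu : Differentiable ℝ (pd 0 (F.tay a b)) := by
    rw [tay, pd_taylor2_zero]; exact differentiable_taylor2 _ _ _ _ _ _ _ _
  have h0 : basePt F.T₀ 0 = F.T₀ := by simp [basePt]
  have hγ : DifferentiableAt ℝ F.γ (basePt F.T₀ 0) := by
    rw [h0]; exact h.hγ.self_of_nhds
  have hγ' : DifferentiableAt ℝ (deriv F.γ) (basePt F.T₀ 0) := by rw [h0]; exact h.hγ'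
  have hβ' : DifferentiableAt ℝ (deriv (F.β a b)) (basePt F.T₀ 0) := by rw [h0]; exact h.hβ' a b
  have e1 := pd_succ_field hβ' hγ' (F.tay_differentiable a b) (F.ε ^ 2) k
  have e2 := pd_succ_field (β := fun _ => 0) (differentiableAt_const _) hγ hu (F.ε ^ 2) k
  have d1 : DifferentiableAt ℝ (fun y : Pt => deriv (F.β a b) (y 0) +
      F.ε ^ 2 * (deriv F.γ (y 0) * F.tay a b y)) (basePt F.T₀) :=
    (differentiableAt_time _ (h.hβ' a b)).add
      (((differentiableAt_time _ h.hγ').mul (F.tay_differentiable a b _)).const_mul _)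
  have d2 : DifferentiableAt ℝ (fun y : Pt => 0 +
      F.ε ^ 2 * (F.γ (y 0) * pd 0 (F.tay a b) y)) (basePt F.T₀) :=
    (differentiableAt_const _).add
      (((differentiableAt_time _ h.hγ.self_of_nhds).mul (hu _)).const_mul _)
  have e3 := pd_add d1 d2 k.succ
  simp only [mpd, Matrix.of_apply]
  have e4 : (fun y : Pt => deriv (F.β a b) (y 0) + F.ε ^ 2 * (deriv F.γ (y 0) * F.tay a b y +
      F.γ (y 0) * pd 0 (F.tay a b) y)) = fun y => (deriv (F.β a b) (y 0) +
      F.ε ^ 2 * (deriv F.γ (y 0) * F.tay a b y)) + (0 + F.ε ^ 2 *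
      (F.γ (y 0) * pd 0 (F.tay a b) y)) := by
    funext y; ring
  rw [e4, e3, e1, e2, pd_succ_tay, tay, pd_taylor2_zero,
    pd_taylor2_succ _ _ _ _ _ _ _ _ _ (fun i j => rfl)]
  simp only [taylor2_base, Matrix.smul_apply, smul_eq_mul, h0, Matrix.add_apply]
  field_simp

end FieldData

theorem jetsD_transpose {M : Pt → Mat4} (hM : ∀ y, (M y).transpose = M y) (y : Pt) (k : Fin 4) :
    (jetsD M y k).transpose = jetsD M y k := by
  ext a b
  have : (fun y => M y b a) = fun y => M y a b := by
    funext z; exact congrFun (congrFun (hM z) a) b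
  simp only [jetsD, mpd, Matrix.transpose_apply, Matrix.of_apply, this]

theorem jetsS_transpose {M : Pt → Mat4} (hM : ∀ y, (M y).transpose = M y) (y : Pt) (p k : Fin 4) :
    (jetsS M y p k).transpose = jetsS M y p k := by
  have := jetsD_transpose (M := fun y => mpd k M y) (fun y => jetsD_transpose hM y k) y p
  exact this

end LocalJets

end

section

/-! ### The constraints at a point as algebraic conditions on jets. -/

section PointwiseConstraints

open Filter Topology

/-- The background density E³ h̄^{μν} simplified to diag(-(Λ/3)E³, E, E, E), which uses E ≠ 0; `bgD`
is its time derivative. -/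
def bgG (Λ e : ℝ) : Mat4 := Matrix.diagonal (Fin.cons (-(Λ / 3) * e ^ 3) fun _ => e)

def bgD (Λ e e' : ℝ) : Mat4 := Matrix.diagonal (Fin.cons (-Λ * e ^ 2 * e') fun _ => e')

def ghatData (P : Params) (T₀ ε : ℝ) (A B : (Fin 3 → ℕ) → Mat4) (W : Mat4) : FieldData where
  β a b t := (Efac P ε t ^ 3 • hbar P ε t) a b
  γ t := Efac P ε t ^ 3
  T₀ := T₀
  ε := ε
  A := A
  B := B
  W := W

theorem ghatData_field (P : Params) (T₀ ε : ℝ) (A B : (Fin 3 → ℕ) → Mat4) (W : Mat4) :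
    (ghatData P T₀ ε A B W).field = ghat P ε (localField T₀ ε A B W) := by
  funext y
  ext a b
  simp only [FieldData.field, ghatData, FieldData.tay, ghat, Matrix.of_apply, Matrix.smul_apply,
    Matrix.add_apply, smul_eq_mul, localField_apply]
  ring

theorem ghat_bg_eventually (P : Params) (hL : 0 < P.Lam) (hK : 0 ≤ P.K) (hr : 0 < P.rho1) (ε : ℝ)
    {T₀ : ℝ} (ht : 0 < T₀) (ht1 : T₀ ≤ 1) (a b : Fin 4) :
    (fun t => (Efac P ε t ^ 3 • hbar P ε t) a b) =ᶠ[𝓝 T₀] fun t => bgG P.Lam (Efac P ε t) a b := by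
  have hc : ContinuousAt (Efac P ε) T₀ := (contDiffAt_Efac P hL hK hr ε ht ht1).continuousAt
  filter_upwards [hc.eventually_const_lt (Efac_pos P hL hK hr ε ht ht1)] with t hpos
  simp only [hbar, bgG, Matrix.smul_apply, smul_eq_mul, Matrix.diagonal_apply]
  split_ifs with h
  · refine Fin.cases ?_ (fun i => ?_) a
    · simp only [Fin.cons_zero]; ring
    · simp only [Fin.cons_succ]; field_simp
  · simp

theorem hasDerivAt_bgG {Λ : ℝ} {E : ℝ → ℝ} {e' t : ℝ} (h : HasDerivAt E e' t) (a b : Fin 4) :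
    HasDerivAt (fun t => bgG Λ (E t) a b) (bgD Λ (E t) e' a b) t := by
  simp only [bgG, bgD, Matrix.diagonal_apply]
  split_ifs with hab
  · refine Fin.cases ?_ (fun i => ?_) a
    · simp only [Fin.cons_zero]
      refine ((h.pow 3).const_mul (-(Λ / 3))).congr_deriv ?_
      push_cast; ring
    · simpa only [Fin.cons_succ] using h
  · exact hasDerivAt_const _ _

theorem ghatData_reg (P : Params) (ε : ℝ) {T₀ : ℝ} (hL : 0 < P.Lam) (hK : 0 ≤ P.K) (hr : 0 < P.rho1) (ht : 0 < T₀) (ht1 : T₀ ≤ 1)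
    (A B : (Fin 3 → ℕ) → Mat4) (W : Mat4) : (ghatData P T₀ ε A B W).Reg := by
  have hE := contDiffAt_Efac P hL hK hr ε ht ht1
  have hreg : ∀ f : ℝ → ℝ, ContDiffAt ℝ 2 f T₀ → (∀ᶠ t in 𝓝 T₀, DifferentiableAt ℝ f t) ∧
      DifferentiableAt ℝ (deriv f) T₀ := fun f hf => by
    refine ⟨(hf.eventually (by simp)).mono fun t h => h.differentiableAt (by simp), ?_⟩
    have h1 : ContDiffAt ℝ 1 (fderiv ℝ f) T₀ := hf.fderiv_right (by norm_num)
    have h2 : DifferentiableAt ℝ (fun t => fderiv ℝ f t 1) T₀ :=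
      (h1.differentiableAt (by simp)).clm_apply (differentiableAt_const _)
    exact h2
  have hb : ∀ a b, ContDiffAt ℝ 2 (fun t => (Efac P ε t ^ 3 • hbar P ε t) a b) T₀ := fun a b => by
    refine ContDiffAt.congr_of_eventuallyEq ?_ (ghat_bg_eventually P hL hK hr ε ht ht1 a b)
    simp only [bgG, Matrix.diagonal_apply]
    split_ifs with h
    · refine Fin.cases ?_ (fun i => ?_) a
      · simp only [Fin.cons_zero]; exact contDiffAt_const.mul (hE.pow 3)
      · simpa only [Fin.cons_succ] using hE
    · exact contDiffAt_const
  exact ⟨fun a b => (hreg _ (hb a b)).1, (hreg _ (hE.pow 3)).1, fun a b => (hreg _ (hb a b)).2,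
    (hreg _ (hE.pow 3)).2⟩

theorem ghatData_jets (P : Params) (ε : ℝ) {T₀ : ℝ} (hL : 0 < P.Lam) (hK : 0 ≤ P.K)
    (hr : 0 < P.rho1) (ht : 0 < T₀) (ht1 : T₀ ≤ 1) :
    (∀ a b, (Efac P ε T₀ ^ 3 • hbar P ε T₀) a b = bgG P.Lam (Efac P ε T₀) a b) ∧
    (∀ a b, deriv (fun t => (Efac P ε t ^ 3 • hbar P ε t) a b) T₀ =
      bgD P.Lam (Efac P ε T₀) (Efac P ε T₀ * Omega P ε T₀ / T₀) a b) ∧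
    deriv (fun t => Efac P ε t ^ 3) T₀ =
      3 * Efac P ε T₀ ^ 2 * (Efac P ε T₀ * Omega P ε T₀ / T₀) := by
  have hE : HasDerivAt (Efac P ε) (Efac P ε T₀ * Omega P ε T₀ / T₀) T₀ := by
    rw [← deriv_Efac P hL hK hr ε ht ht1]
    exact ((contDiffAt_Efac P hL hK hr ε ht ht1).differentiableAt (by simp)).hasDerivAt
  refine ⟨fun a b => (ghat_bg_eventually P hL hK hr ε ht ht1 a b).self_of_nhds, fun a b => ?_, ?_⟩
  · rw [(ghat_bg_eventually P hL hK hr ε ht ht1 a b).deriv_eq]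
    exact (hasDerivAt_bgG hE a b).deriv
  · rw [(hE.fun_pow 3).deriv]
    push_cast; ring

section Jets

variable {𝔸 : Type*} [CommRing 𝔸]

/-- Second derivatives without the purely temporal ones. -/
def secondJets (S0 : Fin 3 → M4 𝔸) (S1 : Fin 3 → Fin 3 → M4 𝔸) (p k : Fin 4) : M4 𝔸 :=
  Fin.cases (Fin.cases 0 (fun k => S0 k) k) (fun p => Fin.cases (S0 p) (fun k => S1 p k) k) p

/-- The Einstein tensor has no second time derivatives in its 0μ components. The contribution
G^{00}∂_t²G^{0μ} of the wave part cancels against the transposed divergence term, and the trace term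
cancels against the other one; both use the symmetry of ∂_t²G. -/
theorem jetSp_congr {G : M4 𝔸} {S S' : Fin 4 → Fin 4 → M4 𝔸}
    (h : ∀ p k, (p ≠ 0 ∨ k ≠ 0) → S p k = S' p k) (hS : (S 0 0).transpose = S 0 0)
    (hS' : (S' 0 0).transpose = S' 0 0) (μ : Fin 4) : jetSp G S 0 μ = jetSp G S' 0 μ := by
  have e1 : S 0 0 0 μ = S 0 0 μ 0 := congrFun (congrFun hS μ) 0
  have e2 : S' 0 0 0 μ = S' 0 0 μ 0 := congrFun (congrFun hS' μ) 0
  simp only [jetSp, jetQ, jetV, Matrix.trace, Matrix.diag_apply, Matrix.sub_apply, Matrix.add_apply,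
    Matrix.smul_apply, Matrix.mul_apply, Matrix.of_apply, Matrix.transpose_apply,
    Fin.sum_univ_four, smul_eq_mul]
  rw [h 0 1 (by simp), h 0 2 (by simp), h 0 3 (by simp), h 1 0 (by simp), h 1 1 (by simp),
    h 1 2 (by simp), h 1 3 (by simp), h 2 0 (by simp), h 2 1 (by simp), h 2 2 (by simp),
    h 2 3 (by simp), h 3 0 (by simp), h 3 1 (by simp), h 3 2 (by simp), h 3 3 (by simp), e1, e2]
  ring

end Jets

/-- The constraints at a point in terms of the jets `A`, `B` of `𝔲` and `∂_t 𝔲`. -/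
theorem constraints_of_jets (P : Params) {T₀ ε : ℝ} (hL : 0 < P.Lam) (hK : 0 ≤ P.K)
    (hr : 0 < P.rho1) (ht : 0 < T₀) (ht1 : T₀ ≤ 1) (hε : ε ≠ 0)
    (A B : (Fin 3 → ℕ) → Mat4) (W : Mat4) (hA : ∀ α, (A α).transpose = A α)
    (hB : ∀ α, (B α).transpose = B α) (hW : W.transpose = W) (ρ : ℝ) (v : Fin 4 → ℝ)
    {e e' : ℝ} (he : e = Efac P ε T₀) (he' : e' = e * Omega P ε T₀ / T₀)
    {G H : Mat4} {D : Fin 4 → Mat4} {S : Fin 4 → Fin 4 → Mat4} {θ : ℝ}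
    (hG : G = bgG P.Lam e + (ε ^ 2 * e ^ 3) • A 0)
    (hD0 : D 0 = bgD P.Lam e e' + ε ^ 2 • ((3 * e ^ 2 * e') • A 0 + e ^ 3 • B 0))
    (hDk : ∀ k : Fin 3, D k.succ = (ε * e ^ 3) • A (unitIdx k))
    (hS : S = secondJets (fun k => ε • ((3 * e ^ 2 * e') • A (unitIdx k) + e ^ 3 • B (unitIdx k)))
      (fun k l => e ^ 3 • A (unitIdx k + unitIdx l)))
    (hH : H * G = 1) (hdet : G.det < 0) (hθ : 0 < θ) (hθ2 : θ ^ 2 = -(3 / P.Lam) * G.det)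
    (h00 : G 0 0 < 0)
    (hpd : (G.submatrix (Fin.succ : Fin 3 → Fin 4) Fin.succ).PosDef)
    (hgrav : ∀ μ, (jetEin G H D 0 + (1 / 2 : ℝ) • jetSp G S
      - jetStress T₀⁻¹ (ε ^ 2 * P.K) P.Lam G H D θ ρ v) 0 μ = 0)
    (hgauge0 : (3 * e ^ 2 * e' - 2 / T₀ * e ^ 3) * A 0 0 0 + e ^ 3 * B 0 0 0
      + e ^ 3 / ε * ∑ k, A (unitIdx k) 0 k.succ
      - (2 * P.Lam / (3 * T₀) - P.Lam / T₀ * Omega P ε T₀) * ((θ - e ^ 3) / ε ^ 2) = 0)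
    (hgauge : ∀ i : Fin 3, (3 * e ^ 2 * e' - 2 / T₀ * e ^ 3) * A 0 i.succ 0 + e ^ 3 * B 0 i.succ 0
      + e ^ 3 / ε * ∑ k, A (unitIdx k) i.succ k.succ = 0)
    (hvel : θ * ∑ μ, ∑ ν, H μ ν * v μ * v ν + 1 = 0) :
    IsLorentz P T₀ ε (localField T₀ ε A B W) ∧
      GravConstraint P T₀ ε (localField T₀ ε A B W) ρ v ∧
      GaugeConstraint P T₀ ε (localField T₀ ε A B W) ∧
      VelNormalized P T₀ ε (localField T₀ ε A B W) v := by
  set U := localField T₀ ε A B W with hU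
  set F := ghatData P T₀ ε A B W with hF
  have hreg : F.Reg := ghatData_reg P ε hL hK hr ht ht1 A B W
  obtain ⟨j1, j2, j3⟩ := ghatData_jets P ε hL hK hr ht ht1
  have j1' : ∀ a b, F.β a b F.T₀ = bgG P.Lam e a b := fun a b => (j1 a b).trans (by rw [he])
  rw [← he] at j2 j3
  rw [← he'] at j2 j3
  have hc : (0 : ℝ) < 3 / P.Lam := by positivity
  have hfield : F.field = ghat P ε U := ghatData_field P T₀ ε A B W
  have hε' : F.ε ≠ 0 := hε
  have hGb : ghat P ε U (basePt T₀) = G := by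
    rw [← hfield, hG]
    refine F.field_base.trans ?_
    congr 1
    · ext a b; exact j1' a b
    · rw [he]; rfl
  have hc2 : C2At (ghat P ε U) (basePt T₀) := hfield ▸ F.c2At hreg
  have hD : jetsD (ghat P ε U) (basePt T₀) = D := by
    rw [← hfield]
    funext k
    refine Fin.cases ?_ (fun k => ?_) k
    · refine (F.jetsD_zero hreg).trans ?_
      rw [hD0]
      congr 1
      · ext a b; exact j2 a b
      · have : deriv F.γ F.T₀ = 3 * e ^ 2 * e' := j3
        rw [this, he]; rfl
    · refine (F.jetsD_succ hreg hε' k).trans ?_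
      rw [hDk, he]; rfl
  have hGt : G.transpose = G := by
    rw [hG, Matrix.transpose_add, Matrix.transpose_smul, hA, bgG, Matrix.diagonal_transpose]
  have hsymm : ∀ y, (ghat P ε U y).transpose = ghat P ε U y := fun y => by
    have hUt : (U y).transpose = U y := by
      simp only [hU, localField, Matrix.transpose_add, Matrix.transpose_smul, Matrix.transpose_sum,
        hA, hB, hW]
    rw [ghat, Matrix.transpose_smul, Matrix.transpose_add, Matrix.transpose_smul, hUt, hbar,
      Matrix.diagonal_transpose]
  have hSj : ∀ p k, (p ≠ 0 ∨ k ≠ 0) → jetsS (ghat P ε U) (basePt T₀) p k = S p k := by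
    rw [← hfield, hS]
    have hg : F.γ F.T₀ = e ^ 3 := by rw [he]; rfl
    have hg' : deriv F.γ F.T₀ = 3 * e ^ 2 * e' := j3
    intro p k
    refine Fin.cases ?_ (fun p => ?_) p <;> refine Fin.cases ?_ (fun k => ?_) k
    · intro h; simp at h
    · intro _; refine (F.jetsS_zero_succ hreg hε' k).trans ?_; rw [hg, hg']; rfl
    · intro _; refine (F.jetsS_succ_zero hreg hε' p).trans ?_; rw [hg, hg']; rfl
    · intro _; refine (F.jetsS_succ_succ hreg hε' p k).trans ?_; rw [hg]; rfl
  have hθeq : √(-(3 / P.Lam) * G.det) = θ := by rw [← hθ2, Real.sqrt_sq hθ.le]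
  have hθU : theta P ε U (basePt T₀) = θ := by rw [theta, hGb, hθeq]
  have hbar_eq : gbar P ε U = confMetric (3 / P.Lam) (ghat P ε U) := rfl
  have hgb : gbar P ε U (basePt T₀) = θ⁻¹ • G := by rw [gbar, hθU, hGb]
  have hHi : G⁻¹ = H := Matrix.inv_eq_left_inv hH
  have h0 : basePt T₀ 0 = T₀ := by simp [basePt]
  have hiT : 0 < θ⁻¹ := inv_pos.2 hθ
  refine ⟨⟨?_, ?_⟩, ?_, ?_, ?_⟩
  · rw [hgb, Matrix.smul_apply, smul_eq_mul]
    exact mul_neg_of_pos_of_neg hiT h00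
  · rw [hgb]
    exact hpd.smul hiT
  · intro μ
    have hdet' : (ghat P ε U (basePt T₀)).det < 0 := by rw [hGb]; exact hdet
    have e1 := einstein_confMetric hc hc2 hdet' 0 μ
    have e2 := stress_confMetric P ε hc hc2 hdet' (by rw [h0]; exact ht) ρ v 0 μ
    rw [hGb, hθeq, hD, hHi] at e1 e2
    rw [h0] at e2
    have hST := jetsS_transpose hsymm (basePt T₀)
    have hScomm : ∀ p k, jetsS (ghat P ε U) (basePt T₀) p k = jetsS (ghat P ε U) (basePt T₀) k p := by
      intro p k
      by_cases h : p ≠ 0 ∨ k ≠ 0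
      · rw [hSj p k h, hSj k p h.symm, hS]
        refine Fin.cases ?_ (fun p => ?_) p <;> refine Fin.cases ?_ (fun k => ?_) k
        · rfl
        · rfl
        · rfl
        · simp only [secondJets, Fin.cases_succ, add_comm]
      · push Not at h
        rw [h.1, h.2]
    have hS00 : (S 0 0).transpose = S 0 0 := by rw [hS]; simp [secondJets]
    -- Here the second time derivative `W` disappears: the true second jets are replaced by `S`,
    -- whose purely temporal entry may be any symmetric matrix.
    rw [jetEin_eq G H D _ hH hGt hScomm hST, Matrix.add_apply, Matrix.smul_apply,
      jetSp_congr hSj (hST 0 0) hS00 μ] at e1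
    have e3 := hgrav μ
    rw [Matrix.sub_apply, Matrix.add_apply, Matrix.smul_apply] at e3
    rw [hbar_eq]
    have hθ0 : θ ^ 2 ≠ 0 := by positivity
    -- Both tensors were computed after multiplication by θ².
    exact mul_left_cancel₀ hθ0 (by rw [e1, e2]; linarith)
  · intro μ
    have hdE : DifferentiableAt ℝ (fun t => Efac P ε t ^ 3) T₀ :=
      ((contDiffAt_Efac P hL hK hr ε ht ht1).pow 3).differentiableAt (by simp)
    have p0 : ∀ a b, pd 0 (fun y => Efac P ε (y 0) ^ 3 * U y a b) (basePt T₀) =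
        3 * e ^ 2 * e' * A 0 a b + e ^ 3 * B 0 a b := by
      intro a b
      have := pd_zero_field (y := basePt T₀) (β := fun _ => 0) (γ := fun t => Efac P ε t ^ 3)
        (differentiableAt_const _) (by rw [h0]; exact hdE) (F.tay_differentiable a b) 1
      simp only [zero_add, one_mul, deriv_const] at this
      simp only [hU, localField_apply]
      refine this.trans ?_
      rw [h0, j3, FieldData.tay, pd_taylor2_zero, hF]
      simp only [ghatData, taylor2_base, he]
    have pk : ∀ (k : Fin 3) a b, pd k.succ (fun y => Efac P ε (y 0) ^ 3 * U y a b) (basePt T₀) =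
        e ^ 3 / ε * A (unitIdx k) a b := by
      intro k a b
      have := pd_succ_field (y := basePt T₀) (β := fun _ => 0) (γ := fun t => Efac P ε t ^ 3)
        (differentiableAt_const _) (by rw [h0]; exact hdE) (F.tay_differentiable a b) 1 k
      simp only [zero_add, one_mul] at this
      simp only [hU, localField_apply]
      refine this.trans ?_
      rw [h0, FieldData.pd_succ_tay, hF]
      simp only [ghatData, taylor2_base, he]
      ring
    have hU0 : ∀ a b, U (basePt T₀) a b = A 0 a b := fun a b => by
      rw [hU, localField_apply, taylor2_base]
    rw [Fin.sum_univ_succ, p0, hθU, hU0, ← he]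
    simp only [pk, ← Finset.mul_sum]
    refine Fin.cases ?_ (fun i => ?_) μ
    · simp only [if_true]
      linear_combination hgauge0
    · simp only [Fin.succ_ne_zero, if_false]
      linear_combination hgauge i
  · have : (gbar P ε U (basePt T₀))⁻¹ = θ • H := by
      rw [hgb]
      refine Matrix.inv_eq_left_inv ?_
      rw [Matrix.smul_mul, Matrix.mul_smul, hH, smul_smul, mul_inv_cancel₀ hθ.ne', one_smul]
    rw [VelNormalized, this, ← hvel]
    simp only [Matrix.smul_apply, smul_eq_mul, Finset.mul_sum, mul_assoc]

end PointwiseConstraints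

end

section

/-! ### Curvature jets of a diagonal metric with diagonal first derivatives. -/

section DiagonalJets

variable {𝔸 : Type*} [CommRing 𝔸] [Algebra ℝ 𝔸]

/-- `c_k(a) = ½ ∑_b u_k(b) - u_k(a)`, where `u_k = G⁻¹ ∂_k G` for a diagonal `G`. -/
def diagC (u : Fin 4 → Fin 4 → 𝔸) (k a : Fin 4) : 𝔸 := (1 / 2 : ℝ) • (∑ b, u k b) - u k a

/-- The value of h_a⁻¹ ∂_p(h_a c_k(a)) when the second derivatives of G are set to zero; see
`jetDK_diag`. -/
def diagE (u : Fin 4 → Fin 4 → 𝔸) (p k a : Fin 4) : 𝔸 :=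
  2 * (u p a * u k a) - (1 / 2 : ℝ) • (∑ b, u p b * u k b + (∑ b, u k b) * u p a)

def diagGam (g h : Fin 4 → 𝔸) (u : Fin 4 → Fin 4 → 𝔸) (l m n : Fin 4) : 𝔸 :=
  (1 / 2 : ℝ) • ((if n = l then diagC u m l else 0) + (if m = l then diagC u n l else 0)
    - (if m = n then g l * h m * diagC u l m else 0))

def diagDGam (g h : Fin 4 → 𝔸) (u : Fin 4 → Fin 4 → 𝔸) (p l m n : Fin 4) : 𝔸 :=
  (1 / 2 : ℝ) • ((if n = l then u p l * diagC u m l + diagE u p m l else 0)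
    + (if m = l then u p l * diagC u n l + diagE u p n l else 0)
    - (if m = n then g l * h m * (u p l * diagC u l m + diagE u p l m) else 0))

variable {g h : Fin 4 → 𝔸} {u : Fin 4 → Fin 4 → 𝔸}

theorem jetK_diag (hg : ∀ a, g a * h a = 1) (k : Fin 4) :
    jetK (Matrix.diagonal h) (Matrix.diagonal fun a => g a * u k a) =
      Matrix.diagonal fun a => h a * diagC u k a := by
  have hgu : ∀ a, h a * (g a * u k a) = u k a := fun a => by rw [← mul_assoc, mul_comm (h a), hg, one_mul]
  simp only [jetK, Matrix.diagonal_mul_diagonal, Matrix.trace_diagonal, hgu, diagC]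
  ext a b
  by_cases hab : a = b
  · subst hab
    simp only [Matrix.sub_apply, Matrix.smul_apply, Matrix.diagonal_apply_eq, smul_eq_mul]
    algebra
  · simp [hab]

theorem jetDK_diag (hg : ∀ a, g a * h a = 1) (p k : Fin 4) :
    jetDK (Matrix.diagonal h) (Matrix.diagonal fun a => g a * u p a)
      (Matrix.diagonal fun a => g a * u k a) 0 =
      Matrix.diagonal fun a => h a * diagE u p k a := by
  have hgu : ∀ k a, h a * (g a * u k a) = u k a := fun k a => by
    rw [← mul_assoc, mul_comm (h a), hg, one_mul]
  have hneg : ∀ d : Fin 4 → 𝔸, -Matrix.diagonal d = Matrix.diagonal fun a => -d a := fun d => by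
    rw [← Matrix.diagonal_neg]
  simp only [jetDK, jetDH, Matrix.diagonal_mul_diagonal, hneg, Matrix.trace_diagonal, hgu, diagE,
    Matrix.mul_zero, Matrix.zero_mul, Matrix.trace_zero, add_zero]
  have e1 : ∀ b, -(u p b * h b) * (g b * u k b) = -(u p b * u k b) := fun b => by
    linear_combination (-(u p b * u k b)) * hg b
  simp only [e1]
  ext a b
  by_cases hab : a = b
  · subst hab
    simp only [Matrix.sub_apply, Matrix.add_apply, Matrix.smul_apply, Matrix.diagonal_apply_eq,
      smul_eq_mul, Finset.sum_neg_distrib]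
    algebra
  · simp [hab]

theorem jetGam_diag (hg : ∀ a, g a * h a = 1) (l m n : Fin 4) :
    jetGam (Matrix.diagonal g) (Matrix.diagonal h) (fun k => Matrix.diagonal fun a => g a * u k a)
      l m n = diagGam g h u l m n := by
  simp only [jetGam, jetK_diag hg, diagGam]
  congr 1
  rw [Finset.sum_eq_single l]
  · simp only [Matrix.diagonal_apply, if_true]
    have e : ∀ x, g l * (h l * x) = x := fun x => by rw [← mul_assoc, hg, one_mul]
    by_cases h1 : n = l <;> by_cases h2 : m = l <;> by_cases h3 : m = n <;>
      simp [h1, h2, h3, mul_sub, e, mul_assoc]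
  · intro b _ hb; rw [Matrix.diagonal_apply_ne _ hb.symm, zero_mul]
  · simp

theorem jetDGam_diag (hg : ∀ a, g a * h a = 1) (p l m n : Fin 4) :
    jetDGam (Matrix.diagonal g) (Matrix.diagonal h) (fun k => Matrix.diagonal fun a => g a * u k a) 0
      p l m n = diagDGam g h u p l m n := by
  simp only [jetDGam, jetK_diag hg, jetDK_diag hg, diagDGam, Pi.zero_apply]
  congr 1
  rw [Finset.sum_eq_single l]
  · simp only [Matrix.diagonal_apply, if_true]
    have h0 := hg l
    by_cases h1 : n = l
    · subst h1
      by_cases h2 : m = n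
      · subst h2
        simp only [if_true]
        linear_combination 2 * (u p m * diagC u m m + diagE u p m m) * h0
      · simp only [h2, if_true, if_false]
        linear_combination (u p n * diagC u m n + diagE u p m n) * h0
    · by_cases h2 : m = l
      · subst h2
        simp only [h1, Ne.symm h1, if_true, if_false]
        linear_combination (u p m * diagC u n m + diagE u p n m) * h0
      · by_cases h3 : m = n
        · subst h3
          simp only [h1, if_true, if_false]
          ring
        · simp only [h1, h2, h3, if_false]
          ring
  · intro b _ hb; rw [Matrix.diagonal_apply_ne _ hb.symm, Matrix.diagonal_apply_ne _ hb.symm]; simp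
  · simp

theorem jetRic_diag (hg : ∀ a, g a * h a = 1) (m n : Fin 4) :
    jetRic (Matrix.diagonal g) (Matrix.diagonal h) (fun k => Matrix.diagonal fun a => g a * u k a) 0
      m n = ∑ l, (diagDGam g h u l l m n - diagDGam g h u n l l m)
    + ∑ l, ∑ k, (diagGam g h u l l k * diagGam g h u k m n
      - diagGam g h u l n k * diagGam g h u k l m) := by
  simp only [jetRic, Matrix.of_apply, jetGam_diag hg, jetDGam_diag hg]

end DiagonalJets

/-! ### The FLRW background with a square-zero spatial gradient in the 00 component. -/

section Background

variable {𝔸 : Type*} [CommRing 𝔸] [Algebra ℝ 𝔸]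

/-- Logarithmic derivatives of the diagonal entries. In time, the 00 entry is a multiple of e³ and
the spatial ones equal e, which gives 3y and y. In space only the 00 entry varies, at rate X_k. -/
def bgU (y : 𝔸) (X : Fin 3 → 𝔸) : Fin 4 → Fin 4 → 𝔸 :=
  ![![3 * y, y, y, y], ![X 0, 0, 0, 0], ![X 1, 0, 0, 0], ![X 2, 0, 0, 0]]

variable (g0 h0 g1 h1 y : 𝔸) (X : Fin 3 → 𝔸)

theorem diagC_bg : diagC (bgU y X) = ![![0, (2:ℝ) • y, (2:ℝ) • y, (2:ℝ) • y],
    ![(-1/2:ℝ) • X 0, (1/2:ℝ) • X 0, (1/2:ℝ) • X 0, (1/2:ℝ) • X 0],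
    ![(-1/2:ℝ) • X 1, (1/2:ℝ) • X 1, (1/2:ℝ) • X 1, (1/2:ℝ) • X 1],
    ![(-1/2:ℝ) • X 2, (1/2:ℝ) • X 2, (1/2:ℝ) • X 2, (1/2:ℝ) • X 2]] := by
  funext k a
  fin_cases k <;> fin_cases a <;> simp [diagC, bgU, Fin.sum_univ_four] <;> algebra


end Background

section Background

variable {𝔸 : Type*} [CommRing 𝔸] [Algebra ℝ 𝔸] {g0 h0 g1 h1 : 𝔸} (y : 𝔸) {X : Fin 3 → 𝔸}

/-- The first derivatives of the background, with a perturbation of the `00`-component. -/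
def bgDX (g0 g1 y : 𝔸) (X : Fin 3 → 𝔸) : Fin 4 → M4 𝔸 :=
  fun k => Matrix.diagonal fun a => (![g0, g1, g1, g1] : Fin 4 → 𝔸) a * bgU y X k a

/-- With second derivatives removed, X enters this component only quadratically, so the value is
that of a spatially homogeneous metric. -/
theorem jetRic00_bg (hX : ∀ i j, X i * X j = 0) (hg0 : g0 * h0 = 1) (hg1 : g1 * h1 = 1) :
    jetRic (Matrix.diagonal ![g0, g1, g1, g1]) (Matrix.diagonal ![h0, h1, h1, h1])
      (bgDX g0 g1 y X) 0 0 0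
      = (9 / 2 : ℝ) • y ^ 2 := by
  refine (jetRic_diag (u := bgU y X) (by intro a; fin_cases a <;> simp [hg0, hg1]) _ _).trans ?_
  simp only [diagDGam, diagGam, diagC_bg, diagE, Fin.sum_univ_four]
  simp only [bgU]
  simp
  have h00 := hX 0 0
  have h11 := hX 1 1
  have h22 := hX 2 2
  linear_combination (norm := skip) (h00 + h11 + h22) * (g1 * h0) *
    ((-3/16:ℝ) • 1 + (-1/16:ℝ) • (h1 * g1))
  algebra

theorem jetRicii_bg (hX : ∀ i j, X i * X j = 0) (hg0 : g0 * h0 = 1) (hg1 : g1 * h1 = 1) (i : Fin 3) :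
    jetRic (Matrix.diagonal ![g0, g1, g1, g1]) (Matrix.diagonal ![h0, h1, h1, h1])
      (bgDX g0 g1 y X) 0 i.succ i.succ
      = (-1 / 2 : ℝ) • (g0 * h1 * y ^ 2) := by
  refine (jetRic_diag (u := bgU y X) (by intro a; fin_cases a <;> simp [hg0, hg1]) _ _).trans ?_
  have h00 := hX 0 0
  have h11 := hX 1 1
  have h22 := hX 2 2
  fin_cases i
  all_goals
    simp only [diagDGam, diagGam, diagC_bg, diagE, Fin.sum_univ_four]
    simp only [bgU]
    simp
  · linear_combination (norm := skip) h00 * ((-1/16:ℝ) • (h1*g1) + (3/16:ℝ) • 1)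
      + (h11 + h22) * ((3/16:ℝ) • (h1*g1) + (1/16:ℝ) • (h1*g1)^2)
    algebra
  · linear_combination (norm := skip) h11 * ((-1/16:ℝ) • (h1*g1) + (3/16:ℝ) • 1)
      + (h00 + h22) * ((3/16:ℝ) • (h1*g1) + (1/16:ℝ) • (h1*g1)^2)
    algebra
  · linear_combination (norm := skip) h22 * ((-1/16:ℝ) • (h1*g1) + (3/16:ℝ) • 1)
      + (h00 + h11) * ((3/16:ℝ) • (h1*g1) + (1/16:ℝ) • (h1*g1)^2)
    algebra

theorem jetRic0i_bg (hg0 : g0 * h0 = 1) (hg1 : g1 * h1 = 1) (i : Fin 3) :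
    jetRic (Matrix.diagonal ![g0, g1, g1, g1]) (Matrix.diagonal ![h0, h1, h1, h1])
      (bgDX g0 g1 y X) 0 0 i.succ
      = y * X i := by
  refine (jetRic_diag (u := bgU y X) (by intro a; fin_cases a <;> simp [hg0, hg1]) _ _).trans ?_
  fin_cases i
  all_goals
    simp only [diagDGam, diagGam, diagC_bg, diagE, Fin.sum_univ_four]
    simp only [bgU]
    simp
  · linear_combination (norm := skip) y * X 0 * hg0 + (1/4:ℝ) • (y * X 0 * g0 * h0 * hg1)
    algebra
  · linear_combination (norm := skip) y * X 1 * hg0 + (1/4:ℝ) • (y * X 1 * g0 * h0 * hg1)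
    algebra
  · linear_combination (norm := skip) y * X 2 * hg0 + (1/4:ℝ) • (y * X 2 * g0 * h0 * hg1)
    algebra

/-- The spatial diagonal Ricci components are needed only for the scalar curvature: 9/2 - ½(9/2 -
3/2) = 3. -/
theorem jetEin00_bg (hX : ∀ i j, X i * X j = 0) (hg0 : g0 * h0 = 1) (hg1 : g1 * h1 = 1) :
    jetEin (Matrix.diagonal ![g0, g1, g1, g1]) (Matrix.diagonal ![h0, h1, h1, h1])
      (bgDX g0 g1 y X) 0 0 0 = 3 * (g0 ^ 2 * y ^ 2) := by
  have r0 := jetRic00_bg y hX hg0 hg1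
  have r1 := jetRicii_bg y hX hg0 hg1
  have e1 := r1 0
  have e2 := r1 1
  have e3 := r1 2
  simp only [Fin.succ_zero_eq_one, Fin.succ_one_eq_two] at e1 e2 e3
  simp only [jetEin, jetRaise, jetTrace, Matrix.diagonal_transpose, Matrix.sub_apply,
    Matrix.smul_apply, Matrix.mul_diagonal, Matrix.diagonal_mul, Matrix.trace, Fin.sum_univ_four,
    Matrix.diag_apply, Matrix.transpose_apply, Matrix.diagonal_apply_eq, r0, e1, e2]
  have e3' : jetRic (Matrix.diagonal ![g0, g1, g1, g1]) (Matrix.diagonal ![h0, h1, h1, h1])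
      (bgDX g0 g1 y X) 0 3 3 = (-1 / 2 : ℝ) • (g0 * h1 * y ^ 2) := e3
  rw [e3']
  simp
  linear_combination (norm := skip) (3 / 4 : ℝ) • (g0 ^ 2 * y ^ 2 * hg1)
  algebra

theorem jetEin0i_bg (hg0 : g0 * h0 = 1) (hg1 : g1 * h1 = 1) (i : Fin 3) :
    jetEin (Matrix.diagonal ![g0, g1, g1, g1]) (Matrix.diagonal ![h0, h1, h1, h1])
      (bgDX g0 g1 y X) 0 0 i.succ = g0 * g1 * y * X i := by
  have r0 := jetRic0i_bg (X := X) y hg0 hg1 i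
  have hne : (0 : Fin 4) ≠ i.succ := (Fin.succ_ne_zero i).symm
  simp only [jetEin, jetRaise, Matrix.diagonal_transpose, Matrix.sub_apply,
    Matrix.smul_apply, Matrix.mul_diagonal, Matrix.diagonal_mul,
    Matrix.diagonal_apply_ne _ hne, r0, smul_zero, sub_zero]
  fin_cases i <;> simp <;> ring

theorem jetStress00_bg (τ κ Λ : ℝ) (θ ρ : 𝔸) (v : Fin 4 → 𝔸) (hg0 : g0 * h0 = 1) (hg1 : g1 * h1 = 1) :
    jetStress τ κ Λ (Matrix.diagonal ![g0, g1, g1, g1]) (Matrix.diagonal ![h0, h1, h1, h1])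
      (bgDX g0 g1 y X) θ ρ v 0 0 = (τ ^ 2 * (1 + κ)) • (θ ^ 2 * ρ * v 0 ^ 2)
        + τ ^ 2 • (θ * (κ • ρ - algebraMap ℝ 𝔸 Λ)) * g0 + 6 * τ • (g0 ^ 2 * y) - (3 * τ ^ 2) • g0 ^ 2 := by
  have hh : ∀ a, (![g0, g1, g1, g1] : Fin 4 → 𝔸) a * (![h0, h1, h1, h1] : Fin 4 → 𝔸) a = 1 := by
    intro a; fin_cases a <;> simp [hg0, hg1]
  have hG : ∀ l m n, jetGam (Matrix.diagonal ![g0, g1, g1, g1]) (Matrix.diagonal ![h0, h1, h1, h1])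
      (bgDX g0 g1 y X) l m n = _ := jetGam_diag hh
  simp only [jetStress, jetRaise, jetTrace, jetHess, Matrix.diagonal_transpose, Matrix.sub_apply,
    Matrix.add_apply, Matrix.of_apply,
    Matrix.smul_apply, Matrix.mul_diagonal, Matrix.diagonal_mul, Matrix.trace, Fin.sum_univ_four,
    Matrix.diag_apply, Matrix.transpose_apply, Matrix.diagonal_apply_eq, hG,
    diagGam, diagC_bg]
  simp
  linear_combination (norm := skip) (6 * τ) • (g0 ^ 2 * y * hg1)
  algebra

theorem jetStress0i_bg (τ κ Λ : ℝ) (θ ρ : 𝔸) (v : Fin 4 → 𝔸) (hg0 : g0 * h0 = 1) (hg1 : g1 * h1 = 1)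
    (i : Fin 3) :
    jetStress τ κ Λ (Matrix.diagonal ![g0, g1, g1, g1]) (Matrix.diagonal ![h0, h1, h1, h1])
      (bgDX g0 g1 y X) θ ρ v 0 i.succ = (τ ^ 2 * (1 + κ)) • (θ ^ 2 * ρ * (v 0 * v i.succ))
        + (-1 / 2 * τ) • (g0 * g1 * X i) := by
  have hh : ∀ a, (![g0, g1, g1, g1] : Fin 4 → 𝔸) a * (![h0, h1, h1, h1] : Fin 4 → 𝔸) a = 1 := by
    intro a; fin_cases a <;> simp [hg0, hg1]
  have hne : (0 : Fin 4) ≠ i.succ := (Fin.succ_ne_zero i).symm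
  have hG : ∀ l m n, jetGam (Matrix.diagonal ![g0, g1, g1, g1]) (Matrix.diagonal ![h0, h1, h1, h1])
      (bgDX g0 g1 y X) l m n = _ := jetGam_diag hh
  simp only [jetStress, jetRaise, jetTrace, jetHess, Matrix.diagonal_transpose, Matrix.sub_apply,
    Matrix.add_apply, Matrix.of_apply, Matrix.diagonal_apply_ne _ hne,
    Matrix.smul_apply, Matrix.mul_diagonal, Matrix.diagonal_mul,  hG,
    diagGam, diagC_bg]
  fin_cases i
  all_goals
    simp
    algebra

end Background

end

section

/-! ### Naturality of the jet expressions under algebra homomorphisms, used for reduction modulo an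
ideal and for evaluation at a point. -/

section JetMap

variable {𝔸 𝔹 : Type*} [CommRing 𝔸] [Algebra ℝ 𝔸] [CommRing 𝔹] [Algebra ℝ 𝔹] (f : 𝔸 →ₐ[ℝ] 𝔹)

theorem jetK_map (H Dk : M4 𝔸) (a b : Fin 4) :
    jetK (H.map f) (Dk.map f) a b = f (jetK H Dk a b) := by
  simp only [jetK, Matrix.sub_apply, Matrix.smul_apply, Matrix.mul_apply, Matrix.trace,
    Matrix.diag_apply, Matrix.map_apply, map_sum, map_mul, map_smul, map_sub, smul_eq_mul]

theorem jetDH_map (H Dk : M4 𝔸) : jetDH (H.map f) (Dk.map f) = (jetDH H Dk).map f := by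
  ext a b
  simp only [jetDH, Matrix.neg_apply, Matrix.mul_apply, Matrix.map_apply, map_sum, map_mul, map_neg]

theorem jetDK_map (H Dp Dk S : M4 𝔸) (a b : Fin 4) :
    jetDK (H.map f) (Dp.map f) (Dk.map f) (S.map f) a b = f (jetDK H Dp Dk S a b) := by
  simp only [jetDK, jetDH_map, Matrix.sub_apply, Matrix.add_apply, Matrix.smul_apply,
    Matrix.mul_apply, Matrix.trace, Matrix.diag_apply, Matrix.map_apply, map_sum, map_mul, map_smul,
    map_sub, map_add, smul_eq_mul]

theorem jetGam_map (G H : M4 𝔸) (D : Fin 4 → M4 𝔸) (l m n : Fin 4) :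
    jetGam (G.map f) (H.map f) (fun k => (D k).map f) l m n = f (jetGam G H D l m n) := by
  simp only [jetGam, jetK_map, Matrix.map_apply, map_sum, map_mul, map_smul, map_sub, map_add]

theorem jetDGam_map (G H : M4 𝔸) (D : Fin 4 → M4 𝔸) (S : Fin 4 → Fin 4 → M4 𝔸) (p l m n : Fin 4) :
    jetDGam (G.map f) (H.map f) (fun k => (D k).map f) (fun k l => (S k l).map f) p l m n =
      f (jetDGam G H D S p l m n) := by
  simp only [jetDGam, jetK_map, jetDK_map, Matrix.map_apply, map_sum, map_mul, map_smul, map_sub,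
    map_add]

theorem jetRic_map (G H : M4 𝔸) (D : Fin 4 → M4 𝔸) (S : Fin 4 → Fin 4 → M4 𝔸) :
    jetRic (G.map f) (H.map f) (fun k => (D k).map f) (fun k l => (S k l).map f) =
      (jetRic G H D S).map f := by
  ext m n
  simp only [jetRic, Matrix.of_apply, jetDGam_map, jetGam_map, Matrix.map_apply, map_sum, map_mul,
    map_sub, map_add]

theorem jetRaise_map (G T : M4 𝔸) : jetRaise (G.map f) (T.map f) = (jetRaise G T).map f := by
  ext m n
  simp only [jetRaise, Matrix.mul_apply, Matrix.map_apply, Matrix.transpose_apply, map_sum, map_mul]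

theorem jetTrace_map (G T : M4 𝔸) : jetTrace (G.map f) (T.map f) = f (jetTrace G T) := by
  simp only [jetTrace, Matrix.trace, Matrix.diag_apply, Matrix.mul_apply, Matrix.map_apply,
    Matrix.transpose_apply, map_sum, map_mul]

theorem jetEin_map (G H : M4 𝔸) (D : Fin 4 → M4 𝔸) :
    jetEin (G.map f) (H.map f) (fun k => (D k).map f) 0 = (jetEin G H D 0).map f := by
  have h : (fun k l : Fin 4 => ((0 : Fin 4 → Fin 4 → M4 𝔸) k l).map f) = 0 := by
    ext k l a b
    simp
  rw [jetEin, ← h, jetRic_map, jetRaise_map, jetTrace_map]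
  ext m n
  simp only [jetEin, Matrix.sub_apply, Matrix.smul_apply, Matrix.map_apply, map_sub, map_smul,
    map_mul, smul_eq_mul]

theorem jetSp_map (G : M4 𝔸) (S : Fin 4 → Fin 4 → M4 𝔸) :
    jetSp (G.map f) (fun k l => (S k l).map f) = (jetSp G S).map f := by
  ext m n
  simp only [jetSp, jetQ, jetV, Matrix.trace, Matrix.diag_apply, Matrix.add_apply, Matrix.sub_apply,
    Matrix.sum_apply, Matrix.smul_apply, Matrix.mul_apply, Matrix.map_apply, Matrix.of_apply,
    Matrix.transpose_apply, map_sub, map_add, map_sum, map_mul, smul_eq_mul]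

theorem jetStress_map (τ κ Λ : ℝ) (G H : M4 𝔸) (D : Fin 4 → M4 𝔸) (θ ρ : 𝔸) (v : Fin 4 → 𝔸) :
    jetStress τ κ Λ (G.map f) (H.map f) (fun k => (D k).map f) (f θ) (f ρ) (fun k => f (v k)) =
      (jetStress τ κ Λ G H D θ ρ v).map f := by
  have h : jetHess τ (G.map f) (H.map f) (fun k => (D k).map f) = (jetHess τ G H D).map f := by
    ext m n
    simp only [jetHess, Matrix.of_apply, Matrix.map_apply, jetGam_map, map_smul]
  rw [jetStress, h, jetRaise_map, jetTrace_map]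
  ext m n
  simp only [jetStress, Matrix.sub_apply, Matrix.add_apply, Matrix.smul_apply, Matrix.map_apply,
    Matrix.of_apply, map_sub, map_add, map_smul, map_mul, map_pow, smul_eq_mul, AlgHom.commutes]

end JetMap

end

section

/-! ### Characters of the torus and integration by parts. -/

section FourierTorus

open UnitAddTorus
open scoped ComplexConjugate

abbrev Freq : Type := Fin 3 → ℤ

/-- The symbol `2πi n_j` of the derivative `∂_j`. -/
def symb (j : Fin 3) (n : Freq) : ℂ := ((2 * Real.pi * n j : ℝ) : ℂ) * Complex.I

/-- The symbol `(2πi n)^α` of the derivative `D^α`. -/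
def symbIdx (α : Fin 3 → ℕ) (n : Freq) : ℂ := ∏ j, symb j n ^ α j

theorem mFourier_add_toTorus (n : Freq) (x : T3) (i : Fin 3) (h : ℝ) :
    mFourier n (x + toTorus (Pi.single i h)) = mFourier n x * Complex.exp (symb i n * h) := by
  have h1 : mFourier n (x + toTorus (Pi.single i h)) =
      mFourier n x * mFourier n (toTorus (Pi.single i h)) := by
    simp only [mFourier, ContinuousMap.coe_mk, ← Finset.prod_mul_distrib]
    refine Finset.prod_congr rfl fun j _ => ?_
    simp [fourier_apply, Pi.add_apply, smul_add, AddCircle.toCircle_add]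
  rw [h1]
  congr 1
  simp only [mFourier, ContinuousMap.coe_mk]
  rw [Finset.prod_eq_single i]
  · simp only [toTorus, Pi.single_eq_same]
    rw [fourier_coe_apply]
    congr 1
    simp only [symb]
    push_cast
    ring
  · intro j _ hj
    simp [toTorus, Pi.single_eq_of_ne hj]
  · simp

theorem mFourier_toTorus (n : Freq) (y : Fin 3 → ℝ) :
    mFourier n (toTorus y) = ∏ j, Complex.exp (symb j n * y j) := by
  simp only [mFourier, ContinuousMap.coe_mk]
  refine Finset.prod_congr rfl fun j _ => ?_
  simp only [toTorus]
  rw [fourier_coe_apply]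
  congr 1
  simp only [symb]
  push_cast
  ring

/-- Real trigonometric test functions. A complex coefficient covers cosine and sine at once, and
differentiation multiplies it by the symbol. -/
def trig (n : Freq) (c : ℂ) (x : T3) : ℝ := (c * mFourier n x).re

theorem isSmooth_trig (n : Freq) (c : ℂ) : IsSmooth (trig n c) := by
  unfold IsSmooth trig
  simp only [mFourier_toTorus]
  refine Complex.reCLM.contDiff.comp (contDiff_const.mul (contDiff_prod fun j _ => ?_))
  refine ContDiff.cexp (contDiff_const.mul (Complex.ofRealCLM.contDiff.comp ?_))
  exact contDiff_apply ℝ ℝ j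

theorem hasDerivAt_mFourier (n : Freq) (x : T3) (i : Fin 3) (h : ℝ) :
    HasDerivAt (fun h : ℝ => mFourier n (x + toTorus (Pi.single i h)))
      (symb i n * mFourier n (x + toTorus (Pi.single i h))) h := by
  simp only [mFourier_add_toTorus]
  have h1 : HasDerivAt (fun h : ℝ => symb i n * (h : ℂ)) (symb i n) h := by
    simpa using (Complex.ofRealCLM.hasDerivAt (x := h)).const_mul (symb i n)
  refine (h1.cexp.const_mul (mFourier n x)).congr_deriv ?_
  ring

theorem torusPartial_trig (i : Fin 3) (n : Freq) (c : ℂ) :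
    torusPartial i (trig n c) = trig n (symb i n * c) := by
  funext x
  have h1 := (hasDerivAt_mFourier n x i 0).const_mul c
  have h2 := Complex.reCLM.hasFDerivAt.comp_hasDerivAt 0 h1
  have h3 : toTorus (Pi.single i (0 : ℝ)) = 0 := by
    ext j; simp [toTorus]
  refine h2.deriv.trans ?_
  simp only [trig, h3, add_zero, Complex.reCLM_apply]
  congr 1
  ring

theorem torusDeriv_trig (α : Fin 3 → ℕ) (n : Freq) (c : ℂ) :
    torusDeriv α (trig n c) = trig n (symbIdx α n * c) := by
  have it : ∀ (i : Fin 3) (k : ℕ) (c : ℂ),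
      (torusPartial i)^[k] (trig n c) = trig n (symb i n ^ k * c) := by
    intro i k
    induction k with
    | zero => intro c; simp
    | succ k ih =>
      intro c
      rw [Function.iterate_succ_apply, torusPartial_trig, ih]
      congr 1; ring
  rw [torusDeriv, it, it, it]
  congr 1
  simp only [symbIdx, Fin.prod_univ_three]
  ring

theorem IsSmooth.hasDerivAt {φ : T3 → ℝ} (hφ : IsSmooth φ) (i : Fin 3) (x : T3) (h : ℝ) :
    HasDerivAt (fun h : ℝ => φ (x + toTorus (Pi.single i h)))
      (NewtonCosmo.torusPartial i φ (x + toTorus (Pi.single i h))) h := by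
  obtain ⟨y, rfl⟩ := isOpenQuotientMap_toTorus.surjective x
  have hadd : ∀ a b : Fin 3 → ℝ, toTorus a + toTorus b = toTorus (a + b) := fun a b => by
    funext j; simp [toTorus]
  have hd : Differentiable ℝ (fun y : Fin 3 → ℝ => φ (toTorus y)) :=
    ContDiff.differentiable hφ (by simp)
  have hlin : Differentiable ℝ (fun h : ℝ => y + Pi.single i h) := by
    refine differentiable_pi.2 fun j => ?_
    by_cases hj : j = i
    · subst hj; simp; fun_prop
    · simp [Pi.single_eq_of_ne hj]
  have hD : Differentiable ℝ (fun h : ℝ => φ (toTorus y + toTorus (Pi.single i h))) := by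
    simp only [hadd]
    exact hd.comp hlin
  have h1 := (hD h).hasDerivAt
  refine h1.congr_deriv ?_
  symm
  unfold NewtonCosmo.torusPartial
  have : (fun t : ℝ => φ (toTorus y + toTorus (Pi.single i h) + toTorus (Pi.single i t))) =
      fun t => (fun h : ℝ => φ (toTorus y + toTorus (Pi.single i h))) (h + t) := by
    funext t
    simp only [add_assoc, hadd, ← Pi.single_add]
  rw [this]
  refine (deriv_comp_const_add (f := fun h : ℝ => φ (toTorus y + toTorus (Pi.single i h))) h 0).trans ?_
  rw [add_zero]

/-- The integral of φ times a character is invariant under translation of the product.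
Differentiating it under the integral sign along the i-th direction gives integration by parts. -/
theorem integral_torusPartial_mul (i : Fin 3) {φ : T3 → ℝ} (hφ : IsSmooth φ) (n : Freq) :
    ∫ x, (torusPartial i φ x : ℂ) * mFourier n x ∂torusMeasure =
      -symb i n * ∫ x, (φ x : ℂ) * mFourier n x ∂torusMeasure := by
  have hc := hφ.continuous
  have hc' := (hφ.torusPartial i).continuous
  obtain ⟨C, hC⟩ := (isCompact_univ (X := T3)).exists_bound_of_continuousOn hc.continuousOn
  obtain ⟨C', hC'⟩ := (isCompact_univ (X := T3)).exists_bound_of_continuousOn hc'.continuousOn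
  have hcont : ∀ {f : T3 → ℂ}, Continuous f → Integrable f torusMeasure := fun hf =>
    hf.integrable_of_hasCompactSupport (HasCompactSupport.of_compactSpace _)
  have hn : ∀ x, ‖mFourier n x‖ ≤ 1 := fun x =>
    ((mFourier n).norm_coe_le_norm x).trans mFourier_norm.le
  set F : ℝ → T3 → ℂ := fun h x =>
    (φ (x + toTorus (Pi.single i h)) : ℂ) * mFourier n (x + toTorus (Pi.single i h))
  set F' : ℝ → T3 → ℂ := fun h x =>
    (torusPartial i φ (x + toTorus (Pi.single i h)) : ℂ) * mFourier n (x + toTorus (Pi.single i h))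
    + (φ (x + toTorus (Pi.single i h)) : ℂ) * (symb i n * mFourier n (x + toTorus (Pi.single i h)))
  have hF : ∀ h, Continuous (F h) := fun h => by
    simp only [F]; fun_prop
  have hF' : ∀ h, Continuous (F' h) := fun h => by
    simp only [F']; fun_prop
  have hder := hasDerivAt_integral_of_dominated_loc_of_deriv_le (μ := torusMeasure) (F := F) (F' := F')
    (x₀ := 0) (s := Set.univ) (bound := fun _ => C' + C * ‖symb i n‖) Filter.univ_mem
    (Filter.Eventually.of_forall fun h => (hF h).aestronglyMeasurable) (hcont (hF 0))
    (hF' 0).aestronglyMeasurable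
    (Filter.Eventually.of_forall fun x h _ => by
      refine (norm_add_le _ _).trans (add_le_add ?_ ?_)
      · rw [norm_mul, Complex.norm_real]
        exact (mul_le_of_le_one_right (norm_nonneg _) (hn _)).trans (hC' _ (Set.mem_univ _))
      · rw [norm_mul, norm_mul, Complex.norm_real]
        refine mul_le_mul (hC _ (Set.mem_univ _)) (mul_le_of_le_one_right (norm_nonneg _) (hn _))
          (by positivity) ((norm_nonneg _).trans (hC 0 (Set.mem_univ _))))
    (integrable_const _)
    (Filter.Eventually.of_forall fun x h _ =>
      ((hφ.hasDerivAt i x h).ofReal_comp).mul (hasDerivAt_mFourier n x i h))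
  have hconst : (fun h => ∫ x, F h x ∂torusMeasure) = fun _ => ∫ x, (φ x : ℂ) * mFourier n x ∂torusMeasure := by
    funext h
    exact integral_add_right_eq_self (μ := torusMeasure) (fun x => (φ x : ℂ) * mFourier n x) _
  have h0 := hder.2
  rw [hconst] at h0
  have h1 := h0.unique (hasDerivAt_const _ _)
  have h3 : toTorus (Pi.single i (0 : ℝ)) = 0 := by
    ext j; simp [toTorus]
  simp only [F', h3, add_zero] at h1
  rw [integral_add (hcont (by fun_prop)) (hcont (by fun_prop))] at h1
  have h4 : ∫ x, (φ x : ℂ) * (symb i n * mFourier n x) ∂torusMeasure =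
      symb i n * ∫ x, (φ x : ℂ) * mFourier n x ∂torusMeasure := by
    rw [← integral_const_mul]
    congr 1; funext x; ring
  rw [h4] at h1
  linear_combination h1

theorem integral_torusDeriv_mul (α : Fin 3 → ℕ) {φ : T3 → ℝ} (hφ : IsSmooth φ) (n : Freq) :
    ∫ x, (torusDeriv α φ x : ℂ) * mFourier n x ∂torusMeasure =
      (-1) ^ (∑ i, α i) * symbIdx α n * ∫ x, (φ x : ℂ) * mFourier n x ∂torusMeasure := by
  have it : ∀ (i : Fin 3) (k : ℕ) (ψ : T3 → ℝ), IsSmooth ψ →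
      IsSmooth ((torusPartial i)^[k] ψ) ∧
      ∫ x, ((torusPartial i)^[k] ψ x : ℂ) * mFourier n x ∂torusMeasure =
      (-symb i n) ^ k * ∫ x, (ψ x : ℂ) * mFourier n x ∂torusMeasure := by
    intro i k
    induction k with
    | zero => intro ψ hψ; simpa using hψ
    | succ k ih =>
      intro ψ hψ
      obtain ⟨h1, h2⟩ := ih _ (hψ.torusPartial i)
      refine ⟨h1, ?_⟩
      rw [Function.iterate_succ_apply, h2, integral_torusPartial_mul i hψ]
      ring
  have a2 := it 2 (α 2) φ hφ
  have a1 := it 1 (α 1) _ a2.1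
  have a0 := it 0 (α 0) _ a1.1
  rw [torusDeriv, a0.2, a1.2, a2.2]
  simp only [symbIdx, Fin.prod_univ_three, Fin.sum_univ_three, neg_pow (symb _ _), pow_add]
  ring

end FourierTorus

end

section

/-! ### Fourier coefficients of square integrable functions and weak derivatives. -/

section FourierLTwo

open UnitAddTorus
open scoped ComplexConjugate

/-- The Fourier coefficients of a real square integrable function. -/
def fc (u : Lp ℝ 2 torusMeasure) (n : Freq) : ℂ :=
  ∫ x, mFourier (-n) x * (u x : ℂ) ∂torusMeasure

def toCpx : Lp ℝ 2 torusMeasure →L[ℝ] Lp ℂ 2 torusMeasure :=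
  Complex.ofRealCLM.compLpL 2 torusMeasure

theorem coeFn_toCpx (u : Lp ℝ 2 torusMeasure) :
    toCpx u =ᵐ[torusMeasure] fun x => (u x : ℂ) := Complex.ofRealCLM.coeFn_compLpL u

def torusBasis : HilbertBasis Freq ℂ (Lp ℂ 2 torusMeasure) := mFourierBasis (d := Fin 3)

theorem torusBasis_repr (f : Lp ℂ 2 torusMeasure) (n : Freq) :
    torusBasis.repr f n = ∫ x, mFourier (-n) x * f x ∂torusMeasure :=
  mFourierBasis_repr (d := Fin 3) f n

theorem fc_eq (u : Lp ℝ 2 torusMeasure) (n : Freq) : fc u n = torusBasis.repr (toCpx u) n := by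
  rw [torusBasis_repr, fc]
  refine integral_congr_ae ?_
  filter_upwards [coeFn_toCpx u] with x hx
  rw [hx]

theorem norm_toCpx (u : Lp ℝ 2 torusMeasure) : ‖toCpx u‖ = ‖u‖ := by
  rw [Lp.norm_def, Lp.norm_def]
  congr 1
  refine eLpNorm_congr_norm_ae ?_
  filter_upwards [coeFn_toCpx u] with x hx
  rw [hx, Complex.norm_real]

theorem fc_add (u v : Lp ℝ 2 torusMeasure) (n : Freq) : fc (u + v) n = fc u n + fc v n := by
  simp only [fc_eq, map_add]; rfl

theorem fc_smul (c : ℝ) (u : Lp ℝ 2 torusMeasure) (n : Freq) : fc (c • u) n = c * fc u n := by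
  have : toCpx (c • u) = (c : ℂ) • toCpx u := by
    rw [map_smul]; rfl
  simp only [fc_eq, this, map_smul]; rfl

theorem continuous_fc (n : Freq) : Continuous fun u => fc u n := by
  simp only [fc_eq]
  have h : Continuous fun f : lp (fun _ : Freq => ℂ) 2 => f n := by
    exact (lp.evalCLM ℂ (fun _ : Freq => ℂ) 2 n).continuous
  exact h.comp (torusBasis.repr.continuous.comp toCpx.continuous)

theorem hasSum_fc_sq (u : Lp ℝ 2 torusMeasure) : HasSum (fun n => ‖fc u n‖ ^ 2) (‖u‖ ^ 2) := by
  simp only [fc_eq]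
  rw [← norm_toCpx, ← torusBasis.repr.norm_map]
  have := lp.hasSum_norm (p := 2) (by norm_num) (torusBasis.repr (toCpx u))
  simpa using this

theorem fc_injective {u v : Lp ℝ 2 torusMeasure} (h : ∀ n, fc u n = fc v n) : u = v := by
  have h1 : toCpx u = toCpx v := by
    apply torusBasis.repr.injective
    ext n
    rw [← fc_eq, ← fc_eq, h]
  have h2 : toCpx (u - v) = 0 := by rw [map_sub, h1, sub_self]
  have h3 := norm_toCpx (u - v)
  rw [h2, norm_zero] at h3
  exact sub_eq_zero.1 (norm_eq_zero.1 h3.symm)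

theorem fc_neg (u : Lp ℝ 2 torusMeasure) (n : Freq) : fc u (-n) = conj (fc u n) := by
  rw [fc, fc, ← integral_conj]
  congr 1
  funext x
  rw [map_mul, Complex.conj_ofReal, ← mFourier_neg]

/-- Riesz–Fischer. The symmetry of the coefficients under n ↦ -n ensures that passing to the real
part of the complex solution does not change them. -/
theorem exists_fc {a : Freq → ℂ} (ha : ∀ n, a (-n) = conj (a n)) (hs : Summable fun n => ‖a n‖ ^ 2) :
    ∃ u : Lp ℝ 2 torusMeasure, ∀ n, fc u n = a n := by
  have hmem : Memℓp a 2 := by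
    rw [memℓp_gen_iff (by norm_num)]
    simpa using hs
  set A : lp (fun _ : Freq => ℂ) 2 := ⟨a, hmem⟩
  set f := torusBasis.repr.symm A
  set u : Lp ℝ 2 torusMeasure := Complex.reCLM.compLp f
  have hu : u =ᵐ[torusMeasure] fun x => (f x).re := Complex.reCLM.coeFn_compLp f
  have hf : ∀ n, ∫ x, mFourier (-n) x * f x ∂torusMeasure = a n := fun n => by
    rw [← torusBasis_repr]
    simp [f, A]
  have hint : ∀ n, Integrable (fun x => mFourier (-n) x * f x) torusMeasure := fun n => by
    have h1 : Integrable (fun x => f x) torusMeasure := (Lp.memLp f).integrable (by norm_num)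
    exact h1.bdd_mul (c := 1) (mFourier (-n)).continuous.aestronglyMeasurable
      (Filter.Eventually.of_forall fun x => ((mFourier (-n)).norm_coe_le_norm x).trans mFourier_norm.le)
  refine ⟨u, fun n => ?_⟩
  have h1 : fc u n = ∫ x, (1 / 2 : ℂ) * (mFourier (-n) x * f x + conj (mFourier (- -n) x * f x))
      ∂torusMeasure := by
    refine integral_congr_ae ?_
    filter_upwards [hu] with x hx
    rw [hx, map_mul, ← mFourier_neg, neg_neg, Complex.re_eq_add_conj]
    ring
  have hc : Integrable (fun x => conj (mFourier (- -n) x * f x)) torusMeasure :=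
    (Complex.conjCLE.toContinuousLinearMap.integrable_comp (hint (-n)))
  rw [h1, integral_const_mul, integral_add (hint n) hc, integral_conj, hf, hf, ha, Complex.conj_conj]
  ring

theorem integral_mul_eq (u v : Lp ℝ 2 torusMeasure) :
    HasSum (fun n => conj (fc u n) * fc v n) ((∫ x, u x * v x ∂torusMeasure : ℝ) : ℂ) := by
  have h := hasSum_prod_mFourierCoeff (d := Fin 3) (toCpx u) (toCpx v)
  have e1 : ∀ w : Lp ℝ 2 torusMeasure, ∀ n, mFourierCoeff (toCpx w) n = fc w n := fun w n => by
    rw [fc_eq, torusBasis_repr]; rfl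
  simp only [e1] at h
  have e2 : ((∫ x, u x * v x ∂torusMeasure : ℝ) : ℂ) =
      ∫ t, conj (toCpx u t) * toCpx v t ∂torusMeasure := ?_
  · rw [e2]; exact h
  refine (integral_ofReal (𝕜 := ℂ) (f := fun x => u x * v x)).symm.trans ?_
  refine integral_congr_ae ?_
  filter_upwards [coeFn_toCpx u, coeFn_toCpx v] with x hx hy
  rw [hx, hy]
  simp

theorem symbIdx_neg (α : Fin 3 → ℕ) (n : Freq) : symbIdx α (-n) = conj (symbIdx α n) := by
  simp only [symbIdx, map_prod, map_pow]
  refine Finset.prod_congr rfl fun j _ => ?_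
  congr 1
  simp only [symb, map_mul, Complex.conj_ofReal, Complex.conj_I, Pi.neg_apply]
  push_cast
  ring

theorem symbIdx_conj (α : Fin 3 → ℕ) (n : Freq) :
    conj (symbIdx α n) = (-1) ^ (∑ i, α i) * symbIdx α n := by
  have : ∀ j, conj (symb j n) = -symb j n := fun j => by
    simp only [symb, map_mul, Complex.conj_ofReal, Complex.conj_I]
    ring
  simp only [symbIdx, Fin.prod_univ_three, Fin.sum_univ_three, map_mul, map_pow, this,
    neg_pow (symb _ _), pow_add]
  ring

theorem integral_trig_mul (n : Freq) (c : ℂ) (u : Lp ℝ 2 torusMeasure) :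
    ∫ x, trig n c x • u x ∂torusMeasure = (c * conj (fc u n)).re := by
  have hint : Integrable (fun x => c * (mFourier (n) x * (u x : ℂ))) torusMeasure := by
    have h1 : Integrable (fun x => (u x : ℂ)) torusMeasure :=
      ((Lp.memLp u).integrable (by norm_num)).ofReal
    exact (h1.bdd_mul (c := 1) (mFourier (n)).continuous.aestronglyMeasurable
      (Filter.Eventually.of_forall fun x => ((mFourier (n)).norm_coe_le_norm x).trans mFourier_norm.le)).const_mul c
  rw [← fc_neg, fc, neg_neg, ← integral_const_mul]
  have := integral_re hint
  refine Eq.trans ?_ this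
  congr 1
  funext x
  simp [trig]
  ring

/-- Testing with trigonometric functions gives the relation between the coefficients. Conversely,
Parseval's identity pairs that relation with the coefficients of an arbitrary smooth test function,
for which integration by parts is classical. -/
theorem isWeakDeriv_iff (α : Fin 3 → ℕ) (u v : Lp ℝ 2 torusMeasure) :
    IsWeakDeriv α u v ↔ ∀ n, fc v n = symbIdx α n * fc u n := by
  constructor
  · intro h n
    have key : ∀ c : ℂ, (c * conj (symbIdx α n * fc u n)).re = (c * conj (fc v n)).re := by
      intro c
      have h1 := h (trig n c) (isSmooth_trig n c)
      rw [torusDeriv_trig, integral_trig_mul, integral_trig_mul] at h1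
      have h2 : ((-1 : ℝ) ^ (∑ i, α i)) * (-1 : ℝ) ^ (∑ i, α i) = 1 := by
        rw [← mul_pow]; norm_num
      have h3 : (c * conj (symbIdx α n * fc u n)) =
          (((-1 : ℝ) ^ (∑ i, α i) : ℝ) : ℂ) * (symbIdx α n * c * conj (fc u n)) := by
        rw [map_mul, symbIdx_conj]; push_cast; ring
      rw [h3, Complex.re_ofReal_mul, h1, smul_eq_mul, ← mul_assoc, h2, one_mul]
    -- The coefficients c = 1 and c = i yield the real and the imaginary part.
    have h1 := key 1
    have h2 := key Complex.I
    apply (starRingEnd ℂ).injective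
    simp only [one_mul, Complex.I_mul_re, neg_inj] at h1 h2
    exact Complex.ext h1.symm h2.symm
  · intro h φ hφ
    set Φ := ContinuousMap.toLp 2 torusMeasure ℝ (⟨φ, hφ.continuous⟩ : C(T3, ℝ))
    set Ψ := ContinuousMap.toLp 2 torusMeasure ℝ (⟨torusDeriv α φ, (hφ.torusDeriv α).continuous⟩ : C(T3, ℝ))
    have hΦ : Φ =ᵐ[torusMeasure] φ := ContinuousMap.coeFn_toLp torusMeasure _
    have hΨ : Ψ =ᵐ[torusMeasure] torusDeriv α φ := ContinuousMap.coeFn_toLp torusMeasure _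
    have e1 : ∫ x, torusDeriv α φ x • u x ∂torusMeasure = ∫ x, Ψ x * u x ∂torusMeasure :=
      integral_congr_ae (by filter_upwards [hΨ] with x hx; rw [hx, smul_eq_mul])
    have e2 : ∫ x, φ x • v x ∂torusMeasure = ∫ x, Φ x * v x ∂torusMeasure :=
      integral_congr_ae (by filter_upwards [hΦ] with x hx; rw [hx, smul_eq_mul])
    have c1 : ∀ n, conj (fc Ψ n) = (-1) ^ (∑ i, α i) * symbIdx α n * conj (fc Φ n) := by
      intro n
      have a1 : ∀ w : Lp ℝ 2 torusMeasure, ∀ ψ : T3 → ℝ, w =ᵐ[torusMeasure] ψ →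
          conj (fc w n) = ∫ x, (ψ x : ℂ) * mFourier n x ∂torusMeasure := by
        intro w ψ hw
        rw [← fc_neg, fc, neg_neg]
        exact integral_congr_ae (by filter_upwards [hw] with x hx; rw [hx, mul_comm])
      rw [a1 _ _ hΨ, a1 _ _ hΦ, integral_torusDeriv_mul α hφ]
    have s1 := integral_mul_eq Ψ u
    have s2 := (integral_mul_eq Φ v).mul_left ((-1 : ℂ) ^ (∑ i, α i))
    have s3 : (fun n => conj (fc Ψ n) * fc u n) =
        fun n => (-1 : ℂ) ^ (∑ i, α i) * (conj (fc Φ n) * fc v n) := by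
      funext n; rw [c1, h]; ring
    rw [s3] at s1
    have := s1.unique s2
    rw [e1, e2, smul_eq_mul]
    exact_mod_cast this

end FourierLTwo

end

section

/-! ### Sobolev spaces described by Fourier coefficients; Fourier multipliers. -/

section SobolevFourier

open scoped ComplexConjugate

theorem zero_mem_multiIdx (k : ℕ) : (0 : Fin 3 → ℕ) ∈ multiIdx k := mem_multiIdx.2 (by simp)

/-- The Fourier coefficients of an element of `H^k`. -/
def ft {k : ℕ} (u : Hs k ℝ) (n : Freq) : ℂ := fc (u.1 ⟨0, zero_mem_multiIdx k⟩) n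

/-- The weight in the description of `H^k` by Fourier coefficients. -/
def wt (k : ℕ) (n : Freq) : ℝ := ∑ α : {α : Fin 3 → ℕ // α ∈ multiIdx k}, ‖symbIdx α.1 n‖ ^ 2

variable {k l : ℕ}

theorem fc_component (u : Hs k ℝ) (α : {α : Fin 3 → ℕ // α ∈ multiIdx k}) (n : Freq) :
    fc (u.1 α) n = symbIdx α.1 n * ft u n :=
  (isWeakDeriv_iff α.1 _ _).1 (u.2 α) n

theorem ft_add (u v : Hs k ℝ) (n : Freq) : ft (u + v) n = ft u n + ft v n := fc_add _ _ n

theorem ft_smul (c : ℝ) (u : Hs k ℝ) (n : Freq) : ft (c • u) n = c * ft u n := fc_smul _ _ n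

theorem ft_neg_freq (u : Hs k ℝ) (n : Freq) : ft u (-n) = conj (ft u n) := fc_neg _ n

theorem ft_injective {u v : Hs k ℝ} (h : ∀ n, ft u n = ft v n) : u = v := by
  apply Subtype.ext
  apply PiLp.ext
  intro α
  refine fc_injective fun n => ?_
  rw [fc_component, fc_component, h]

theorem hasSum_norm_sq (u : Hs k ℝ) : HasSum (fun n => wt k n * ‖ft u n‖ ^ 2) (‖u‖ ^ 2) := by
  have h1 : ‖u‖ ^ 2 = ∑ α, ‖u.1 α‖ ^ 2 := PiLp.norm_sq_eq_of_L2 _ u.1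
  rw [h1]
  have h2 := hasSum_sum (s := Finset.univ) fun α _ => hasSum_fc_sq (u.1 α)
  refine h2.congr_fun fun n => ?_
  simp only [fc_component, norm_mul, mul_pow, wt, Finset.sum_mul]

theorem wt_nonneg (k : ℕ) (n : Freq) : 0 ≤ wt k n := Finset.sum_nonneg fun _ _ => by positivity

theorem symbIdx_zero (n : Freq) : symbIdx 0 n = 1 := by simp [symbIdx]

theorem symbIdx_le_wt {α : Fin 3 → ℕ} (h : α ∈ multiIdx k) (n : Freq) : ‖symbIdx α n‖ ^ 2 ≤ wt k n :=
  Finset.single_le_sum (f := fun α : {α : Fin 3 → ℕ // α ∈ multiIdx k} => ‖symbIdx α.1 n‖ ^ 2)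
    (fun _ _ => by positivity) (Finset.mem_univ ⟨α, h⟩)

theorem one_le_wt (k : ℕ) (n : Freq) : 1 ≤ wt k n := by
  have := symbIdx_le_wt (zero_mem_multiIdx k) n
  simpa [symbIdx_zero] using this

theorem exists_ft {a : Freq → ℂ} (ha : ∀ n, a (-n) = conj (a n))
    (hs : Summable fun n => wt k n * ‖a n‖ ^ 2) : ∃ u : Hs k ℝ, ∀ n, ft u n = a n := by
  have h1 : ∀ α : {α : Fin 3 → ℕ // α ∈ multiIdx k}, ∃ u : Lp ℝ 2 torusMeasure,
      ∀ n, fc u n = symbIdx α.1 n * a n := fun α => by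
    refine exists_fc (fun n => by rw [ha, symbIdx_neg, map_mul]) ?_
    refine Summable.of_nonneg_of_le (fun _ => by positivity) (fun n => ?_) hs
    rw [norm_mul, mul_pow]
    exact mul_le_mul_of_nonneg_right (symbIdx_le_wt α.2 n) (by positivity)
  choose U hU using h1
  have h0 : ∀ n, fc (U ⟨0, zero_mem_multiIdx k⟩) n = a n := fun n => by
    rw [hU, symbIdx_zero, one_mul]
  refine ⟨⟨WithLp.toLp 2 U, fun α => (isWeakDeriv_iff _ _ _).2 fun n => ?_⟩, fun n => h0 n⟩
  have := hU α n
  rw [← h0 n] at this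
  exact this

/-- The relations between the components are equations between Fourier coefficients, which are
continuous on L²; hence the subspace is closed. -/
instance : CompleteSpace (Hs k ℝ) := by
  have hc : IsClosed ((sobolevSubmodule k ℝ : Submodule ℝ _) :
      Set (PiLp 2 fun _ : {α : Fin 3 → ℕ // α ∈ multiIdx k} => Lp ℝ 2 torusMeasure)) := by
    have : ((sobolevSubmodule k ℝ : Submodule ℝ _) :
        Set (PiLp 2 fun _ : {α : Fin 3 → ℕ // α ∈ multiIdx k} => Lp ℝ 2 torusMeasure)) =
        ⋂ α, ⋂ n, {w | fc (w α) n = symbIdx α.1 n * fc (w ⟨0, zero_mem_multiIdx k⟩) n} := by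
      ext w
      simp only [Set.mem_iInter]
      exact forall_congr' fun α => isWeakDeriv_iff α.1 _ _
    rw [this]
    refine isClosed_iInter fun α => isClosed_iInter fun n => isClosed_eq ?_ ?_
    · exact (continuous_fc n).comp (PiLp.continuous_apply 2 _ _)
    · exact continuous_const.mul ((continuous_fc n).comp (PiLp.continuous_apply 2 _ _))
  exact hc.completeSpace_coe

theorem continuous_ft (n : Freq) : Continuous fun u : Hs k ℝ => ft u n :=
  (continuous_fc n).comp ((PiLp.continuous_apply 2 _ _).comp continuous_subtype_val)

theorem mem_meanZero_iff (u : Hs k ℝ) : u ∈ meanZeroSubmodule k ℝ ↔ ft u 0 = 0 := by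
  have h1 : ft u 0 = ((∫ x, weakD u 0 x ∂torusMeasure : ℝ) : ℂ) := by
    rw [weakD_of_mem u (zero_mem_multiIdx k)]
    refine Eq.trans ?_ (integral_ofReal (𝕜 := ℂ) (f := u.1 ⟨0, zero_mem_multiIdx k⟩))
    refine integral_congr_ae (Filter.Eventually.of_forall fun x => ?_)
    simp [UnitAddTorus.mFourier_zero]
  rw [h1]
  norm_cast

instance : CompleteSpace (HsBar k ℝ) := by
  have hc : IsClosed ((meanZeroSubmodule k ℝ : Submodule ℝ _) : Set (Hs k ℝ)) := by
    have : ((meanZeroSubmodule k ℝ : Submodule ℝ _) : Set (Hs k ℝ)) = {u | ft u 0 = 0} := by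
      ext u; exact mem_meanZero_iff u
    rw [this]
    exact isClosed_eq (continuous_ft 0) continuous_const
  exact hc.completeSpace_coe

theorem norm_le_of_ft {u : Hs k ℝ} {v : Hs l ℝ} {C : ℝ} (hC : 0 ≤ C)
    (h : ∀ n, wt l n * ‖ft v n‖ ^ 2 ≤ C ^ 2 * (wt k n * ‖ft u n‖ ^ 2)) : ‖v‖ ≤ C * ‖u‖ := by
  refine le_of_sq_le_sq ?_ (by positivity) |> fun h => h
  rw [mul_pow]
  exact hasSum_le h (hasSum_norm_sq v) ((hasSum_norm_sq u).mul_left _)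

theorem exists_multiplier (m : Freq → ℂ) (hm : ∀ n, m (-n) = conj (m n)) (C : ℝ) (hC : 0 ≤ C)
    (h : ∀ n, wt l n * ‖m n‖ ^ 2 ≤ C ^ 2 * wt k n) :
    ∃ T : Hs k ℝ →L[ℝ] Hs l ℝ, ∀ u n, ft (T u) n = m n * ft u n := by
  have hb : ∀ (u : Hs k ℝ) n, wt l n * ‖m n * ft u n‖ ^ 2 ≤ C ^ 2 * (wt k n * ‖ft u n‖ ^ 2) :=
    fun u n => by
      rw [norm_mul, mul_pow, ← mul_assoc, ← mul_assoc]
      exact mul_le_mul_of_nonneg_right (h n) (by positivity)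
  have h1 : ∀ u : Hs k ℝ, ∃ v : Hs l ℝ, ∀ n, ft v n = m n * ft u n := fun u => by
    refine exists_ft (fun n => by rw [hm, ft_neg_freq, map_mul]) ?_
    exact Summable.of_nonneg_of_le (fun n => mul_nonneg (wt_nonneg _ _) (by positivity)) (hb u)
      ((hasSum_norm_sq u).mul_left _).summable
  choose T hT using h1
  refine ⟨LinearMap.mkContinuous ⟨⟨T, fun u v => ft_injective fun n => ?_⟩,
    fun c u => ft_injective fun n => ?_⟩ C fun u => ?_, hT⟩
  · rw [hT, ft_add, ft_add, hT, hT]; ring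
  · simp only [RingHom.id_apply]
    rw [hT, ft_smul, ft_smul, hT]; ring
  · exact norm_le_of_ft hC fun n => by
      simp only [LinearMap.coe_mk, AddHom.coe_mk]
      rw [hT]; exact hb u n

/-- `1 + |2πn|²`. -/
def qwt (n : Freq) : ℝ := 1 + ∑ j, ‖symb j n‖ ^ 2

theorem one_le_qwt (n : Freq) : 1 ≤ qwt n :=
  le_add_of_nonneg_right (Finset.sum_nonneg fun _ _ => by positivity)

theorem symb_le_qwt (j : Fin 3) (n : Freq) : ‖symb j n‖ ^ 2 ≤ qwt n := by
  have := Finset.single_le_sum (f := fun j => ‖symb j n‖ ^ 2) (fun _ _ => by positivity)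
    (Finset.mem_univ j)
  unfold qwt
  linarith

theorem symbIdx_le_qwt (α : Fin 3 → ℕ) (n : Freq) : ‖symbIdx α n‖ ^ 2 ≤ qwt n ^ (∑ i, α i) := by
  rw [symbIdx, norm_prod, ← Finset.prod_pow, ← Finset.prod_pow_eq_pow_sum]
  refine Finset.prod_le_prod (fun _ _ => by positivity) fun j _ => ?_
  rw [norm_pow, ← pow_mul, mul_comm, pow_mul]
  exact pow_le_pow_left₀ (by positivity) (symb_le_qwt j n) _

theorem wt_le_qwt (k : ℕ) : ∃ C : ℝ, 0 < C ∧ ∀ n, wt k n ≤ C * qwt n ^ k := by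
  refine ⟨Fintype.card {α : Fin 3 → ℕ // α ∈ multiIdx k}, ?_, fun n => ?_⟩
  · have : Nonempty {α : Fin 3 → ℕ // α ∈ multiIdx k} := ⟨⟨0, zero_mem_multiIdx k⟩⟩
    exact_mod_cast Fintype.card_pos
  · refine (Finset.sum_le_card_nsmul _ _ (qwt n ^ k) fun α _ => ?_).trans_eq ?_
    · exact (symbIdx_le_qwt α.1 n).trans (pow_le_pow_right₀ (one_le_qwt n) (mem_multiIdx.1 α.2))
    · simp

/-- The weight 1 + |2πn|² has four summands. Either one |2πn_j|² is at least a quarter of the total,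
and the pure derivative ∂_j^k controls the power, or the total is less than 4 and α = 0 suffices. -/
theorem qwt_le_wt (k : ℕ) : ∃ C : ℝ, 0 < C ∧ ∀ n, qwt n ^ k ≤ C * wt k n := by
  refine ⟨4 ^ k, by positivity, fun n => ?_⟩
  have hex : ∃ a : ℝ, qwt n ≤ 4 * a ∧ 0 ≤ a ∧ a ^ k ≤ wt k n := by
    by_cases h : ∃ j, qwt n ≤ 4 * ‖symb j n‖ ^ 2
    · obtain ⟨j, hj⟩ := h
      refine ⟨_, hj, by positivity, ?_⟩
      have hmem : (Pi.single j k : Fin 3 → ℕ) ∈ multiIdx k := mem_multiIdx.2 (by simp)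
      refine le_of_eq_of_le ?_ (symbIdx_le_wt hmem n)
      rw [symbIdx, Finset.prod_eq_single j (fun i _ hi => by simp [Pi.single_eq_of_ne hi]) (by simp),
        Pi.single_eq_same, norm_pow]
      ring
    · push Not at h
      refine ⟨1, ?_, zero_le_one, by rw [one_pow]; exact one_le_wt k n⟩
      have h0 := h 0
      have h1 := h 1
      have h2 := h 2
      simp only [qwt, Fin.sum_univ_three] at h0 h1 h2 ⊢
      linarith
  obtain ⟨a, h1, h2, h3⟩ := hex
  calc qwt n ^ k ≤ (4 * a) ^ k := pow_le_pow_left₀ (zero_le_one.trans (one_le_qwt n)) h1 k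
    _ = 4 ^ k * a ^ k := mul_pow _ _ _
    _ ≤ 4 ^ k * wt k n := mul_le_mul_of_nonneg_left h3 (by positivity)

/-- A Fourier multiplier of order `l - k` maps `H^k` to `H^l`. -/
theorem exists_multiplier_of_order (m : Freq → ℂ) (hm : ∀ n, m (-n) = conj (m n)) (C : ℝ)
    (h : ∀ n, qwt n ^ l * ‖m n‖ ^ 2 ≤ C * qwt n ^ k) :
    ∃ T : Hs k ℝ →L[ℝ] Hs l ℝ, ∀ u n, ft (T u) n = m n * ft u n := by
  obtain ⟨C1, hC1, h1⟩ := wt_le_qwt l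
  obtain ⟨C2, hC2, h2⟩ := qwt_le_wt k
  have hq : ∀ n, 0 < qwt n := fun n => zero_lt_one.trans_le (one_le_qwt n)
  have hC : 0 ≤ C := by
    have := (mul_nonneg (pow_pos (hq 0) l).le (by positivity : (0:ℝ) ≤ ‖m 0‖ ^ 2)).trans (h 0)
    exact nonneg_of_mul_nonneg_left this (pow_pos (hq 0) k)
  refine exists_multiplier m hm (√(C1 * C * C2)) (Real.sqrt_nonneg _) fun n => ?_
  rw [Real.sq_sqrt (by positivity)]
  calc wt l n * ‖m n‖ ^ 2 ≤ C1 * qwt n ^ l * ‖m n‖ ^ 2 :=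
        mul_le_mul_of_nonneg_right (h1 n) (by positivity)
    _ = C1 * (qwt n ^ l * ‖m n‖ ^ 2) := by ring
    _ ≤ C1 * (C * qwt n ^ k) := mul_le_mul_of_nonneg_left (h n) hC1.le
    _ ≤ C1 * (C * (C2 * wt k n)) := by gcongr; exact h2 n
    _ = _ := by ring

end SobolevFourier

end

section

/-! ### Absolute summability of Fourier coefficients and the algebra property. -/

section SobolevAlgebra

open UnitAddTorus
open scoped ComplexConjugate

theorem qwt_pos (n : Freq) : 0 < qwt n := zero_lt_one.trans_le (one_le_qwt n)

theorem norm_symb_sq (j : Fin 3) (n : Freq) : ‖symb j n‖ ^ 2 = (2 * Real.pi) ^ 2 * (n j : ℝ) ^ 2 := by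
  rw [symb, norm_mul, Complex.norm_I, mul_one, Complex.norm_real, Real.norm_eq_abs, sq_abs, mul_pow]

theorem one_add_sq_le_qwt (n : Freq) (j : Fin 3) : 1 + (n j : ℝ) ^ 2 ≤ qwt n := by
  have h1 := Finset.single_le_sum (f := fun j => ‖symb j n‖ ^ 2) (fun _ _ => by positivity)
    (Finset.mem_univ j)
  rw [norm_symb_sq] at h1
  have h2 : (1 : ℝ) ≤ (2 * Real.pi) ^ 2 := by
    have := Real.pi_gt_three
    nlinarith
  have h3 : (n j : ℝ) ^ 2 ≤ (2 * Real.pi) ^ 2 * (n j : ℝ) ^ 2 := le_mul_of_one_le_left (by positivity) h2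
  unfold qwt
  linarith

/-- The exponent is chosen so that three such factors dominate the weight to the power -2, one for
each space dimension; each series converges because 4/3 > 1. -/
theorem summable_int_weight : Summable fun m : ℤ => (1 + (m : ℝ) ^ 2) ^ (-(2 / 3) : ℝ) := by
  have h1 : Summable fun m : ℤ => |(m : ℝ)| ^ (-(4 / 3) : ℝ) :=
    Real.summable_abs_int_rpow (by norm_num)
  have h2 : Summable fun m : ℤ => |(m : ℝ)| ^ (-(4 / 3) : ℝ) + if m = 0 then (1 : ℝ) else 0 :=
    h1.add (summable_of_ne_finset_zero (s := {0}) (by simp +contextual))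
  refine Summable.of_nonneg_of_le (fun m => by positivity) (fun m => ?_) h2
  by_cases hm : m = 0
  · subst hm
    simp
  · simp only [hm, if_false, add_zero]
    have hpos : 0 < |(m : ℝ)| := abs_pos.2 (by exact_mod_cast hm)
    have : |(m : ℝ)| ^ (-(4 / 3) : ℝ) = ((m : ℝ) ^ 2) ^ (-(2 / 3) : ℝ) := by
      rw [← sq_abs, ← Real.rpow_natCast, ← Real.rpow_mul hpos.le]
      norm_num
    rw [this]
    exact Real.rpow_le_rpow_of_nonpos (by positivity) (by linarith) (by norm_num)

theorem summable_qwt_inv {k : ℕ} (hk : 2 ≤ k) : Summable fun n : Freq => (qwt n ^ k)⁻¹ := by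
  set f : ℤ → ℝ := fun m => (1 + (m : ℝ) ^ 2) ^ (-(2 / 3) : ℝ)
  have hf : Summable f := summable_int_weight
  have hf0 : ∀ m, 0 ≤ f m := fun m => by simp only [f]; positivity
  have h2 : Summable fun p : ℤ × ℤ => f p.1 * f p.2 := hf.mul_of_nonneg hf hf0 hf0
  have h3 : Summable fun p : ℤ × (ℤ × ℤ) => f p.1 * (f p.2.1 * f p.2.2) :=
    hf.mul_of_nonneg h2 hf0 (fun p => mul_nonneg (hf0 _) (hf0 _))
  have h4 := h3.comp_injective (i := fun n : Freq => (n 0, (n 1, n 2))) (by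
    intro a b h
    simp only [Prod.mk.injEq] at h
    funext j
    fin_cases j
    exacts [h.1, h.2.1, h.2.2])
  refine Summable.of_nonneg_of_le (fun n => by have := qwt_pos n; positivity) (fun n => ?_) h4
  have hq := qwt_pos n
  have hle : ∀ j, (qwt n) ^ (-(2 / 3) : ℝ) ≤ f (n j) := fun j =>
    Real.rpow_le_rpow_of_nonpos (by positivity) (one_add_sq_le_qwt n j) (by norm_num)
  have hp : 0 ≤ (qwt n) ^ (-(2 / 3) : ℝ) := by positivity
  calc (qwt n ^ k)⁻¹ ≤ (qwt n ^ 2)⁻¹ :=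
        inv_anti₀ (by positivity) (pow_le_pow_right₀ (one_le_qwt n) hk)
    _ = (qwt n) ^ (-(2 / 3) : ℝ) * ((qwt n) ^ (-(2 / 3) : ℝ) * (qwt n) ^ (-(2 / 3) : ℝ)) := by
        rw [← Real.rpow_add hq, ← Real.rpow_add hq, ← Real.rpow_natCast, ← Real.rpow_neg hq.le]
        norm_num
    _ ≤ _ := mul_le_mul (hle 0) (mul_le_mul (hle 1) (hle 2) hp (hf0 _)) (mul_nonneg hp hp) (hf0 _)

variable {k : ℕ}

/-- The Sobolev embedding for k > 3/2: Cauchy–Schwarz against the summable weight. The proof uses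
the weighted arithmetic–geometric inequality with a free parameter t. -/
theorem summable_ft (hk : 2 ≤ k) : ∃ C : ℝ, 0 ≤ C ∧ ∀ u : Hs k ℝ, Summable (fun n => ‖ft u n‖) ∧
    ∑' n, ‖ft u n‖ ≤ C * ‖u‖ := by
  obtain ⟨C2, hC2, h2⟩ := qwt_le_wt k
  have hS := summable_qwt_inv hk
  set S := ∑' n : Freq, (qwt n ^ k)⁻¹
  have hS0 : 0 ≤ S := tsum_nonneg fun n => by have := qwt_pos n; positivity
  have key : ∀ (u : Hs k ℝ) (t : ℝ), 0 < t → Summable (fun n => ‖ft u n‖) ∧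
      ∑' n, ‖ft u n‖ ≤ (1 / 2) * (t * C2) * ‖u‖ ^ 2 + 1 / 2 * t⁻¹ * S := by
    intro u t ht
    have h3 := ((hasSum_norm_sq u).mul_left ((1 / 2) * (t * C2))).add
      (hS.hasSum.mul_left (1 / 2 * t⁻¹))
    have hle : ∀ n, ‖ft u n‖ ≤ (1 / 2) * (t * C2) * (wt k n * ‖ft u n‖ ^ 2) +
        1 / 2 * t⁻¹ * (qwt n ^ k)⁻¹ := by
      intro n
      have hq : 0 < qwt n ^ k := pow_pos (qwt_pos n) k
      have e1 : qwt n ^ k * ‖ft u n‖ ^ 2 ≤ C2 * wt k n * ‖ft u n‖ ^ 2 :=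
        mul_le_mul_of_nonneg_right (h2 n) (by positivity)
      have e2 : ‖ft u n‖ ≤ (1 / 2) * t * (qwt n ^ k * ‖ft u n‖ ^ 2) + 1 / 2 * t⁻¹ * (qwt n ^ k)⁻¹ := by
        have hx : 0 < t * qwt n ^ k := by positivity
        have : (1 / 2) * t * (qwt n ^ k * ‖ft u n‖ ^ 2) + 1 / 2 * t⁻¹ * (qwt n ^ k)⁻¹ - ‖ft u n‖ =
            (t * qwt n ^ k)⁻¹ / 2 * (t * qwt n ^ k * ‖ft u n‖ - 1) ^ 2 := by
          field_simp
          ring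
        have h5 : 0 ≤ (t * qwt n ^ k)⁻¹ / 2 * (t * qwt n ^ k * ‖ft u n‖ - 1) ^ 2 := by positivity
        linarith
      refine e2.trans (add_le_add_left ?_ _)
      calc (1 / 2) * t * (qwt n ^ k * ‖ft u n‖ ^ 2) ≤ (1 / 2) * t * (C2 * wt k n * ‖ft u n‖ ^ 2) :=
            mul_le_mul_of_nonneg_left e1 (by positivity)
        _ = _ := by ring
    have hs := Summable.of_nonneg_of_le (fun n => norm_nonneg _) hle h3.summable
    exact ⟨hs, hasSum_le hle hs.hasSum h3⟩
  refine ⟨(C2 + S) / 2, by positivity, fun u => ⟨(key u 1 one_pos).1, ?_⟩⟩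
  by_cases hu : u = 0
  · subst hu
    have h0 : ∀ n, ft (0 : Hs k ℝ) n = 0 := fun n => by
      have := ft_smul 0 (0 : Hs k ℝ) n
      simpa using this
    simp [h0]
  · have hpos : 0 < ‖u‖ := norm_pos_iff.2 hu
    -- With t = ‖u‖⁻¹ both terms become multiples of ‖u‖, which gives the constant (C2 + S)/2.
    refine (key u ‖u‖⁻¹ (inv_pos.2 hpos)).2.trans_eq ?_
    rw [inv_inv]
    field_simp

/-- The continuous function with absolutely summable Fourier coefficients `b`. -/
def contF (b : Freq → ℂ) : C(T3, ℂ) := ∑' m, b m • mFourier m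

def realF (b : Freq → ℂ) : C(T3, ℝ) := ⟨fun x => (contF b x).re, by fun_prop⟩

section
variable {b : Freq → ℂ} (hb : Summable fun n => ‖b n‖) (hsymm : ∀ n, b (-n) = conj (b n))

theorem hasSum_contF (hb : Summable fun n => ‖b n‖) : HasSum (fun m => b m • mFourier m) (contF b) := by
  refine (Summable.of_norm ?_).hasSum
  simpa only [norm_smul, mFourier_norm, mul_one] using hb

theorem hasSum_contF_apply (hb : Summable fun n => ‖b n‖) (x : T3) :
    HasSum (fun m => b m * mFourier m x) (contF b x) := by
  have := (ContinuousMap.evalCLM ℂ x).hasSum (hasSum_contF hb)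
  simpa using this

theorem ofReal_realF (hb : Summable fun n => ‖b n‖) (hsymm : ∀ n, b (-n) = conj (b n)) (x : T3) :
    (realF b x : ℂ) = contF b x := by
  have h1 := hasSum_contF_apply hb x
  have h2 : HasSum (fun m => conj (b m * mFourier m x)) (conj (contF b x)) :=
    Complex.hasSum_conj'.2 (by simpa using h1)
  have h3 : HasSum (fun m => b m * mFourier m x) (conj (contF b x)) := by
    rw [← (Equiv.neg Freq).hasSum_iff]
    refine h2.congr_fun fun m => ?_
    simp only [Function.comp, Equiv.neg_apply, hsymm, mFourier_neg, map_mul]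
  exact (Complex.conj_eq_iff_re.1 (h3.unique h1))

theorem abs_realF_le (hb : Summable fun n => ‖b n‖) (x : T3) : |realF b x| ≤ ∑' n, ‖b n‖ := by
  refine (Complex.abs_re_le_norm _).trans ?_
  refine le_trans ?_ (le_of_eq (tsum_congr fun n => ?_) : ∑' n, ‖b n * mFourier n x‖ ≤ _)
  · rw [← (hasSum_contF_apply hb x).tsum_eq]
    refine norm_tsum_le_tsum_norm ?_
    refine Summable.of_nonneg_of_le (fun _ => norm_nonneg _) (fun n => ?_) hb
    rw [norm_mul]
    exact mul_le_of_le_one_right (norm_nonneg _) (((mFourier n).norm_coe_le_norm x).trans mFourier_norm.le)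
  · have : ‖mFourier n x‖ = 1 := by
      simp only [mFourier, ContinuousMap.coe_mk, norm_prod, fourier_apply, Circle.norm_coe,
        Finset.prod_const_one]
    rw [norm_mul, this, mul_one]

end

/-- Multiplication by a real function with absolutely summable Fourier coefficients. -/
theorem exists_mul_realF {b : Freq → ℂ} (hb : Summable fun n => ‖b n‖)
    (hsymm : ∀ n, b (-n) = conj (b n)) (G : Lp ℝ 2 torusMeasure) :
    ∃ w : Lp ℝ 2 torusMeasure, (w =ᵐ[torusMeasure] fun x => realF b x * G x) ∧
      ‖w‖ ≤ (∑' n, ‖b n‖) * ‖G‖ ∧ ∀ n, HasSum (fun m => b m * fc G (n - m)) (fc w n) := by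
  have hle : ∀ x, ‖realF b x * G x‖ ≤ (∑' n, ‖b n‖) * ‖G x‖ := fun x => by
    rw [norm_mul]
    exact mul_le_mul_of_nonneg_right (abs_realF_le hb x) (norm_nonneg _)
  have hmeas : AEStronglyMeasurable (fun x => realF b x * G x) torusMeasure :=
    (realF b).continuous.aestronglyMeasurable.mul (Lp.aestronglyMeasurable G)
  have hmem : MemLp (fun x => realF b x * G x) 2 torusMeasure :=
    (Lp.memLp G).of_le_mul hmeas (Filter.Eventually.of_forall hle)
  refine ⟨hmem.toLp _, hmem.coeFn_toLp, ?_, fun n => ?_⟩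
  · refine Lp.norm_le_mul_norm_of_ae_le_mul ?_
    filter_upwards [hmem.coeFn_toLp] with x hx
    rw [hx]
    exact hle x
  · have hG : Integrable (fun x => (G x : ℂ)) torusMeasure :=
      ((Lp.memLp G).integrable (by norm_num)).ofReal
    have hn : ∀ (m : Freq) x, ‖mFourier m x‖ ≤ 1 := fun m x =>
      ((mFourier m).norm_coe_le_norm x).trans mFourier_norm.le
    have hI : ∀ m, Integrable (fun x => b m * (mFourier (-(n - m)) x * (G x : ℂ))) torusMeasure :=
      fun m => ((hG.bdd_mul (c := 1) (mFourier _).continuous.aestronglyMeasurable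
        (Filter.Eventually.of_forall (hn _))).const_mul _)
    have hs : Summable fun m => ∫ x, ‖b m * (mFourier (-(n - m)) x * (G x : ℂ))‖ ∂torusMeasure := by
      refine Summable.of_nonneg_of_le (fun m => integral_nonneg fun _ => norm_nonneg _) (fun m => ?_)
        (hb.mul_right (∫ x, ‖(G x : ℂ)‖ ∂torusMeasure))
      rw [← integral_const_mul]
      refine integral_mono (hI m).norm (hG.norm.const_mul _) fun x => ?_
      simp only [norm_mul]
      exact mul_le_mul_of_nonneg_left (mul_le_of_le_one_left (norm_nonneg _) (hn _ x)) (norm_nonneg _)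
    have h1 := hasSum_integral_of_summable_integral_norm hI hs
    have e1 : ∀ m, ∫ x, b m * (mFourier (-(n - m)) x * (G x : ℂ)) ∂torusMeasure = b m * fc G (n - m) :=
      fun m => integral_const_mul _ _
    simp only [e1] at h1
    have e2 : fc (hmem.toLp _) n =
        ∫ x, ∑' m, b m * (mFourier (-(n - m)) x * (G x : ℂ)) ∂torusMeasure := ?_
    · rw [e2]; exact h1
    refine integral_congr_ae ?_
    filter_upwards [hmem.coeFn_toLp] with x hx
    rw [hx]
    push_cast
    rw [ofReal_realF hb hsymm]
    have h2 := ((hasSum_contF_apply hb x).mul_right (mFourier (-n) x * (G x : ℂ))).tsum_eq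
    rw [show mFourier (-n) x * (contF b x * (G x : ℂ)) = contF b x * (mFourier (-n) x * (G x : ℂ)) by ring,
      ← h2]
    refine tsum_congr fun m => ?_
    rw [neg_sub, sub_eq_add_neg, mFourier_add]
    ring

/-- Since n = m + (n - m), the weight at n is at most four times the larger of the weights at m and
n - m. In a convolution the weight can therefore be placed on one of the two factors. -/
theorem qwt_add_le (k : ℕ) (n m : Freq) :
    √(qwt n ^ k) ≤ 2 ^ k * (√(qwt m ^ k) + √(qwt (n - m) ^ k)) := by
  have h1 : qwt n ≤ 2 * qwt m + 2 * qwt (n - m) := by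
    have hj : ∀ j, ‖symb j n‖ ^ 2 ≤ 2 * ‖symb j m‖ ^ 2 + 2 * ‖symb j (n - m)‖ ^ 2 := fun j => by
      rw [norm_symb_sq, norm_symb_sq, norm_symb_sq, Pi.sub_apply]
      push_cast
      have : (n j : ℝ) ^ 2 ≤ 2 * (m j : ℝ) ^ 2 + 2 * ((n j : ℝ) - m j) ^ 2 := by
        nlinarith [sq_nonneg ((n j : ℝ) - 2 * m j)]
      nlinarith [sq_nonneg (2 * Real.pi)]
    have := Finset.sum_le_sum fun j (_ : j ∈ Finset.univ) => hj j
    rw [Finset.sum_add_distrib, ← Finset.mul_sum, ← Finset.mul_sum] at this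
    unfold qwt
    linarith
  have p1 := qwt_pos m
  have p2 := qwt_pos (n - m)
  have h2 : qwt n ^ k ≤ 4 ^ k * (qwt m ^ k + qwt (n - m) ^ k) := by
    rcases le_total (qwt m) (qwt (n - m)) with h | h
    · calc qwt n ^ k ≤ (4 * qwt (n - m)) ^ k := pow_le_pow_left₀ (qwt_pos n).le (by linarith) k
        _ = 4 ^ k * qwt (n - m) ^ k := mul_pow _ _ _
        _ ≤ _ := mul_le_mul_of_nonneg_left (le_add_of_nonneg_left (by positivity)) (by positivity)
    · calc qwt n ^ k ≤ (4 * qwt m) ^ k := pow_le_pow_left₀ (qwt_pos n).le (by linarith) k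
        _ = 4 ^ k * qwt m ^ k := mul_pow _ _ _
        _ ≤ _ := mul_le_mul_of_nonneg_left (le_add_of_nonneg_right (by positivity)) (by positivity)
  rw [Real.sqrt_le_left (by positivity), mul_pow, ← pow_mul, mul_comm k 2, pow_mul]
  norm_num
  refine h2.trans (mul_le_mul_of_nonneg_left ?_ (by positivity))
  have s1 := Real.sq_sqrt (pow_pos p1 k).le
  have s2 := Real.sq_sqrt (pow_pos p2 k).le
  nlinarith [mul_nonneg (Real.sqrt_nonneg (qwt m ^ k)) (Real.sqrt_nonneg (qwt (n - m) ^ k))]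

theorem realF_ft_ae (hk : 2 ≤ k) (u : Hs k ℝ) :
    realF (ft u) =ᵐ[torusMeasure] u.1 ⟨0, zero_mem_multiIdx k⟩ := by
  obtain ⟨C, -, hC⟩ := summable_ft hk
  have hb := (hC u).1
  set v := u.1 ⟨0, zero_mem_multiIdx k⟩
  have h1 := hasSum_mFourier_series_L2 (d := Fin 3) (toCpx v)
  have e1 : ∀ n, mFourierCoeff (toCpx v) n = ft u n := fun n => by
    rw [ft, fc_eq, torusBasis_repr]; rfl
  simp only [e1] at h1
  have h2 := (ContinuousMap.toLp (E := ℂ) 2 torusMeasure ℂ).hasSum (hasSum_contF hb)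
  simp only [map_smul] at h2
  have h3 : toCpx v = ContinuousMap.toLp (E := ℂ) 2 torusMeasure ℂ (contF (ft u)) := h1.unique h2
  have h4 := ContinuousMap.coeFn_toLp (p := 2) (𝕜 := ℂ) torusMeasure (contF (ft u))
  rw [← h3] at h4
  filter_upwards [h4, coeFn_toCpx v] with x hx hy
  rw [hy, ← ofReal_realF hb (ft_neg_freq u)] at hx
  exact_mod_cast hx.symm

theorem qwt_neg (n : Freq) : qwt (-n) = qwt n := by
  simp only [qwt, norm_symb_sq]
  simp

/-- An L² function that carries the weighted moduli of the coefficients of u. It turns the sums in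
the algebra estimate into Fourier coefficients of products. -/
theorem exists_weighted (k : ℕ) : ∃ C : ℝ, 0 < C ∧ ∀ u : Hs k ℝ, ∃ G : Lp ℝ 2 torusMeasure,
    (∀ n, fc G n = ((√(qwt n ^ k) * ‖ft u n‖ : ℝ) : ℂ)) ∧ ‖G‖ ≤ C * ‖u‖ := by
  obtain ⟨C, hC, h⟩ := qwt_le_wt k
  refine ⟨√C, Real.sqrt_pos.2 hC, fun u => ?_⟩
  have hle : ∀ n, ‖((√(qwt n ^ k) * ‖ft u n‖ : ℝ) : ℂ)‖ ^ 2 ≤ C * (wt k n * ‖ft u n‖ ^ 2) := fun n => by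
    rw [Complex.norm_real, Real.norm_eq_abs, sq_abs, mul_pow, Real.sq_sqrt (pow_pos (qwt_pos n) k).le,
      ← mul_assoc]
    exact mul_le_mul_of_nonneg_right (h n) (by positivity)
  have hs := (hasSum_norm_sq u).mul_left C
  obtain ⟨G, hG⟩ := exists_fc (a := fun n => ((√(qwt n ^ k) * ‖ft u n‖ : ℝ) : ℂ))
    (fun n => by rw [qwt_neg, ft_neg_freq, Complex.conj_ofReal, RCLike.norm_conj])
    (Summable.of_nonneg_of_le (fun _ => by positivity) hle hs.summable)
  refine ⟨G, hG, ?_⟩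
  have h1 := hasSum_fc_sq G
  simp only [hG] at h1
  have h2 := hasSum_le hle h1 hs
  refine le_of_sq_le_sq ?_ (by positivity) |> fun h => h
  rw [mul_pow, Real.sq_sqrt hC.le]
  exact h2

/-- `H^k` is an algebra for `k ≥ 2`. -/
theorem exists_mul (hk : 2 ≤ k) : ∃ C : ℝ, 0 < C ∧ ∀ u v : Hs k ℝ, ∃ w : Hs k ℝ,
    realF (ft w) = realF (ft u) * realF (ft v) ∧ ‖w‖ ≤ C * ‖u‖ * ‖v‖ := by
  obtain ⟨C1, hC1, h1⟩ := summable_ft hk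
  obtain ⟨Cw, hCw, hw⟩ := wt_le_qwt k
  obtain ⟨Cg, hCg, hg⟩ := exists_weighted k
  -- The additional 1 only makes the constant visibly positive.
  refine ⟨√(Cw * 4 ^ k * 4) * (C1 * Cg) + 1, by positivity, fun u v => ?_⟩
  have habs : ∀ z : Hs k ℝ, Summable fun n => ‖((‖ft z n‖ : ℝ) : ℂ)‖ := fun z => by
    simpa using (h1 z).1
  have hsym : ∀ (z : Hs k ℝ) n, ((‖ft z (-n)‖ : ℝ) : ℂ) = conj ((‖ft z n‖ : ℝ) : ℂ) := fun z n => by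
    rw [ft_neg_freq, Complex.conj_ofReal, RCLike.norm_conj]
  have htsum : ∀ z : Hs k ℝ, ∑' n, ‖((‖ft z n‖ : ℝ) : ℂ)‖ ≤ C1 * ‖z‖ := fun z => by
    simpa using (h1 z).2
  obtain ⟨w0, hw0, -, hw0s⟩ := exists_mul_realF (h1 u).1 (ft_neg_freq u) (v.1 ⟨0, zero_mem_multiIdx k⟩)
  obtain ⟨Gu, hGu, hGu'⟩ := hg u
  obtain ⟨Gv, hGv, hGv'⟩ := hg v
  -- `A` has the coefficients of |û| convolved with the weighted |v̂|, and `B` those with the roles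
  -- exchanged. Together they dominate the weighted coefficients of the product.
  obtain ⟨A, -, hA, hAs⟩ := exists_mul_realF (habs u) (hsym u) Gv
  obtain ⟨B, -, hB, hBs⟩ := exists_mul_realF (habs v) (hsym v) Gu
  -- pointwise bound
  have hpt : ∀ n, √(qwt n ^ k) * ‖fc w0 n‖ ≤ 2 ^ k * (‖fc A n‖ + ‖fc B n‖) := by
    intro n
    have a1 := hAs n
    have b1 := hBs n
    simp only [hGv, hGu] at a1 b1
    -- The substitution m ↦ n - m brings both convolutions to the same pairs of frequencies.
    have b2 := ((Equiv.subLeft n).hasSum_iff).2 b1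
    simp only [Function.comp_def, Equiv.subLeft_apply, sub_sub_cancel] at b2
    have a3 := Complex.hasSum_re a1
    have b3 := Complex.hasSum_re b2
    have w1 := hw0s n
    have hterm : ∀ m, ‖(√(qwt n ^ k) : ℂ) * (ft u m * fc (v.1 ⟨0, zero_mem_multiIdx k⟩) (n - m))‖ ≤
        2 ^ k * ((((‖ft u m‖ : ℝ) : ℂ) * ((√(qwt (n - m) ^ k) * ‖ft v (n - m)‖ : ℝ) : ℂ)).re +
          (((‖ft v (n - m)‖ : ℝ) : ℂ) * ((√(qwt m ^ k) * ‖ft u m‖ : ℝ) : ℂ)).re) := by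
      intro m
      rw [← Complex.ofReal_mul, ← Complex.ofReal_mul, Complex.ofReal_re, Complex.ofReal_re, norm_mul,
        norm_mul, Complex.norm_real, Real.norm_eq_abs, abs_of_nonneg (Real.sqrt_nonneg _)]
      have := mul_le_mul_of_nonneg_right (qwt_add_le k n m)
        (mul_nonneg (norm_nonneg (ft u m)) (norm_nonneg (ft v (n - m))))
      refine this.trans_eq ?_
      ring
    have hsum := (a3.add b3).mul_left (2 ^ k)
    have w2 := w1.mul_left (√(qwt n ^ k) : ℂ)
    have hs := Summable.of_nonneg_of_le (fun m => norm_nonneg _) hterm hsum.summable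
    have h5 : ‖(√(qwt n ^ k) : ℂ) * fc w0 n‖ ≤ 2 ^ k * ((fc A n).re + (fc B n).re) := by
      rw [← w2.tsum_eq, ← hsum.tsum_eq]
      exact (norm_tsum_le_tsum_norm hs).trans (hs.tsum_le_tsum hterm hsum.summable)
    rw [norm_mul, Complex.norm_real, Real.norm_eq_abs, abs_of_nonneg (Real.sqrt_nonneg _)] at h5
    exact h5.trans (mul_le_mul_of_nonneg_left
      (add_le_add (Complex.re_le_norm _) (Complex.re_le_norm _)) (by positivity))
  have hsq : ∀ n, wt k n * ‖fc w0 n‖ ^ 2 ≤ (Cw * 4 ^ k * 2) * (‖fc A n‖ ^ 2 + ‖fc B n‖ ^ 2) := by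
    intro n
    have h2 := pow_le_pow_left₀ (by positivity) (hpt n) 2
    rw [mul_pow, Real.sq_sqrt (pow_pos (qwt_pos n) k).le, mul_pow, ← pow_mul, mul_comm k 2, pow_mul] at h2
    norm_num at h2
    calc wt k n * ‖fc w0 n‖ ^ 2 ≤ Cw * qwt n ^ k * ‖fc w0 n‖ ^ 2 :=
          mul_le_mul_of_nonneg_right (hw n) (by positivity)
      _ = Cw * (qwt n ^ k * ‖fc w0 n‖ ^ 2) := by ring
      _ ≤ Cw * (4 ^ k * (‖fc A n‖ + ‖fc B n‖) ^ 2) := mul_le_mul_of_nonneg_left h2 hCw.le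
      _ ≤ Cw * (4 ^ k * (2 * (‖fc A n‖ ^ 2 + ‖fc B n‖ ^ 2))) := by
          gcongr
          exact add_sq_le
      _ = _ := by ring
  have hAB := ((hasSum_fc_sq A).add (hasSum_fc_sq B)).mul_left (Cw * 4 ^ k * 2)
  have hsm : Summable fun n => wt k n * ‖fc w0 n‖ ^ 2 :=
    Summable.of_nonneg_of_le (fun n => mul_nonneg (wt_nonneg _ _) (by positivity)) hsq hAB.summable
  obtain ⟨w, hwf⟩ := exists_ft (fun n => fc_neg w0 n) hsm
  refine ⟨w, ?_, ?_⟩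
  · have e0 : w.1 ⟨0, zero_mem_multiIdx k⟩ = w0 := fc_injective hwf
    refine ContinuousMap.ext fun x => ?_
    refine congrFun (Continuous.ae_eq_iff_eq torusMeasure (realF (ft w)).continuous
      (realF (ft u) * realF (ft v)).continuous |>.1 ?_) x
    filter_upwards [realF_ft_ae hk w, realF_ft_ae hk v, hw0] with x hx hv hx0
    rw [hx, e0, hx0, ContinuousMap.mul_apply, hv]
  · have hn := hasSum_norm_sq w
    simp only [hwf] at hn
    have h2 := hasSum_le hsq hn hAB
    have hA2 : ‖A‖ ≤ (C1 * Cg) * (‖u‖ * ‖v‖) := by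
      refine hA.trans ((mul_le_mul (htsum u) hGv' (norm_nonneg _) (by positivity)).trans_eq ?_)
      ring
    have hB2 : ‖B‖ ≤ (C1 * Cg) * (‖u‖ * ‖v‖) := by
      refine hB.trans ((mul_le_mul (htsum v) hGu' (norm_nonneg _) (by positivity)).trans_eq ?_)
      ring
    have hA3 := pow_le_pow_left₀ (norm_nonneg _) hA2 2
    have hB3 := pow_le_pow_left₀ (norm_nonneg _) hB2 2
    have h3 : ‖w‖ ^ 2 ≤ (√(Cw * 4 ^ k * 4) * (C1 * Cg) * (‖u‖ * ‖v‖)) ^ 2 := by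
      rw [mul_pow, mul_pow, Real.sq_sqrt (by positivity)]
      calc ‖w‖ ^ 2 ≤ Cw * 4 ^ k * 2 * (‖A‖ ^ 2 + ‖B‖ ^ 2) := h2
        _ ≤ Cw * 4 ^ k * 2 * (((C1 * Cg) * (‖u‖ * ‖v‖)) ^ 2 + ((C1 * Cg) * (‖u‖ * ‖v‖)) ^ 2) := by
            gcongr
        _ = _ := by ring
    have h4 := le_of_sq_le_sq h3 (by positivity)
    calc ‖w‖ ≤ √(Cw * 4 ^ k * 4) * (C1 * Cg) * (‖u‖ * ‖v‖) := h4
      _ ≤ (√(Cw * 4 ^ k * 4) * (C1 * Cg) + 1) * (‖u‖ * ‖v‖) :=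
          mul_le_mul_of_nonneg_right (le_add_of_nonneg_right zero_le_one) (by positivity)
      _ = _ := (mul_assoc _ _ _).symm

end SobolevAlgebra

end

section

/-! ### The Banach algebra structure on H^k. -/

section SobolevBanachAlgebra

open UnitAddTorus
open scoped ComplexConjugate

variable (k : ℕ) [hk : Fact (2 ≤ k)]

/-- `H^k(T³)`, `k ≥ 2`, with pointwise multiplication and an equivalent submultiplicative norm. -/
def Alg (k : ℕ) : Type := Hs k ℝ

instance : AddCommGroup (Alg k) := inferInstanceAs (AddCommGroup (Hs k ℝ))

instance : Module ℝ (Alg k) := inferInstanceAs (Module ℝ (Hs k ℝ))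

/-- Multiplying the H^k norm by this constant makes it submultiplicative. -/
def algConst : ℝ := (exists_mul hk.1).choose

theorem algConst_pos : 0 < algConst k := (exists_mul hk.1).choose_spec.1

def toHs : Alg k ≃ₗ[ℝ] Hs k ℝ := LinearEquiv.refl ℝ (Hs k ℝ)

variable {k}

/-- The continuous representative. -/
def cont (u : Alg k) : C(T3, ℝ) := realF (ft (toHs k u))

theorem cont_apply (u : Alg k) (x : T3) : (cont u x : ℂ) = contF (ft (toHs k u)) x := by
  obtain ⟨C, -, hC⟩ := summable_ft hk.1
  exact ofReal_realF (hC _).1 (ft_neg_freq _) x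

theorem cont_ae (u : Alg k) : cont u =ᵐ[torusMeasure] (toHs k u).1 ⟨0, zero_mem_multiIdx k⟩ :=
  realF_ft_ae hk.1 (toHs k u)

/-- All ring axioms of `Alg k` are transported from the ring of continuous functions through this
embedding. -/
theorem cont_injective : Function.Injective (cont (k := k)) := by
  intro u v h
  apply (toHs k).injective
  refine ft_injective fun n => ?_
  have e : (toHs k u).1 ⟨0, zero_mem_multiIdx k⟩ = (toHs k v).1 ⟨0, zero_mem_multiIdx k⟩ := by
    apply Lp.ext
    exact (cont_ae u).symm.trans ((Filter.EventuallyEq.of_eq (by rw [h])).trans (cont_ae v))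
  rw [ft, ft, e]

theorem cont_ext {u v : Alg k} (h : ∀ x, cont u x = cont v x) : u = v :=
  cont_injective (ContinuousMap.ext h)

theorem cont_add (u v : Alg k) : cont (u + v) = cont u + cont v := by
  refine ContinuousMap.ext fun x => ?_
  refine congrFun (Continuous.ae_eq_iff_eq torusMeasure (cont (u + v)).continuous
    (cont u + cont v).continuous |>.1 ?_) x
  filter_upwards [cont_ae u, cont_ae v, cont_ae (u + v), Lp.coeFn_add
    ((toHs k u).1 ⟨0, zero_mem_multiIdx k⟩) ((toHs k v).1 ⟨0, zero_mem_multiIdx k⟩)] with x h1 h2 h3 h4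
  rw [h3, ContinuousMap.add_apply, h1, h2]
  exact h4

theorem cont_smul (c : ℝ) (u : Alg k) : cont (c • u) = c • cont u := by
  refine ContinuousMap.ext fun x => ?_
  refine congrFun (Continuous.ae_eq_iff_eq torusMeasure (cont (c • u)).continuous
    (c • cont u).continuous |>.1 ?_) x
  filter_upwards [cont_ae u, cont_ae (c • u), Lp.coeFn_smul c
    ((toHs k u).1 ⟨0, zero_mem_multiIdx k⟩)] with x h1 h3 h4
  rw [h3, ContinuousMap.smul_apply, h1]
  exact h4

theorem exists_cont_one : ∃ u : Alg k, cont u = 1 ∧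
    ft (toHs k u) = fun n => if n = 0 then 1 else 0 := by
  set a : Freq → ℂ := fun n => if n = 0 then 1 else 0
  obtain ⟨u, hu⟩ := exists_ft (k := k) (a := a) (fun n => by
    by_cases h : n = 0 <;> simp [a, h])
    (summable_of_ne_finset_zero (s := {0}) (by intro n hn; simp at hn; simp [a, hn]))
  refine ⟨(toHs k).symm u, ContinuousMap.ext fun x => ?_, by
    rw [LinearEquiv.apply_symm_apply]; exact funext hu⟩
  have h1 := cont_apply ((toHs k).symm u) x
  have hf : ft (toHs k ((toHs k).symm u)) = a := by
    funext n; rw [LinearEquiv.apply_symm_apply, hu]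
  obtain ⟨C, -, hC⟩ := summable_ft hk.1
  have hs := hasSum_contF_apply (hC (toHs k ((toHs k).symm u))).1 x
  rw [hf] at hs h1
  have h2 : HasSum (fun m => a m * mFourier m x) 1 := by
    have := hasSum_ite_eq (0 : Freq) (1 : ℂ)
    refine this.congr_fun fun m => ?_
    by_cases h : m = 0
    · subst h; simp [a, mFourier_zero]
    · simp [a, h]
  rw [hs.unique h2] at h1
  exact_mod_cast h1

instance : One (Alg k) := ⟨exists_cont_one.choose⟩

instance : Mul (Alg k) := ⟨fun u v => (toHs k).symm
  ((exists_mul hk.1).choose_spec.2 (toHs k u) (toHs k v)).choose⟩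

theorem cont_one : cont (1 : Alg k) = 1 := exists_cont_one.choose_spec.1

theorem ft_one : ft (toHs k (1 : Alg k)) = fun n => if n = 0 then 1 else 0 :=
  exists_cont_one.choose_spec.2

theorem cont_mul (u v : Alg k) : cont (u * v) = cont u * cont v :=
  ((exists_mul hk.1).choose_spec.2 (toHs k u) (toHs k v)).choose_spec.1

theorem norm_toHs_mul_le (u v : Alg k) :
    ‖toHs k (u * v)‖ ≤ algConst k * ‖toHs k u‖ * ‖toHs k v‖ :=
  ((exists_mul hk.1).choose_spec.2 (toHs k u) (toHs k v)).choose_spec.2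

theorem cont_zero : cont (0 : Alg k) = 0 := by
  have := cont_smul 0 (0 : Alg k)
  simpa using this

instance : CommRing (Alg k) :=
  { (inferInstance : AddCommGroup (Alg k)), (inferInstance : One (Alg k)),
    (inferInstance : Mul (Alg k)) with
    left_distrib := fun a b c => cont_injective (by simp only [cont_mul, cont_add, mul_add])
    right_distrib := fun a b c => cont_injective (by simp only [cont_mul, cont_add, add_mul])
    zero_mul := fun a => cont_injective (by rw [cont_mul, cont_zero, zero_mul])
    mul_zero := fun a => cont_injective (by rw [cont_mul, cont_zero, mul_zero])
    mul_assoc := fun a b c => cont_injective (by simp only [cont_mul, mul_assoc])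
    one_mul := fun a => cont_injective (by rw [cont_mul, cont_one, one_mul])
    mul_one := fun a => cont_injective (by rw [cont_mul, cont_one, mul_one])
    mul_comm := fun a b => cont_injective (by rw [cont_mul, cont_mul, mul_comm]) }

instance : NormedAddCommGroup (Alg k) := AddGroupNorm.toNormedAddCommGroup
  { toFun := fun u => algConst k * ‖toHs k u‖
    map_zero' := by simp
    add_le' := fun u v => by
      rw [map_add, ← mul_add]
      exact mul_le_mul_of_nonneg_left (norm_add_le _ _) (algConst_pos k).le
    neg' := fun u => by rw [map_neg, norm_neg]
    eq_zero_of_map_eq_zero' := fun u h => by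
      have := (mul_eq_zero.1 h).resolve_left (algConst_pos k).ne'
      simpa using this }

theorem norm_alg (u : Alg k) : ‖u‖ = algConst k * ‖toHs k u‖ := rfl

instance : NormedCommRing (Alg k) :=
  { (inferInstance : CommRing (Alg k)), (inferInstance : NormedAddCommGroup (Alg k)) with
    norm_mul_le := fun u v => by
      rw [norm_alg, norm_alg, norm_alg]
      refine (mul_le_mul_of_nonneg_left (norm_toHs_mul_le u v) (algConst_pos k).le).trans_eq ?_
      ring }

instance : NormedSpace ℝ (Alg k) where
  norm_smul_le c u := by
    rw [norm_alg, norm_alg, map_smul, norm_smul]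
    exact le_of_eq (by ring)

instance : Algebra ℝ (Alg k) := Algebra.ofModule
  (fun c a b => cont_injective (by simp only [cont_mul, cont_smul, smul_mul_assoc]))
  (fun c a b => cont_injective (by simp only [cont_mul, cont_smul, mul_smul_comm]))

instance : NormedAlgebra ℝ (Alg k) where
  norm_smul_le := norm_smul_le

/-- The identification of `Alg k` with `H^k`. -/
def algEquiv : Alg k ≃L[ℝ] Hs k ℝ :=
  (toHs k).toContinuousLinearEquivOfBounds (algConst k)⁻¹ (algConst k)
    (fun u => by rw [norm_alg, ← mul_assoc, inv_mul_cancel₀ (algConst_pos k).ne', one_mul])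
    (fun u => by rw [norm_alg]; simp)

theorem algEquiv_apply (u : Alg k) : algEquiv u = toHs k u := rfl

instance : CompleteSpace (Alg k) :=
  (completeSpace_congr (e := (algEquiv (k := k)).toEquiv) algEquiv.isUniformEmbedding).2 inferInstance

/-- Evaluation at a point. -/
def evalAlg (x : T3) : Alg k →ₐ[ℝ] ℝ := AlgHom.ofLinearMap
  { toFun := fun u => cont u x
    map_add' := fun u v => by rw [cont_add]; rfl
    map_smul' := fun c u => by rw [cont_smul]; rfl }
  (by simp [cont_one]) (fun u v => by simp [cont_mul])

/-- Uniformity in the point is what makes sign conditions hold on the whole torus at once. -/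
theorem exists_evalAlg_bound : ∃ C : ℝ, 0 < C ∧ ∀ (x : T3) (u : Alg k), |evalAlg x u| ≤ C * ‖u‖ := by
  obtain ⟨C, hC0, hC⟩ := summable_ft hk.1
  refine ⟨C * (algConst k)⁻¹ + 1, by have := algConst_pos k; positivity, fun x u => ?_⟩
  have h1 := (abs_realF_le (hC (toHs k u)).1 x).trans (hC (toHs k u)).2
  refine h1.trans ?_
  rw [add_mul, one_mul, norm_alg, mul_assoc, ← mul_assoc (algConst k)⁻¹,
    inv_mul_cancel₀ (algConst_pos k).ne', one_mul]
  have := mul_nonneg (algConst_pos k).le (norm_nonneg (toHs k u))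
  linarith

end SobolevBanachAlgebra

end

section

/-! ### Derivatives, mean value and inverse Laplacian as operators. -/

section SobolevOperators

open UnitAddTorus
open scoped ComplexConjugate

theorem exists_derivOp {j k : ℕ} (α : Fin 3 → ℕ) (h : k + ∑ i, α i ≤ j) :
    ∃ T : Hs j ℝ →L[ℝ] Hs k ℝ, ∀ u n, ft (T u) n = symbIdx α n * ft u n := by
  refine exists_multiplier_of_order _ (symbIdx_neg α) 1 fun n => ?_
  have h1 := mul_le_mul_of_nonneg_left (symbIdx_le_qwt α n) (pow_pos (qwt_pos n) k).le
  rw [← pow_add] at h1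
  rw [one_mul]
  exact h1.trans (pow_le_pow_right₀ (one_le_qwt n) h)

/-- The derivative `D^α : H^j → H^k`, `k + |α| ≤ j`. -/
def derivOp {j k : ℕ} (α : Fin 3 → ℕ) (h : k + ∑ i, α i ≤ j) : Hs j ℝ →L[ℝ] Hs k ℝ :=
  (exists_derivOp α h).choose

theorem ft_derivOp {j k : ℕ} (α : Fin 3 → ℕ) (h : k + ∑ i, α i ≤ j) (u : Hs j ℝ) (n : Freq) :
    ft (derivOp α h u) n = symbIdx α n * ft u n := (exists_derivOp α h).choose_spec u n

theorem derivOp_zero_component {j k : ℕ} (α : Fin 3 → ℕ) (h : k + ∑ i, α i ≤ j) (u : Hs j ℝ) :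
    (derivOp α h u).1 ⟨0, zero_mem_multiIdx k⟩ = u.1 ⟨α, mem_multiIdx.2 (by omega)⟩ := by
  refine fc_injective fun n => ?_
  rw [fc_component u]
  exact ft_derivOp α h u n

theorem weakD_ae {j k : ℕ} [hk : Fact (2 ≤ k)] (α : Fin 3 → ℕ) (h : k + ∑ i, α i ≤ j) (u : Hs j ℝ) :
    weakD u α =ᵐ[torusMeasure] cont ((toHs k).symm (derivOp α h u)) := by
  refine Filter.EventuallyEq.symm ?_
  refine (cont_ae ((toHs k).symm (derivOp α h u))).trans (Filter.EventuallyEq.of_eq ?_)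
  rw [weakD_of_mem u (mem_multiIdx.2 (by omega))]
  exact congrArg (fun f : Lp ℝ 2 torusMeasure => (f : T3 → ℝ)) (derivOp_zero_component α h u)

theorem symbIdx_add (α β : Fin 3 → ℕ) (n : Freq) :
    symbIdx (α + β) n = symbIdx α n * symbIdx β n := by
  simp only [symbIdx, Pi.add_apply, pow_add, Finset.prod_mul_distrib]

theorem symbIdx_unitIdx (i : Fin 3) (n : Freq) : symbIdx (unitIdx i) n = symb i n := by
  rw [symbIdx, Finset.prod_eq_single i (fun j _ hj => by simp [unitIdx, Pi.single_eq_of_ne hj]) (by simp)]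
  simp [unitIdx]

theorem symb_sq (i : Fin 3) (n : Freq) : symb i n * symb i n = -((‖symb i n‖ ^ 2 : ℝ) : ℂ) := by
  rw [norm_symb_sq, symb, mul_mul_mul_comm, Complex.I_mul_I]
  push_cast
  ring

theorem sum_symb_eq_zero {n : Freq} : ∑ j, ‖symb j n‖ ^ 2 = 0 ↔ n = 0 := by
  constructor
  · intro h
    funext j
    have h1 := (Finset.sum_eq_zero_iff_of_nonneg (fun j _ => by positivity)).1 h j (Finset.mem_univ j)
    rw [norm_symb_sq] at h1
    have h2 : (2 * Real.pi) ^ 2 ≠ 0 := by positivity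
    have h3 := (mul_eq_zero.1 h1).resolve_left h2
    exact_mod_cast pow_eq_zero_iff (two_ne_zero) |>.1 h3
  · rintro rfl
    simp [symb]

/-- At n = 0 the inverse of zero is zero by convention, so the constant mode is annihilated and the
multiplier maps into mean zero functions. -/
def lapSymb (n : Freq) : ℂ := ((-(∑ j, ‖symb j n‖ ^ 2)⁻¹ : ℝ) : ℂ)

/-- For n ≠ 0 one has |2πn|² ≥ 1, hence 1 + |2πn|² ≤ 2|2πn|². Squaring gives the constant 4 and the
gain of two derivatives. -/
theorem exists_invLapHs (k : ℕ) :
    ∃ T : Hs k ℝ →L[ℝ] Hs (k + 2) ℝ, ∀ u n, ft (T u) n = lapSymb n * ft u n := by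
  refine exists_multiplier_of_order _ (fun n => ?_) 4 fun n => ?_
  · rw [lapSymb, lapSymb, Complex.conj_ofReal]
    simp only [norm_symb_sq]
    simp
  · by_cases hn : n = 0
    · have h0 : lapSymb n = 0 := by
        rw [lapSymb, sum_symb_eq_zero.2 hn]; simp
      rw [h0]
      have := qwt_pos n
      simp
      positivity
    · have hL : 1 ≤ ∑ j, ‖symb j n‖ ^ 2 := by
        obtain ⟨j, hj⟩ := Function.ne_iff.1 hn
        refine le_trans ?_ (Finset.single_le_sum (f := fun j => ‖symb j n‖ ^ 2)
          (fun _ _ => by positivity) (Finset.mem_univ j))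
        rw [norm_symb_sq]
        have h1 : (1 : ℝ) ≤ (n j : ℝ) ^ 2 := by
          have : (1 : ℤ) ≤ (n j) ^ 2 := by
            have := sq_nonneg (n j)
            have h2 : (n j) ^ 2 ≠ 0 := pow_ne_zero 2 hj
            omega
          exact_mod_cast this
        have := Real.pi_gt_three
        nlinarith
      have hq : qwt n ≤ 2 * ∑ j, ‖symb j n‖ ^ 2 := by unfold qwt; linarith
      have hnorm : ‖lapSymb n‖ ^ 2 = ((∑ j, ‖symb j n‖ ^ 2) ^ 2)⁻¹ := by
        rw [lapSymb, Complex.norm_real, Real.norm_eq_abs, sq_abs, neg_sq, inv_pow]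
      rw [hnorm]
      generalize ∑ j, ‖symb j n‖ ^ 2 = L at *
      have hq0 := qwt_pos n
      rw [pow_add, mul_assoc, mul_comm]
      refine mul_le_mul_of_nonneg_right ?_ (by positivity)
      rw [← div_eq_mul_inv, div_le_iff₀ (by positivity)]
      nlinarith

/-- `Δ⁻¹ ∘ (1 - mean)`. -/
def invLap (k : ℕ) : Hs k ℝ →L[ℝ] HsBar (k + 2) ℝ :=
  ContinuousLinearMap.codRestrict (exists_invLapHs k).choose (meanZeroSubmodule (k + 2) ℝ) fun u => by
    rw [mem_meanZero_iff, (exists_invLapHs k).choose_spec, lapSymb, sum_symb_eq_zero.2 rfl]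
    simp

theorem ft_invLap (k : ℕ) (u : Hs k ℝ) (n : Freq) : ft (invLap k u).1 n = lapSymb n * ft u n :=
  (exists_invLapHs k).choose_spec u n

/-- The mean value. -/
def meanOp (k : ℕ) : Hs k ℝ →L[ℝ] ℝ :=
  ⟨⟨⟨fun u => (ft u 0).re, fun u v => by rw [ft_add]; rfl⟩, fun c u => by
      change (ft (c • u) 0).re = c * (ft u 0).re
      rw [ft_smul, Complex.re_ofReal_mul]⟩,
    Complex.continuous_re.comp (continuous_ft 0)⟩

theorem ft_zero_eq {k : ℕ} (u : Hs k ℝ) : ft u 0 = (meanOp k u : ℂ) := by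
  have h := ft_neg_freq u 0
  rw [neg_zero] at h
  exact (Complex.conj_eq_iff_re.1 h.symm).symm

theorem meanOp_bar {k : ℕ} (u : HsBar k ℝ) : meanOp k u.1 = 0 := by
  have h := (mem_meanZero_iff u.1).1 u.2
  rw [ft_zero_eq] at h
  exact_mod_cast h

theorem meanOp_derivOp {j k : ℕ} (α : Fin 3 → ℕ) (h : k + ∑ i, α i ≤ j) (hα : α ≠ 0) (u : Hs j ℝ) :
    meanOp k (derivOp α h u) = 0 := by
  have h1 := ft_zero_eq (derivOp α h u)
  obtain ⟨i, hi⟩ := Function.ne_iff.1 hα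
  have h2 : symbIdx α 0 = 0 := by
    rw [symbIdx]
    refine Finset.prod_eq_zero (Finset.mem_univ i) ?_
    have : symb i 0 = 0 := by simp [symb]
    rw [this]
    exact zero_pow hi
  rw [ft_derivOp, h2, zero_mul] at h1
  exact_mod_cast h1.symm

/-- An equation in H^k is equivalent to a scalar equation for the mean and an equation after Δ⁻¹.
This is the splitting by which the constraints are solved. -/
theorem eq_zero_of_mean_of_invLap {k : ℕ} {u : Hs k ℝ} (h1 : meanOp k u = 0) (h2 : invLap k u = 0) :
    u = 0 := by
  refine ft_injective fun n => ?_
  have h0 : ∀ (j : ℕ) n, ft (0 : Hs j ℝ) n = 0 := fun j n => by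
    have := ft_smul 0 (0 : Hs j ℝ) n
    simpa using this
  rw [h0]
  by_cases hn : n = 0
  · rw [hn, ft_zero_eq, h1]; simp
  · have h3 := ft_invLap k u n
    rw [h2] at h3
    have h4 : ft ((0 : HsBar (k + 2) ℝ).1) n = 0 := h0 _ n
    rw [h4] at h3
    refine (mul_eq_zero.1 h3.symm).resolve_left ?_
    rw [lapSymb, Complex.ofReal_eq_zero, neg_eq_zero]
    exact inv_ne_zero (mt sum_symb_eq_zero.1 hn)

theorem ft_sum_derivOp {j k : ℕ} (h : k + 2 ≤ j) (u : Hs j ℝ) (n : Freq) :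
    ft (∑ i : Fin 3, derivOp (k := k) (unitIdx i + unitIdx i)
      (by simpa [Finset.sum_add_distrib, unitIdx] using h) u) n =
      -((∑ i, ‖symb i n‖ ^ 2 : ℝ) : ℂ) * ft u n := by
  simp only [Fin.sum_univ_three, ft_add, ft_derivOp, symbIdx_add, symbIdx_unitIdx, symb_sq]
  push_cast
  ring

theorem invLap_laplacian {k : ℕ} (u : HsBar (k + 2) ℝ) :
    invLap k (∑ i : Fin 3, derivOp (k := k) (unitIdx i + unitIdx i)
      (by simp [Finset.sum_add_distrib, unitIdx]) u.1) = u := by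
  refine Subtype.ext (ft_injective fun n => ?_)
  rw [ft_invLap, ft_sum_derivOp le_rfl]
  by_cases hn : n = 0
  · rw [hn, (mem_meanZero_iff u.1).1 u.2, mul_zero, mul_zero]
  · have h1 : ((∑ i, ‖symb i n‖ ^ 2 : ℝ) : ℂ) ≠ 0 :=
      Complex.ofReal_ne_zero.2 (mt sum_symb_eq_zero.1 hn)
    rw [lapSymb]
    push_cast at h1 ⊢
    rw [← mul_assoc, neg_mul_neg, inv_mul_cancel₀ h1, one_mul]

theorem isInvLaplacian_invLap {k j : ℕ} (h : k ≤ j) (f : HsBar j ℝ) :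
    IsInvLaplacian (invLap k (derivOp 0 (by simpa using h) f.1)) f := by
  set w := invLap k (derivOp 0 (by simpa using h) f.1)
  have hsum : ∀ i : Fin 3, 0 + ∑ j, (unitIdx i + unitIdx i) j ≤ k + 2 := fun i => by
    simp [Finset.sum_add_distrib, unitIdx]
  have e : (∑ i : Fin 3, derivOp (k := 0) (unitIdx i + unitIdx i) (hsum i) w.1) =
      derivOp 0 (by simp) f.1 := by
    refine ft_injective fun n => ?_
    rw [ft_sum_derivOp (by omega), ft_invLap, ft_derivOp, ft_derivOp, symbIdx_zero, one_mul]
    by_cases hn : n = 0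
    · rw [hn, (mem_meanZero_iff f.1).1 f.2, mul_zero, mul_zero]
    · have h1 : ((∑ i, ‖symb i n‖ ^ 2 : ℝ) : ℂ) ≠ 0 :=
        Complex.ofReal_ne_zero.2 (mt sum_symb_eq_zero.1 hn)
      rw [lapSymb]
      push_cast at h1 ⊢
      rw [← mul_assoc, neg_mul_neg, mul_inv_cancel₀ h1, one_mul]
  have e2 : ∑ i : Fin 3, w.1.1 ⟨unitIdx i + unitIdx i, mem_multiIdx.2 (by
      simp [Finset.sum_add_distrib, unitIdx])⟩ = f.1.1 ⟨0, zero_mem_multiIdx j⟩ := by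
    refine fc_injective fun n => ?_
    have h3 := congrArg (fun u => ft u n) e
    simp only [Fin.sum_univ_three, ft_add, ft_derivOp] at h3
    simp only [Fin.sum_univ_three, fc_add, fc_component]
    rw [h3, symbIdx_zero]
  have hw : ∀ i : Fin 3, weakD w.1 (unitIdx i + unitIdx i) = w.1.1 ⟨unitIdx i + unitIdx i, mem_multiIdx.2 (by
      simp [Finset.sum_add_distrib, unitIdx])⟩ := fun i => weakD_of_mem _ _
  have hf : weakD f.1 0 = f.1.1 ⟨0, zero_mem_multiIdx j⟩ := weakD_of_mem _ _
  unfold IsInvLaplacian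
  simp only [hw, hf]
  rw [← e2]
  have a1 := Lp.coeFn_add (w.1.1 ⟨unitIdx 0 + unitIdx 0, mem_multiIdx.2 (by
      simp [Finset.sum_add_distrib, unitIdx])⟩) (w.1.1 ⟨unitIdx 1 + unitIdx 1, mem_multiIdx.2 (by
      simp [Finset.sum_add_distrib, unitIdx])⟩)
  have a2 := Lp.coeFn_add ((w.1.1 ⟨unitIdx 0 + unitIdx 0, mem_multiIdx.2 (by
      simp [Finset.sum_add_distrib, unitIdx])⟩) + (w.1.1 ⟨unitIdx 1 + unitIdx 1, mem_multiIdx.2 (by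
      simp [Finset.sum_add_distrib, unitIdx])⟩)) (w.1.1 ⟨unitIdx 2 + unitIdx 2, mem_multiIdx.2 (by
      simp [Finset.sum_add_distrib, unitIdx])⟩)
  simp only [Fin.sum_univ_three]
  filter_upwards [a1, a2] with x h1 h2
  rw [h2, Pi.add_apply, h1, Pi.add_apply]

end SobolevOperators

/-! ### Linear maps acting on the values of Sobolev functions. -/

section Components

variable {k : ℕ} {V W : Type*} [NormedAddCommGroup V] [InnerProductSpace ℝ V]
  [NormedAddCommGroup W] [InnerProductSpace ℝ W]

/-- Weak derivatives are tested with scalar functions, and continuous linear maps commute with the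
integral. -/
theorem exists_mapHs [CompleteSpace V] [CompleteSpace W] (T : V →L[ℝ] W) (k : ℕ) :
    ∃ F : Hs k V →L[ℝ] Hs k W, ∀ u α, weakD (F u) α =ᵐ[torusMeasure] fun x => T (weakD u α x) := by
  have hT : ∀ u : Lp V 2 torusMeasure, T.compLpL 2 torusMeasure u =ᵐ[torusMeasure] fun x => T (u x) :=
    fun u => T.coeFn_compLpL u
  set L : (PiLp 2 fun _ : {α : Fin 3 → ℕ // α ∈ multiIdx k} => Lp V 2 torusMeasure) →L[ℝ]
      (PiLp 2 fun _ : {α : Fin 3 → ℕ // α ∈ multiIdx k} => Lp W 2 torusMeasure) :=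
    (PiLp.continuousLinearEquiv 2 ℝ _).symm.toContinuousLinearMap ∘L
      (ContinuousLinearMap.pi fun α => T.compLpL 2 torusMeasure ∘L ContinuousLinearMap.proj α) ∘L
      (PiLp.continuousLinearEquiv 2 ℝ _).toContinuousLinearMap
  have hL : ∀ w α, L w α = T.compLpL 2 torusMeasure (w α) := fun w α => rfl
  have hmem : ∀ u : sobolevSubmodule k V, L u.1 ∈ sobolevSubmodule k W := by
    intro u α φ hφ
    have key : ∀ (ψ : T3 → ℝ), IsSmooth ψ → ∀ v : Lp V 2 torusMeasure,
        ∫ x, ψ x • (T.compLpL 2 torusMeasure v) x ∂torusMeasure = T (∫ x, ψ x • v x ∂torusMeasure) := by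
      intro ψ hψ v
      rw [← T.integral_comp_comm (integrable_smul hψ v)]
      refine integral_congr_ae ?_
      filter_upwards [hT v] with x hx
      rw [hx, map_smul]
    rw [hL, hL, key _ (hφ.torusDeriv _), key _ hφ, u.2 α φ hφ, map_smul]
  refine ⟨(L ∘L (sobolevSubmodule k V).subtypeL).codRestrict (sobolevSubmodule k W) hmem,
    fun u α => ?_⟩
  by_cases hα : α ∈ multiIdx k
  · rw [weakD_of_mem _ hα, weakD_of_mem u hα]
    exact hT _
  · simp [weakD, hα]
    rfl

/-- Composition with a linear map of the values. -/
def mapHs [CompleteSpace V] [CompleteSpace W] (T : V →L[ℝ] W) (k : ℕ) : Hs k V →L[ℝ] Hs k W :=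
  (exists_mapHs T k).choose

theorem weakD_mapHs [CompleteSpace V] [CompleteSpace W] (T : V →L[ℝ] W) (u : Hs k V) (α : Fin 3 → ℕ) :
    weakD (mapHs T k u) α =ᵐ[torusMeasure] fun x => T (weakD u α x) :=
  (exists_mapHs T k).choose_spec u α

theorem integrable_weakD (u : Hs k V) (α : Fin 3 → ℕ) : Integrable (weakD u α) torusMeasure := by
  by_cases hα : α ∈ multiIdx k
  · rw [weakD_of_mem _ hα]
    exact (Lp.memLp _).integrable (by norm_num)
  · simp only [weakD, hα, dif_neg, not_false_eq_true]
    exact integrable_zero _ _ _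

/-- Composition with a linear map of the values, on mean zero functions. -/
def mapHsBar [CompleteSpace V] [CompleteSpace W] (T : V →L[ℝ] W) (k : ℕ) : HsBar k V →L[ℝ] HsBar k W :=
  ((mapHs T k) ∘L (meanZeroSubmodule k V).subtypeL).codRestrict (meanZeroSubmodule k W) fun u => by
    change ∫ x, weakD (mapHs T k u.1) 0 x ∂torusMeasure = 0
    rw [integral_congr_ae (weakD_mapHs T u.1 0), T.integral_comp_comm (integrable_weakD _ _)]
    have : ∫ x, weakD u.1 0 x ∂torusMeasure = 0 := u.2
    rw [this, map_zero]

end Components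

end

section

/-! ### An implicit function theorem for linear solution operators. -/

section AnalyticOperators

open Filter Topology

variable {E V W W' : Type*} [NormedAddCommGroup E] [NormedSpace ℝ E]
  [NormedAddCommGroup V] [NormedSpace ℝ V] [NormedAddCommGroup W] [NormedSpace ℝ W]
  [NormedAddCommGroup W'] [NormedSpace ℝ W']

theorem analyticAt_clm_comp {f : E → W →L[ℝ] W'} {g : E → V →L[ℝ] W} {x : E}
    (hf : AnalyticAt ℝ f x) (hg : AnalyticAt ℝ g x) : AnalyticAt ℝ (fun y => (f y).comp (g y)) x :=
  ((ContinuousLinearMap.compL ℝ V W W').analyticAt_bilinear (f x, g x)).comp₂ hf hg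

theorem analyticAt_clm_apply {f : E → W →L[ℝ] W'} {g : E → W} {x : E}
    (hf : AnalyticAt ℝ f x) (hg : AnalyticAt ℝ g x) : AnalyticAt ℝ (fun y => f y (g y)) x :=
  ((ContinuousLinearMap.id ℝ (W →L[ℝ] W')).analyticAt_bilinear (f x, g x)).comp₂ hf hg

theorem analyticAt_clm (T : V →L[ℝ] W) {f : E → V} {x : E} (hf : AnalyticAt ℝ f x) :
    AnalyticAt ℝ (fun y => T (f y)) x := (T.analyticAt (f x)).comp hf

/-- The unknown is the operator Y that takes data to solutions, not the solution itself, so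
linearity in z is built in. At the origin the term with S vanishes, because its first argument is
(0, 0), and the equation becomes Y = M + NY with N² = 0. Its linearization 1 - N is invertible, and
the implicit function theorem applies in the space of operators. The operator acts on an arbitrary
z, while ζ enters as a separate parameter. -/
theorem exists_implicit {P Z X : Type*} [NormedAddCommGroup P] [NormedSpace ℝ P] [CompleteSpace P]
    [NormedAddCommGroup Z] [NormedSpace ℝ Z] [CompleteSpace Z]
    [NormedAddCommGroup X] [NormedSpace ℝ X] [CompleteSpace X]
    {L : ℝ → (Z × X) →L[ℝ] X} (hL : AnalyticAt ℝ L 0)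
    {S : ℝ × P × (Z × X) → (ℝ × (Z × X)) →L[ℝ] (Z × X) →L[ℝ] X} (hS : AnalyticAt ℝ S 0)
    (hN : ∀ x : X, L 0 (0, L 0 (0, x)) = 0) :
    ∃ Y : ℝ × P × Z → Z →L[ℝ] X, AnalyticAt ℝ Y 0 ∧ ∀ᶠ q in 𝓝 (0 : ℝ × P × Z), ∀ z,
      Y q z = L q.1 (z, Y q z) +
        S (q.1, q.2.1, (q.2.2, Y q q.2.2)) (q.1, (q.2.2, Y q q.2.2)) (z, Y q z) := by
  set N : X →L[ℝ] X := (L 0).comp (ContinuousLinearMap.inr ℝ Z X)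
  have hNN : N.comp N = 0 := by ext x; exact hN x
  set M : Z →L[ℝ] X := (L 0).comp (ContinuousLinearMap.inl ℝ Z X)
  have hsplit : ∀ Y : Z →L[ℝ] X, (L 0).comp ((ContinuousLinearMap.id ℝ Z).prod Y) = M + N.comp Y := by
    intro Y
    ext z
    simp only [M, N, ContinuousLinearMap.comp_apply, ContinuousLinearMap.prod_apply,
      add_apply, ContinuousLinearMap.inl_apply, ContinuousLinearMap.inr_apply,
      ContinuousLinearMap.id_apply]
    rw [← map_add, Prod.mk_add_mk, add_zero, zero_add]
  -- The solution (1 - N)⁻¹M of the equation at the origin, by N² = 0.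
  set Y0 : Z →L[ℝ] X := M + N.comp M
  have hY0 : Y0 - (M + N.comp Y0) = 0 := by
    simp only [Y0, ContinuousLinearMap.comp_add, ← ContinuousLinearMap.comp_assoc, hNN,
      ContinuousLinearMap.zero_comp, add_zero, sub_self]
  set F : (ℝ × P × Z) × (Z →L[ℝ] X) → (Z →L[ℝ] X) := fun p =>
    p.2 - (L p.1.1 + S (p.1.1, p.1.2.1, (p.1.2.2, p.2 p.1.2.2)) (p.1.1, (p.1.2.2, p.2 p.1.2.2))).comp
      ((ContinuousLinearMap.id ℝ Z).prod p.2)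
  have hF0 : ∀ Y, F (0, Y) = Y - (M + N.comp Y) := by
    intro Y
    have e0 : ((0 : ℝ), ((0 : Z), (0 : X))) = 0 := rfl
    simp only [F, Prod.fst_zero, Prod.snd_zero, map_zero, e0, add_zero, hsplit]
  have hanal : AnalyticAt ℝ F (0, Y0) := by
    have h1 : AnalyticAt ℝ (fun p : (ℝ × P × Z) × (Z →L[ℝ] X) => p.1.1) (0, Y0) := analyticAt_fst.fun_comp analyticAt_fst
    have h2 : AnalyticAt ℝ (fun p : (ℝ × P × Z) × (Z →L[ℝ] X) => p.1.2.1) (0, Y0) :=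
      analyticAt_fst.fun_comp (analyticAt_snd.fun_comp analyticAt_fst)
    have h3 : AnalyticAt ℝ (fun p : (ℝ × P × Z) × (Z →L[ℝ] X) => p.1.2.2) (0, Y0) :=
      analyticAt_snd.fun_comp (analyticAt_snd.fun_comp analyticAt_fst)
    have h4 : AnalyticAt ℝ (fun p : (ℝ × P × Z) × (Z →L[ℝ] X) => p.2) (0, Y0) := analyticAt_snd
    have h5 := analyticAt_clm_apply h4 h3
    have h6 : AnalyticAt ℝ (fun p : (ℝ × P × Z) × (Z →L[ℝ] X) =>
        L p.1.1) (0, Y0) := AnalyticAt.fun_comp (g := L) hL h1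
    have h7 : AnalyticAt ℝ (fun p : (ℝ × P × Z) × (Z →L[ℝ] X) =>
        S (p.1.1, p.1.2.1, (p.1.2.2, p.2 p.1.2.2))) (0, Y0) := by
      refine AnalyticAt.fun_comp (g := S) ?_ (h1.prod (h2.prod (h3.prod h5)))
      simp only [Prod.fst_zero, Prod.snd_zero, map_zero]
      exact hS
    have h8 := analyticAt_clm_apply h7 (h1.prod (h3.prod h5))
    have h9 : AnalyticAt ℝ (fun p : (ℝ × P × Z) × (Z →L[ℝ] X) =>
        (ContinuousLinearMap.id ℝ Z).prod p.2) (0, Y0) := by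
      have e : (fun p : (ℝ × P × Z) × (Z →L[ℝ] X) => (ContinuousLinearMap.id ℝ Z).prod p.2) =
          fun p => ContinuousLinearMap.inl ℝ Z X + (ContinuousLinearMap.inr ℝ Z X).comp p.2 := by
        funext p
        ext z <;> simp
      rw [e]
      exact analyticAt_const.add (analyticAt_clm_comp analyticAt_const h4)
    exact h4.sub (analyticAt_clm_comp (h6.add h8) h9)
  set D : (Z →L[ℝ] X) →L[ℝ] (Z →L[ℝ] X) :=
    ContinuousLinearMap.id ℝ _ - ContinuousLinearMap.compL ℝ Z X X N
  have hD : fderiv ℝ F (0, Y0) ∘L ContinuousLinearMap.inr ℝ (ℝ × P × Z) (Z →L[ℝ] X) = D := by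
    have h1 : HasFDerivAt (fun Y => F (0, Y))
        (fderiv ℝ F (0, Y0) ∘L ContinuousLinearMap.inr ℝ (ℝ × P × Z) (Z →L[ℝ] X)) Y0 :=
      hanal.differentiableAt.hasFDerivAt.comp Y0 (hasFDerivAt_prodMk_right 0 Y0)
    have h2 : HasFDerivAt (fun Y => F (0, Y)) D Y0 := by
      have e : (fun Y => F (0, Y)) = fun Y => D Y - M := by
        funext Y
        rw [hF0]
        simp only [D, sub_apply, ContinuousLinearMap.id_apply,
          ContinuousLinearMap.compL_apply]
        abel
      rw [e]
      exact D.hasFDerivAt.sub_const M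
    exact h1.unique h2
  have hinv : (fderiv ℝ F (0, Y0) ∘L ContinuousLinearMap.inr ℝ (ℝ × P × Z) (Z →L[ℝ] X)).IsInvertible := by
    rw [hD]
    -- The inverse of 1 - N is 1 + N.
    set D' : (Z →L[ℝ] X) →L[ℝ] (Z →L[ℝ] X) :=
      ContinuousLinearMap.id ℝ _ + ContinuousLinearMap.compL ℝ Z X X N
    have e1 : ∀ Y : Z →L[ℝ] X, N.comp (N.comp Y) = 0 := fun Y => by
      rw [← ContinuousLinearMap.comp_assoc, hNN, ContinuousLinearMap.zero_comp]
    refine ⟨ContinuousLinearEquiv.equivOfInverse D D' (fun Y => ?_) (fun Y => ?_), rfl⟩ <;>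
    · simp only [D, D', sub_apply, add_apply,
        ContinuousLinearMap.id_apply, ContinuousLinearMap.compL_apply, ContinuousLinearMap.comp_sub,
        ContinuousLinearMap.comp_add, e1]
      abel
  have cdf : ContDiffAt ℝ ω F (0, Y0) := hanal.contDiffAt
  refine ⟨cdf.implicitFunction (by simp) hinv, (cdf.contDiffAt_implicitFunction (by simp) hinv).analyticAt, ?_⟩
  filter_upwards [cdf.eventually_apply_implicitFunction (by simp) hinv] with q hq z
  rw [hF0, hY0] at hq
  have := congrArg (fun T : Z →L[ℝ] X => T z) hq
  simp only [F, sub_apply, ContinuousLinearMap.comp_apply,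
    add_apply, ContinuousLinearMap.prod_apply, ContinuousLinearMap.id_apply,
    zero_apply] at this
  exact sub_eq_zero.1 this

end AnalyticOperators

/-! ### Analytic families, the ideal of terms linear in ζ and the ideal of negligible terms. -/

section Ideals

open Filter Topology

variable {P V W W' : Type*} [NormedAddCommGroup P] [NormedSpace ℝ P]
  [NormedAddCommGroup V] [NormedSpace ℝ V] [NormedAddCommGroup W] [NormedSpace ℝ W]
  [NormedAddCommGroup W'] [NormedSpace ℝ W']

/-- `f(ε, p, ζ) = T(ε, p, ζ) ζ` near the origin, with `T` analytic. -/
def IsZ (f : ℝ × P × V → W) : Prop :=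
  ∃ T : ℝ × P × V → V →L[ℝ] W, AnalyticAt ℝ T 0 ∧ ∀ᶠ q in 𝓝 0, f q = T q q.2.2

/-- `f(ε, p, ζ) = S(ε, p, ζ) (ε, ζ) ζ` near the origin, with `S` analytic. -/
def IsI (f : ℝ × P × V → W) : Prop :=
  ∃ S : ℝ × P × V → (ℝ × V) →L[ℝ] V →L[ℝ] W, AnalyticAt ℝ S 0 ∧
    ∀ᶠ q in 𝓝 0, f q = S q (q.1, q.2.2) q.2.2

variable {f g : ℝ × P × V → W}

theorem IsZ.add (hf : IsZ f) (hg : IsZ g) : IsZ (f + g) := by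
  obtain ⟨T, hT, h1⟩ := hf
  obtain ⟨T', hT', h2⟩ := hg
  refine ⟨T + T', hT.add hT', ?_⟩
  filter_upwards [h1, h2] with q a b
  rw [Pi.add_apply, a, b]; rfl

theorem IsI.add (hf : IsI f) (hg : IsI g) : IsI (f + g) := by
  obtain ⟨T, hT, h1⟩ := hf
  obtain ⟨T', hT', h2⟩ := hg
  refine ⟨T + T', hT.add hT', ?_⟩
  filter_upwards [h1, h2] with q a b
  rw [Pi.add_apply, a, b]; rfl

theorem isZ_of_eventually (h : ∀ᶠ q in 𝓝 0, f q = 0) : IsZ f :=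
  ⟨0, analyticAt_const, by filter_upwards [h] with q a; rw [a]; rfl⟩

theorem isI_of_eventually (h : ∀ᶠ q in 𝓝 0, f q = 0) : IsI f :=
  ⟨0, analyticAt_const, by filter_upwards [h] with q a; rw [a]; rfl⟩

theorem IsI.congr (hf : IsI f) (h : ∀ᶠ q in 𝓝 0, g q = f q) : IsI g := by
  obtain ⟨T, hT, h1⟩ := hf
  refine ⟨T, hT, ?_⟩
  filter_upwards [h1, h] with q a b
  rw [b, a]

theorem IsZ.clm (hf : IsZ f) {A : ℝ × P × V → W →L[ℝ] W'} (hA : AnalyticAt ℝ A 0) :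
    IsZ (fun q => A q (f q)) := by
  obtain ⟨T, hT, h1⟩ := hf
  refine ⟨fun q => (A q).comp (T q), analyticAt_clm_comp hA hT, ?_⟩
  filter_upwards [h1] with q a
  rw [a]; rfl

theorem IsI.clm (hf : IsI f) {A : ℝ × P × V → W →L[ℝ] W'} (hA : AnalyticAt ℝ A 0) :
    IsI (fun q => A q (f q)) := by
  obtain ⟨T, hT, h1⟩ := hf
  refine ⟨fun q => (ContinuousLinearMap.compL ℝ V W W' (A q)).comp (T q),
    analyticAt_clm_comp (analyticAt_clm _ hA) hT, ?_⟩
  filter_upwards [h1] with q a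
  rw [a]; rfl

/-- Together with `IsZ.bilinear` this is the reason for introducing the second ideal: it absorbs ε
times a linear term and products of two linear terms. After the substitution ζ = ε(z, x) its
elements are of order ε². -/
theorem IsZ.eps_smul (hf : IsZ f) : IsI (fun q => q.1 • f q) := by
  obtain ⟨T, hT, h1⟩ := hf
  refine ⟨fun q => ContinuousLinearMap.smulRightL ℝ (ℝ × V) (V →L[ℝ] W)
    (ContinuousLinearMap.fst ℝ ℝ V) (T q), analyticAt_clm _ hT, ?_⟩
  filter_upwards [h1] with q a
  rw [a]
  simp [ContinuousLinearMap.smulRightL]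

theorem isZ_linear (A : V →L[ℝ] W) : IsZ (fun q : ℝ × P × V => A q.2.2) :=
  ⟨fun _ => A, analyticAt_const, Eventually.of_forall fun _ => rfl⟩

theorem IsZ.bilinear {W'' : Type*} [NormedAddCommGroup W''] [NormedSpace ℝ W'']
    (hf : IsZ f) {g : ℝ × P × V → W'} (hg : IsZ g) (B : W →L[ℝ] W' →L[ℝ] W'') :
    IsI (fun q => B (f q) (g q)) := by
  obtain ⟨T, hT, h1⟩ := hf
  obtain ⟨T', hT', h2⟩ := hg
  refine ⟨fun q => ((ContinuousLinearMap.compL ℝ V W' W'').flip (T' q)).comp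
    (B.comp ((T q).comp (ContinuousLinearMap.snd ℝ ℝ V))), ?_, ?_⟩
  · exact analyticAt_clm_comp (analyticAt_clm _ hT')
      (analyticAt_clm_comp analyticAt_const (analyticAt_clm_comp hT analyticAt_const))
  · filter_upwards [h1, h2] with q a b
    rw [a, b]; rfl

theorem IsI.isZ (hf : IsI f) : IsZ f := by
  obtain ⟨S, hS, h⟩ := hf
  refine ⟨fun q => S q (q.1, q.2.2), analyticAt_clm_apply hS
    (analyticAt_fst.prod (analyticAt_snd.fun_comp analyticAt_snd)), ?_⟩
  filter_upwards [h] with q a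
  rw [a]

variable {𝔸 𝔹 : Type*} [NormedCommRing 𝔸] [NormedAlgebra ℝ 𝔸] [NormedCommRing 𝔹] [NormedAlgebra ℝ 𝔹]

variable (P V 𝔸) in
/-- The algebra of `𝔸`-valued functions of `(ε, p, ζ)` that are analytic at the origin. -/
def AnAlg : Subalgebra ℝ (ℝ × P × V → 𝔸) where
  carrier := {f | AnalyticAt ℝ f 0}
  mul_mem' := fun ha hb => ha.mul hb
  add_mem' := fun ha hb => ha.add hb
  algebraMap_mem' := fun _ => analyticAt_const

variable (P V 𝔸) in
def idealZ : Ideal (AnAlg P V 𝔸) where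
  carrier := {f | IsZ f.1}
  add_mem' := fun ha hb => ha.add hb
  zero_mem' := isZ_of_eventually (Eventually.of_forall fun _ => rfl)
  smul_mem' := fun c _ hf => hf.clm (analyticAt_clm (ContinuousLinearMap.mul ℝ 𝔸) c.2)

variable (P V 𝔸) in
def idealI : Ideal (AnAlg P V 𝔸) where
  carrier := {f | IsI f.1}
  add_mem' := fun ha hb => ha.add hb
  zero_mem' := isI_of_eventually (Eventually.of_forall fun _ => rfl)
  smul_mem' := fun c _ hf => hf.clm (analyticAt_clm (ContinuousLinearMap.mul ℝ 𝔸) c.2)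

theorem mul_mem_idealI {a b : AnAlg P V 𝔸} (ha : a ∈ idealZ P V 𝔸) (hb : b ∈ idealZ P V 𝔸) :
    a * b ∈ idealI P V 𝔸 := IsZ.bilinear ha hb (ContinuousLinearMap.mul ℝ 𝔸)

theorem idealI_le : idealI P V 𝔸 ≤ idealZ P V 𝔸 := fun _ h => IsI.isZ h

/-- A scalar function of `ε`. -/
def scal (f : ℝ → ℝ) (hf : AnalyticAt ℝ f 0) : AnAlg P V 𝔸 :=
  ⟨fun q => algebraMap ℝ 𝔸 (f q.1), by
    have h1 : AnalyticAt ℝ (fun q : ℝ × P × V => f q.1) 0 :=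
      AnalyticAt.fun_comp (g := f) hf analyticAt_fst
    exact analyticAt_clm (algebraMapCLM ℝ 𝔸) h1⟩

variable (P V 𝔸) in
def epsEl : AnAlg P V 𝔸 := scal (fun e => e) analyticAt_id

theorem eps_mul_mem {a : AnAlg P V 𝔸} (ha : a ∈ idealZ P V 𝔸) : epsEl P V 𝔸 * a ∈ idealI P V 𝔸 := by
  refine IsI.congr (IsZ.eps_smul ha) (Eventually.of_forall fun q => ?_)
  exact (Algebra.smul_def _ _).symm

/-- A linear function of `ζ`. -/
def lin (A : V →L[ℝ] 𝔸) : AnAlg P V 𝔸 := ⟨fun q => A q.2.2, by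
  exact analyticAt_clm A (analyticAt_snd.fun_comp analyticAt_snd)⟩

theorem lin_mem (A : V →L[ℝ] 𝔸) : (lin A : AnAlg P V 𝔸) ∈ idealZ P V 𝔸 := isZ_linear A

/-- Composition with a continuous linear map of the values. -/
def mapLin (T : 𝔸 →L[ℝ] 𝔹) : AnAlg P V 𝔸 →ₗ[ℝ] AnAlg P V 𝔹 where
  toFun f := ⟨fun q => T (f.1 q), analyticAt_clm T f.2⟩
  map_add' f g := Subtype.ext (by funext q; exact map_add T _ _)
  map_smul' c f := Subtype.ext (by funext q; exact map_smul T _ _)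

theorem mapLin_mem_idealZ (T : 𝔸 →L[ℝ] 𝔹) {f : AnAlg P V 𝔸} (hf : f ∈ idealZ P V 𝔸) :
    mapLin T f ∈ idealZ P V 𝔹 := IsZ.clm hf (A := fun _ => T) analyticAt_const

theorem mapLin_mem_idealI (T : 𝔸 →L[ℝ] 𝔹) {f : AnAlg P V 𝔸} (hf : f ∈ idealI P V 𝔸) :
    mapLin T f ∈ idealI P V 𝔹 := IsI.clm hf (A := fun _ => T) analyticAt_const

/-- Composition with a continuous algebra homomorphism of the values. -/
def mapHom (ι : 𝔸 →ₐ[ℝ] 𝔹) (hι : Continuous ι) : AnAlg P V 𝔸 →ₐ[ℝ] AnAlg P V 𝔹 :=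
  AlgHom.ofLinearMap (mapLin ⟨ι.toLinearMap, hι⟩)
    (Subtype.ext (by funext q; exact map_one ι)) (fun f g => Subtype.ext (by funext q; exact map_mul ι _ _))

/-- Evaluation at a point of the parameter space. -/
def evalAn (q : ℝ × P × V) : AnAlg P V 𝔸 →ₐ[ℝ] 𝔸 := (Pi.evalAlgHom ℝ (fun _ : ℝ × P × V => 𝔸) q).comp
  (AnAlg P V 𝔸).val

/-- The inverse of an element that is invertible at the origin. -/
theorem exists_inv [CompleteSpace 𝔸] (f : AnAlg P V 𝔸) (hf : IsUnit (f.1 0)) :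
    ∃ g : AnAlg P V 𝔸, (∀ᶠ q in 𝓝 0, g.1 q * f.1 q = 1) ∧ g.1 0 = Ring.inverse (f.1 0) := by
  obtain ⟨u, hu⟩ := hf
  refine ⟨⟨fun q => Ring.inverse (f.1 q), AnalyticAt.fun_comp (g := Ring.inverse) ?_ f.2⟩, ?_, rfl⟩
  · rw [← hu]; exact analyticAt_inverse u
  · have h1 : ∀ᶠ q in 𝓝 0, IsUnit (f.1 q) :=
      f.2.continuousAt.eventually (by rw [← hu]; exact u.nhds)
    filter_upwards [h1] with q hq
    exact Ring.inverse_mul_cancel _ hq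

/-- The square root near a positive constant. -/
theorem exists_sqrt [CompleteSpace 𝔸] (f : AnAlg P V 𝔸) (c : ℝ) (hc : c ≠ 0)
    (hf : f.1 0 = algebraMap ℝ 𝔸 (c ^ 2)) :
    ∃ g : AnAlg P V 𝔸, (∀ᶠ q in 𝓝 0, g.1 q ^ 2 = f.1 q) ∧ g.1 0 = algebraMap ℝ 𝔸 c := by
  -- The square root is an implicit function of y² = f; at y = c the linearization is multiplication
  -- by the nonzero number 2c.
  set F : 𝔸 × 𝔸 → 𝔸 := fun p => p.2 ^ 2 - p.1
  have hF : AnalyticAt ℝ F (algebraMap ℝ 𝔸 (c ^ 2), algebraMap ℝ 𝔸 c) := by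
    exact (analyticAt_snd.pow 2).sub analyticAt_fst
  have hD : fderiv ℝ F (algebraMap ℝ 𝔸 (c ^ 2), algebraMap ℝ 𝔸 c) ∘L ContinuousLinearMap.inr ℝ 𝔸 𝔸 =
      (2 * c) • ContinuousLinearMap.id ℝ 𝔸 := by
    have h1 : HasFDerivAt (fun y => F (algebraMap ℝ 𝔸 (c ^ 2), y))
        (fderiv ℝ F (algebraMap ℝ 𝔸 (c ^ 2), algebraMap ℝ 𝔸 c) ∘L ContinuousLinearMap.inr ℝ 𝔸 𝔸)
        (algebraMap ℝ 𝔸 c) :=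
      hF.differentiableAt.hasFDerivAt.comp _ (hasFDerivAt_prodMk_right _ _)
    have h2 : HasFDerivAt (fun y => F (algebraMap ℝ 𝔸 (c ^ 2), y)) ((2 * c) • ContinuousLinearMap.id ℝ 𝔸)
        (algebraMap ℝ 𝔸 c) := by
      have h3 : HasFDerivAt (fun y : 𝔸 => y * y - algebraMap ℝ 𝔸 (c ^ 2)) _ (algebraMap ℝ 𝔸 c) :=
        ((hasFDerivAt_id (𝕜 := ℝ) (algebraMap ℝ 𝔸 c)).mul (hasFDerivAt_id _)).sub_const _
      have e : (fun y => F (algebraMap ℝ 𝔸 (c ^ 2), y)) = fun y => y * y - algebraMap ℝ 𝔸 (c ^ 2) := by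
        funext y; simp only [F]; ring
      rw [e]
      refine h3.congr_fderiv ?_
      ext y
      change algebraMap ℝ 𝔸 c * y + algebraMap ℝ 𝔸 c * y = (2 * c) • y
      rw [Algebra.smul_def, map_mul, map_ofNat]
      ring
    exact h1.unique h2
  have hinv : (fderiv ℝ F (algebraMap ℝ 𝔸 (c ^ 2), algebraMap ℝ 𝔸 c) ∘L
      ContinuousLinearMap.inr ℝ 𝔸 𝔸).IsInvertible := by
    rw [hD]
    have h2c : 2 * c ≠ 0 := by simpa using hc
    exact ⟨ContinuousLinearEquiv.smulLeft (Units.mk0 (2 * c) h2c), by ext y; rfl⟩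
  have cdf : ContDiffAt ℝ ω F (algebraMap ℝ 𝔸 (c ^ 2), algebraMap ℝ 𝔸 c) := hF.contDiffAt
  have hn : (ω : WithTop ℕ∞) ≠ 0 := by simp
  have han := (cdf.contDiffAt_implicitFunction hn hinv).analyticAt
  have hself := cdf.implicitFunction_apply_self hn hinv
  have hev := cdf.eventually_apply_implicitFunction hn hinv
  have hF0 : F (algebraMap ℝ 𝔸 (c ^ 2), algebraMap ℝ 𝔸 c) = 0 := by simp [F]
  rw [hF0] at hev
  refine ⟨⟨fun q => cdf.implicitFunction hn hinv (f.1 q),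
      AnalyticAt.fun_comp (g := cdf.implicitFunction hn hinv) (by rw [hf]; exact han) f.2⟩,
    ?_, ?_⟩
  · have h1 := f.2.continuousAt.eventually (by rw [hf]; exact hev)
    filter_upwards [h1] with q hq
    exact sub_eq_zero.1 hq
  · change cdf.implicitFunction hn hinv (f.1 0) = _
    rw [hf]; exact hself

end Ideals

end

/-! ### The jets of the perturbed metric over a ring, and the constraints at background level. -/

section

/-- The jet of a perturbation of the background: `eps • 𝔲` corresponds to `N`, `eps • ∂_k 𝔲` to `N1 k`,
`eps • ∂_t 𝔲` to `B`, `eps • ∂_k ∂_t 𝔲` to `B1 k` and `eps • ∂_k ∂_l 𝔲` to `S2 k l`; `e` and `e1` are the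
scale factor and its time derivative. -/
structure FieldJet (𝔸 : Type*) where
  eps : 𝔸
  e : 𝔸
  e1 : 𝔸
  N : M4 𝔸
  N1 : Fin 3 → M4 𝔸
  B : M4 𝔸
  B1 : Fin 3 → M4 𝔸
  S2 : Fin 3 → Fin 3 → M4 𝔸

namespace FieldJet

variable {𝔸 𝔹 : Type*} [CommRing 𝔸] [Algebra ℝ 𝔸] [CommRing 𝔹] [Algebra ℝ 𝔹]

def map (f : 𝔸 → 𝔹) (F : FieldJet 𝔸) : FieldJet 𝔹 where
  eps := f F.eps
  e := f F.e
  e1 := f F.e1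
  N := F.N.map f
  N1 := fun k => (F.N1 k).map f
  B := F.B.map f
  B1 := fun k => (F.B1 k).map f
  S2 := fun k l => (F.S2 k l).map f

def G (Λ : ℝ) (F : FieldJet 𝔸) : M4 𝔸 :=
  Matrix.diagonal ![(-(Λ / 3)) • F.e ^ 3, F.e, F.e, F.e] + (F.eps * F.e ^ 3) • F.N

def D (Λ : ℝ) (F : FieldJet 𝔸) : Fin 4 → M4 𝔸 :=
  Fin.cons (Matrix.diagonal ![(-Λ) • (F.e ^ 2 * F.e1), F.e1, F.e1, F.e1]
    + F.eps • ((3 * F.e ^ 2 * F.e1) • F.N + F.e ^ 3 • F.B)) fun k => F.e ^ 3 • F.N1 k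

def S (F : FieldJet 𝔸) : Fin 4 → Fin 4 → M4 𝔸 :=
  secondJets (fun k => (3 * F.e ^ 2 * F.e1) • F.N1 k + F.e ^ 3 • F.B1 k) fun k l => F.e ^ 3 • F.S2 k l

theorem G_map (Λ : ℝ) (F : FieldJet 𝔸) (f : 𝔸 →ₐ[ℝ] 𝔹) : (F.map f).G Λ = (F.G Λ).map f := by
  ext a b
  fin_cases a <;> fin_cases b <;> simp [G, map, map_add, map_ofNat]

theorem D_map (Λ : ℝ) (F : FieldJet 𝔸) (f : 𝔸 →ₐ[ℝ] 𝔹) :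
    (F.map f).D Λ = fun k => (F.D Λ k).map f := by
  funext k
  refine Fin.cases ?_ (fun k => ?_) k
  · ext a b
    fin_cases a <;> fin_cases b <;> simp [D, map, map_add, map_ofNat]
  · ext a b
    simp [D, map]

theorem S_map (F : FieldJet 𝔸) (f : 𝔸 →ₐ[ℝ] 𝔹) :
    (F.map f).S = fun k l => (F.S k l).map f := by
  funext k l
  refine Fin.cases ?_ (fun k => ?_) k <;> refine Fin.cases ?_ (fun l => ?_) l <;> ext a b <;>
    simp [S, map, secondJets, map_ofNat]

end FieldJet

section BackgroundEquations

variable {𝔸 : Type*} [CommRing 𝔸] [Algebra ℝ 𝔸] {Λ : ℝ} {F : FieldJet 𝔸} {ei y : 𝔸} {u1 : Fin 3 → 𝔸}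

theorem FieldJet.G_bg (hN : F.eps • F.N = 0) :
    F.G Λ = Matrix.diagonal ![(-(Λ / 3)) • F.e ^ 3, F.e, F.e, F.e] := by
  have : (F.eps * F.e ^ 3) • F.N = 0 := by rw [mul_comm, mul_smul, hN, smul_zero]
  rw [FieldJet.G, this, add_zero]

/-- When ε annihilates N and B, the time derivative is that of the background, and the only spatial
derivatives are e³u₁ in the 00 slot. Divided by the background entry -(Λ/3)e³ they give the factor
-3/Λ. -/
theorem FieldJet.D_bg (hΛ : Λ ≠ 0) (hN : F.eps • F.N = 0) (hB : F.eps • F.B = 0)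
    (hN1 : ∀ k, F.N1 k = Matrix.diagonal ![u1 k, 0, 0, 0]) (hy : F.e * y = F.e1) :
    F.D Λ = bgDX ((-(Λ / 3)) • F.e ^ 3) F.e y fun k => (-(3 / Λ)) • u1 k := by
  have h0 : F.eps • ((3 * F.e ^ 2 * F.e1) • F.N + F.e ^ 3 • F.B) = 0 := by
    rw [smul_add, smul_comm, hN, smul_comm F.eps, hB, smul_zero, smul_zero, add_zero]
  funext k
  refine Fin.cases ?_ (fun k => ?_) k
  · simp only [FieldJet.D, Fin.cons_zero, h0, add_zero, bgDX]
    congr 1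
    funext a
    fin_cases a
    · simp [bgU]
      rw [← hy]
      algebra
    all_goals simp [bgU, hy]
  · simp only [FieldJet.D, Fin.cons_succ, hN1, bgDX, ← Matrix.diagonal_smul]
    congr 1
    funext a
    fin_cases a <;> fin_cases k <;> simp [bgU, smul_smul, div_self hΛ]

theorem FieldJet.H_bg (hΛ : Λ ≠ 0) (hN : F.eps • F.N = 0) (hei : F.e * ei = 1) {H : M4 𝔸}
    (hH : H * F.G Λ = 1) :
    H = Matrix.diagonal ![(-(3 / Λ)) • ei ^ 3, ei, ei, ei] := by
  have h3 : F.e ^ 3 * ei ^ 3 = 1 := by rw [← mul_pow, hei, one_pow]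
  have h1 : F.G Λ * Matrix.diagonal ![(-(3 / Λ)) • ei ^ 3, ei, ei, ei] = 1 := by
    rw [FieldJet.G_bg hN, Matrix.diagonal_mul_diagonal, ← Matrix.diagonal_one]
    congr 1
    funext a
    fin_cases a <;> simp [hei, smul_smul, div_self hΛ, h3]
  calc H = H * (F.G Λ * Matrix.diagonal ![(-(3 / Λ)) • ei ^ 3, ei, ei, ei]) := by rw [h1, mul_one]
    _ = _ := by rw [← mul_assoc, hH, one_mul]

theorem inverse_g0 (hΛ : Λ ≠ 0) (hei : F.e * ei = 1) :
    ((-(Λ / 3)) • F.e ^ 3) * ((-(3 / Λ)) • ei ^ 3) = 1 := by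
  have h3 : F.e ^ 3 * ei ^ 3 = 1 := by rw [← mul_pow, hei, one_pow]
  simp [smul_smul, div_self hΛ, h3]

/-- Of the trace and divergence terms only the double divergence of the spatial block survives next
to the Laplacian of the 00 component; the mixed terms cancel by symmetry. -/
theorem jetSp00_diagonal (g0 g1 : 𝔸) {S : Fin 4 → Fin 4 → M4 𝔸} (h0 : S 0 0 = 0)
    (hS : ∀ p k, S p k = S k p) (hS' : ∀ p k, (S p k).transpose = S p k) :
    jetSp (Matrix.diagonal ![g0, g1, g1, g1]) S 0 0 = g1 * ∑ k : Fin 3, S k.succ k.succ 0 0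
      + g0 * ∑ k : Fin 3, ∑ l : Fin 3, S k.succ l.succ k.succ l.succ := by
  have e : ∀ p k a b, S p k a b = S p k b a := fun p k a b => congrFun (congrFun (hS' p k) b) a
  have h0' : ∀ a b, S 0 0 a b = 0 := fun a b => by rw [h0]; rfl
  simp only [jetSp, jetQ, jetV, Matrix.trace, Matrix.sub_apply, Matrix.add_apply, Matrix.sum_apply,
    Matrix.smul_apply, Matrix.mul_diagonal, Matrix.diagonal_mul, smul_eq_mul,
    Matrix.transpose_apply, Matrix.diag_apply, Matrix.of_apply, Fin.sum_univ_succ, Finset.univ_eq_empty,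
    Finset.sum_empty, Matrix.diagonal_apply]
  simp [h0']
  rw [hS 1 0, hS 2 0, hS 3 0, hS 2 1, hS 3 1, hS 3 2, e 0 1 1 0, e 0 2 2 0, e 0 3 3 0, e 1 2 2 1,
    e 1 3 3 1, e 2 3 3 2]
  ring

theorem jetSp0i_diagonal (g0 g1 : 𝔸) {S : Fin 4 → Fin 4 → M4 𝔸} (h0 : S 0 0 = 0)
    (hS : ∀ p k, S p k = S k p) (i : Fin 3) :
    jetSp (Matrix.diagonal ![g0, g1, g1, g1]) S 0 i.succ =
      g1 * (∑ k : Fin 3, S k.succ k.succ 0 i.succ - S 0 i.succ 0 0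
        - ∑ k : Fin 3, S i.succ k.succ 0 k.succ) - g0 * ∑ k : Fin 3, S 0 k.succ i.succ k.succ := by
  have h0' : ∀ a b, S 0 0 a b = 0 := fun a b => by rw [h0]; rfl
  simp only [jetSp, jetQ, jetV, Matrix.trace, Matrix.sub_apply, Matrix.add_apply, Matrix.sum_apply,
    Matrix.smul_apply, Matrix.mul_diagonal, Matrix.diagonal_mul, smul_eq_mul,
    Matrix.transpose_apply, Matrix.diag_apply, Matrix.of_apply, Fin.sum_univ_succ, Finset.univ_eq_empty,
    Finset.sum_empty, Matrix.diagonal_apply]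
  fin_cases i <;> simp [h0']
  · rw [hS 1 0, hS 2 0, hS 3 0, hS 2 1, hS 3 1]; ring
  · rw [hS 1 0, hS 2 0, hS 3 0, hS 1 2, hS 3 2]; ring
  · rw [hS 1 0, hS 2 0, hS 3 0, hS 1 3, hS 2 3]; ring

/-- The symmetries of a jet. -/
structure FieldJet.IsSymm (F : FieldJet 𝔸) : Prop where
  N1 : ∀ k, (F.N1 k).transpose = F.N1 k
  B1 : ∀ k, (F.B1 k).transpose = F.B1 k
  S2 : ∀ k l, (F.S2 k l).transpose = F.S2 k l
  comm : ∀ k l, F.S2 k l = F.S2 l k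

theorem FieldJet.IsSymm.S_comm (h : F.IsSymm) (p k : Fin 4) : F.S p k = F.S k p := by
  refine Fin.cases ?_ (fun p => ?_) p <;> refine Fin.cases ?_ (fun k => ?_) k <;>
    simp [FieldJet.S, secondJets, h.comm]

theorem FieldJet.IsSymm.S_transpose (h : F.IsSymm) (p k : Fin 4) : (F.S p k).transpose = F.S p k := by
  refine Fin.cases ?_ (fun p => ?_) p <;> refine Fin.cases ?_ (fun k => ?_) k <;>
    simp [FieldJet.S, secondJets, h.N1, h.B1, h.S2]

theorem jetSp00_bg (hN : F.eps • F.N = 0) (h : F.IsSymm) (hS2 : ∀ k l, F.S2 k l 0 0 = 0) :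
    jetSp (F.G Λ) F.S 0 0 = (-(Λ / 3)) • (F.e ^ 6 * ∑ k, ∑ l, F.S2 k l k.succ l.succ) := by
  rw [FieldJet.G_bg hN, jetSp00_diagonal _ _ rfl h.S_comm h.S_transpose]
  have e1 : ∀ k l : Fin 3, F.S k.succ l.succ = F.e ^ 3 • F.S2 k l := fun _ _ => rfl
  simp only [e1, Matrix.smul_apply, hS2, smul_eq_mul, mul_zero, Finset.sum_const_zero, zero_add,
    ← Finset.mul_sum]
  algebra

theorem jetSp0i_bg (hN : F.eps • F.N = 0) (h : F.IsSymm) (i : Fin 3) :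
    jetSp (F.G Λ) F.S 0 i.succ = F.e ^ 4 * (∑ k, F.S2 k k 0 i.succ - ∑ k, F.S2 i k 0 k.succ)
      - F.e * (3 * F.e ^ 2 * F.e1 * F.N1 i 0 0 + F.e ^ 3 * F.B1 i 0 0)
      + (Λ / 3) • (F.e ^ 3 * ∑ k, (3 * F.e ^ 2 * F.e1 * F.N1 k i.succ k.succ
        + F.e ^ 3 * F.B1 k i.succ k.succ)) := by
  rw [FieldJet.G_bg hN, jetSp0i_diagonal _ _ rfl h.S_comm]
  have e1 : ∀ k l : Fin 3, F.S k.succ l.succ = F.e ^ 3 • F.S2 k l := fun _ _ => rfl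
  have e2 : ∀ k : Fin 3, F.S 0 k.succ = (3 * F.e ^ 2 * F.e1) • F.N1 k + F.e ^ 3 • F.B1 k := fun _ => rfl
  simp only [e1, e2, Matrix.add_apply, Matrix.smul_apply, smul_eq_mul, ← Finset.mul_sum]
  algebra

variable {T0 : ℝ}

theorem jetEin00_field (hΛ : Λ ≠ 0) (hN : F.eps • F.N = 0) (hB : F.eps • F.B = 0)
    (hN1 : ∀ k, F.N1 k = Matrix.diagonal ![u1 k, 0, 0, 0]) (hu : ∀ i j, u1 i * u1 j = 0)
    (hei : F.e * ei = 1) (hy : F.e * y = F.e1) {H : M4 𝔸} (hH : H * F.G Λ = 1) :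
    jetEin (F.G Λ) H (F.D Λ) 0 0 0 = (Λ ^ 2 / 3) • (F.e ^ 6 * y ^ 2) := by
  rw [FieldJet.H_bg hΛ hN hei hH, FieldJet.G_bg hN, FieldJet.D_bg hΛ hN hB hN1 hy,
    jetEin00_bg y (fun i j => by simp [hu]) (inverse_g0 hΛ hei) hei]
  algebra

theorem jetEin0i_field (hΛ : Λ ≠ 0) (hN : F.eps • F.N = 0) (hB : F.eps • F.B = 0)
    (hN1 : ∀ k, F.N1 k = Matrix.diagonal ![u1 k, 0, 0, 0])
    (hei : F.e * ei = 1) (hy : F.e * y = F.e1) {H : M4 𝔸} (hH : H * F.G Λ = 1) (i : Fin 3) :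
    jetEin (F.G Λ) H (F.D Λ) 0 0 i.succ = F.e ^ 4 * y * u1 i := by
  rw [FieldJet.H_bg hΛ hN hei hH, FieldJet.G_bg hN, FieldJet.D_bg hΛ hN hB hN1 hy,
    jetEin0i_bg y (inverse_g0 hΛ hei) hei]
  have h : (-(Λ / 3)) * (-(3 / Λ)) = 1 := by field_simp
  calc _ = ((-(Λ / 3)) * (-(3 / Λ))) • (F.e ^ 4 * y * u1 i) := by algebra
    _ = _ := by rw [h, one_smul]

theorem jetStress00_field (hΛ : Λ ≠ 0) (hN : F.eps • F.N = 0) (hB : F.eps • F.B = 0)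
    (hN1 : ∀ k, F.N1 k = Matrix.diagonal ![u1 k, 0, 0, 0])
    (hei : F.e * ei = 1) (hy : F.e * y = F.e1) {H : M4 𝔸} (hH : H * F.G Λ = 1)
    {θ ρ : 𝔸} {v : Fin 4 → 𝔸} (hθ : θ = F.e ^ 3) (hv : v 0 ^ 2 = algebraMap ℝ 𝔸 (Λ / 3)) (τ : ℝ) :
    jetStress τ 0 Λ (F.G Λ) H (F.D Λ) θ ρ v 0 0 =
      (Λ / 3 * τ ^ 2) • (F.e ^ 6 * ρ) + (2 / 3 * τ * Λ ^ 2) • (F.e ^ 6 * y) := by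
  rw [FieldJet.H_bg hΛ hN hei hH, FieldJet.G_bg hN, FieldJet.D_bg hΛ hN hB hN1 hy,
    jetStress00_bg y τ 0 Λ θ ρ v (inverse_g0 hΛ hei) hei, hv, hθ]
  algebra

theorem jetStress0i_field (hΛ : Λ ≠ 0) (hN : F.eps • F.N = 0) (hB : F.eps • F.B = 0)
    (hN1 : ∀ k, F.N1 k = Matrix.diagonal ![u1 k, 0, 0, 0])
    (hei : F.e * ei = 1) (hy : F.e * y = F.e1) {H : M4 𝔸} (hH : H * F.G Λ = 1)
    {θ ρ : 𝔸} {v : Fin 4 → 𝔸} (hθ : θ = F.e ^ 3) (τ : ℝ) (i : Fin 3) :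
    jetStress τ 0 Λ (F.G Λ) H (F.D Λ) θ ρ v 0 i.succ =
      τ ^ 2 • (F.e ^ 6 * (v 0 * (ρ * v i.succ))) - (τ / 2) • (F.e ^ 4 * u1 i) := by
  rw [FieldJet.H_bg hΛ hN hei hH, FieldJet.G_bg hN, FieldJet.D_bg hΛ hN hB hN1 hy,
    jetStress0i_bg y τ 0 Λ θ ρ v (inverse_g0 hΛ hei) hei, hθ]
  have h : (Λ / 3) * (3 / Λ) = 1 := by field_simp
  calc _ = τ ^ 2 • (F.e ^ 6 * (v 0 * (ρ * v i.succ)))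
        - ((Λ / 3) * (3 / Λ) * (τ / 2)) • (F.e ^ 4 * u1 i) := by algebra
    _ = _ := by rw [h, one_mul]

end BackgroundEquations

end

section

/-! ### The constraint equations modulo negligible terms. -/

section ConstraintMap

variable {𝔸 𝔹 : Type*} [CommRing 𝔸] [Algebra ℝ 𝔸] [CommRing 𝔹] [Algebra ℝ 𝔹]

/-- `θ²(Ḡ^{0μ} - T̄^{0μ})`, with the second derivatives of `𝔲` taken from `F.S`. -/
def jetEqn (Λ τ : ℝ) (F : FieldJet 𝔸) (H : M4 𝔸) (θ ρ κ : 𝔸) (v : Fin 4 → 𝔸) (μ : Fin 4) : 𝔸 :=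
  (1 / 2 : ℝ) • jetSp (F.G Λ) F.S 0 μ + jetEin (F.G Λ) H (F.D Λ) 0 0 μ
    - jetStress τ 0 Λ (F.G Λ) H (F.D Λ) θ ρ v 0 μ
    - τ ^ 2 • (κ * (θ ^ 2 * ρ * (v 0 * v μ) + θ * ρ * F.G Λ 0 μ))

theorem jetEqn_map (f : 𝔸 →ₐ[ℝ] 𝔹) (Λ τ : ℝ) (F : FieldJet 𝔸) (H : M4 𝔸) (θ ρ κ : 𝔸)
    (v : Fin 4 → 𝔸) (μ : Fin 4) :
    jetEqn Λ τ (F.map f) (H.map f) (f θ) (f ρ) (f κ) (fun k => f (v k)) μ =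
      f (jetEqn Λ τ F H θ ρ κ v μ) := by
  simp only [jetEqn, FieldJet.G_map, FieldJet.D_map, FieldJet.S_map, jetSp_map, jetEin_map,
    jetStress_map, Matrix.map_apply, map_sub, map_add, map_smul, map_mul, map_pow]

/-- In `jetEqn` the pressure terms are split off from `jetStress`, because there ε²K has to be an
element of the ring, a function of ε, and not a real number. -/
theorem jetEqn_real (Λ τ κ : ℝ) (F : FieldJet ℝ) (H : M4 ℝ) (θ ρ : ℝ) (v : Fin 4 → ℝ) (μ : Fin 4) :
    jetEqn Λ τ F H θ ρ κ v μ = (jetEin (F.G Λ) H (F.D Λ) 0 + (1 / 2 : ℝ) • jetSp (F.G Λ) F.S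
      - jetStress τ κ Λ (F.G Λ) H (F.D Λ) θ ρ v) 0 μ := by
  simp only [jetEqn, jetStress, Matrix.sub_apply, Matrix.add_apply, Matrix.smul_apply, Matrix.of_apply,
    smul_eq_mul]
  ring

variable {Λ τ : ℝ} {F : FieldJet 𝔸} {ei y : 𝔸} {u1 : Fin 3 → 𝔸} {H : M4 𝔸} {θ ρ κ : 𝔸} {v : Fin 4 → 𝔸}

/-- The Friedmann equation `hF` cancels the curvature and the homogeneous density. The pressure
terms cancel among themselves, since θ²v₀² + θG^{00} = 0 on the background. What remains is linear.
-/
theorem jetEqn_zero_bg (hΛ : Λ ≠ 0) (hN : F.eps • F.N = 0) (hB : F.eps • F.B = 0)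
    (hN1 : ∀ k, F.N1 k = Matrix.diagonal ![u1 k, 0, 0, 0]) (hu : ∀ i j, u1 i * u1 j = 0)
    (hei : F.e * ei = 1) (hy : F.e * y = F.e1) (hH : H * F.G Λ = 1) (h : F.IsSymm)
    (hS2 : ∀ k l, F.S2 k l 0 0 = 0) (hθ : θ = F.e ^ 3) (hv : v 0 ^ 2 = algebraMap ℝ 𝔸 (Λ / 3))
    {rH p : 𝔸} (hρ : ρ = rH + p)
    (hF : (Λ ^ 2 / 3) • y ^ 2 = (Λ / 3 * τ ^ 2) • rH + (2 / 3 * τ * Λ ^ 2) • y) :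
    jetEqn Λ τ F H θ ρ κ v 0 = (-(Λ / 6)) • (F.e ^ 6 * ∑ k, ∑ l, F.S2 k l k.succ l.succ)
      - (Λ / 3 * τ ^ 2) • (F.e ^ 6 * p) := by
  rw [jetEqn, jetSp00_bg hN h hS2, jetEin00_field hΛ hN hB hN1 hu hei hy hH,
    jetStress00_field hΛ hN hB hN1 hei hy hH hθ hv, FieldJet.G_bg hN, ← pow_two, hv, hθ, hρ]
  simp only [Matrix.diagonal_apply_eq, Matrix.cons_val_zero]
  linear_combination (norm := skip) F.e ^ 6 * hF
  algebra

/-- The relation `hB1` is the spatially differentiated gauge condition. It replaces the mixed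
derivative of u^{00} and thereby cancels the gradient of the divergence of u^{0k}, so that only the
Laplacian of u^{0i} is left and the momentum constraint is elliptic. -/
theorem jetEqn_succ_bg (hΛ : Λ ≠ 0) (hN : F.eps • F.N = 0) (hB : F.eps • F.B = 0)
    (hN1 : ∀ k, F.N1 k = Matrix.diagonal ![u1 k, 0, 0, 0])
    (hei : F.e * ei = 1) (hy : F.e * y = F.e1) (hH : H * F.G Λ = 1) (h : F.IsSymm)
    (hθ : θ = F.e ^ 3) {v0 : ℝ} (hv : v 0 = algebraMap ℝ 𝔸 v0)
    (i : Fin 3) (hκ : κ * v i.succ = 0) {n m κ' : 𝔸} (hn : ρ * v i.succ = n)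
    (hB1 : F.e ^ 3 * F.B1 i 0 0 = (-(3 * F.e ^ 2 * F.e1) + (2 * τ) • F.e ^ 3) * u1 i
      - F.e ^ 3 * ∑ k, F.S2 i k 0 k.succ + κ' * m)
    (hm : m = (-(3 / (2 * Λ))) • (F.e ^ 3 * u1 i))
    (hκ' : κ' = algebraMap ℝ 𝔸 (2 * Λ / 3 * τ) - Λ • y) :
    jetEqn Λ τ F H θ ρ κ v i.succ = (1 / 2 : ℝ) • (F.e ^ 4 * ∑ k, F.S2 k k 0 i.succ)
      + (1 / 4 : ℝ) • (F.e ^ 4 * y * u1 i) + (Λ / 6) • (F.e ^ 6 * ∑ k, F.B1 k i.succ k.succ)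
      - (τ ^ 2 * v0) • (F.e ^ 6 * n) := by
  have hz : ∀ k : Fin 3, F.N1 k i.succ k.succ = 0 := fun k => by
    rw [hN1]
    fin_cases i <;> fin_cases k <;> simp [Matrix.diagonal_apply]
  have h1 : Λ * (3 / (2 * Λ)) = 3 / 2 := by field_simp
  have h2 : 2 * Λ / 3 * (3 / (2 * Λ)) = 1 := by field_simp
  have hκm : κ' * m = (-τ) • (F.e ^ 3 * u1 i) + (3 / 2 : ℝ) • (y * F.e ^ 3 * u1 i) := by
    rw [hκ', hm]
    calc _ = (-(2 * Λ / 3 * (3 / (2 * Λ)) * τ)) • (F.e ^ 3 * u1 i)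
          + (Λ * (3 / (2 * Λ))) • (y * F.e ^ 3 * u1 i) := by algebra
      _ = _ := by rw [h1, h2, one_mul]
  rw [hκm] at hB1
  have hG0 : F.G Λ 0 i.succ = 0 := by
    rw [FieldJet.G_bg hN]; exact Matrix.diagonal_apply_ne _ (Fin.succ_ne_zero i).symm
  have hκ0 : κ * (θ ^ 2 * ρ * (v 0 * v i.succ) + θ * ρ * F.G Λ 0 i.succ) = 0 := by
    rw [hG0]; linear_combination (θ ^ 2 * ρ * v 0) * hκ
  rw [jetEqn, hκ0, jetSp0i_bg hN h, jetEin0i_field hΛ hN hB hN1 hei hy hH,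
    jetStress0i_field hΛ hN hB hN1 hei hy hH hθ, hn, hv]
  have hu : F.N1 i 0 0 = u1 i := by rw [hN1]; simp
  simp only [hz, hu, mul_zero, zero_add, ← Finset.mul_sum]
  linear_combination (norm := skip) (-(1 / 2) : ℝ) • (F.e * hB1)
  algebra

end ConstraintMap

end

section

/-! ### Analytic dependence of the FLRW quantities on ε. -/

section BackgroundScalars

theorem analyticAt_rpow_of_pos {f g : ℝ → ℝ} {x : ℝ} (hf : AnalyticAt ℝ f x) (hg : AnalyticAt ℝ g x)
    (h : 0 < f x) : AnalyticAt ℝ (fun y => f y ^ g y) x := by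
  have h1 : AnalyticAt ℝ (fun y => Real.exp (Real.log (f y) * g y)) x := ((hf.log h).mul hg).rexp
  refine h1.congr ?_
  filter_upwards [hf.continuousAt.eventually (lt_mem_nhds h)] with y hy
  rw [Real.rpow_def_of_pos hy]

variable (P : Params) {T₀ : ℝ}

theorem analyticAt_expo (ε : ℝ) : AnalyticAt ℝ (expo P) ε := by
  unfold expo
  exact analyticAt_const.mul (analyticAt_const.add ((analyticAt_id.pow 2).mul analyticAt_const))

theorem scaleFactor_base_pos (hL : 0 < P.Lam) (hK : 0 ≤ P.K) (hr : 0 < P.rho1) (ht : 0 < T₀)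
    (ht1 : T₀ ≤ 1) (ε : ℝ) : 0 < expo P ε ∧ 0 < (C0 P - T₀ ^ expo P ε) / (C0 P - 1) := by
  obtain ⟨hC, -⟩ := C0_facts P hL hr
  have hp : 0 < expo P ε := by unfold expo; positivity
  have h1 : T₀ ^ expo P ε ≤ 1 := Real.rpow_le_one ht.le ht1 hp.le
  exact ⟨hp, div_pos (by linarith) (by linarith)⟩

theorem analyticAt_scaleFactor (hL : 0 < P.Lam) (hK : 0 ≤ P.K) (hr : 0 < P.rho1) (ht : 0 < T₀)
    (ht1 : T₀ ≤ 1) (ε : ℝ) : AnalyticAt ℝ (fun ε => scaleFactor P ε T₀) ε := by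
  obtain ⟨hp, hb⟩ := scaleFactor_base_pos P hL hK hr ht ht1 ε
  unfold scaleFactor
  have h1 := analyticAt_rpow_of_pos (f := fun _ => T₀) analyticAt_const (analyticAt_expo P ε) ht
  have h2 : AnalyticAt ℝ (fun ε => (C0 P - T₀ ^ expo P ε) / (C0 P - 1)) ε :=
    (analyticAt_const.sub h1).div_const
  have h3 : AnalyticAt ℝ (fun ε => 2 / expo P ε) ε :=
    analyticAt_const.div (analyticAt_expo P ε) hp.ne'
  exact (analyticAt_rpow_of_pos h2 h3 hb).div_const

theorem scaleFactor_pos (hL : 0 < P.Lam) (hK : 0 ≤ P.K) (hr : 0 < P.rho1) (ht : 0 < T₀)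
    (ht1 : T₀ ≤ 1) (ε : ℝ) : 0 < scaleFactor P ε T₀ := by
  obtain ⟨-, hb⟩ := scaleFactor_base_pos P hL hK hr ht ht1 ε
  exact div_pos (Real.rpow_pos_of_pos hb _) ht

theorem analyticAt_Efac (hL : 0 < P.Lam) (hK : 0 ≤ P.K) (hr : 0 < P.rho1) (ht : 0 < T₀)
    (ht1 : T₀ ≤ 1) (ε : ℝ) : AnalyticAt ℝ (fun ε => Efac P ε T₀) ε :=
  (analyticAt_scaleFactor P hL hK hr ht ht1 ε).mul analyticAt_const

theorem rhoH_pos (hL : 0 < P.Lam) (hK : 0 ≤ P.K) (hr : 0 < P.rho1) (ht : 0 < T₀)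
    (ht1 : T₀ ≤ 1) (ε : ℝ) : 0 < rhoH P ε T₀ :=
  div_pos hr (Real.rpow_pos_of_pos (scaleFactor_pos P hL hK hr ht ht1 ε) _)

theorem analyticAt_rhoH (hL : 0 < P.Lam) (hK : 0 ≤ P.K) (hr : 0 < P.rho1) (ht : 0 < T₀)
    (ht1 : T₀ ≤ 1) (ε : ℝ) : AnalyticAt ℝ (fun ε => rhoH P ε T₀) ε := by
  have h := scaleFactor_pos P hL hK hr ht ht1 ε
  exact analyticAt_const.div (analyticAt_rpow_of_pos (analyticAt_scaleFactor P hL hK hr ht ht1 ε)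
    (analyticAt_expo P ε) h) (Real.rpow_pos_of_pos h _).ne'

theorem analyticAt_Omega (hL : 0 < P.Lam) (hK : 0 ≤ P.K) (hr : 0 < P.rho1) (ht : 0 < T₀)
    (ht1 : T₀ ≤ 1) (ε : ℝ) : AnalyticAt ℝ (fun ε => Omega P ε T₀) ε := by
  have h := rhoH_pos P hL hK hr ht ht1 ε
  have h1 : AnalyticAt ℝ (fun ε => P.Lam / 3 + rhoH P ε T₀ / 3) ε :=
    analyticAt_const.add (analyticAt_rhoH P hL hK hr ht ht1 ε).div_const
  have h2 : AnalyticAt ℝ (fun x => √x) (P.Lam / 3 + rhoH P ε T₀ / 3) :=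
    (Real.contDiffAt_sqrt (n := ω) (by positivity)).analyticAt
  exact analyticAt_const.sub (analyticAt_const.mul (AnalyticAt.fun_comp (g := fun x => √x)
    (f := fun ε => P.Lam / 3 + rhoH P ε T₀ / 3) h2 h1))

theorem friedmann (hL : 0 < P.Lam) (hK : 0 ≤ P.K) (hr : 0 < P.rho1) (ht : 0 < T₀)
    (ht1 : T₀ ≤ 1) (ε : ℝ) : (1 - Omega P ε T₀) ^ 2 = 1 + rhoH P ε T₀ / P.Lam := by
  have h := rhoH_pos P hL hK hr ht ht1 ε
  rw [Omega, sub_sub_cancel, mul_pow, Real.sq_sqrt (by positivity), Real.sq_sqrt (by positivity)]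
  field_simp

end BackgroundScalars

end

section

/-! ### Evaluation of analytic families and reduction modulo negligible terms. -/

section AnAlgLemmas

open Filter Topology

variable {P V : Type*} [NormedAddCommGroup P] [NormedSpace ℝ P] [NormedAddCommGroup V] [NormedSpace ℝ V]
variable {𝔸 𝔹 : Type*} [NormedCommRing 𝔸] [NormedAlgebra ℝ 𝔸] [NormedCommRing 𝔹] [NormedAlgebra ℝ 𝔹]

theorem anAlg_ext {a b : AnAlg P V 𝔸} (h : ∀ q, evalAn q a = evalAn q b) : a = b :=
  Subtype.ext (funext h)

theorem evalAn_scal (q : ℝ × P × V) {f : ℝ → ℝ} (hf : AnalyticAt ℝ f 0) :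
    evalAn q (scal f hf : AnAlg P V 𝔸) = algebraMap ℝ 𝔸 (f q.1) := rfl

theorem evalAn_eps (q : ℝ × P × V) : evalAn q (epsEl P V 𝔸) = algebraMap ℝ 𝔸 q.1 := rfl

theorem evalAn_lin (q : ℝ × P × V) (A : V →L[ℝ] 𝔸) : evalAn q (lin A : AnAlg P V 𝔸) = A q.2.2 := rfl

theorem evalAn_mapLin (q : ℝ × P × V) (T : 𝔸 →L[ℝ] 𝔹) (f : AnAlg P V 𝔸) :
    evalAn q (mapLin T f) = T (evalAn q f) := rfl

theorem evalAn_mapHom (q : ℝ × P × V) (ι : 𝔸 →ₐ[ℝ] 𝔹) (hι : Continuous ι) (f : AnAlg P V 𝔸) :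
    evalAn q (mapHom ι hι f) = ι (evalAn q f) := rfl

/-- A linear function of the parameter. -/
def par (A : P →L[ℝ] 𝔸) : AnAlg P V 𝔸 := ⟨fun q => A q.2.1, by
  exact analyticAt_clm A (analyticAt_fst.fun_comp analyticAt_snd)⟩

theorem evalAn_par (q : ℝ × P × V) (A : P →L[ℝ] 𝔸) : evalAn q (par A : AnAlg P V 𝔸) = A q.2.1 := rfl

theorem mapLin_scal_mul (T : 𝔸 →L[ℝ] 𝔹) {f : ℝ → ℝ} (hf : AnalyticAt ℝ f 0) (x : AnAlg P V 𝔸) :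
    mapLin T (scal f hf * x) = scal f hf * mapLin T x := by
  refine anAlg_ext fun q => ?_
  rw [evalAn_mapLin, map_mul (evalAn q), map_mul (evalAn q), evalAn_scal, evalAn_scal, evalAn_mapLin, ← Algebra.smul_def,
    ← Algebra.smul_def, map_smul]

theorem mapHom_scal (ι : 𝔸 →ₐ[ℝ] 𝔹) (hι : Continuous ι) {f : ℝ → ℝ} (hf : AnalyticAt ℝ f 0) :
    mapHom ι hι (scal f hf : AnAlg P V 𝔸) = scal f hf := by
  refine anAlg_ext fun q => ?_
  rw [evalAn_mapHom, evalAn_scal, evalAn_scal, AlgHom.commutes]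

theorem mapHom_mem_idealZ (ι : 𝔸 →ₐ[ℝ] 𝔹) (hι : Continuous ι) {f : AnAlg P V 𝔸}
    (hf : f ∈ idealZ P V 𝔸) : mapHom ι hι f ∈ idealZ P V 𝔹 := mapLin_mem_idealZ _ hf

theorem evalAn_zero_of_mem {f : AnAlg P V 𝔸} (hf : f ∈ idealZ P V 𝔸) : evalAn 0 f = 0 := by
  obtain ⟨T, -, h⟩ := hf
  exact h.self_of_nhds.trans (map_zero (T 0))

variable (P V 𝔸) in
/-- The quotient of `AnAlg` by `idealI`. -/
def ModI : Type _ := AnAlg P V 𝔸 ⧸ idealI P V 𝔸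

instance : CommRing (ModI P V 𝔸) := inferInstanceAs (CommRing (AnAlg P V 𝔸 ⧸ idealI P V 𝔸))

instance : Algebra ℝ (ModI P V 𝔸) := inferInstanceAs (Algebra ℝ (AnAlg P V 𝔸 ⧸ idealI P V 𝔸))

variable (P V 𝔸) in
/-- The reduction modulo `idealI`. -/
def mkI : AnAlg P V 𝔸 →ₐ[ℝ] ModI P V 𝔸 := Ideal.Quotient.mkₐ ℝ (idealI P V 𝔸)

theorem mkI_eq_zero {a : AnAlg P V 𝔸} : mkI P V 𝔸 a = 0 ↔ a ∈ idealI P V 𝔸 :=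
  Ideal.Quotient.eq_zero_iff_mem

theorem mkI_eq {a b : AnAlg P V 𝔸} : mkI P V 𝔸 a = mkI P V 𝔸 b ↔ a - b ∈ idealI P V 𝔸 :=
  Ideal.Quotient.eq

/-- Elements of `AnAlg` are functions, but modulo the ideal only their germs at the origin matter.
Inverses and square roots that satisfy their equations only near the origin become exact in the
quotient. -/
theorem mkI_eq_of_eventually {a b : AnAlg P V 𝔸} (h : ∀ᶠ q in 𝓝 0, evalAn q a = evalAn q b) :
    mkI P V 𝔸 a = mkI P V 𝔸 b := by
  refine mkI_eq.2 (isI_of_eventually ?_)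
  filter_upwards [h] with q hq
  exact sub_eq_zero.2 hq

theorem mkI_eps_mul {a : AnAlg P V 𝔸} (ha : a ∈ idealZ P V 𝔸) :
    mkI P V 𝔸 (epsEl P V 𝔸) * mkI P V 𝔸 a = 0 := by
  rw [← map_mul]; exact mkI_eq_zero.2 (eps_mul_mem ha)

theorem mkI_mul {a b : AnAlg P V 𝔸} (ha : a ∈ idealZ P V 𝔸) (hb : b ∈ idealZ P V 𝔸) :
    mkI P V 𝔸 a * mkI P V 𝔸 b = 0 := by
  rw [← map_mul]; exact mkI_eq_zero.2 (mul_mem_idealI ha hb)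

theorem exists_inv' [CompleteSpace 𝔸] (f : AnAlg P V 𝔸) {c : ℝ} (hc : c ≠ 0)
    (hf : evalAn 0 f = algebraMap ℝ 𝔸 c) :
    ∃ g : AnAlg P V 𝔸, (∀ᶠ q in 𝓝 0, evalAn q g * evalAn q f = 1) ∧
      evalAn 0 g = algebraMap ℝ 𝔸 c⁻¹ := by
  obtain ⟨g, h1, -⟩ := exists_inv f (by
    change IsUnit (evalAn 0 f)
    rw [hf]; exact (isUnit_iff_ne_zero.2 hc).map (algebraMap ℝ 𝔸))
  refine ⟨g, h1, ?_⟩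
  have h2 : evalAn 0 g * evalAn 0 f = 1 := h1.self_of_nhds
  rw [hf] at h2
  calc evalAn 0 g = evalAn 0 g * (algebraMap ℝ 𝔸 c * algebraMap ℝ 𝔸 c⁻¹) := by
        rw [← map_mul, mul_inv_cancel₀ hc, map_one, mul_one]
    _ = _ := by rw [← mul_assoc, h2, one_mul]

end AnAlgLemmas

/-! ### Expansion of the determinant with remainder in an ideal. -/

section Determinant

variable {𝔸 : Type*} [CommRing 𝔸]

/-- Modulo J the matrix M is zero, so the polynomial det(1 + XM) reduces to 1, and all its
coefficients of positive degree lie in J. -/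
theorem exists_det_expansion (J : Ideal 𝔸) (x : 𝔸) (M : M4 𝔸) (hM : ∀ i j, M i j ∈ J) :
    ∃ R ∈ J, (1 + x • M).det = 1 + M.trace * x + R * x ^ 2 := by
  refine ⟨_, ?_, Matrix.det_one_add_smul x M⟩
  set p : Polynomial 𝔸 := (1 + (Polynomial.X : Polynomial 𝔸) • M.map Polynomial.C).det with hp
  have hmap : p.map (Ideal.Quotient.mk J) = 1 := by
    rw [hp, ← Polynomial.coe_mapRingHom, RingHom.map_det]
    have : (Polynomial.mapRingHom (Ideal.Quotient.mk J)).mapMatrix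
        (1 + (Polynomial.X : Polynomial 𝔸) • M.map Polynomial.C) = 1 := by
      ext1 i j
      have h0 : Ideal.Quotient.mk J (M i j) = 0 := Ideal.Quotient.eq_zero_iff_mem.2 (hM i j)
      by_cases hij : i = j
      · subst hij; simp [h0]
      · simp [h0, Matrix.one_apply_ne hij]
    rw [this, Matrix.det_one]
  have hc : ∀ n, p.coeff (n + 1) ∈ J := fun n => by
    rw [← Ideal.Quotient.eq_zero_iff_mem, ← Polynomial.coeff_map, hmap]
    simp [Polynomial.coeff_one]
  rw [Polynomial.eval_eq_sum]
  refine J.sum_mem fun n _ => J.mul_mem_right _ ?_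
  rw [Polynomial.coeff_divX, Polynomial.coeff_divX]
  exact hc _

/-- The background matrix is factored out, and the expansion of det(1 + xM) is applied to e³ times
its inverse multiplied by N. -/
theorem exists_det_diagonal [Algebra ℝ 𝔸] {Λ : ℝ} (hΛ : Λ ≠ 0) {e ei : 𝔸} (he : e * ei = 1) (J : Ideal 𝔸) (x : 𝔸) (N : M4 𝔸)
    (hN : ∀ i j, N i j ∈ J) :
    ∃ R ∈ J, (Matrix.diagonal ![(-(Λ / 3)) • e ^ 3, e, e, e] + (x * e ^ 3) • N).det =
      (-(Λ / 3)) • e ^ 6 + x * (e ^ 6 * N 0 0 - (Λ / 3) • (e ^ 8 * (N 1 1 + N 2 2 + N 3 3)) + x * R) := by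
  set h : M4 𝔸 := Matrix.diagonal ![(-(3 / Λ)) • ei ^ 3, ei, ei, ei]
  have h3 : e ^ 3 * ei ^ 3 = 1 := by rw [← mul_pow, he, one_pow]
  have hg : Matrix.diagonal ![(-(Λ / 3)) • e ^ 3, e, e, e] * h = 1 := by
    rw [Matrix.diagonal_mul_diagonal, ← Matrix.diagonal_one]
    congr 1
    funext a
    fin_cases a <;> simp [he, smul_smul, div_self hΛ, h3]
  obtain ⟨R, hR, hdet⟩ := exists_det_expansion J x (e ^ 3 • (h * N)) (fun i j => by
    rw [Matrix.smul_apply, Matrix.diagonal_mul]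
    exact J.mul_mem_left _ (J.mul_mem_left _ (hN i j)))
  refine ⟨(-(Λ / 3)) • (e ^ 6 * R), by
    rw [Algebra.smul_def]; exact J.mul_mem_left _ (J.mul_mem_left _ hR), ?_⟩
  have e1 : Matrix.diagonal ![(-(Λ / 3)) • e ^ 3, e, e, e] + (x * e ^ 3) • N =
      Matrix.diagonal ![(-(Λ / 3)) • e ^ 3, e, e, e] * (1 + x • e ^ 3 • (h * N)) := by
    rw [mul_add, mul_one, Matrix.mul_smul, Matrix.mul_smul, ← mul_assoc, hg, one_mul, mul_smul]
  rw [e1, Matrix.det_mul, hdet, Matrix.det_diagonal, Matrix.trace_smul]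
  have e2 : (h * N).trace = (-(3 / Λ)) • (ei ^ 3 * N 0 0) + ei * (N 1 1 + N 2 2 + N 3 3) := by
    simp [h, Matrix.trace, Fin.sum_univ_four, Matrix.diagonal_mul]
    ring
  rw [e2]
  have hΛ3 : (Λ / 3) * (3 / Λ) = 1 := by field_simp
  simp only [Fin.prod_univ_four, Matrix.cons_val_zero, Matrix.cons_val_one, Matrix.cons_val,
    smul_eq_mul]
  have e3 : e ^ 6 * (e ^ 3 * ei ^ 3) = e ^ 6 := by rw [h3, mul_one]
  have e4 : e ^ 8 * (e * ei) = e ^ 8 := by rw [he, mul_one]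
  calc _ = (-(Λ / 3)) • e ^ 6 + x * (((Λ / 3) * (3 / Λ)) • (e ^ 6 * (e ^ 3 * ei ^ 3) * N 0 0)
        - (Λ / 3) • (e ^ 8 * (e * ei) * (N 1 1 + N 2 2 + N 3 3))
        + x * ((-(Λ / 3)) • (e ^ 6 * R))) := by algebra
    _ = _ := by rw [e3, e4, hΛ3, one_smul]

end Determinant

end

/-! ### Solution of the algebraic constraints: the density θ and the velocity component v̄⁰. -/

section

/-- The background quantities at a fixed time, as functions of `ε`: `e` is the scale factor, `y` its
logarithmic time derivative, `rH` the density; `τ` is the inverse of the time. -/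
structure Background where
  Λ : ℝ
  τ : ℝ
  K : ℝ
  e : ℝ → ℝ
  y : ℝ → ℝ
  rH : ℝ → ℝ
  Λ_pos : 0 < Λ
  τ_pos : 0 < τ
  e_pos : ∀ ε, 0 < e ε
  rH_pos : 0 < rH 0
  he : AnalyticAt ℝ e 0
  hy : AnalyticAt ℝ y 0
  hrH : AnalyticAt ℝ rH 0
  friedmann : ∀ ε, Λ ^ 2 / 3 * y ε ^ 2 = Λ / 3 * τ ^ 2 * rH ε + 2 / 3 * τ * Λ ^ 2 * y ε

namespace Background

open Filter Topology

variable (b : Background)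
variable {P V : Type*} [NormedAddCommGroup P] [NormedSpace ℝ P] [NormedAddCommGroup V] [NormedSpace ℝ V]
variable {𝔸 : Type*} [NormedCommRing 𝔸] [NormedAlgebra ℝ 𝔸]

theorem hei : AnalyticAt ℝ (fun ε => (b.e ε)⁻¹) 0 := b.he.inv (b.e_pos 0).ne'

def E : AnAlg P V 𝔸 := scal b.e b.he
def Ei : AnAlg P V 𝔸 := scal (fun ε => (b.e ε)⁻¹) b.hei
def Y : AnAlg P V 𝔸 := scal b.y b.hy

theorem E_mul_Ei : (b.E : AnAlg P V 𝔸) * b.Ei = 1 := anAlg_ext fun q => by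
  rw [map_mul, E, Ei, evalAn_scal, evalAn_scal, ← map_mul, mul_inv_cancel₀ (b.e_pos _).ne', map_one, map_one]

/-- `θ² = c f` near the origin. -/
def IsScaledSqrt (c : ℝ) (θ f : AnAlg P V 𝔸) : Prop :=
  ∀ᶠ q in 𝓝 0, evalAn q θ ^ 2 = algebraMap ℝ 𝔸 c * evalAn q f

theorem IsScaledSqrt.mapHom {𝔹 : Type*} [NormedCommRing 𝔹] [NormedAlgebra ℝ 𝔹] {c : ℝ} {θ f : AnAlg P V 𝔸}
    (h : IsScaledSqrt c θ f) (φ : 𝔸 →ₐ[ℝ] 𝔹) (hφ : Continuous φ) :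
    IsScaledSqrt c (NewtonCosmo.mapHom φ hφ θ) (NewtonCosmo.mapHom φ hφ f : AnAlg P V 𝔹) := by
  filter_upwards [h] with q h
  rw [evalAn_mapHom, evalAn_mapHom, ← map_pow, h, map_mul, AlgHom.commutes]

/-- `θ = e³ + ε m` near the origin. -/
def IsTheta (θ m : AnAlg P V 𝔸) : Prop :=
  ∀ᶠ q in 𝓝 0, evalAn q θ = evalAn q (b.E ^ 3 + epsEl P V 𝔸 * m)

theorem IsTheta.mapHom {b : Background} {𝔹 : Type*} [NormedCommRing 𝔹] [NormedAlgebra ℝ 𝔹] {θ m : AnAlg P V 𝔸}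
    (h : b.IsTheta θ m) (φ : 𝔸 →ₐ[ℝ] 𝔹) (hφ : Continuous φ) :
    b.IsTheta (NewtonCosmo.mapHom φ hφ θ) (NewtonCosmo.mapHom φ hφ m : AnAlg P V 𝔹) := by
  filter_upwards [h] with q h
  set M : AnAlg P V 𝔸 →ₐ[ℝ] AnAlg P V 𝔹 := NewtonCosmo.mapHom φ hφ with hM
  have h1 : M b.E = b.E := mapHom_scal _ _ _
  have h2 : M (epsEl P V 𝔸) = epsEl P V 𝔹 := mapHom_scal _ _ _
  have h3 : M (b.E ^ 3 + epsEl P V 𝔸 * m) = b.E ^ 3 + epsEl P V 𝔹 * M m := by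
    rw [map_add, map_mul, map_pow, h1, h2]
  rw [← h3, hM, evalAn_mapHom, h, ← evalAn_mapHom _ φ hφ]

theorem IsTheta.mkI_eq {b : Background} {θ m : AnAlg P V 𝔸} (h : b.IsTheta θ m) (hm : m ∈ idealZ P V 𝔸) :
    mkI P V 𝔸 θ = mkI P V 𝔸 (b.E ^ 3) := by
  have h1 := mkI_eq_of_eventually h
  rwa [map_add, map_mul, mkI_eps_mul hm, add_zero] at h1

/-- The contravariant metric density with perturbation `N`. -/
def metricMat (N : M4 (AnAlg P V 𝔸)) : M4 (AnAlg P V 𝔸) :=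
  Matrix.diagonal ![(-(b.Λ / 3)) • b.E ^ 3, b.E, b.E, b.E] + (epsEl P V 𝔸 * b.E ^ 3) • N

/-- From θ² = e⁶ - (3/Λ)εm₀ the factor ε of θ - e³ is extracted by dividing by θ + e³, which is
invertible near the origin. Modulo negligible terms m₀ reduces to e⁶N₀₀ and θ + e³ to 2e³, whence
the coefficient -3/(2Λ). -/
theorem exists_theta [CompleteSpace 𝔸] (N : M4 (AnAlg P V 𝔸)) (hN : ∀ i j, N i j ∈ idealZ P V 𝔸)
    (hN' : ∀ i : Fin 3, N i.succ i.succ ∈ idealI P V 𝔸) :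
    ∃ θ m : AnAlg P V 𝔸, evalAn 0 θ = algebraMap ℝ 𝔸 (b.e 0 ^ 3) ∧
      IsScaledSqrt (-(3 / b.Λ)) θ (b.metricMat N).det ∧
      b.IsTheta θ m ∧
      m ∈ idealZ P V 𝔸 ∧ mkI P V 𝔸 m = mkI P V 𝔸 ((-(3 / (2 * b.Λ))) • (b.E ^ 3 * N 0 0)) := by
  unfold metricMat
  have hΛ := b.Λ_pos.ne'
  have hΛ3 : (3 / b.Λ) * (b.Λ / 3) = 1 := by field_simp
  have he0 := b.e_pos 0
  set x := epsEl P V 𝔸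
  set e : AnAlg P V 𝔸 := b.E
  have hx0 : evalAn 0 x = 0 := by rw [evalAn_eps]; exact map_zero _
  have hE0 : evalAn 0 e = algebraMap ℝ 𝔸 (b.e 0) := rfl
  obtain ⟨R, hR, hdet⟩ := exists_det_diagonal hΛ b.E_mul_Ei (idealZ P V 𝔸) x N hN
  set m0 := e ^ 6 * N 0 0 - (b.Λ / 3) • (e ^ 8 * (N 1 1 + N 2 2 + N 3 3)) + x * R
  have hm0I : m0 - e ^ 6 * N 0 0 ∈ idealI P V 𝔸 := by
    have e1 : m0 - e ^ 6 * N 0 0 = x * R - (b.Λ / 3) • (e ^ 8 * (N 1 1 + N 2 2 + N 3 3)) := by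
      simp only [m0]; ring
    rw [e1]
    refine Ideal.sub_mem _ (eps_mul_mem hR) ?_
    rw [Algebra.smul_def]
    exact Ideal.mul_mem_left _ _ (Ideal.mul_mem_left _ _
      (Ideal.add_mem _ (Ideal.add_mem _ (hN' 0) (hN' 1)) (hN' 2)))
  have hm0 : m0 ∈ idealZ P V 𝔸 := by
    have := Ideal.add_mem _ (idealI_le hm0I) (Ideal.mul_mem_left _ (e ^ 6) (hN 0 0))
    rwa [sub_add_cancel] at this
  set f : AnAlg P V 𝔸 := e ^ 6 - (3 / b.Λ) • (x * m0)
  have hf : f = (-(3 / b.Λ)) • (Matrix.diagonal ![(-(b.Λ / 3)) • e ^ 3, e, e, e]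
      + (x * e ^ 3) • N).det := by
    rw [hdet]
    change f = (-(3 / b.Λ)) • ((-(b.Λ / 3)) • e ^ 6 + x * m0)
    rw [smul_add, smul_smul, neg_mul_neg, hΛ3, one_smul, neg_smul, ← sub_eq_add_neg]
  obtain ⟨θ, hθ, hθ0⟩ := exists_sqrt f (b.e 0 ^ 3) (by positivity) (by
    change evalAn 0 f = _
    simp only [f, map_sub, map_smul, map_mul, map_pow, hx0, hE0, zero_mul, smul_zero, sub_zero]
    ring)
  replace hθ : ∀ᶠ q in 𝓝 0, evalAn q θ ^ 2 = evalAn q f := hθ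
  replace hθ0 : evalAn 0 θ = algebraMap ℝ 𝔸 (b.e 0 ^ 3) := hθ0
  -- Difference of squares: θ - e³ = (θ² - e⁶)/(θ + e³).
  obtain ⟨g, hg, -⟩ := exists_inv' (θ + e ^ 3) (c := 2 * b.e 0 ^ 3) (by positivity) (by
    rw [map_add, hθ0, map_pow (evalAn 0), hE0]; simp only [map_mul, map_pow, map_ofNat]; ring)
  set m := (-(3 / b.Λ)) • (m0 * g)
  have hm : m ∈ idealZ P V 𝔸 := by
    simp only [m, Algebra.smul_def]
    exact Ideal.mul_mem_left _ _ (Ideal.mul_mem_right _ _ hm0)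
  have hθm : ∀ᶠ q in 𝓝 0, evalAn q θ = evalAn q (e ^ 3 + x * m) := by
    filter_upwards [hθ, hg] with q h1 h2
    simp only [f, m, map_sub, map_smul, map_mul, map_add, map_pow] at h1 h2 ⊢
    linear_combination (norm := skip) (evalAn q g) * h1 - (evalAn q θ - evalAn q e ^ 3) * h2
    algebra
  refine ⟨θ, m, hθ0, ?_, hθm, hm, ?_⟩
  · filter_upwards [hθ] with q h1
    rw [h1, hf, map_smul, Algebra.smul_def]
  · have k1 := mkI_eq_of_eventually hθm
    rw [map_add, map_mul _ x, mkI_eps_mul hm, add_zero] at k1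
    have k2 : mkI P V 𝔸 (g * (θ + e ^ 3)) = mkI P V 𝔸 1 :=
      mkI_eq_of_eventually (by filter_upwards [hg] with q h; rw [map_mul, h, map_one])
    have k3 := mkI_eq.2 hm0I
    have k4 : mkI P V 𝔸 (e * b.Ei) = mkI P V 𝔸 1 := by rw [b.E_mul_Ei]
    have h2 : (3 / b.Λ) = 2 * (3 / (2 * b.Λ)) := by field_simp
    simp only [m, map_smul, map_mul, map_add, map_pow, map_one, k3, k1] at k2 k4 ⊢
    rw [h2]
    generalize mkI P V 𝔸 g = g' at *
    generalize mkI P V 𝔸 e = e' at *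
    generalize mkI P V 𝔸 (N 0 0) = n' at *
    generalize mkI P V 𝔸 b.Ei = i' at *
    linear_combination (norm := skip) (-(3 / (2 * b.Λ))) • (e' ^ 3 * n' * k2)
    algebra

/-- The normalization is the quadratic equation H₀₀v₀² + 2βv₀ + γ + θ⁻¹ = 0. The terms β and γ are
negligible, since H is diagonal modulo the ideal and γ is quadratic in the spatial velocity, so v₀
agrees modulo the ideal with its background value. -/
theorem exists_velocity [CompleteSpace 𝔸] {H : M4 (AnAlg P V 𝔸)} {θ : AnAlg P V 𝔸} {w : Fin 3 → AnAlg P V 𝔸}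
    (hw : ∀ i, w i ∈ idealZ P V 𝔸)
    (hH : H.map (mkI P V 𝔸) = Matrix.diagonal ![(-(3 / b.Λ)) • mkI P V 𝔸 b.Ei ^ 3,
      mkI P V 𝔸 b.Ei, mkI P V 𝔸 b.Ei, mkI P V 𝔸 b.Ei])
    (hH0 : evalAn 0 (H 0 0) = algebraMap ℝ 𝔸 (-(3 / b.Λ) * (b.e 0)⁻¹ ^ 3))
    (hθ : mkI P V 𝔸 θ = mkI P V 𝔸 (b.E ^ 3)) (hθ0 : evalAn 0 θ = algebraMap ℝ 𝔸 (b.e 0 ^ 3))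
    {s : ℝ} (hs : s ^ 2 = 1) :
    ∃ v0 : AnAlg P V 𝔸, evalAn 0 v0 = algebraMap ℝ 𝔸 (s * √(b.Λ / 3)) ∧
      mkI P V 𝔸 v0 = algebraMap ℝ _ (s * √(b.Λ / 3)) ∧
      ∀ᶠ q in 𝓝 0, evalAn q (θ * ∑ μ, ∑ ν, H μ ν * (Fin.cons v0 w : Fin 4 → AnAlg P V 𝔸) μ
        * (Fin.cons v0 w : Fin 4 → AnAlg P V 𝔸) ν) + 1 = 0 := by
  have hΛ := b.Λ_pos
  have hΛ' := hΛ.ne'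
  have he0 := b.e_pos 0
  have hHa : ∀ a c, mkI P V 𝔸 (H a c) = Matrix.diagonal ![(-(3 / b.Λ)) • mkI P V 𝔸 b.Ei ^ 3,
      mkI P V 𝔸 b.Ei, mkI P V 𝔸 b.Ei, mkI P V 𝔸 b.Ei] a c := fun a c => by rw [← hH]; rfl
  have hH0i : ∀ i : Fin 3, H 0 i.succ ∈ idealI P V 𝔸 := fun i => mkI_eq_zero.1 (by
    rw [hHa]; exact Matrix.diagonal_apply_ne _ (Fin.succ_ne_zero i).symm)
  have hHi0 : ∀ i : Fin 3, H i.succ 0 ∈ idealI P V 𝔸 := fun i => mkI_eq_zero.1 (by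
    rw [hHa]; exact Matrix.diagonal_apply_ne _ (Fin.succ_ne_zero i))
  have hw0 : ∀ i, evalAn 0 (w i) = 0 := fun i => evalAn_zero_of_mem (hw i)
  set β := (1 / 2 : ℝ) • ∑ i : Fin 3, (H 0 i.succ + H i.succ 0) * w i
  set γ := ∑ i : Fin 3, ∑ j : Fin 3, H i.succ j.succ * w i * w j
  have hβ : β ∈ idealI P V 𝔸 := by
    simp only [β, Algebra.smul_def]
    exact Ideal.mul_mem_left _ _ (Ideal.sum_mem _ fun i _ => Ideal.mul_mem_right _ _
      (Ideal.add_mem _ (hH0i i) (hHi0 i)))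
  have hγ : γ ∈ idealI P V 𝔸 := Ideal.sum_mem _ fun i _ => Ideal.sum_mem _ fun j _ => by
    rw [mul_assoc]; exact Ideal.mul_mem_left _ _ (mul_mem_idealI (hw i) (hw j))
  have hβ0 : evalAn 0 β = 0 := evalAn_zero_of_mem (idealI_le hβ)
  have hγ0 : evalAn 0 γ = 0 := evalAn_zero_of_mem (idealI_le hγ)
  obtain ⟨θi, hθi, hθi0⟩ := exists_inv' θ (by positivity) hθ0
  have hh0 : -(3 / b.Λ) * (b.e 0)⁻¹ ^ 3 ≠ 0 := by
    refine mul_ne_zero (neg_ne_zero.2 (by positivity)) (by positivity)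
  obtain ⟨gi, hgi, hgi0⟩ := exists_inv' (H 0 0) hh0 hH0
  obtain ⟨σ, hσ, hσ0⟩ := exists_sqrt (β ^ 2 - H 0 0 * (γ + θi)) (√(3 / b.Λ) * (b.e 0)⁻¹ ^ 3)
    (by positivity) (by
      change evalAn 0 (β ^ 2 - H 0 0 * (γ + θi)) = _
      rw [map_sub (evalAn 0), map_pow (evalAn 0), map_mul (evalAn 0), map_add (evalAn 0), hβ0, hγ0, hH0,
        hθi0]
      rw [zero_add, zero_pow two_ne_zero, zero_sub, ← map_mul, ← map_neg]
      congr 1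
      rw [mul_pow, Real.sq_sqrt (by positivity)]
      field_simp)
  replace hσ : ∀ᶠ q in 𝓝 0, evalAn q σ ^ 2 = evalAn q (β ^ 2 - H 0 0 * (γ + θi)) := hσ
  replace hσ0 : evalAn 0 σ = algebraMap ℝ 𝔸 (√(3 / b.Λ) * (b.e 0)⁻¹ ^ 3) := hσ0
  -- The branch of the quadratic formula for which v₀ has the sign of s, since H₀₀ is negative on
  -- the background.
  set v0 := (-β - s • σ) * gi
  have hv00 : evalAn 0 v0 = algebraMap ℝ 𝔸 (s * √(b.Λ / 3)) := by
    simp only [v0, map_sub, map_mul, map_neg, map_smul, hβ0, hσ0, hgi0, neg_zero, zero_sub]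
    rw [Algebra.smul_def, ← map_mul, ← map_mul, ← map_mul, ← map_neg, ← map_mul]
    congr 1
    have h1 : √(3 / b.Λ) * √(b.Λ / 3) = 1 := by
      rw [← Real.sqrt_mul (by positivity), div_mul_div_cancel₀ hΛ']; norm_num
    have h2 : √(b.Λ / 3) ^ 2 = b.Λ / 3 := Real.sq_sqrt (by positivity)
    have h3 : √(3 / b.Λ) * (b.Λ / 3) = √(b.Λ / 3) := by
      calc _ = √(3 / b.Λ) * √(b.Λ / 3) * √(b.Λ / 3) := by rw [mul_assoc, ← pow_two, h2]
        _ = _ := by rw [h1, one_mul]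
    rw [← h3]
    field_simp
  have hev : ∀ᶠ q in 𝓝 0, evalAn q (H 0 0 * v0 ^ 2 + 2 * β * v0 + γ + θi) = 0 := by
    filter_upwards [hσ, hgi] with q h1 h2
    simp only [v0, map_sub, map_smul, map_mul, map_add, map_pow, map_neg, map_ofNat] at h1 h2 ⊢
    generalize evalAn q (H 0 0) = a at *
    generalize evalAn q gi = g at *
    generalize evalAn q β = B at *
    generalize evalAn q γ = c at *
    generalize evalAn q θi = t at *
    generalize evalAn q σ = z at *
    have hs' : (s ^ 2 - 1) • (z ^ 2 * g) = 0 := by rw [hs, sub_self, zero_smul]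
    linear_combination (norm := skip) (((B + s • z) ^ 2 * g) - (c + t)) * h2
      + g * h1 + hs'
    algebra
  have hrel := mkI_eq_of_eventually (b := (0 : AnAlg P V 𝔸)) (by
    filter_upwards [hev] with q h; rw [h, map_zero])
  have k1 : mkI P V 𝔸 (θi * θ) = mkI P V 𝔸 1 :=
    mkI_eq_of_eventually (by filter_upwards [hθi] with q h; rw [map_mul, h, map_one])
  have k2 : mkI P V 𝔸 (b.E * b.Ei) = mkI P V 𝔸 1 := by rw [b.E_mul_Ei]
  have hsq : mkI P V 𝔸 v0 ^ 2 = algebraMap ℝ _ (b.Λ / 3) := by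
    simp only [map_add, map_mul, map_pow, map_zero, map_one, mkI_eq_zero.2 hβ, mkI_eq_zero.2 hγ, hθ,
      mul_zero, zero_mul, add_zero, hHa, Matrix.diagonal_apply_eq, Matrix.cons_val_zero] at hrel k1 k2
    generalize mkI P V 𝔸 v0 = v' at *
    generalize mkI P V 𝔸 b.E = e' at *
    generalize mkI P V 𝔸 b.Ei = i' at *
    generalize mkI P V 𝔸 θi = t' at *
    have k3 : e' ^ 3 * i' ^ 3 = 1 := by rw [← mul_pow, k2, one_pow]
    have hΛ3 : (b.Λ / 3) * (3 / b.Λ) = 1 := by field_simp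
    have k4 : ((b.Λ / 3) * (3 / b.Λ)) • (v' ^ 2) = algebraMap ℝ _ (b.Λ / 3) := by
      linear_combination (norm := skip) (-(b.Λ / 3)) • (e' ^ 3 * hrel) + (b.Λ / 3) • k1
        - ((b.Λ / 3) * (3 / b.Λ)) • (v' ^ 2 * k3)
      algebra
    rwa [hΛ3, one_smul] at k4
  refine ⟨v0, hv00, ?_, ?_⟩
  · have hs0 : s ≠ 0 := by rintro rfl; norm_num at hs
    have hvb : s * √(b.Λ / 3) ≠ 0 := mul_ne_zero hs0 (by positivity)
    -- With c = s√(Λ/3), equality of squares modulo the ideal reads (v₀ - c)(v₀ + c) = 0, and v₀ + c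
    -- is invertible near the origin.
    obtain ⟨d, hd, -⟩ := exists_inv' (v0 + algebraMap ℝ _ (s * √(b.Λ / 3)))
      (c := 2 * (s * √(b.Λ / 3))) (by positivity) (by
        rw [map_add, hv00, AlgHom.commutes, ← map_add, two_mul])
    have k5 : mkI P V 𝔸 (d * (v0 + algebraMap ℝ _ (s * √(b.Λ / 3)))) = mkI P V 𝔸 1 :=
      mkI_eq_of_eventually (by filter_upwards [hd] with q h; rw [map_mul, h, map_one])
    rw [map_mul, map_add, AlgHom.commutes, map_one] at k5
    have k6 : (s * √(b.Λ / 3)) ^ 2 = b.Λ / 3 := by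
      rw [mul_pow, hs, one_mul, Real.sq_sqrt (by positivity)]
    rw [← k6, map_pow] at hsq
    linear_combination (-(mkI P V 𝔸 v0 - algebraMap ℝ _ (s * √(b.Λ / 3)))) * k5 + mkI P V 𝔸 d * hsq
  · filter_upwards [hev, hθi] with q h1 h2
    have e1 : θ * ∑ μ, ∑ ν, H μ ν * (Fin.cons v0 w : Fin 4 → AnAlg P V 𝔸) μ
        * (Fin.cons v0 w : Fin 4 → AnAlg P V 𝔸) ν = θ * (H 0 0 * v0 ^ 2 + 2 * β * v0 + γ) := by
      congr 1
      rw [Fin.sum_univ_succ]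
      have e2 : ∀ i : Fin 3, ∑ ν, H i.succ ν * (Fin.cons v0 w : Fin 4 → AnAlg P V 𝔸) i.succ
          * (Fin.cons v0 w : Fin 4 → AnAlg P V 𝔸) ν = H i.succ 0 * w i * v0
            + ∑ j : Fin 3, H i.succ j.succ * w i * w j := fun i => by
        rw [Fin.sum_univ_succ]; simp
      simp only [e2]
      rw [Fin.sum_univ_succ]
      simp only [Fin.cons_zero, Fin.cons_succ, Finset.sum_add_distrib]
      have e3 : 2 * β = ∑ i : Fin 3, (H 0 i.succ + H i.succ 0) * w i := by
        have : (2 : AnAlg P V 𝔸) = algebraMap ℝ _ 2 := (map_ofNat (algebraMap ℝ (AnAlg P V 𝔸)) 2).symm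
        simp only [β]
        rw [this, ← Algebra.smul_def, smul_smul]
        norm_num
      rw [e3, Finset.sum_mul]
      simp only [γ, add_mul, Finset.sum_add_distrib]
      have e4 : ∀ i : Fin 3, H 0 i.succ * v0 * w i = H 0 i.succ * w i * v0 := fun i => by ring
      simp only [e4]
      ring
    rw [e1]
    simp only [map_mul, map_add] at h1 ⊢
    linear_combination evalAn q θ * h1 - h2

end Background

end

section

/-! ### Differential operators between the Sobolev algebras. -/

section AlgebraOperators

instance instFactTwoLeSucc {k : ℕ} [h : Fact (2 ≤ k)] : Fact (2 ≤ k + 1) := ⟨by have := h.1; omega⟩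

theorem sum_unitIdx (i : Fin 3) : ∑ j, unitIdx i j = 1 := by simp [unitIdx]

variable {j n : ℕ} [Fact (2 ≤ n)]

/-- The derivative `D^α`, with values in the algebra. -/
def dOp (α : Fin 3 → ℕ) (h : n + ∑ i, α i ≤ j) : Hs j ℝ →L[ℝ] Alg n :=
  (algEquiv (k := n)).symm.toContinuousLinearMap ∘L derivOp α h

theorem weakD_dOp (α : Fin 3 → ℕ) (h : n + ∑ i, α i ≤ j) (u : Hs j ℝ) :
    weakD u α =ᵐ[torusMeasure] fun x => evalAlg x (dOp α h u) := weakD_ae α h u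

theorem dOp_congr {α β : Fin 3 → ℕ} (e : α = β) (h : n + ∑ i, α i ≤ j) (h' : n + ∑ i, β i ≤ j) :
    dOp (n := n) α h = dOp β h' := by subst e; rfl

def d0 (h : n ≤ j) : Hs j ℝ →L[ℝ] Alg n := dOp 0 (by simpa using h)
def d1 (i : Fin 3) (h : n + 1 ≤ j) : Hs j ℝ →L[ℝ] Alg n := dOp (unitIdx i) (by rw [sum_unitIdx]; exact h)
def d2 (i l : Fin 3) (h : n + 2 ≤ j) : Hs j ℝ →L[ℝ] Alg n := dOp (unitIdx i + unitIdx l) (by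
  simp only [Pi.add_apply, Finset.sum_add_distrib, sum_unitIdx]; exact h)

theorem d2_comm (i l : Fin 3) (h : n + 2 ≤ j) : d2 (n := n) i l h = d2 l i h :=
  dOp_congr (add_comm _ _) _ _

variable {k : ℕ} [Fact (2 ≤ k)]

/-- `∂_i` on the algebra. -/
def algD (i : Fin 3) : Alg (k + 1) →L[ℝ] Alg k :=
  d1 i le_rfl ∘L (algEquiv (k := k + 1)).toContinuousLinearMap

theorem dOp_algEquiv_dOp {j : ℕ} (α β : Fin 3 → ℕ) (h : k + 1 + ∑ i, α i ≤ j) (h' : k + ∑ i, β i ≤ k + 1)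
    (h'' : k + ∑ i, (β + α) i ≤ j) (u : Hs j ℝ) :
    dOp β h' (algEquiv (dOp (n := k + 1) α h u)) = dOp (n := k) (β + α) h'' u := by
  refine congrArg (algEquiv (k := k)).symm (ft_injective fun n => ?_)
  exact (ft_derivOp β h' (derivOp α h u) n).trans
    (by rw [ft_derivOp, ← mul_assoc, ← symbIdx_add]; exact (ft_derivOp _ h'' u n).symm)

theorem algD_d0 (i : Fin 3) {j : ℕ} (h : k + 1 ≤ j) (u : Hs j ℝ) : algD i (d0 h u) = d1 (n := k) i h u :=
  (dOp_algEquiv_dOp _ _ _ _ (by simpa [sum_unitIdx] using h) u).trans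
    (by rw [d1, dOp_congr (add_zero (unitIdx i))])

theorem algD_d1 (i l : Fin 3) {j : ℕ} (h : k + 2 ≤ j) (u : Hs j ℝ) :
    algD i (d1 l (by omega) u) = d2 (n := k) i l h u :=
  dOp_algEquiv_dOp _ _ _ _ _ u

theorem cont_dOp_zero (h : k + ∑ i : Fin 3, (0 : Fin 3 → ℕ) i ≤ k + 1) (u : Alg (k + 1)) :
    cont (dOp 0 h (algEquiv u)) = cont u := by
  have : ft (derivOp 0 h (algEquiv u)) = ft (toHs (k + 1) u) := by
    ext n
    rw [ft_derivOp]
    simp [symbIdx, algEquiv_apply]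
  change realF (ft (derivOp 0 h (algEquiv u))) = realF (ft (toHs (k + 1) u))
  rw [this]

/-- The inclusion of the algebras. -/
def algIncl : Alg (k + 1) →ₐ[ℝ] Alg k :=
  AlgHom.ofLinearMap (d0 (Nat.le_succ k) ∘L (algEquiv (k := k + 1)).toContinuousLinearMap).toLinearMap
    (cont_ext fun x => by
      change cont (dOp 0 _ (algEquiv 1)) x = _
      rw [cont_dOp_zero, cont_one, cont_one])
    (fun u v => cont_ext fun x => by
      change cont (dOp 0 _ (algEquiv (u * v))) x = cont (dOp 0 _ (algEquiv u) * dOp 0 _ (algEquiv v)) x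
      rw [cont_mul, cont_dOp_zero, cont_dOp_zero, cont_dOp_zero, cont_mul])

theorem algIncl_apply (u : Alg (k + 1)) : algIncl u = d0 (Nat.le_succ k) (algEquiv u) := rfl

theorem continuous_algIncl : Continuous (algIncl (k := k)) :=
  (d0 (Nat.le_succ k) ∘L (algEquiv (k := k + 1)).toContinuousLinearMap).continuous

theorem algIncl_dOp (α : Fin 3 → ℕ) {j : ℕ} (h : k + 1 + ∑ i, α i ≤ j) (u : Hs j ℝ) :
    algIncl (dOp α h u) = dOp (n := k) α (by omega) u :=
  (dOp_algEquiv_dOp _ _ _ _ (by rw [zero_add]; omega) u).trans (by rw [dOp_congr (zero_add α)])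

/-- The mean value. -/
def algMean : Alg k →L[ℝ] ℝ := meanOp k ∘L (algEquiv (k := k)).toContinuousLinearMap

def algInvLap : Alg k →L[ℝ] HsBar (k + 2) ℝ := invLap k ∘L (algEquiv (k := k)).toContinuousLinearMap

theorem eq_zero_of_algMean {u : Alg k} (h1 : algMean u = 0) (h2 : algInvLap u = 0) : u = 0 :=
  (algEquiv (k := k)).injective ((eq_zero_of_mean_of_invLap h1 h2).trans (map_zero _).symm)

theorem algMean_d1 {j : ℕ} (i : Fin 3) (h : k + 1 ≤ j) (u : Hs j ℝ) : algMean (d1 (n := k) i h u) = 0 :=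
  meanOp_derivOp _ _ (fun h => by simpa [unitIdx] using congrFun h i) u

theorem algMean_d2 {j : ℕ} (i l : Fin 3) (h : k + 2 ≤ j) (u : Hs j ℝ) :
    algMean (d2 (n := k) i l h u) = 0 :=
  meanOp_derivOp _ _ (fun h => by simpa [unitIdx] using congrFun h i) u

theorem algMean_d0 {j : ℕ} (h : k ≤ j) (u : HsBar j ℝ) : algMean (d0 (n := k) h u.1) = 0 := by
  have h1 := meanOp_bar u
  have h2 := ft_zero_eq (derivOp (k := k) 0 (by simpa using h) u.1)
  rw [ft_derivOp, ft_zero_eq, h1] at h2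
  have : ((meanOp k (derivOp (k := k) 0 (by simpa using h) u.1) : ℝ) : ℂ) = 0 := by
    rw [← h2]; simp
  exact_mod_cast this

theorem algInvLap_lap (u : HsBar (k + 2) ℝ) :
    algInvLap (∑ i : Fin 3, d2 (n := k) i i le_rfl u.1) = u := by
  refine Eq.trans ?_ (invLap_laplacian u)
  change invLap k (algEquiv (∑ i : Fin 3, d2 (n := k) i i le_rfl u.1)) = _
  rw [map_sum]
  rfl

theorem ft_algConst (c : ℝ) (n : Freq) :
    ft (algEquiv (algebraMap ℝ (Alg k) c)) n = if n = 0 then (c : ℂ) else 0 := by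
  rw [Algebra.algebraMap_eq_smul_one, map_smul, ft_smul, algEquiv_apply, ft_one]
  simp

theorem algInvLap_const (c : ℝ) : algInvLap (algebraMap ℝ (Alg k) c) = 0 := by
  refine Subtype.ext (ft_injective fun n => ?_)
  refine (ft_invLap k _ n).trans ((congrArg (lapSymb n * ·) (ft_algConst c n)).trans ?_)
  beta_reduce
  have h0 : ft (0 : HsBar (k + 2) ℝ).1 n = 0 := by
    have := ft_smul 0 (0 : Hs (k + 2) ℝ) n
    rw [zero_smul] at this
    exact this.trans (by simp)
  rw [h0]
  split_ifs with h
  · rw [h, lapSymb, sum_symb_eq_zero.2 rfl]; simp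
  · simp

theorem algMean_const (c : ℝ) : algMean (algebraMap ℝ (Alg k) c) = c := by
  have h := ft_zero_eq (algEquiv (algebraMap ℝ (Alg k) c))
  rw [ft_algConst, if_pos rfl] at h
  exact_mod_cast h.symm

end AlgebraOperators

end

section

/-! ### Symmetric matrices in block form. -/

section SymMatrix

variable {𝔸 𝔹 : Type*}

/-- The symmetric matrix with `00`-entry `a`, `0j`-entries `b` and `ij`-entries `c`. -/
def symM (a : 𝔸) (b : Fin 3 → 𝔸) (c : Fin 3 → Fin 3 → 𝔸) : M4 𝔸 :=
  Matrix.of (Fin.cons (Fin.cons a b) fun i => Fin.cons (b i) (c i))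

theorem symM_map (f : 𝔸 → 𝔹) (a : 𝔸) (b : Fin 3 → 𝔸) (c : Fin 3 → Fin 3 → 𝔸) :
    (symM a b c).map f = symM (f a) (fun i => f (b i)) fun i j => f (c i j) := by
  ext μ ν
  refine Fin.cases ?_ (fun i => ?_) μ <;> refine Fin.cases ?_ (fun j => ?_) ν <;> rfl

theorem symM_transpose {a : 𝔸} {b : Fin 3 → 𝔸} {c : Fin 3 → Fin 3 → 𝔸} (hc : ∀ i j, c i j = c j i) :
    (symM a b c).transpose = symM a b c := by
  ext μ ν
  refine Fin.cases ?_ (fun i => ?_) μ <;> refine Fin.cases ?_ (fun j => ?_) ν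
  · rfl
  · rfl
  · rfl
  · exact hc j i

theorem symM_forall {p : 𝔸 → Prop} {a : 𝔸} {b : Fin 3 → 𝔸} {c : Fin 3 → Fin 3 → 𝔸} (ha : p a)
    (hb : ∀ i, p (b i)) (hc : ∀ i j, p (c i j)) (μ ν : Fin 4) : p (symM a b c μ ν) := by
  refine Fin.cases ?_ (fun i => ?_) μ <;> refine Fin.cases ?_ (fun j => ?_) ν
  · exact ha
  · exact hb j
  · exact hb i
  · exact hc i j

theorem symM_zero [Zero 𝔸] (a : 𝔸) : symM a 0 0 = Matrix.diagonal ![a, 0, 0, 0] := by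
  ext μ ν
  fin_cases μ <;> fin_cases ν <;> rfl

end SymMatrix

/-! ### Coordinates on data and unknowns, the ansatz for the fields and its reduction. -/

section Coordinates

variable (k : ℕ)

/-- The space of parameters: densities. -/
abbrev ParSp : Type := HsBar (k + 1) ℝ

/-- The space of components of the free data `(u^{ij}, u₀^{ij}, ρ₀, ν^i)`. -/
abbrev DatSp : Type := (Fin 3 → Fin 3 → Hs (k + 2) ℝ) × (Fin 3 → Fin 3 → Hs (k + 1) ℝ) ×
  HsBar (k + 1) ℝ × (Fin 3 → HsBar (k + 1) ℝ)

/-- The space of unknowns `(u^{00}, w^i, φ, ψ^i)`. -/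
abbrev UnkSp : Type := HsBar (k + 2) ℝ × (Fin 3 → HsBar (k + 2) ℝ) × ℝ × (Fin 3 → ℝ)

abbrev VSp : Type := DatSp k × UnkSp k

variable {k}

def incHs {j : ℕ} : HsBar j ℝ →L[ℝ] Hs j ℝ := (meanZeroSubmodule j ℝ).subtypeL

def matComp {W : Type*} [NormedAddCommGroup W] [NormedSpace ℝ W] (i j : Fin 3) :
    (Fin 3 → Fin 3 → W) →L[ℝ] W :=
  ContinuousLinearMap.proj (R := ℝ) (φ := fun _ : Fin 3 => W) j ∘L
    ContinuousLinearMap.proj (R := ℝ) (φ := fun _ : Fin 3 => Fin 3 → W) i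

/-- The entries are symmetrized, because `DatSp` consists of arbitrary matrices of functions; on
actual free data this changes nothing (`zA_freeCoord`). -/
def zA (i j : Fin 3) : VSp k →L[ℝ] Hs (k + 2) ℝ :=
  (1 / 2 : ℝ) • (matComp i j + matComp j i) ∘L
      (ContinuousLinearMap.fst ℝ _ _ ∘L ContinuousLinearMap.fst ℝ _ _)

def zB (i j : Fin 3) : VSp k →L[ℝ] Hs (k + 1) ℝ :=
  (1 / 2 : ℝ) • (matComp i j + matComp j i) ∘L
      (ContinuousLinearMap.fst ℝ _ _ ∘L ContinuousLinearMap.snd ℝ _ _ ∘L ContinuousLinearMap.fst ℝ _ _)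

def zRho : VSp k →L[ℝ] Hs (k + 1) ℝ := incHs ∘L ContinuousLinearMap.fst ℝ _ _ ∘L
  ContinuousLinearMap.snd ℝ _ _ ∘L ContinuousLinearMap.snd ℝ _ _ ∘L ContinuousLinearMap.fst ℝ _ _

def zNu (i : Fin 3) : VSp k →L[ℝ] Hs (k + 1) ℝ := incHs ∘L ContinuousLinearMap.proj i ∘L
  ContinuousLinearMap.snd ℝ _ _ ∘L ContinuousLinearMap.snd ℝ _ _ ∘L ContinuousLinearMap.snd ℝ _ _ ∘L
  ContinuousLinearMap.fst ℝ _ _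

def zU : VSp k →L[ℝ] Hs (k + 2) ℝ := incHs ∘L ContinuousLinearMap.fst ℝ _ _ ∘L
  ContinuousLinearMap.snd ℝ _ _

def zW (i : Fin 3) : VSp k →L[ℝ] Hs (k + 2) ℝ := incHs ∘L ContinuousLinearMap.proj i ∘L
  ContinuousLinearMap.fst ℝ _ _ ∘L ContinuousLinearMap.snd ℝ _ _ ∘L ContinuousLinearMap.snd ℝ _ _

def zPhi : VSp k →L[ℝ] ℝ := ContinuousLinearMap.fst ℝ _ _ ∘L ContinuousLinearMap.snd ℝ _ _ ∘L
  ContinuousLinearMap.snd ℝ _ _ ∘L ContinuousLinearMap.snd ℝ _ _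

def zPsi (i : Fin 3) : VSp k →L[ℝ] ℝ := ContinuousLinearMap.proj i ∘L ContinuousLinearMap.snd ℝ _ _ ∘L
  ContinuousLinearMap.snd ℝ _ _ ∘L ContinuousLinearMap.snd ℝ _ _ ∘L ContinuousLinearMap.snd ℝ _ _

theorem zA_symm (i j : Fin 3) : zA (k := k) i j = zA j i := by rw [zA, zA, add_comm (matComp i j)]

theorem zB_symm (i j : Fin 3) : zB (k := k) i j = zB j i := by rw [zB, zB, add_comm (matComp i j)]

variable [Fact (2 ≤ k)]

variable (k) in
/-- Analytic families with values in `H^k`. -/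
abbrev OA : Subalgebra ℝ (ℝ × ParSp k × VSp k → Alg k) := AnAlg (ParSp k) (VSp k) (Alg k)

variable (k) in
/-- Analytic families with values in `H^{k+1}`. -/
abbrev OB : Subalgebra ℝ (ℝ × ParSp k × VSp k → Alg (k + 1)) := AnAlg (ParSp k) (VSp k) (Alg (k + 1))

/-- The linear family given by a derivative of a coordinate. -/
def el {n j : ℕ} [Fact (2 ≤ n)] (d : Hs j ℝ →L[ℝ] Alg n) (z : VSp k →L[ℝ] Hs j ℝ) :
    AnAlg (ParSp k) (VSp k) (Alg n) := lin (d ∘L z)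

theorem el_mem {n j : ℕ} [Fact (2 ≤ n)] (d : Hs j ℝ →L[ℝ] Alg n) (z : VSp k →L[ℝ] Hs j ℝ) :
    el d z ∈ idealZ (ParSp k) (VSp k) (Alg n) := lin_mem _

/-- The inclusion of families. -/
def inc : OB k →ₐ[ℝ] OA k := mapHom algIncl continuous_algIncl

/-- `∂_i` of a family. -/
def der (i : Fin 3) : OB k →ₗ[ℝ] OA k := mapLin (algD i)

variable (b : Background)

namespace Background

/-- The perturbation of the metric. -/
def N : M4 (OB k) := symM (el (d0 (by omega)) zU) (fun i => epsEl _ _ _ * el (d0 (by omega)) (zW i))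
  fun i j => epsEl _ _ _ * el (d0 (by omega)) (zA i j)

theorem hgauge : AnalyticAt ℝ (fun ε => 2 * b.τ - 3 * b.y ε) 0 :=
  analyticAt_const.sub (analyticAt_const.mul b.hy)

theorem hgauge' : AnalyticAt ℝ (fun ε => (2 * b.Λ / 3 * b.τ - b.Λ * b.y ε) * (b.e ε)⁻¹ ^ 3) 0 :=
  (analyticAt_const.sub (analyticAt_const.mul b.hy)).mul (b.hei.pow 3)

/-- The time derivative of `u^{00}`, from the gauge condition; `m = (θ - e³)/ε`. -/
def vB (m : OB k) : OB k := scal _ b.hgauge * el (d0 (by omega)) zU - ∑ j, el (d1 j le_rfl) (zW j)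
  + scal _ b.hgauge' * m

/-- The time derivative of `u^{0i}`, from the gauge condition. -/
def cB (i : Fin 3) : OB k := scal _ b.hgauge * (epsEl _ _ _ * el (d0 (by omega)) (zW i))
  - ∑ j, el (d1 j le_rfl) (zA i j)

/-- The jet of the solution. -/
def FJ (m : OB k) : FieldJet (OA k) where
  eps := epsEl _ _ _
  e := b.E
  e1 := b.E * b.Y
  N := (N (k := k)).map inc
  N1 := fun l => symM (el (d1 l (by omega)) zU) (fun i => epsEl _ _ _ * el (d1 l (by omega)) (zW i))
    fun i j => epsEl _ _ _ * el (d1 l (by omega)) (zA i j)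
  B := symM (inc (b.vB m)) (fun i => inc (b.cB i)) fun i j => el (d0 (by omega)) (zB i j)
  B1 := fun l => symM (der l (b.vB m)) (fun i => der l (b.cB i)) fun i j => el (d1 l le_rfl) (zB i j)
  S2 := fun l n => symM 0 (fun i => el (d2 l n le_rfl) (zW i)) fun i j => el (d2 l n le_rfl) (zA i j)

theorem N_mem (μ ν : Fin 4) : N (k := k) μ ν ∈ idealZ (ParSp k) (VSp k) (Alg (k + 1)) :=
  symM_forall (el_mem _ _) (fun _ => Ideal.mul_mem_left _ _ (el_mem _ _))
    (fun _ _ => Ideal.mul_mem_left _ _ (el_mem _ _)) μ ν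

/-- The spatial block carries an explicit factor ε, so its trace does not contribute to the
determinant at leading order. -/
theorem N_mem' (i : Fin 3) : N (k := k) i.succ i.succ ∈ idealI (ParSp k) (VSp k) (Alg (k + 1)) :=
  eps_mul_mem (el_mem _ _)

theorem vB_mem {m : OB k} (hm : m ∈ idealZ (ParSp k) (VSp k) (Alg (k + 1))) :
    b.vB m ∈ idealZ (ParSp k) (VSp k) (Alg (k + 1)) :=
  Ideal.add_mem _ (Ideal.sub_mem _ (Ideal.mul_mem_left _ _ (el_mem _ _))
    (Ideal.sum_mem _ fun _ _ => el_mem _ _)) (Ideal.mul_mem_left _ _ hm)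

theorem cB_mem (i : Fin 3) : b.cB i ∈ idealZ (ParSp k) (VSp k) (Alg (k + 1)) :=
  Ideal.sub_mem _ (Ideal.mul_mem_left _ _ (Ideal.mul_mem_left _ _ (el_mem _ _)))
    (Ideal.sum_mem _ fun _ _ => el_mem _ _)

theorem inc_mem {m : OB k} (hm : m ∈ idealZ (ParSp k) (VSp k) (Alg (k + 1))) :
    inc m ∈ idealZ (ParSp k) (VSp k) (Alg k) := mapHom_mem_idealZ _ _ hm

theorem FJ_B_mem {m : OB k} (hm : m ∈ idealZ (ParSp k) (VSp k) (Alg (k + 1))) (μ ν : Fin 4) :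
    (b.FJ m).B μ ν ∈ idealZ (ParSp k) (VSp k) (Alg k) :=
  symM_forall (p := fun x => x ∈ idealZ (ParSp k) (VSp k) (Alg k)) (inc_mem (b.vB_mem hm))
    (fun i => inc_mem (b.cB_mem i)) (fun _ _ => el_mem _ _) μ ν

variable (m : OB k)

/-- The jet modulo `idealI`. -/
abbrev FJI : FieldJet (ModI (ParSp k) (VSp k) (Alg k)) := (b.FJ m).map (mkI (ParSp k) (VSp k) (Alg k))

theorem FJI_isSymm : (b.FJI m).IsSymm where
  N1 := fun l => by
    simp only [FieldJet.map, FJ, symM_map]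
    exact symM_transpose fun i j => by rw [zA_symm]
  B1 := fun l => by
    simp only [FieldJet.map, FJ, symM_map]
    exact symM_transpose fun i j => by rw [zB_symm]
  S2 := fun l n => by
    simp only [FieldJet.map, FJ, symM_map]
    exact symM_transpose fun i j => by rw [zA_symm]
  comm := fun l n => by
    simp only [FieldJet.map, FJ, d2_comm l n]

theorem FJI_N : (b.FJI m).eps • (b.FJI m).N = 0 := by
  ext μ ν
  exact mkI_eps_mul (inc_mem (N_mem μ ν))

theorem FJI_B (hm : m ∈ idealZ (ParSp k) (VSp k) (Alg (k + 1))) : (b.FJI m).eps • (b.FJI m).B = 0 := by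
  ext μ ν
  exact mkI_eps_mul (b.FJ_B_mem hm μ ν)

/-- The derivatives of `u^{00}` modulo `idealI`. -/
def u1I (k : ℕ) [Fact (2 ≤ k)] (l : Fin 3) : ModI (ParSp k) (VSp k) (Alg k) := mkI _ _ _ (el (d1 l (by omega)) zU)

/-- The remaining entries are ε times linear functions, hence negligible. The gradient of u^{00} is
the one first order quantity that survives without a factor ε. -/
theorem FJI_N1 (l : Fin 3) : (b.FJI m).N1 l = Matrix.diagonal ![u1I k l, 0, 0, 0] := by
  rw [← symM_zero]
  simp only [FieldJet.map, FJ, symM_map]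
  congr 1
  · funext i; rw [map_mul]; exact mkI_eps_mul (el_mem _ _)
  · funext i j; rw [map_mul]; exact mkI_eps_mul (el_mem _ _)

theorem u1I_mul (i j : Fin 3) : u1I k i * u1I k j = 0 := mkI_mul (el_mem _ _) (el_mem _ _)

theorem FJI_S2 (l n : Fin 3) : (b.FJI m).S2 l n 0 0 = 0 := map_zero (mkI (ParSp k) (VSp k) (Alg k))

theorem der_el_d0 (i : Fin 3) {j : ℕ} (h : k + 1 ≤ j) (z : VSp k →L[ℝ] Hs j ℝ) :
    der i (el (d0 h) z) = el (d1 i h) z := anAlg_ext fun q => algD_d0 i h _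

theorem der_el_d1 (i l : Fin 3) {j : ℕ} (h : k + 2 ≤ j) (z : VSp k →L[ℝ] Hs j ℝ) :
    der i (el (d1 l (by omega)) z) = el (d2 i l h) z := anAlg_ext fun q => algD_d1 i l h _

theorem der_vB (i : Fin 3) : der i (b.vB m) = scal _ b.hgauge * el (d1 i (by omega)) zU
    - ∑ j, el (d2 i j le_rfl) (zW j) + scal _ b.hgauge' * der i m := by
  rw [vB, map_add, map_sub, map_sum, der, mapLin_scal_mul, mapLin_scal_mul]
  congr 2
  · congr 1; exact der_el_d0 _ _ _
  · exact Finset.sum_congr rfl fun j _ => der_el_d1 _ _ _ _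

theorem scal_gauge : (scal _ b.hgauge : OA k) = algebraMap ℝ _ (2 * b.τ) - 3 * b.Y := by
  refine anAlg_ext fun q => ?_
  change algebraMap ℝ (Alg k) (2 * b.τ - 3 * b.y q.1) =
    algebraMap ℝ (Alg k) (2 * b.τ) - 3 * algebraMap ℝ (Alg k) (b.y q.1)
  rw [map_sub, map_mul _ 3, map_ofNat]

theorem scal_gauge' : (scal _ b.hgauge' : OA k) =
    (algebraMap ℝ _ (2 * b.Λ / 3 * b.τ) - b.Λ • b.Y) * b.Ei ^ 3 := by
  refine anAlg_ext fun q => ?_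
  change algebraMap ℝ (Alg k) ((2 * b.Λ / 3 * b.τ - b.Λ * b.y q.1) * (b.e q.1)⁻¹ ^ 3) =
    (algebraMap ℝ (Alg k) (2 * b.Λ / 3 * b.τ) - b.Λ • algebraMap ℝ (Alg k) (b.y q.1))
      * algebraMap ℝ (Alg k) (b.e q.1)⁻¹ ^ 3
  rw [map_mul, map_sub, map_mul _ b.Λ, map_pow, Algebra.smul_def]

theorem gauge_identity {R : Type*} [CommRing R] [Algebra ℝ R] {e ei : R} (h : e * ei = 1)
    (y u s m κ : R) (τ : ℝ) :
    e ^ 3 * ((algebraMap ℝ R (2 * τ) - 3 * y) * u - s + κ * ei ^ 3 * m) =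
      (-(3 * e ^ 2 * (e * y)) + (2 * τ) • e ^ 3) * u - e ^ 3 * s + κ * m := by
  have h3 : e ^ 3 * ei ^ 3 = 1 := by rw [← mul_pow, h, one_pow]
  linear_combination (norm := skip) κ * m * h3
  algebra

theorem mkI_E_mul_Ei : mkI (ParSp k) (VSp k) (Alg k) b.E * mkI _ _ _ b.Ei = 1 := by
  rw [← map_mul, b.E_mul_Ei, map_one]

/-- The gauge condition expresses ∂_t u^{00} through u^{00}, the divergence of w and m. Applying ∂_i
gives precisely the relation needed in `jetEqn_succ_bg`. -/
theorem FJI_B1 (i : Fin 3) : (b.FJI m).e ^ 3 * (b.FJI m).B1 i 0 0 =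
    (-(3 * (b.FJI m).e ^ 2 * (b.FJI m).e1) + (2 * b.τ) • (b.FJI m).e ^ 3) * u1I k i
      - (b.FJI m).e ^ 3 * ∑ l, (b.FJI m).S2 i l 0 l.succ
      + (algebraMap ℝ _ (2 * b.Λ / 3 * b.τ) - b.Λ • mkI _ _ _ b.Y) * mkI _ _ _ (der i m) := by
  have h0 : (b.FJI m).B1 i 0 0 = mkI _ _ _ (der i (b.vB m)) := rfl
  have h1 : (b.FJI m).e = mkI _ _ _ b.E := rfl
  have h2 : (b.FJI m).e1 = mkI _ _ _ b.E * mkI _ _ _ b.Y := map_mul _ _ _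
  have h3 : ∀ l : Fin 3, (b.FJI m).S2 i l 0 l.succ = mkI _ _ _ (el (d2 i l le_rfl) (zW l)) := fun _ => rfl
  rw [h1, h2, ← gauge_identity b.mkI_E_mul_Ei, h0, der_vB, scal_gauge, scal_gauge', u1I]
  simp only [h3, map_add (mkI _ _ _), map_sub (mkI _ _ _), map_mul (mkI _ _ _), map_sum (mkI _ _ _),
    map_pow (mkI _ _ _), map_smul (mkI _ _ _), AlgHom.commutes, map_ofNat (mkI _ _ _)]

end Background

end Coordinates

end

/-! ### The constraints as analytic families and their linear parts. -/

section

open Filter Topology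

section

variable {P V : Type*} [NormedAddCommGroup P] [NormedSpace ℝ P] [NormedAddCommGroup V] [NormedSpace ℝ V]
variable {𝔸 : Type*} [NormedCommRing 𝔸] [NormedAlgebra ℝ 𝔸]

theorem exists_matrix_inv [CompleteSpace 𝔸] (G : M4 (AnAlg P V 𝔸)) {c : ℝ} (hc : c ≠ 0)
    (hG : evalAn 0 G.det = algebraMap ℝ 𝔸 c) :
    ∃ H : M4 (AnAlg P V 𝔸), ∀ᶠ q in 𝓝 0, H.map (evalAn q) * G.map (evalAn q) = 1 := by
  obtain ⟨g, hg, -⟩ := exists_inv' G.det hc hG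
  refine ⟨g • G.adjugate, ?_⟩
  have hHG : (g • G.adjugate) * G = (g * G.det) • 1 := by
    rw [Matrix.smul_mul, Matrix.adjugate_mul, smul_smul]
  filter_upwards [hg] with q h
  rw [← Matrix.map_mul, hHG]
  ext i j
  rw [Matrix.map_apply, Matrix.smul_apply, smul_eq_mul, map_mul, map_mul, h, one_mul]
  by_cases hij : i = j
  · subst hij; simp
  · simp [Matrix.one_apply_ne hij]

theorem mkI_matrix_inv {H G : M4 (AnAlg P V 𝔸)}
    (hinv : ∀ᶠ q in 𝓝 0, H.map (evalAn q) * G.map (evalAn q) = 1) :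
    H.map (mkI P V 𝔸) * G.map (mkI P V 𝔸) = 1 := by
  rw [← Matrix.map_mul]
  ext i j
  have h1 : mkI P V 𝔸 ((H * G) i j) = mkI P V 𝔸 ((1 : M4 (AnAlg P V 𝔸)) i j) := by
    refine mkI_eq_of_eventually ?_
    filter_upwards [hinv] with q h
    rw [← Matrix.map_mul] at h
    have h2 := congrFun (congrFun h i) j
    rw [Matrix.map_apply] at h2
    rw [h2]
    by_cases hij : i = j
    · subst hij; simp
    · simp [Matrix.one_apply_ne hij]
  rw [Matrix.map_apply, h1]
  by_cases hij : i = j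
  · subst hij; simp
  · simp [Matrix.one_apply_ne hij]

/-- The inverse of the metric density comes from the adjugate and the inverse of the determinant.
The spatial velocity is the momentum density divided by ρ, both invertibilities holding near the
origin; the normalization then gives the time component. -/
theorem exists_inverse_velocity [CompleteSpace 𝔸] (b : Background) {F : FieldJet (AnAlg P V 𝔸)}
    (hFe : F.e = b.E) (hFeps : F.eps = epsEl P V 𝔸) (hN : ∀ μ ν, F.N μ ν ∈ idealZ P V 𝔸)
    {θ : AnAlg P V 𝔸} (hθ2 : Background.IsScaledSqrt (-(3 / b.Λ)) θ (F.G b.Λ).det)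
    (hθ0 : evalAn 0 θ = algebraMap ℝ 𝔸 (b.e 0 ^ 3)) (hθI : mkI P V 𝔸 θ = mkI P V 𝔸 (b.E ^ 3))
    {ρ : AnAlg P V 𝔸} (hρ0 : evalAn 0 ρ = algebraMap ℝ 𝔸 (b.rH 0)) {n : Fin 3 → AnAlg P V 𝔸}
    (hn : ∀ i, n i ∈ idealZ P V 𝔸) {s : ℝ} (hs : s ^ 2 = 1) :
    ∃ (H : M4 (AnAlg P V 𝔸)) (v : Fin 4 → AnAlg P V 𝔸),
      (∀ᶠ q in 𝓝 0, H.map (evalAn q) * (F.G b.Λ).map (evalAn q) = 1) ∧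
      H.map (mkI P V 𝔸) * (F.map (mkI P V 𝔸)).G b.Λ = 1 ∧
      evalAn 0 (v 0) = algebraMap ℝ 𝔸 (s * √(b.Λ / 3)) ∧
      mkI P V 𝔸 (v 0) = algebraMap ℝ _ (s * √(b.Λ / 3)) ∧
      (∀ᶠ q in 𝓝 0, evalAn q (θ * ∑ μ, ∑ ν, H μ ν * v μ * v ν) + 1 = 0) ∧
      (∀ i : Fin 3, v i.succ ∈ idealZ P V 𝔸) ∧
      ∀ i : Fin 3, ∀ᶠ q in 𝓝 0, evalAn q (ρ * v i.succ) = evalAn q (n i) := by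
  have hΛ := b.Λ_pos.ne'
  have he0 := b.e_pos 0
  set G := F.G b.Λ
  have hdet0 : evalAn 0 G.det = algebraMap ℝ _ (-(b.Λ / 3) * b.e 0 ^ 6) := by
    have h1 : evalAn 0 θ ^ 2 = algebraMap ℝ 𝔸 (-(3 / b.Λ)) * evalAn 0 G.det := hθ2.self_of_nhds
    have h2 : (-(b.Λ / 3)) • evalAn 0 θ ^ 2 = evalAn 0 G.det := by
      rw [h1, ← Algebra.smul_def, smul_smul]
      have : -(b.Λ / 3) * -(3 / b.Λ) = 1 := by field_simp
      rw [this, one_smul]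
    rw [← h2, hθ0, ← map_pow, Algebra.smul_def, ← map_mul]
    congr 1
    ring
  obtain ⟨H, hinv⟩ := exists_matrix_inv G
    (mul_ne_zero (neg_ne_zero.2 (by have := b.Λ_pos; positivity)) (by positivity)) hdet0
  have hHI : H.map (mkI _ _ _) * (F.map (mkI P V 𝔸)).G b.Λ = 1 := by
    rw [FieldJet.G_map]
    exact mkI_matrix_inv hinv
  have hNI : (F.map (mkI P V 𝔸)).eps • (F.map (mkI P V 𝔸)).N = 0 := by
    ext μ ν
    change mkI P V 𝔸 F.eps * mkI P V 𝔸 (F.N μ ν) = 0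
    rw [← map_mul, hFeps, map_mul]
    exact mkI_eps_mul (hN μ ν)
  have hEI : (F.map (mkI P V 𝔸)).e * mkI P V 𝔸 b.Ei = 1 := by
    change mkI P V 𝔸 F.e * _ = 1
    rw [← map_mul, hFe, b.E_mul_Ei, map_one]
  have hHI' := FieldJet.H_bg hΛ hNI hEI hHI
  have hH00 : evalAn 0 (H 0 0) = algebraMap ℝ _ (-(3 / b.Λ) * (b.e 0)⁻¹ ^ 3) := by
    have h1 : H.map (evalAn 0) * (F.map (evalAn 0)).G b.Λ = 1 := by
      rw [FieldJet.G_map]; exact hinv.self_of_nhds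
    have h2 : (F.map (evalAn 0)).eps • (F.map (evalAn 0)).N = 0 := by
      have : (F.map (evalAn 0)).eps = 0 := by
        change evalAn 0 F.eps = 0
        rw [hFeps]; exact map_zero (algebraMap ℝ 𝔸)
      rw [this, zero_smul]
    have h3 : (F.map (evalAn 0)).e * evalAn 0 (b.Ei : AnAlg P V 𝔸) = 1 := by
      change evalAn 0 F.e * _ = 1
      rw [hFe, ← map_mul, b.E_mul_Ei, map_one]
    have h4 := congrFun (congrFun (FieldJet.H_bg hΛ h2 h3 h1) 0) 0
    rw [Matrix.map_apply, Matrix.diagonal_apply_eq, Matrix.cons_val_zero] at h4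
    rw [h4, map_mul, map_pow, ← Algebra.smul_def]
    rfl
  obtain ⟨ρi, hρi, -⟩ := exists_inv' ρ b.rH_pos.ne' hρ0
  set w : Fin 3 → AnAlg P V 𝔸 := fun i => n i * ρi
  have hw : ∀ i, w i ∈ idealZ P V 𝔸 := fun i => Ideal.mul_mem_right _ _ (hn i)
  obtain ⟨v0, hv00, hv0I, hnorm⟩ := b.exists_velocity hw hHI' hH00 hθI hθ0 hs
  have hnn : ∀ i : Fin 3, ∀ᶠ q in 𝓝 0, evalAn q (ρ * w i) = evalAn q (n i) := fun i => by
    filter_upwards [hρi] with q h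
    simp only [w, map_mul]
    linear_combination evalAn q (n i) * h
  refine ⟨H, Fin.cons v0 w, hinv, hHI, hv00, hv0I, hnorm, hw, hnn⟩

end

namespace Background

variable {k : ℕ} [Fact (2 ≤ k)] (b : Background)

/-- The density. -/
def rho : OA k := scal b.rH b.hrH + par (d0 (by omega) ∘L incHs) + lin (algebraMapCLM ℝ (Alg k) ∘L zPhi)

theorem evalAn_zero_rho : evalAn 0 (b.rho (k := k)) = algebraMap ℝ _ (b.rH 0) := by
  rw [rho, map_add, map_add, evalAn_scal, evalAn_par, evalAn_lin]
  simp

/-- The momentum density. -/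
def mom (i : Fin 3) : OA k := el (d0 (by omega)) (zNu i) + lin (algebraMapCLM ℝ (Alg k) ∘L zPsi i)

theorem mom_mem (i : Fin 3) : mom (k := k) i ∈ idealZ (ParSp k) (VSp k) (Alg k) :=
  Ideal.add_mem _ (el_mem _ _) (lin_mem _)

def kap : OA k := scal (fun ε => ε ^ 2 * b.K) ((analyticAt_id.pow 2).mul analyticAt_const)

/-- One of the two factors ε in κ = ε²K is enough. -/
theorem kap_mul_mem {a : OA k} (ha : a ∈ idealZ (ParSp k) (VSp k) (Alg k)) :
    b.kap * a ∈ idealI (ParSp k) (VSp k) (Alg k) := by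
  have e : (b.kap : OA k) = epsEl _ _ _ * scal (fun ε => ε * b.K) (analyticAt_id.mul analyticAt_const) :=
    anAlg_ext fun q => by
      change algebraMap ℝ (Alg k) (q.1 ^ 2 * b.K) = algebraMap ℝ (Alg k) q.1 * algebraMap ℝ (Alg k) (q.1 * b.K)
      rw [← map_mul]; congr 1; ring
  rw [e, mul_assoc]
  exact eps_mul_mem (Ideal.mul_mem_left _ _ ha)

theorem inc_E : inc (b.E : OB k) = (b.E : OA k) := mapHom_scal _ _ _

theorem inc_eps : inc (epsEl (ParSp k) (VSp k) (Alg (k + 1))) = epsEl (ParSp k) (VSp k) (Alg k) :=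
  mapHom_scal _ _ _

theorem FJ_G (m : OB k) : (b.FJ m).G b.Λ = (b.metricMat (N (k := k))).map inc := by
  ext μ ν
  simp only [FieldJet.G, FJ, metricMat, Matrix.map_apply, Matrix.add_apply, Matrix.smul_apply, smul_eq_mul,
    map_add, map_mul, map_pow, inc_E, inc_eps]
  congr 1
  fin_cases μ <;> fin_cases ν <;> simp [inc_E]

theorem der_E_mul (i : Fin 3) (x : OB k) : der i (b.E ^ 3 * x) = b.E ^ 3 * der i x := by
  refine anAlg_ext fun q => ?_
  change algD i (algebraMap ℝ _ (b.e q.1) ^ 3 * evalAn q x) = algebraMap ℝ _ (b.e q.1) ^ 3 * algD i (evalAn q x)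
  rw [← map_pow, ← map_pow, ← Algebra.smul_def, ← Algebra.smul_def, map_smul]

/-- The part of the energy constraint linear in the fields. -/
def lin0 : OA k := (-(b.Λ / 6)) • (b.E ^ 6 * ∑ l, ∑ n, el (d2 l n le_rfl) (zA l n))
  - (b.Λ / 3 * b.τ ^ 2) • (b.E ^ 6 * lin (algebraMapCLM ℝ (Alg k) ∘L zPhi))

/-- The part of the momentum constraint linear in the fields; `v` is the background value of `v̄⁰`. -/
def lini (v : ℝ) (i : Fin 3) : OA k := (1 / 2 : ℝ) • (b.E ^ 4 * ∑ l, el (d2 l l le_rfl) (zW i))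
  + (1 / 4 : ℝ) • (b.E ^ 4 * b.Y * el (d1 i (by omega)) zU)
  + (b.Λ / 6) • (b.E ^ 6 * ∑ l, el (d1 l le_rfl) (zB i l)) - (b.τ ^ 2 * v) • (b.E ^ 6 * mom i)

/-- The constraints `Ḡ^{0μ} - T̄^{0μ}` up to a factor, as analytic families. -/
def eqn (m : OB k) (θ : OA k) (H : M4 (OA k)) (v : Fin 4 → OA k) (μ : Fin 4) : OA k :=
  jetEqn b.Λ b.τ (b.FJ m) H θ b.rho b.kap v μ

/-- The solution of the algebraic and gauge constraints as analytic families, and the form of the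
remaining constraints modulo `idealI`. -/
structure IsSystem (s : ℝ) (m : OB k) (θ : OA k) (H : M4 (OA k)) (v : Fin 4 → OA k) : Prop where
  m_mem : m ∈ idealZ (ParSp k) (VSp k) (Alg (k + 1))
  inverse : ∀ᶠ q in 𝓝 0, H.map (evalAn q) * ((b.FJ m).G b.Λ).map (evalAn q) = 1
  theta_sq : IsScaledSqrt (-(3 / b.Λ)) θ ((b.FJ m).G b.Λ).det
  theta_eq : b.IsTheta θ (inc m)
  theta_zero : evalAn 0 θ = algebraMap ℝ _ (b.e 0 ^ 3)
  v_zero : evalAn 0 (v 0) = algebraMap ℝ _ (s * √(b.Λ / 3))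
  normalized : ∀ᶠ q in 𝓝 0, evalAn q (θ * ∑ μ, ∑ ν, H μ ν * v μ * v ν) + 1 = 0
  momentum : ∀ i : Fin 3, ∀ᶠ q in 𝓝 0, evalAn q (b.rho * v i.succ) = evalAn q (mom i)
  energy_mem : b.eqn m θ H v 0
    + (b.Λ / 3 * b.τ ^ 2) • (b.E ^ 6 * par (d0 (by omega) ∘L incHs)) - b.lin0 ∈
      idealI (ParSp k) (VSp k) (Alg k)
  momentum_mem : ∀ i : Fin 3, b.eqn m θ H v i.succ
    - b.lini (s * √(b.Λ / 3)) i ∈ idealI (ParSp k) (VSp k) (Alg k)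

-- All quantities are constructed as analytic families. The two statements about the equations are
-- then checked in the quotient by the ideal, where the jets are exactly of the background form and
-- the explicit formulas apply.
set_option maxHeartbeats 2000000 in
theorem exists_system {s : ℝ} (hs : s ^ 2 = 1) : ∃ (m : OB k) (θ : OA k) (H : M4 (OA k))
    (v : Fin 4 → OA k), b.IsSystem s m θ H v := by
  have hΛ := b.Λ_pos.ne'
  have he0 := b.e_pos 0
  obtain ⟨θB, m, hθ0, hθ2, hθm, hm, hmI⟩ := b.exists_theta (P := ParSp k) (V := VSp k) (𝔸 := Alg (k + 1)) (N (k := k)) N_mem N_mem'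
  set θ : OA k := inc θB
  set G := (b.FJ m).G b.Λ
  have hdet : G.det = inc (b.metricMat (N (k := k))).det := by
    rw [AlgHom.map_det, AlgHom.mapMatrix_apply, ← b.FJ_G m]
  have hθ2' : IsScaledSqrt (-(3 / b.Λ)) θ G.det := by
    have h1 : IsScaledSqrt (-(3 / b.Λ)) θ (inc (b.metricMat (N (k := k))).det) := by
      have h2 := hθ2.mapHom algIncl continuous_algIncl
      generalize (b.metricMat (N (k := k))).det = d at *
      exact h2
    rw [hdet]
    exact h1
  have hθm' : b.IsTheta θ (inc m) := hθm.mapHom _ _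
  have hθ0' : evalAn 0 θ = algebraMap ℝ _ (b.e 0 ^ 3) :=
    (congrArg algIncl hθ0).trans (AlgHom.commutes _ _)
  have hθI := hθm'.mkI_eq (inc_mem hm)
  obtain ⟨H, v, hinv, hHI, hv00, hv0I, hnorm, hw, hmom⟩ := exists_inverse_velocity b (F := b.FJ m) rfl rfl
    (fun μ ν => inc_mem (N_mem μ ν)) hθ2' hθ0' hθI (b.evalAn_zero_rho) mom_mem hs
  have hy : (b.FJI m).e * mkI _ _ _ b.Y = (b.FJI m).e1 := (map_mul _ _ _).symm
  have hθF : mkI _ _ _ θ = (b.FJI m).e ^ 3 := by rw [hθI, map_pow]; rfl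
  -- The spatial derivative is a continuous linear map on values, so it preserves the ideal and may
  -- be applied to the congruence for m.
  have hderm : ∀ i : Fin 3, mkI _ _ _ (der i m) = (-(3 / (2 * b.Λ))) • ((b.FJI m).e ^ 3 * u1I k i) := by
    intro i
    have h1 : der i (m - (-(3 / (2 * b.Λ))) • (b.E ^ 3 * N 0 0)) ∈ idealI (ParSp k) (VSp k) (Alg k) :=
      mapLin_mem_idealI _ (mkI_eq.1 hmI)
    rw [map_sub, map_smul, der_E_mul, ← mkI_eq, map_smul, map_mul, map_pow] at h1
    rw [h1]
    congr 3
    exact der_el_d0 _ _ _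
  refine ⟨m, θ, H, v, hm, hinv, hθ2', hθm', hθ0', hv00, hnorm, hmom, ?_, fun i => ?_⟩
  · rw [← mkI_eq, map_add, eqn, ← jetEqn_map]
    have hv2 : (mkI _ _ _ (v 0)) ^ 2 =
        algebraMap ℝ (ModI (ParSp k) (VSp k) (Alg k)) (b.Λ / 3) := by
      rw [hv0I, ← map_pow, mul_pow, hs, one_mul, Real.sq_sqrt (by have := b.Λ_pos; positivity)]
    have hfr : (b.Λ ^ 2 / 3) • mkI (ParSp k) (VSp k) (Alg k) b.Y ^ 2 =
        (b.Λ / 3 * b.τ ^ 2) • mkI _ _ _ (scal b.rH b.hrH) + (2 / 3 * b.τ * b.Λ ^ 2) • mkI _ _ _ b.Y := by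
      rw [← map_pow, ← map_smul, ← map_smul, ← map_smul, ← map_add]
      congr 1
      refine anAlg_ext fun q => ?_
      change (b.Λ ^ 2 / 3) • algebraMap ℝ (Alg k) (b.y q.1) ^ 2 = (b.Λ / 3 * b.τ ^ 2) • algebraMap ℝ (Alg k) (b.rH q.1)
        + (2 / 3 * b.τ * b.Λ ^ 2) • algebraMap ℝ (Alg k) (b.y q.1)
      rw [Algebra.smul_def, Algebra.smul_def, Algebra.smul_def, ← map_pow, ← map_mul, ← map_mul, ← map_mul,
        ← map_add, b.friedmann]
    have hρ : mkI (ParSp k) (VSp k) (Alg k) b.rho = mkI _ _ _ (scal b.rH b.hrH) +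
        (mkI _ _ _ (par (d0 (by omega) ∘L incHs)) + mkI _ _ _ (lin (algebraMapCLM ℝ (Alg k) ∘L zPhi))) := by
      rw [rho, map_add, map_add, add_assoc]
    rw [jetEqn_zero_bg hΛ (b.FJI_N m) (b.FJI_B m hm) (b.FJI_N1 m) u1I_mul b.mkI_E_mul_Ei hy hHI
      (b.FJI_isSymm m) (b.FJI_S2 m) hθF hv2 hρ hfr, lin0]
    have e1 : ∀ l n : Fin 3, (b.FJI m).S2 l n l.succ n.succ = mkI _ _ _ (el (d2 l n le_rfl) (zA l n)) :=
      fun _ _ => rfl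
    have e2 : (b.FJI m).e = mkI _ _ _ b.E := rfl
    simp only [e1, e2, map_sub, map_smul, map_mul, map_pow, map_sum]
    algebra
  · rw [← mkI_eq, eqn, ← jetEqn_map]
    have hκ : mkI (ParSp k) (VSp k) (Alg k) b.kap * mkI _ _ _ (v i.succ) = 0 := by
      rw [← map_mul]
      exact mkI_eq_zero.2 (b.kap_mul_mem (hw i))
    have hn : mkI (ParSp k) (VSp k) (Alg k) b.rho * mkI _ _ _ (v i.succ) =
        mkI _ _ _ (mom i) := by
      rw [← map_mul]
      exact mkI_eq_of_eventually (hmom i)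
    rw [jetEqn_succ_bg hΛ (b.FJI_N m) (b.FJI_B m hm) (b.FJI_N1 m) b.mkI_E_mul_Ei hy hHI
      (b.FJI_isSymm m) hθF (v0 := s * √(b.Λ / 3)) hv0I i hκ hn (b.FJI_B1 m i)
      (hderm i) rfl, lini]
    have e1 : ∀ l : Fin 3, (b.FJI m).S2 l l 0 i.succ = mkI _ _ _ (el (d2 l l le_rfl) (zW i)) :=
      fun _ => rfl
    have e2 : (b.FJI m).e = mkI _ _ _ b.E := rfl
    have e3 : ∀ l : Fin 3, (b.FJI m).B1 l i.succ l.succ = mkI _ _ _ (el (d1 l le_rfl) (zB i l)) :=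
      fun _ => rfl
    simp only [e1, e2, e3, u1I, map_add, map_sub, map_smul, map_mul, map_pow, map_sum]

end Background

end

/-! ### The fixed point equation and its equivalence with the constraints. -/

section

namespace Background

open Filter Topology

variable {k : ℕ} [Fact (2 ≤ k)] (b : Background)

theorem evalAn_lin0 (q : ℝ × ParSp k × VSp k) : evalAn q b.lin0 =
    (-(b.Λ / 6) * b.e q.1 ^ 6) • (∑ l, ∑ n, d2 (n := k) l n le_rfl (zA l n q.2.2))
    - (b.Λ / 3 * b.τ ^ 2 * b.e q.1 ^ 6) • algebraMap ℝ (Alg k) (zPhi q.2.2) := by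
  have h : evalAn q (b.lin0 (k := k)) = (-(b.Λ / 6)) • (algebraMap ℝ (Alg k) (b.e q.1) ^ 6 *
      evalAn q (∑ l, ∑ n, el (d2 l n le_rfl) (zA l n)))
    - (b.Λ / 3 * b.τ ^ 2) • (algebraMap ℝ (Alg k) (b.e q.1) ^ 6 * algebraMap ℝ (Alg k) (zPhi q.2.2)) := rfl
  rw [h, ← map_pow, ← Algebra.smul_def, ← Algebra.smul_def, smul_smul, smul_smul, map_sum]
  simp only [map_sum]
  rfl

theorem evalAn_lini (v : ℝ) (i : Fin 3) (q : ℝ × ParSp k × VSp k) : evalAn q (b.lini v i) =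
    (1 / 2 * b.e q.1 ^ 4) • (∑ l, d2 (n := k) l l le_rfl (zW i q.2.2))
    + (1 / 4 * b.e q.1 ^ 4 * b.y q.1) • d1 (n := k) i (by omega) (zU q.2.2)
    + (b.Λ / 6 * b.e q.1 ^ 6) • (∑ l, d1 (n := k) l le_rfl (zB i l q.2.2))
    - (b.τ ^ 2 * v * b.e q.1 ^ 6) • (d0 (n := k) (by omega) (zNu i q.2.2) +
      algebraMap ℝ (Alg k) (zPsi i q.2.2)) := by
  have h : evalAn q (b.lini (k := k) v i) = (1 / 2 : ℝ) • (algebraMap ℝ (Alg k) (b.e q.1) ^ 4 *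
      evalAn q (∑ l, el (d2 l l le_rfl) (zW i)))
    + (1 / 4 : ℝ) • (algebraMap ℝ (Alg k) (b.e q.1) ^ 4 * algebraMap ℝ (Alg k) (b.y q.1) *
      d1 (n := k) i (by omega) (zU q.2.2))
    + (b.Λ / 6) • (algebraMap ℝ (Alg k) (b.e q.1) ^ 6 * evalAn q (∑ l, el (d1 l le_rfl) (zB i l)))
    - (b.τ ^ 2 * v) • (algebraMap ℝ (Alg k) (b.e q.1) ^ 6 * (d0 (n := k) (by omega) (zNu i q.2.2) +
      algebraMap ℝ (Alg k) (zPsi i q.2.2))) := rfl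
  rw [h, ← map_pow, ← map_pow, ← map_mul, ← Algebra.smul_def, ← Algebra.smul_def, ← Algebra.smul_def,
    ← Algebra.smul_def, smul_smul, smul_smul, smul_smul, smul_smul, map_sum, map_sum, ← mul_assoc]
  rfl

/-- Embeddings of the components of the unknowns. -/
def embU : HsBar (k + 2) ℝ →L[ℝ] UnkSp k := ContinuousLinearMap.inl ℝ _ _
def embW (i : Fin 3) : HsBar (k + 2) ℝ →L[ℝ] UnkSp k := ContinuousLinearMap.inr ℝ _ _ ∘L
  ContinuousLinearMap.inl ℝ _ _ ∘L ContinuousLinearMap.single ℝ (fun _ : Fin 3 => HsBar (k + 2) ℝ) i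
def embPhi : ℝ →L[ℝ] UnkSp k := ContinuousLinearMap.inr ℝ _ _ ∘L ContinuousLinearMap.inr ℝ _ _ ∘L
  ContinuousLinearMap.inl ℝ _ _
def embPsi (i : Fin 3) : ℝ →L[ℝ] UnkSp k := ContinuousLinearMap.inr ℝ _ _ ∘L ContinuousLinearMap.inr ℝ _ _ ∘L
  ContinuousLinearMap.inr ℝ _ _ ∘L ContinuousLinearMap.single ℝ (fun _ : Fin 3 => ℝ) i

theorem sum_emb (u : HsBar (k + 2) ℝ) (w : Fin 3 → HsBar (k + 2) ℝ) (φ : ℝ) (ψ : Fin 3 → ℝ) :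
    embU u + ∑ i, embW i (w i) + embPhi φ + ∑ i, embPsi i (ψ i) = ((u, w, φ, ψ) : UnkSp k) := by
  have h1 : ∑ i, embW (k := k) i (w i) = (0, w, 0, 0) := by
    have : ∀ i, embW (k := k) i (w i) = (ContinuousLinearMap.inr ℝ _ _ ∘L ContinuousLinearMap.inl ℝ _ _)
      (Pi.single i (w i)) := fun _ => rfl
    simp only [this, ← map_sum]
    rw [Finset.univ_sum_single]
    rfl
  have h2 : ∑ i, embPsi (k := k) i (ψ i) = (0, 0, 0, ψ) := by
    have : ∀ i, embPsi (k := k) i (ψ i) = (ContinuousLinearMap.inr ℝ _ _ ∘L ContinuousLinearMap.inr ℝ _ _ ∘L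
      ContinuousLinearMap.inr ℝ _ _) (Pi.single i (ψ i)) := fun _ => rfl
    simp only [this, ← map_sum]
    rw [Finset.univ_sum_single]
    rfl
  rw [h1, h2]
  change ((u + 0 + 0 + 0, 0 + w + 0 + 0, 0 + 0 + φ + 0, 0 + 0 + 0 + ψ) : UnkSp k) = _
  simp

variable (k) in
/-- The linear part of the fixed point equation. -/
def rowL (v : ℝ) (ε : ℝ) : VSp k →L[ℝ] UnkSp k :=
  (2 * b.Λ / 3 * b.τ ^ 2 * b.e ε ^ 2) • (embU ∘L algInvLap ∘L d0 (by omega) ∘L zRho)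
  + ∑ i, ((-(b.Λ / 3) * b.e ε ^ 2) • (embW i ∘L algInvLap ∘L ∑ l, (d1 l le_rfl ∘L zB i l))
    + (-(1 / 2) * b.y ε) • (embW i ∘L algInvLap ∘L d1 i (by omega) ∘L zU)
    + (2 * b.τ ^ 2 * v * b.e ε ^ 2) • (embW i ∘L algInvLap ∘L d0 (by omega) ∘L zNu i))

theorem analyticAt_rowL (v : ℝ) : AnalyticAt ℝ (b.rowL k v) 0 := by
  refine ((analyticAt_const.mul (b.he.pow 2)).smul analyticAt_const).add ?_
  refine Finset.analyticAt_fun_sum _ fun i _ => ?_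
  exact ((((analyticAt_const.mul (b.he.pow 2)).smul analyticAt_const).add
    ((analyticAt_const.mul b.hy).smul analyticAt_const)).add
    ((analyticAt_const.mul (b.he.pow 2)).smul analyticAt_const))

theorem rowL_apply (v ε : ℝ) (V : VSp k) : b.rowL k v ε V =
    ((2 * b.Λ / 3 * b.τ ^ 2 * b.e ε ^ 2) • algInvLap (d0 (n := k) (by omega) (zRho V)),
      fun i => (-(b.Λ / 3) * b.e ε ^ 2) • algInvLap (∑ l, d1 (n := k) l le_rfl (zB i l V))
        + (-(1 / 2) * b.y ε) • algInvLap (d1 (n := k) i (by omega) (zU V))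
        + (2 * b.τ ^ 2 * v * b.e ε ^ 2) • algInvLap (d0 (n := k) (by omega) (zNu i V)), 0, 0) := by
  rw [← sum_emb]
  simp only [rowL, add_apply, ContinuousLinearMap.sum_apply, smul_apply,
    ContinuousLinearMap.comp_apply, map_add, map_smul, map_zero, add_zero, Pi.zero_apply, Finset.sum_const_zero]

/-- With zero data the only nonzero entry of the operator takes u^{00} to w. Its output has
vanishing u^{00}, so a second application gives zero. -/
theorem rowL_nilpotent (v : ℝ) (x : UnkSp k) : b.rowL k v 0 (0, b.rowL k v 0 (0, x)) = 0 := by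
  have h1 : (b.rowL k v 0 (0, x)).1 = 0 := by
    rw [rowL_apply]
    have : zRho ((0, x) : VSp k) = 0 := map_zero incHs
    simp [this]
  have h2 : ∀ y : UnkSp k, y.1 = 0 → b.rowL k v 0 (0, y) = 0 := by
    intro y hy
    rw [rowL_apply]
    have e1 : zRho ((0, y) : VSp k) = 0 := map_zero incHs
    have e2 : zU ((0, y) : VSp k) = 0 := (congrArg incHs hy).trans (map_zero incHs)
    have e3 : ∀ i, zNu i ((0, y) : VSp k) = 0 := fun i => map_zero incHs
    have e4 : ∀ i l, zB i l ((0, y) : VSp k) = 0 := fun i l => by simp [zB, matComp]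
    simp only [e1, e2, e3, e4, map_zero, smul_zero, Finset.sum_const_zero, add_zero]
    rfl
  exact h2 _ h1

/-- The remainder of the energy constraint multiplied by `ε`. -/
def rem0 (m : OB k) (θ : OA k) (H : M4 (OA k)) (v : Fin 4 → OA k) : OA k :=
  b.eqn m θ H v 0
    + (b.Λ / 3 * b.τ ^ 2) • (b.E ^ 6 * par (d0 (by omega) ∘L incHs))
    + (1 / 2 : ℝ) • (epsEl _ _ _ * (b.E ^ 6 * ∑ l, ∑ n, el (d0 (by omega)) (zA l n) * el (d2 l n le_rfl) zU))

theorem rem0_mem {s : ℝ} {m : OB k} {θ : OA k} {H : M4 (OA k)} {v : Fin 4 → OA k}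
    (h : b.IsSystem s m θ H v) : b.rem0 m θ H v - b.lin0 ∈ idealI (ParSp k) (VSp k) (Alg k) := by
  have h1 : (1 / 2 : ℝ) • (epsEl (ParSp k) (VSp k) (Alg k) * (b.E ^ 6 * ∑ l, ∑ n, el (d0 (by omega)) (zA l n)
      * el (d2 l n le_rfl) zU)) ∈ idealI (ParSp k) (VSp k) (Alg k) := by
    rw [Algebra.smul_def]
    exact Ideal.mul_mem_left _ _ (Ideal.mul_mem_left _ _ (Ideal.mul_mem_left _ _ (Ideal.sum_mem _ fun l _ =>
      Ideal.sum_mem _ fun n _ => mul_mem_idealI (el_mem _ _) (el_mem _ _))))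
  have h2 := Ideal.add_mem _ h.energy_mem h1
  rw [rem0]
  convert h2 using 1
  abel

theorem lin0_mem : b.lin0 ∈ idealZ (ParSp k) (VSp k) (Alg k) := by
  rw [lin0, Algebra.smul_def, Algebra.smul_def]
  exact Ideal.sub_mem _ (Ideal.mul_mem_left _ _ (Ideal.mul_mem_left _ _ (Ideal.sum_mem _ fun l _ =>
      Ideal.sum_mem _ fun n _ => el_mem _ _))) (Ideal.mul_mem_left _ _ (Ideal.mul_mem_left _ _ (lin_mem _)))

/-- The nonlinear part of the fixed point equation. -/
def rowR (v : ℝ) (r0 : OA k) (ri : Fin 3 → OA k) (q : ℝ × ParSp k × VSp k) : UnkSp k :=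
  embU ((-(2 * (b.e q.1)⁻¹ ^ 4)) • algInvLap (evalAn q (epsEl _ _ _ * r0)))
  + ∑ i, embW i ((-(2 * (b.e q.1)⁻¹ ^ 4)) • algInvLap (evalAn q (ri i - b.lini v i)))
  + embPhi (((b.Λ / 3 * b.τ ^ 2)⁻¹ * (b.e q.1)⁻¹ ^ 6) • algMean (evalAn q (r0 - b.lin0)))
  + ∑ i, embPsi i (((b.τ ^ 2 * v)⁻¹ * (b.e q.1)⁻¹ ^ 6) • algMean (evalAn q (ri i - b.lini v i)))

theorem isI_sum {ι P V W : Type*} [NormedAddCommGroup P] [NormedSpace ℝ P]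
    [NormedAddCommGroup V] [NormedSpace ℝ V] [NormedAddCommGroup W] [NormedSpace ℝ W]
    (t : Finset ι) {f : ι → ℝ × P × V → W} (h : ∀ i ∈ t, IsI (f i)) : IsI (fun q => ∑ i ∈ t, f i q) := by
  classical
  induction t using Finset.induction_on with
  | empty => exact isI_of_eventually (Eventually.of_forall fun _ => Finset.sum_empty)
  | insert a t ha ih =>
    refine ((h a (Finset.mem_insert_self _ _)).add (ih fun i hi => h i (Finset.mem_insert_of_mem hi))).congr
      (Eventually.of_forall fun q => Finset.sum_insert ha)

theorem isI_scaled {W W' : Type*} [NormedAddCommGroup W] [NormedSpace ℝ W] [NormedAddCommGroup W'] [NormedSpace ℝ W']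
    {f : OA k} (hf : f ∈ idealI (ParSp k) (VSp k) (Alg k)) {c : ℝ → ℝ} (hc : AnalyticAt ℝ c 0) (A : Alg k →L[ℝ] W)
    (B : W →L[ℝ] W') : IsI (fun q : ℝ × ParSp k × VSp k => B (c q.1 • A (evalAn q f))) := by
  have h1 : AnalyticAt ℝ (fun q : ℝ × ParSp k × VSp k => c q.1 • (B ∘L A)) 0 :=
    AnalyticAt.fun_smul (AnalyticAt.fun_comp (g := c) hc analyticAt_fst) analyticAt_const
  refine (IsI.clm hf h1).congr (Eventually.of_forall fun q => ?_)
  rw [map_smul]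
  rfl

/-- The row of u^{00} contains r₀ only with a factor ε, so it is enough that r₀ is linear in ζ. In
the other rows the linear part has been subtracted. -/
theorem isI_rowR (v : ℝ) {r0 : OA k} {ri : Fin 3 → OA k}
    (h0 : r0 - b.lin0 ∈ idealI (ParSp k) (VSp k) (Alg k))
    (hi : ∀ i, ri i - b.lini v i ∈ idealI (ParSp k) (VSp k) (Alg k)) : IsI (b.rowR v r0 ri) := by
  have hr0 : r0 ∈ idealZ (ParSp k) (VSp k) (Alg k) := by
    have := Ideal.add_mem _ (idealI_le h0) b.lin0_mem
    rwa [sub_add_cancel] at this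
  have h4 : AnalyticAt ℝ (fun ε => -(2 * (b.e ε)⁻¹ ^ 4)) 0 := (analyticAt_const.mul (b.hei.pow 4)).neg
  exact (((isI_scaled (eps_mul_mem hr0) h4 _ _).add (isI_sum _ fun i _ => isI_scaled (hi i) h4 _ _)).add
    (isI_scaled h0 (analyticAt_const.mul (b.hei.pow 6)) _ _)).add
    (isI_sum _ fun i _ => isI_scaled (hi i) (analyticAt_const.mul (b.hei.pow 6)) _ _)

theorem rowR_eq (v : ℝ) (r0 : OA k) (ri : Fin 3 → OA k) (q : ℝ × ParSp k × VSp k) : b.rowR v r0 ri q =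
    ((-(2 * (b.e q.1)⁻¹ ^ 4)) • algInvLap (evalAn q (epsEl _ _ _ * r0)),
      fun i => (-(2 * (b.e q.1)⁻¹ ^ 4)) • algInvLap (evalAn q (ri i - b.lini v i)),
      ((b.Λ / 3 * b.τ ^ 2)⁻¹ * (b.e q.1)⁻¹ ^ 6) • algMean (evalAn q (r0 - b.lin0)),
      fun i => ((b.τ ^ 2 * v)⁻¹ * (b.e q.1)⁻¹ ^ 6) • algMean (evalAn q (ri i - b.lini v i))) :=
  sum_emb _ _ _ _

/-- A solution of the fixed point equation solves the momentum constraint. -/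
theorem momentum_of_row {v : ℝ} (hv : v ≠ 0) {r0 : OA k} {ri : Fin 3 → OA k} {q : ℝ × ParSp k × VSp k}
    (h : q.2.2.2 = b.rowL k v q.1 q.2.2 + b.rowR v r0 ri q) (i : Fin 3) : evalAn q (ri i) = 0 := by
  have he := (b.e_pos q.1).ne'
  have hτ := b.τ_pos.ne'
  rw [rowL_apply, rowR_eq] at h
  have hw : q.2.2.2.2.1 i = _ := congrFun (congrArg (fun x : UnkSp k => x.2.1) h) i
  have hψ : zPsi i q.2.2 = 0 + ((b.τ ^ 2 * v)⁻¹ * (b.e q.1)⁻¹ ^ 6) • algMean (evalAn q (ri i - b.lini v i)) :=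
    congrFun (congrArg (fun x : UnkSp k => x.2.2.2) h) i
  have e1 : evalAn q (ri i) = evalAn q (ri i - b.lini v i) + evalAn q (b.lini v i) := by
    rw [← map_add, sub_add_cancel]
  rw [e1, evalAn_lini]
  simp only [Prod.fst_add, Prod.snd_add, Pi.add_apply] at hw
  generalize evalAn q (ri i - b.lini v i) = I at *
  have hW : zW i q.2.2 = (q.2.2.2.2.1 i).1 := rfl
  have hN : zNu i q.2.2 = (q.2.2.1.2.2.2 i).1 := rfl
  -- The mean of the equation is the row of ψ, since derivatives and ν̆ have mean zero; its image
  -- under Δ⁻¹ is the row of w.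
  refine eq_zero_of_algMean ?_ ?_
  · simp only [map_add, map_sub, map_smul, map_sum, algMean_d1, algMean_d2, algMean_const, hψ, hN, algMean_d0,
      smul_eq_mul]
    field_simp
    simp
    ring
  · have e2 : algInvLap (∑ l, d2 (n := k) l l le_rfl (zW i q.2.2)) = q.2.2.2.2.1 i := algInvLap_lap _
    rw [map_add, map_sub, map_add, map_add, map_smul, map_smul, map_smul, map_smul, map_add algInvLap (d0 _ _), e2, algInvLap_const, hw]
    match_scalars <;> field_simp <;> ring

/-- A solution of the fixed point equation solves the energy constraint. -/
theorem energy_of_row {v : ℝ} {r0 : OA k} {ri : Fin 3 → OA k} {q : ℝ × ParSp k × VSp k}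
    (h : q.2.2.2 = b.rowL k v q.1 q.2.2 + b.rowR v r0 ri q) :
    (1 / 2 * b.e q.1 ^ 4) • (∑ l, d2 (n := k) l l le_rfl (zU q.2.2)) + evalAn q (epsEl _ _ _ * r0)
      - (b.Λ / 3 * b.τ ^ 2 * b.e q.1 ^ 6) • d0 (n := k) (by omega) (zRho q.2.2) = 0 := by
  have he := (b.e_pos q.1).ne'
  have hτ := b.τ_pos.ne'
  have hΛ := b.Λ_pos.ne'
  rw [rowL_apply, rowR_eq] at h
  have hu : q.2.2.2.1 = _ := congrArg (fun x : UnkSp k => x.1) h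
  have hφ : zPhi q.2.2 = 0 + ((b.Λ / 3 * b.τ ^ 2)⁻¹ * (b.e q.1)⁻¹ ^ 6) • algMean (evalAn q (r0 - b.lin0)) :=
    congrArg (fun x : UnkSp k => x.2.2.1) h
  simp only [Prod.fst_add] at hu
  have hR : zRho q.2.2 = (q.2.2.1.2.2.1).1 := rfl
  refine eq_zero_of_algMean ?_ ?_
  -- The row of φ says that r₀ has mean zero. The remaining terms, Δu^{00} and ρ̆₀, have mean zero
  -- anyway.
  · have e1 : algMean (evalAn q r0) = 0 := by
      have e1 : evalAn q r0 = evalAn q (r0 - b.lin0) + evalAn q b.lin0 := by rw [← map_add, sub_add_cancel]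
      rw [e1, evalAn_lin0]
      simp only [map_add, map_sub, map_smul, map_sum, algMean_d2, algMean_const, hφ, smul_eq_mul]
      field_simp
      simp
      ring
    have e2 : evalAn q (epsEl _ _ _ * r0) = q.1 • evalAn q r0 := by
      rw [map_mul, evalAn_eps, ← Algebra.smul_def]
    rw [e2]
    simp only [map_add, map_sub, map_smul, map_sum, algMean_d2, hR, algMean_d0, e1]
    simp
  · have e2 : algInvLap (∑ l, d2 (n := k) l l le_rfl (zU q.2.2)) = q.2.2.2.1 := algInvLap_lap _
    rw [map_sub, map_add, map_smul, map_smul, e2, hu]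
    generalize evalAn q (epsEl _ _ _ * r0) = I
    match_scalars <;> field_simp <;> ring

end Background

end

section

/-! ### From ring-valued jets back to real fields at a point. -/

section RealJets

variable {𝔸 : Type*} [CommRing 𝔸] [Algebra ℝ 𝔸]

theorem jetSp_add (G : M4 𝔸) (S S' : Fin 4 → Fin 4 → M4 𝔸) :
    jetSp G (fun p k => S p k + S' p k) = jetSp G S + jetSp G S' := by
  have hQ : jetQ G (fun p k => S p k + S' p k) = jetQ G S + jetQ G S' := by
    simp only [jetQ, smul_add, Finset.sum_add_distrib]
  have hV : jetV (fun p k => S p k + S' p k) = jetV S + jetV S' := by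
    ext a c
    simp only [jetV, Matrix.of_apply, Matrix.add_apply, Finset.sum_add_distrib]
  simp only [jetSp, hQ, hV, Matrix.trace_add, add_smul, Matrix.add_mul, Matrix.transpose_add,
    Matrix.mul_add]
  abel

/-- A divergence sees the 00 entry only through time derivatives, so the terms with `jetV` vanish.
Hence the second spatial derivatives of u^{00} occur in the energy constraint alone. -/
theorem jetSp_single (G : M4 𝔸) (c : Fin 3 → Fin 3 → 𝔸) (μ : Fin 4) :
    jetSp G (secondJets 0 fun k l => Matrix.diagonal ![c k l, 0, 0, 0]) 0 μ =
      if μ = 0 then ∑ k : Fin 3, ∑ l : Fin 3, G k.succ l.succ * c k l else 0 := by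
  have hV : jetV (secondJets 0 fun k l => Matrix.diagonal ![c k l, 0, 0, 0]) = 0 := by
    ext a d
    simp only [jetV, Matrix.of_apply, Matrix.zero_apply]
    refine Finset.sum_eq_zero fun p _ => ?_
    refine Fin.cases ?_ (fun p => ?_) p
    · refine Fin.cases ?_ (fun d => ?_) d <;> simp [secondJets]
    · refine Fin.cases ?_ (fun d => ?_) d
      · simp [secondJets]
      · simp [secondJets, Matrix.diagonal_apply]
        rintro rfl
        fin_cases p <;> rfl
  have hQ : jetQ G (secondJets 0 fun k l => Matrix.diagonal ![c k l, 0, 0, 0]) 0 μ =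
      if μ = 0 then ∑ k : Fin 3, ∑ l : Fin 3, G k.succ l.succ * c k l else 0 := by
    simp only [jetQ, Matrix.sum_apply, Matrix.smul_apply, smul_eq_mul]
    rw [Fin.sum_univ_succ]
    simp only [Fin.sum_univ_succ (n := 3)]
    refine Fin.cases ?_ (fun i => ?_) μ
    · simp [secondJets]
    · simp [secondJets, Matrix.diagonal_apply]
      exact fun h => absurd h (Fin.succ_ne_zero i).symm
  simp only [jetSp, hV, Matrix.trace_zero, zero_smul, Matrix.zero_mul, Matrix.transpose_zero, Matrix.mul_zero,
    Matrix.sub_apply, Matrix.add_apply, Matrix.zero_apply, add_zero, sub_zero, hQ]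

/-- The entrywise error c/4 and |x_i x_j| ≤ (x_i² + x_j²)/2 change the quadratic form c|x|² by at
most (3/4)c|x|². -/
theorem posDef_of_close {M : Matrix (Fin 3) (Fin 3) ℝ} (hM : M.transpose = M) {c : ℝ} (hc : 0 < c)
    (h : ∀ i j, |M i j - (if i = j then c else 0)| < c / 4) : M.PosDef := by
  have hs : ∀ i j, M i j = M j i := fun i j => congrFun (congrFun hM j) i
  refine Matrix.PosDef.of_dotProduct_mulVec_pos ?_ fun x hx => ?_
  · rw [Matrix.IsHermitian, Matrix.conjTranspose_eq_transpose_of_trivial, hM]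
  · have e : star x ⬝ᵥ M.mulVec x = ∑ i, ∑ j, M i j * (x i * x j) := by
      simp only [dotProduct, Matrix.mulVec, Finset.mul_sum, Pi.star_apply, star_trivial]
      exact Finset.sum_congr rfl fun i _ => Finset.sum_congr rfl fun j _ => by ring
    have hpos : 0 < ∑ i, x i ^ 2 := by
      obtain ⟨i, hi⟩ := Function.ne_iff.1 hx
      exact Finset.sum_pos' (fun i _ => sq_nonneg _) ⟨i, Finset.mem_univ _, by have : x i ≠ 0 := hi; positivity⟩
    have hij : ∀ i j, M i j * (x i * x j) ≥ (if i = j then c else 0) * (x i * x j)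
        - c / 8 * (x i ^ 2 + x j ^ 2) := fun i j => by
      have h1 := abs_lt.1 (h i j)
      have h2 : |x i * x j| ≤ (x i ^ 2 + x j ^ 2) / 2 := by
        rw [abs_le]; constructor <;> nlinarith [sq_nonneg (x i + x j), sq_nonneg (x i - x j)]
      have h3 : |(M i j - (if i = j then c else 0)) * (x i * x j)| ≤ c / 4 * ((x i ^ 2 + x j ^ 2) / 2) := by
        rw [abs_mul]
        exact mul_le_mul (h i j).le h2 (abs_nonneg _) (by positivity)
      have h4 := (abs_le.1 h3).1
      linarith
    rw [e]
    have h5 : ∑ i, ∑ j, M i j * (x i * x j) ≥ ∑ i, ∑ j, ((if i = j then c else 0) * (x i * x j)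
        - c / 8 * (x i ^ 2 + x j ^ 2)) := Finset.sum_le_sum fun i _ => Finset.sum_le_sum fun j _ => hij i j
    refine lt_of_lt_of_le ?_ h5
    simp only [Fin.sum_univ_three] at hpos ⊢
    simp
    nlinarith

/-- The entries `N`, `N1`, `B`, `B1` of the jet are ε times the fields. The entry `S2` is ∂_k∂_l 𝔲
itself with its 00 part removed; that part is u₂/ε and stands separately. Accordingly `hen` is the
energy constraint multiplied by ε, and the gauge equations are rescaled by powers of ε and e. -/
theorem constraints_of_fieldJet (P : Params) {T₀ ε : ℝ} (hL : 0 < P.Lam) (hK : 0 ≤ P.K)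
    (hr : 0 < P.rho1) (ht : 0 < T₀) (ht1 : T₀ ≤ 1) (hε : ε ≠ 0)
    (A B : (Fin 3 → ℕ) → Mat4) (W : Mat4) (hA : ∀ α, (A α).transpose = A α)
    (hB : ∀ α, (B α).transpose = B α) (hW : W.transpose = W) (ρ : ℝ) (v : Fin 4 → ℝ)
    {F : FieldJet ℝ} (heps : F.eps = ε) (he : F.e = Efac P ε T₀) {y : ℝ} (hy : y = Omega P ε T₀ / T₀)
    (he1 : F.e1 = F.e * y) {H : M4 ℝ} {θ : ℝ} {u2 : Fin 3 → Fin 3 → ℝ}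
    (hN : ε • A 0 = F.N) (hN1 : ∀ k, ε • A (unitIdx k) = F.N1 k)
    (hB0 : ε • B 0 = F.B) (hB1 : ∀ k, ε • B (unitIdx k) = F.B1 k)
    (hS2 : ∀ k l, A (unitIdx k + unitIdx l) = F.S2 k l + Matrix.diagonal ![ε⁻¹ * u2 k l, 0, 0, 0])
    (hH : H * F.G P.Lam = 1) (hθ : 0 < θ) (hθ2 : θ ^ 2 = -(3 / P.Lam) * (F.G P.Lam).det)
    (h00 : F.G P.Lam 0 0 < 0)
    (hpd : ((F.G P.Lam).submatrix (Fin.succ : Fin 3 → Fin 4) Fin.succ).PosDef)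
    (hmom : ∀ i : Fin 3, jetEqn P.Lam T₀⁻¹ F H θ ρ (ε ^ 2 * P.K) v i.succ = 0)
    (hen : 1 / 2 * ∑ k : Fin 3, ∑ l : Fin 3, F.G P.Lam k.succ l.succ * (F.e ^ 3 * u2 k l)
      + ε * jetEqn P.Lam T₀⁻¹ F H θ ρ (ε ^ 2 * P.K) v 0 = 0)
    (hg0 : ε * F.B 0 0 = ε * ((2 * T₀⁻¹ - 3 * y) * F.N 0 0) - ∑ k, F.N1 k 0 k.succ
      + (2 * P.Lam / 3 * T₀⁻¹ - P.Lam * y) * F.e⁻¹ ^ 3 * (θ - F.e ^ 3))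
    (hgi : ∀ i : Fin 3, ε * F.B 0 i.succ = ε * ((2 * T₀⁻¹ - 3 * y) * F.N 0 i.succ)
      - ∑ k, F.N1 k i.succ k.succ)
    (hvel : θ * ∑ μ, ∑ ν, H μ ν * v μ * v ν + 1 = 0) :
    IsLorentz P T₀ ε (localField T₀ ε A B W) ∧
      GravConstraint P T₀ ε (localField T₀ ε A B W) ρ v ∧
      GaugeConstraint P T₀ ε (localField T₀ ε A B W) ∧
      VelNormalized P T₀ ε (localField T₀ ε A B W) v := by
  have hepos : 0 < F.e := by
    rw [he]; exact mul_pos (scaleFactor_pos P hL hK hr ht ht1 ε) ht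
  have hsym : ∀ (M : Mat4), M.transpose = M → ∀ i, M i 0 = M 0 i := fun M hM i => congrFun (congrFun hM 0) i
  have hNe : ∀ a c, F.N a c = ε * A 0 a c := fun a c => by rw [← hN]; rfl
  have hBe : ∀ a c, F.B a c = ε * B 0 a c := fun a c => by rw [← hB0]; rfl
  have hN1e : ∀ k a c, F.N1 k a c = ε * A (unitIdx k) a c := fun k a c => by rw [← hN1]; rfl
  refine constraints_of_jets P hL hK hr ht ht1 hε A B W hA hB hW ρ v (e := F.e) (e' := F.e1) he (by rw [he1, hy]; ring)
    (G := F.G P.Lam) (H := H) (D := F.D P.Lam)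
    (S := fun p k => F.S p k + secondJets 0 (fun k l => Matrix.diagonal ![F.e ^ 3 * (ε⁻¹ * u2 k l), 0, 0, 0]) p k)
    (θ := θ) ?_ ?_ ?_ ?_ hH ?_ hθ hθ2 h00 hpd ?_ ?_ ?_ hvel
  · rw [FieldJet.G, ← hN, heps]
    congr 1
    · rw [bgG]
      congr 1
      funext a
      refine Fin.cases ?_ (fun a => ?_) a
      · simp
      · fin_cases a <;> rfl
    · rw [smul_smul]; congr 1; ring
  · rw [FieldJet.D, Fin.cons_zero, ← hN, ← hB0, heps]
    congr 1
    · rw [bgD]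
      congr 1
      funext a
      refine Fin.cases ?_ (fun a => ?_) a
      · simp; ring
      · fin_cases a <;> rfl
    · simp only [smul_add, smul_smul]
      congr 2 <;> ring
  · intro k
    rw [FieldJet.D, Fin.cons_succ, ← hN1, smul_smul]; congr 1; ring
  · funext p k
    refine Fin.cases ?_ (fun p => ?_) p <;> refine Fin.cases ?_ (fun k => ?_) k
    · simp [FieldJet.S, secondJets]
    · simp only [FieldJet.S, secondJets, Fin.cases_zero, Fin.cases_succ, Pi.zero_apply, add_zero, ← hN1, ← hB1,
        smul_add, smul_smul]
      congr 2 <;> ring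
    · simp only [FieldJet.S, secondJets, Fin.cases_zero, Fin.cases_succ, Pi.zero_apply, add_zero, ← hN1, ← hB1,
        smul_add, smul_smul]
      congr 2 <;> ring
    · simp only [FieldJet.S, secondJets, Fin.cases_succ, hS2, smul_add]
      congr 1
      rw [← Matrix.diagonal_smul]
      congr 1
      funext a
      fin_cases a <;> simp
  · have h1 : 0 < θ ^ 2 := by positivity
    rw [hθ2] at h1
    have h2 : 0 < 3 / P.Lam := by positivity
    nlinarith
  · intro μ
    rw [jetSp_add, smul_add]
    have e1 : jetEin (F.G P.Lam) H (F.D P.Lam) 0 + ((1 / 2 : ℝ) • jetSp (F.G P.Lam) F.S + (1 / 2 : ℝ) •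
        jetSp (F.G P.Lam) (secondJets 0 (fun k l => Matrix.diagonal ![F.e ^ 3 * (ε⁻¹ * u2 k l), 0, 0, 0])))
        - jetStress T₀⁻¹ (ε ^ 2 * P.K) P.Lam (F.G P.Lam) H (F.D P.Lam) θ ρ v =
        (jetEin (F.G P.Lam) H (F.D P.Lam) 0 + (1 / 2 : ℝ) • jetSp (F.G P.Lam) F.S
        - jetStress T₀⁻¹ (ε ^ 2 * P.K) P.Lam (F.G P.Lam) H (F.D P.Lam) θ ρ v) + (1 / 2 : ℝ) •
        jetSp (F.G P.Lam) (secondJets 0 (fun k l => Matrix.diagonal ![F.e ^ 3 * (ε⁻¹ * u2 k l), 0, 0, 0])) := by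
      abel
    refine (congrFun (congrFun e1 0) μ).trans ?_
    rw [Matrix.add_apply, ← jetEqn_real, Matrix.smul_apply, jetSp_single]
    refine Fin.cases ?_ (fun i => ?_) μ
    · rw [if_pos rfl]
      have e2 : ∑ k : Fin 3, ∑ l : Fin 3, F.G P.Lam k.succ l.succ * (F.e ^ 3 * (ε⁻¹ * u2 k l)) =
          ε⁻¹ * ∑ k : Fin 3, ∑ l : Fin 3, F.G P.Lam k.succ l.succ * (F.e ^ 3 * u2 k l) := by
        simp only [Finset.mul_sum]
        exact Finset.sum_congr rfl fun k _ => Finset.sum_congr rfl fun l _ => by ring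
      rw [e2]
      -- After division by ε the hypothesis `hen` is exactly the sum of the regular part J and the
      -- contribution of the second derivatives of u^{00}.
      generalize jetEqn P.Lam T₀⁻¹ F H θ ρ (ε ^ 2 * P.K) v 0 = J at *
      generalize ∑ k : Fin 3, ∑ l : Fin 3, F.G P.Lam k.succ l.succ * (F.e ^ 3 * u2 k l) = X at *
      rw [smul_eq_mul]
      field_simp
      linarith
    · rw [hmom i, if_neg (Fin.succ_ne_zero i), smul_zero, add_zero]
  · have hs : ∑ k, F.N1 k 0 k.succ = ε * ∑ k, A (unitIdx k) 0 k.succ := by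
      rw [Finset.mul_sum]; exact Finset.sum_congr rfl fun k _ => hN1e _ _ _
    rw [hs, hNe, hBe] at hg0
    have hΩ : Omega P ε T₀ = y * T₀ := by rw [hy]; field_simp
    rw [hΩ, he1]
    generalize ∑ k, A (unitIdx k) 0 k.succ = X at *
    have h3 : F.e ^ 3 * F.e⁻¹ ^ 3 = 1 := by rw [← mul_pow, mul_inv_cancel₀ hepos.ne', one_pow]
    have hg : ε * (ε * (B 0 0 0)) * F.e ^ 3 = (ε * ((2 * T₀⁻¹ - 3 * y) * (ε * A 0 0 0)) - ε * X) * F.e ^ 3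
        + (2 * P.Lam / 3 * T₀⁻¹ - P.Lam * y) * (θ - F.e ^ 3) := by
      linear_combination F.e ^ 3 * hg0 + (2 * P.Lam / 3 * T₀⁻¹ - P.Lam * y) * (θ - F.e ^ 3) * h3
    field_simp at hg ⊢
    linear_combination hg
  · intro i
    have hs : ∑ k, F.N1 k i.succ k.succ = ε * ∑ k, A (unitIdx k) i.succ k.succ := by
      rw [Finset.mul_sum]; exact Finset.sum_congr rfl fun k _ => hN1e _ _ _
    have hgi := hgi i
    rw [hs, hNe, hBe] at hgi
    rw [hsym _ (hA 0), hsym _ (hB 0), he1]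
    generalize ∑ k, A (unitIdx k) i.succ k.succ = X at *
    have hg : ε * (ε * B 0 0 i.succ) * F.e ^ 3 = (ε * ((2 * T₀⁻¹ - 3 * y) * (ε * A 0 0 i.succ)) - ε * X) * F.e ^ 3 := by
      rw [hgi]
    field_simp at hg ⊢
    linear_combination F.e ^ 3 * hg

end RealJets

end

/-! ### Evaluation at points of the torus and sign conditions near the background. -/

section

open Filter Topology

variable {k : ℕ} [Fact (2 ≤ k)]

/-- Evaluation of a family at a parameter and a point of the torus. -/
def evx (q : ℝ × ParSp k × VSp k) (x : T3) : OA k →ₐ[ℝ] ℝ := (evalAlg x).comp (evalAn q)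

section

variable (q : ℝ × ParSp k × VSp k) (x : T3)

theorem evx_apply (a : OA k) : evx q x a = evalAlg x (evalAn q a) := rfl

theorem evalAlg_const (c : ℝ) : evalAlg x (algebraMap ℝ (Alg k) c) = c := AlgHom.commutes _ _

theorem evx_scal {f : ℝ → ℝ} (hf : AnalyticAt ℝ f 0) : evx q x (scal f hf) = f q.1 := evalAlg_const x _

theorem evx_eps : evx q x (epsEl _ _ _) = q.1 := evx_scal _ _ _

theorem evx_el {j : ℕ} (d : Hs j ℝ →L[ℝ] Alg k) (z : VSp k →L[ℝ] Hs j ℝ) :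
    evx q x (el d z) = evalAlg x (d (z q.2.2)) := rfl

theorem evx_par (A : ParSp k →L[ℝ] Alg k) : evx q x (par A) = evalAlg x (A q.2.1) := rfl

theorem evx_lin (A : VSp k →L[ℝ] Alg k) : evx q x (lin A) = evalAlg x (A q.2.2) := rfl

end

/-- Continuity in the norm of H^k at the origin becomes closeness uniform in x by the evaluation
bound. -/
theorem eventually_evx {a : OA k} {c : ℝ} (h : evalAn 0 a = algebraMap ℝ (Alg k) c) {δ : ℝ} (hδ : 0 < δ) :
    ∀ᶠ q in 𝓝 (0 : ℝ × ParSp k × VSp k), ∀ x, |evx q x a - c| < δ := by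
  obtain ⟨C, hC, hb⟩ := exists_evalAlg_bound (k := k)
  have hcont : ContinuousAt a.1 0 := AnalyticAt.continuousAt a.2
  have h1 : ∀ᶠ q in 𝓝 (0 : ℝ × ParSp k × VSp k), ‖a.1 q - a.1 0‖ < δ / C := by
    have := hcont.eventually (Metric.ball_mem_nhds (a.1 0) (show 0 < δ / C by positivity))
    filter_upwards [this] with q hq
    rwa [← dist_eq_norm]
  filter_upwards [h1] with q hq x
  have h2 : evx q x a - c = evalAlg x (a.1 q - a.1 0) := by
    have h3 : a.1 0 = algebraMap ℝ (Alg k) c := h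
    rw [map_sub, h3, evalAlg_const]
    rfl
  rw [h2]
  calc _ ≤ C * ‖a.1 q - a.1 0‖ := hb _ _
    _ < C * (δ / C) := by gcongr
    _ = δ := by field_simp

theorem inc_el (α : Fin 3 → ℕ) {j : ℕ} (h : k + 1 + ∑ i, α i ≤ j) (z : VSp k →L[ℝ] Hs j ℝ) :
    inc (el (dOp α h) z) = el (dOp (n := k) α (by omega)) z := anAlg_ext fun _ => algIncl_dOp _ _ _

theorem inc_el0 {j : ℕ} (h : k + 1 ≤ j) (z : VSp k →L[ℝ] Hs j ℝ) :
    inc (el (d0 h) z) = el (d0 (n := k) (by omega)) z := inc_el _ _ _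

theorem inc_el1 (i : Fin 3) {j : ℕ} (h : k + 1 + 1 ≤ j) (z : VSp k →L[ℝ] Hs j ℝ) :
    inc (el (d1 i h) z) = el (d1 (n := k) i (by omega)) z := inc_el _ _ _

theorem inc_scal {f : ℝ → ℝ} (hf : AnalyticAt ℝ f 0) : inc (scal f hf : OB k) = (scal f hf : OA k) :=
  mapHom_scal _ _ _

namespace Background

variable (b : Background)

theorem inc_vB (m : OB k) : inc (b.vB m) = scal _ b.hgauge * el (d0 (by omega)) zU
    - ∑ j, el (d1 j (by omega)) (zW j) + scal _ b.hgauge' * inc m := by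
  simp only [vB, map_add, map_sub, map_mul, map_sum, inc_scal, inc_el0, inc_el1]

theorem inc_cB (i : Fin 3) : inc (b.cB (k := k) i) =
    scal _ b.hgauge * (epsEl _ _ _ * el (d0 (by omega)) (zW i)) - ∑ j, el (d1 j (by omega)) (zA i j) := by
  simp only [cB, map_sub, map_mul, map_sum, inc_scal, inc_el0, inc_el1, inc_eps]

theorem evalAn_zero_G (m : OB k) (μ ν : Fin 4) : evalAn 0 ((b.FJ m).G b.Λ μ ν) = algebraMap ℝ (Alg k)
    ((Matrix.diagonal ![-(b.Λ / 3) * b.e 0 ^ 3, b.e 0, b.e 0, b.e 0] : Mat4) μ ν) := by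
  have h1 : ((b.FJ m).map (evalAn 0)).eps • ((b.FJ m).map (evalAn 0)).N = 0 := by
    have : ((b.FJ m).map (evalAn 0)).eps = 0 := map_zero (algebraMap ℝ (Alg k))
    rw [this, zero_smul]
  have h2 := congrFun (congrFun (FieldJet.G_bg (Λ := b.Λ) h1) μ) ν
  rw [FieldJet.G_map] at h2
  refine h2.trans ?_
  have h3 : ((b.FJ m).map (evalAn 0)).e = algebraMap ℝ (Alg k) (b.e 0) := rfl
  rw [h3, Algebra.smul_def, ← map_pow, ← map_mul]
  by_cases h : μ = ν
  · subst h
    rw [Matrix.diagonal_apply_eq, Matrix.diagonal_apply_eq]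
    fin_cases μ <;> rfl
  · rw [Matrix.diagonal_apply_ne _ h, Matrix.diagonal_apply_ne _ h, map_zero]

/-- The background of the given parameters at time `T₀`. -/
def ofParams (P : Params) {T₀ : ℝ} (hL : 0 < P.Lam) (hK : 0 ≤ P.K) (hr : 0 < P.rho1) (ht : 0 < T₀)
    (ht1 : T₀ ≤ 1) : Background where
  Λ := P.Lam
  τ := T₀⁻¹
  K := P.K
  e ε := Efac P ε T₀
  y ε := Omega P ε T₀ / T₀
  rH ε := rhoH P ε T₀
  Λ_pos := hL
  τ_pos := inv_pos.2 ht
  e_pos ε := mul_pos (scaleFactor_pos P hL hK hr ht ht1 ε) ht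
  rH_pos := rhoH_pos P hL hK hr ht ht1 0
  he := analyticAt_Efac P hL hK hr ht ht1 0
  hy := (analyticAt_Omega P hL hK hr ht ht1 0).div_const
  hrH := analyticAt_rhoH P hL hK hr ht ht1 0
  friedmann ε := by
    have h := NewtonCosmo.friedmann P hL hK hr ht ht1 ε
    field_simp at h ⊢
    linear_combination h

variable {b}

theorem IsSystem.FJ_G_symm {m : OB k} (q : ℝ × ParSp k × VSp k) (x : T3) :
    (((b.FJ m).map (evx q x)).G b.Λ).transpose = ((b.FJ m).map (evx q x)).G b.Λ := by
  have hN : ((b.FJ m).map (evx q x)).N.transpose = ((b.FJ m).map (evx q x)).N := by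
    simp only [FieldJet.map, FJ, N, symM_map]
    exact symM_transpose fun i j => by rw [zA_symm]
  rw [FieldJet.G, Matrix.transpose_add, Matrix.diagonal_transpose, Matrix.transpose_smul, hN]

/-- Sign conditions near the background. -/
theorem IsSystem.eventually_signs {s : ℝ} (hs : s ^ 2 = 1) {m : OB k} {θ : OA k} {H : M4 (OA k)} {v : Fin 4 → OA k}
    (h : b.IsSystem s m θ H v) : ∀ᶠ q in 𝓝 (0 : ℝ × ParSp k × VSp k), ∀ x, 0 < evx q x b.rho ∧
      0 < evx q x θ ∧ 0 < s * evx q x (v 0) ∧ ((b.FJ m).map (evx q x)).G b.Λ 0 0 < 0 ∧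
      ((((b.FJ m).map (evx q x)).G b.Λ).submatrix (Fin.succ : Fin 3 → Fin 4) Fin.succ).PosDef := by
  have he := b.e_pos 0
  have hΛ := b.Λ_pos
  have hsq : 0 < √(b.Λ / 3) := Real.sqrt_pos.2 (by positivity)
  have hG : ∀ᶠ q in 𝓝 (0 : ℝ × ParSp k × VSp k), ∀ i j : Fin 3, ∀ x,
      |evx q x ((b.FJ m).G b.Λ i.succ j.succ) - (if i = j then b.e 0 else 0)| < b.e 0 / 4 := by
    simp only [eventually_all]
    intro i j
    have h1 := eventually_evx (b.evalAn_zero_G m i.succ j.succ) (show 0 < b.e 0 / 4 by positivity)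
    filter_upwards [h1] with q hq x
    convert hq x using 3
    by_cases hij : i = j
    · subst hij
      rw [if_pos rfl, Matrix.diagonal_apply_eq]
      fin_cases i <;> rfl
    · rw [if_neg hij, Matrix.diagonal_apply_ne _ (fun h => hij (Fin.succ_injective _ h))]
  filter_upwards [eventually_evx b.evalAn_zero_rho b.rH_pos, eventually_evx h.theta_zero (pow_pos he 3),
    eventually_evx h.v_zero hsq,
    eventually_evx (b.evalAn_zero_G m 0 0) (show 0 < b.Λ / 3 * b.e 0 ^ 3 by positivity), hG] with q h1 h2 h3 h4 h5 x
  refine ⟨by linarith [(abs_lt.1 (h1 x)).1], by linarith [(abs_lt.1 (h2 x)).1], ?_, ?_, ?_⟩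
  · have e1 : s * evx q x (v 0) = s * (evx q x (v 0) - s * √(b.Λ / 3)) + s ^ 2 * √(b.Λ / 3) := by ring
    have hs1 : |s| = 1 := by rw [← sq_eq_sq₀ (abs_nonneg _) zero_le_one, sq_abs, hs, one_pow]
    have e2 : |s * (evx q x (v 0) - s * √(b.Λ / 3))| < √(b.Λ / 3) := by
      rw [abs_mul, hs1, one_mul]; exact h3 x
    rw [e1, hs]
    linarith [(abs_lt.1 e2).1]
  · rw [FieldJet.G_map, Matrix.map_apply]
    have := (abs_lt.1 (h4 x)).2
    simp at this
    linarith
  · refine posDef_of_close ?_ he fun i j => ?_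
    · rw [Matrix.transpose_submatrix, IsSystem.FJ_G_symm]
    · rw [FieldJet.G_map]
      exact h5 i j x

end Background

end

/-! ### The constraints at every point for solutions of the fixed point equation. -/

section

open Filter Topology

variable {k : ℕ} [Fact (2 ≤ k)]

namespace Background

variable {b : Background}

theorem evx_energy {m : OB k} {θ : OA k} {H : M4 (OA k)} {v : Fin 4 → OA k} {q : ℝ × ParSp k × VSp k}
    (hen : (1 / 2 * b.e q.1 ^ 4) • (∑ l, d2 (n := k) l l le_rfl (zU q.2.2))
      + evalAn q (epsEl _ _ _ * b.rem0 m θ H v)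
      - (b.Λ / 3 * b.τ ^ 2 * b.e q.1 ^ 6) • d0 (n := k) (by omega) (zRho q.2.2) = 0)
    (hρ : zRho q.2.2 = q.1 • incHs q.2.1) (x : T3) :
    1 / 2 * b.e q.1 ^ 4 * ∑ l, evalAlg x (d2 (n := k) l l le_rfl (zU q.2.2))
      + q.1 * (evx q x (b.eqn m θ H v 0)
      + 1 / 2 * (q.1 * (b.e q.1 ^ 6 * ∑ l, ∑ n, evalAlg x (d0 (n := k) (by omega) (zA l n q.2.2))
        * evalAlg x (d2 l n le_rfl (zU q.2.2))))) = 0 := by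
  have h1 := congrArg (evalAlg x) hen
  rw [map_sub, map_add, map_smul, map_smul, map_zero, hρ, map_smul, map_smul, map_sum, ← evx_apply, map_mul,
    evx_eps, rem0, map_add, map_add, map_smul, map_smul, map_mul, map_mul, map_mul, map_pow, evx_eps, evx_par,
    map_sum] at h1
  have hE : evx q x b.E = b.e q.1 := evx_scal _ _ _
  simp only [map_sum, map_mul, evx_el, smul_eq_mul, hE] at h1
  simp only [ContinuousLinearMap.comp_apply] at h1
  linear_combination h1

theorem evx_E (q : ℝ × ParSp k × VSp k) (x : T3) : evx q x b.E = b.e q.1 := evx_scal q x b.he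

theorem inc_eps_el0 {j : ℕ} (h : k + 1 ≤ j) (z : VSp k →L[ℝ] Hs j ℝ) :
    inc (epsEl (ParSp k) (VSp k) (Alg (k + 1)) * el (d0 h) z) = epsEl _ _ _ * el (d0 (n := k) (by omega)) z := by
  rw [map_mul, inc_eps, inc_el0]

theorem evx_N_succ (m : OB k) (q : ℝ × ParSp k × VSp k) (x : T3) (l n : Fin 3) :
    ((b.FJ m).map (evx q x)).N l.succ n.succ = q.1 * evalAlg x (d0 (n := k) (by omega) (zA l n q.2.2)) := by
  have h1 : ((b.FJ m).map (evx q x)).N l.succ n.succ =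
    evx q x (inc (epsEl (ParSp k) (VSp k) (Alg (k + 1)) * el (d0 (by omega)) (zA l n))) := rfl
  rw [h1, inc_eps_el0, map_mul, evx_eps, evx_el]

theorem evx_G_succ (m : OB k) (Λ : ℝ) (q : ℝ × ParSp k × VSp k) (x : T3) (l n : Fin 3) :
    ((b.FJ m).map (evx q x)).G Λ l.succ n.succ = (if l = n then b.e q.1 else 0)
      + q.1 * b.e q.1 ^ 3 * (q.1 * evalAlg x (d0 (n := k) (by omega) (zA l n q.2.2))) := by
  have h4 : ((b.FJ m).map (evx q x)).eps = q.1 := evx_eps q x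
  have hEe : ((b.FJ m).map (evx q x)).e = b.e q.1 := evx_E q x
  rw [FieldJet.G, Matrix.add_apply, Matrix.smul_apply, evx_N_succ, h4, hEe, smul_eq_mul]
  congr 1
  by_cases hln : l = n
  · subst hln; rw [Matrix.diagonal_apply_eq, if_pos rfl]; fin_cases l <;> rfl
  · rw [Matrix.diagonal_apply_ne _ (fun h => hln (Fin.succ_injective _ h)), if_neg hln]

/-- The second derivatives of u^{00} are contracted with the full spatial metric. Its background
part gives the Laplacian; the rest is the product that was included in `rem0`. -/
theorem energy_sum {e ε J : ℝ} {a u : Fin 3 → Fin 3 → ℝ} (h : 1 / 2 * e ^ 4 * ∑ l, u l l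
      + ε * (J + 1 / 2 * (ε * (e ^ 6 * ∑ l, ∑ n, a l n * u l n))) = 0) :
    1 / 2 * ∑ l, ∑ n, ((if l = n then e else 0) + ε * e ^ 3 * (ε * a l n)) * (e ^ 3 * u l n) + ε * J = 0 := by
  have h1 : ∀ l n : Fin 3, ((if l = n then e else 0) + ε * e ^ 3 * (ε * a l n)) * (e ^ 3 * u l n) =
      e ^ 4 * (if l = n then u l n else 0) + ε ^ 2 * e ^ 6 * (a l n * u l n) := fun l n => by
    split_ifs <;> ring
  simp only [h1, Finset.sum_add_distrib, ← Finset.mul_sum, Finset.sum_ite_eq, Finset.mem_univ, if_true]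
  linear_combination h

theorem evx_gauge_zero {m : OB k} {θ : OA k} {q : ℝ × ParSp k × VSp k}
    (hθ : evalAn q θ = evalAn q (b.E ^ 3 + epsEl _ _ _ * inc m)) (x : T3) :
    q.1 * ((b.FJ m).map (evx q x)).B 0 0 = q.1 * ((2 * b.τ - 3 * b.y q.1) * ((b.FJ m).map (evx q x)).N 0 0)
      - ∑ l : Fin 3, ((b.FJ m).map (evx q x)).N1 l 0 l.succ
      + (2 * b.Λ / 3 * b.τ - b.Λ * b.y q.1) * (b.e q.1)⁻¹ ^ 3 * (evx q x θ - b.e q.1 ^ 3) := by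
  have h1 : ((b.FJ m).map (evx q x)).B 0 0 = evx q x (inc (b.vB m)) := rfl
  have h2 : ((b.FJ m).map (evx q x)).N 0 0 = evx q x (inc (el (d0 (by omega)) zU)) := rfl
  have h3 : ∀ l : Fin 3, ((b.FJ m).map (evx q x)).N1 l 0 l.succ =
      evx q x (epsEl _ _ _ * el (d1 l (by omega)) (zW l)) := fun _ => rfl
  have h4 := congrArg (evalAlg x) hθ
  rw [← evx_apply, ← evx_apply, map_add, map_pow, map_mul, evx_eps, evx_E] at h4
  simp only [h1, h2, h3, h4, inc_vB, inc_el0, map_add, map_sub, map_mul, map_sum, evx_scal, evx_eps]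
  rw [← Finset.mul_sum]
  ring

theorem evx_gauge_succ (m : OB k) (q : ℝ × ParSp k × VSp k) (x : T3) (i : Fin 3) :
    q.1 * ((b.FJ m).map (evx q x)).B 0 i.succ =
      q.1 * ((2 * b.τ - 3 * b.y q.1) * ((b.FJ m).map (evx q x)).N 0 i.succ)
      - ∑ l : Fin 3, ((b.FJ m).map (evx q x)).N1 l i.succ l.succ := by
  have h1 : ((b.FJ m).map (evx q x)).B 0 i.succ = evx q x (inc (b.cB i)) := rfl
  have h2 : ((b.FJ m).map (evx q x)).N 0 i.succ =
    evx q x (inc (epsEl (ParSp k) (VSp k) (Alg (k + 1)) * el (d0 (by omega)) (zW i))) := rfl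
  have h3 : ∀ l : Fin 3, ((b.FJ m).map (evx q x)).N1 l i.succ l.succ =
      evx q x (epsEl _ _ _ * el (d1 l (by omega)) (zA i l)) := fun _ => rfl
  simp only [h1, h2, h3, inc_cB, inc_eps, inc_el0, map_sub, map_mul, map_sum, evx_scal, evx_eps]
  rw [← Finset.mul_sum]
  ring

theorem evx_inverse {G H : M4 (OA k)} {q : ℝ × ParSp k × VSp k}
    (h : H.map (evalAn q) * G.map (evalAn q) = 1) (x : T3) : H.map (evx q x) * G.map (evx q x) = 1 := by
  have h1 := congrArg (fun M : M4 (Alg k) => M.map (evalAlg x)) h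
  simp only [Matrix.map_mul] at h1
  refine h1.trans ?_
  ext i j
  by_cases hij : i = j
  · subst hij; simp
  · simp [Matrix.one_apply_ne hij]

variable (b) in
/-- The fields with jets given by `b.FJ m` at `(q, x)` solve the constraints. -/
def SolvesAt (P : Params) (T₀ s : ℝ) (m : OB k) (q : ℝ × ParSp k × VSp k) (x : T3) : Prop :=
  0 < evx q x b.rho ∧ ∃ vt, 0 < s * vt ∧ ∀ (A B : (Fin 3 → ℕ) → Mat4) (W : Mat4),
    (∀ α, (A α).transpose = A α) → (∀ α, (B α).transpose = B α) → W.transpose = W →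
    q.1 • A 0 = ((b.FJ m).map (evx q x)).N → (∀ l, q.1 • A (unitIdx l) = ((b.FJ m).map (evx q x)).N1 l) →
    q.1 • B 0 = ((b.FJ m).map (evx q x)).B → (∀ l, q.1 • B (unitIdx l) = ((b.FJ m).map (evx q x)).B1 l) →
    (∀ l n, A (unitIdx l + unitIdx n) = ((b.FJ m).map (evx q x)).S2 l n
      + Matrix.diagonal ![q.1⁻¹ * evalAlg x (d2 (n := k) l n le_rfl (zU q.2.2)), 0, 0, 0]) →
    ∀ vv : Fin 4 → ℝ, vv = Fin.cons vt (fun i => (evx q x b.rho)⁻¹ * evx q x (mom i)) →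
    IsLorentz P T₀ q.1 (localField T₀ q.1 A B W) ∧
    GravConstraint P T₀ q.1 (localField T₀ q.1 A B W) (evx q x b.rho) vv ∧
    GaugeConstraint P T₀ q.1 (localField T₀ q.1 A B W) ∧
    VelNormalized P T₀ q.1 (localField T₀ q.1 A B W) vv

/-- The constraints at almost every point, for a solution of the fixed point equation near the background. -/
theorem IsSystem.eventually_constraints (P : Params) {T₀ : ℝ} (hL : 0 < P.Lam) (hK : 0 ≤ P.K) (hr : 0 < P.rho1)
    (ht : 0 < T₀) (ht1 : T₀ ≤ 1) (hb : b = ofParams P hL hK hr ht ht1) {s : ℝ} (hs : s ^ 2 = 1) {m : OB k}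
    {θ : OA k} {H : M4 (OA k)} {v : Fin 4 → OA k} (h : b.IsSystem s m θ H v) :
    ∀ᶠ q in 𝓝 (0 : ℝ × ParSp k × VSp k), q.1 ≠ 0 → zRho q.2.2 = q.1 • incHs q.2.1 →
      (∀ i : Fin 3, evalAn q (b.eqn m θ H v i.succ) = 0) →
      ((1 / 2 * b.e q.1 ^ 4) • (∑ l, d2 (n := k) l l le_rfl (zU q.2.2))
        + evalAn q (epsEl _ _ _ * b.rem0 m θ H v)
        - (b.Λ / 3 * b.τ ^ 2 * b.e q.1 ^ 6) • d0 (n := k) (by omega) (zRho q.2.2) = 0) →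
      ∀ x, b.SolvesAt P T₀ s m q x := by
  filter_upwards [h.eventually_signs hs, h.inverse, h.theta_sq, h.theta_eq, h.normalized,
    (eventually_all.2 h.momentum)] with q hsig hinv hθ2 hθe hvel hmom hε hzρ hEi hE0 x
  obtain ⟨hρ, hθ, hv0, hG0, hpd⟩ := hsig x
  unfold SolvesAt
  refine ⟨hρ, evx q x (v 0), hv0, fun A B W hA hB hW hN hN1 hB0 hB1 hS2 vv hvv => ?_⟩
  -- The spatial velocity is recovered from the momentum density, since ρ does not vanish.
  have hvi : ∀ i : Fin 3, evx q x (v i.succ) = (evx q x b.rho)⁻¹ * evx q x (mom i) := fun i => by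
    have h1 := congrArg (evalAlg x) (hmom i)
    rw [← evx_apply, ← evx_apply, map_mul] at h1
    rw [← h1, inv_mul_cancel_left₀ hρ.ne']
  have hvv' : vv = fun μ => evx q x (v μ) := by
    rw [hvv]
    funext μ
    refine Fin.cases rfl (fun i => ?_) μ
    exact (hvi i).symm
  have hκ : evx q x b.kap = q.1 ^ 2 * P.K := by
    rw [kap, evx_scal, hb]; rfl
  have hjet : ∀ μ, jetEqn P.Lam T₀⁻¹ ((b.FJ m).map (evx q x)) (H.map (evx q x)) (evx q x θ) (evx q x b.rho)
      (q.1 ^ 2 * P.K) vv μ = evx q x (b.eqn m θ H v μ) := fun μ => by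
    rw [eqn, ← jetEqn_map, hvv', hκ, hb]
    rfl
  have hΛ : b.Λ = P.Lam := by rw [hb]; rfl
  have hτ : b.τ = T₀⁻¹ := by rw [hb]; rfl
  have hEe : ((b.FJ m).map (evx q x)).e = b.e q.1 := evx_scal q x b.he
  have hY : evx q x b.Y = b.y q.1 := evx_scal q x b.hy
  rw [hΛ] at hG0 hpd
  refine constraints_of_fieldJet P hL hK hr ht ht1 hε A B W hA hB hW (evx q x b.rho) vv
    (F := (b.FJ m).map (evx q x)) (y := b.y q.1) (H := H.map (evx q x)) (θ := evx q x θ)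
    (u2 := fun l n => evalAlg x (d2 (n := k) l n le_rfl (zU q.2.2))) (evx_eps q x) ?_ ?_ ?_ hN hN1 hB0 hB1 hS2
    ?_ hθ ?_ hG0 hpd ?_ ?_ ?_ ?_ ?_
  · rw [hEe, hb]; rfl
  · rw [hb]; rfl
  · rw [hEe, ← hY]
    change evx q x (b.E * b.Y) = _
    rw [map_mul]
    exact congrArg (· * evx q x b.Y) (evx_scal q x b.he)
  · rw [← hΛ, FieldJet.G_map]
    exact evx_inverse hinv x
  · have h1 := congrArg (evalAlg x) hθ2
    rw [map_pow, map_mul, evalAlg_const, ← evx_apply, ← evx_apply] at h1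
    rw [h1, ← hΛ, FieldJet.G_map]
    congr 1
    rw [AlgHom.map_det, AlgHom.mapMatrix_apply]
  · intro i
    rw [hjet, evx_apply, hEi i, map_zero]
  · rw [hjet, hEe]
    simp only [evx_G_succ]
    exact energy_sum (evx_energy hE0 hzρ x)
  · have h1 := evx_gauge_zero hθe x
    rwa [hΛ, hτ, ← hEe] at h1
  · intro i
    have h1 := evx_gauge_succ (b := b) m q x i
    rwa [hτ] at h1
  · have h1 := congrArg (evalAlg x) hvel
    rw [map_add, map_one, map_zero, ← evx_apply, map_mul, map_sum] at h1
    simp only [map_sum, map_mul] at h1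
    rw [hvv']
    exact h1

end Background

end

/-! ### Existence of the solution operator. -/

section

open Filter Topology

variable {k : ℕ} [Fact (2 ≤ k)]

namespace Background

/-- The point of the parameter space determined by data and the solution family `Y`. -/
def solPt (Y : ℝ × ParSp k × DatSp k → DatSp k →L[ℝ] UnkSp k) (p : ℝ × ParSp k × DatSp k) :
    ℝ × ParSp k × VSp k := (p.1, p.2.1, (p.2.2, Y p p.2.2))

theorem tendsto_solPt {Y : ℝ × ParSp k × DatSp k → DatSp k →L[ℝ] UnkSp k} (hY : AnalyticAt ℝ Y 0) :
    Tendsto (solPt Y) (𝓝 0) (𝓝 0) := by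
  have h1 : ContinuousAt (fun p : ℝ × ParSp k × DatSp k => Y p p.2.2) 0 :=
    (analyticAt_clm_apply hY (analyticAt_snd.fun_comp analyticAt_snd)).continuousAt
  have h2 : ContinuousAt (solPt Y) 0 := continuousAt_fst.prodMk
    ((continuousAt_fst.comp continuousAt_snd).prodMk ((continuousAt_snd.comp continuousAt_snd).prodMk h1))
  have h3 : solPt Y 0 = 0 := by
    simp only [solPt, Prod.fst_zero, Prod.snd_zero, map_zero]
    rfl
  have h4 := h2.tendsto
  rwa [h3] at h4

/-- The nonlinear rows lie in the ideal of negligible terms, so they have the form S(q)(ε,ζ)ζ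
required by the implicit function theorem for operators. -/
theorem exists_solution (P : Params) {T₀ : ℝ} (hL : 0 < P.Lam) (hK : 0 ≤ P.K) (hr : 0 < P.rho1)
    (ht : 0 < T₀) (ht1 : T₀ ≤ 1) {s : ℝ} (hs : s ^ 2 = 1) (b : Background)
    (hb : b = ofParams P hL hK hr ht ht1) :
    ∃ (v : ℝ) (m : OB k) (Y : ℝ × ParSp k × DatSp k → DatSp k →L[ℝ] UnkSp k)
      (S : ℝ × ParSp k × VSp k → (ℝ × VSp k) →L[ℝ] VSp k →L[ℝ] UnkSp k),
      m ∈ idealZ (ParSp k) (VSp k) (Alg (k + 1)) ∧ AnalyticAt ℝ Y 0 ∧ AnalyticAt ℝ S 0 ∧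
      ∀ᶠ p in 𝓝 (0 : ℝ × ParSp k × DatSp k),
        (∀ z, Y p z = b.rowL k v p.1 (z, Y p z) + S (solPt Y p) (p.1, (solPt Y p).2.2) (z, Y p z)) ∧
        (p.1 ≠ 0 → zRho (solPt Y p).2.2 = p.1 • incHs p.2.1 → ∀ x, b.SolvesAt P T₀ s m (solPt Y p) x) := by
  obtain ⟨m, θ, H, v, h⟩ := b.exists_system (k := k) hs
  have hΛ := b.Λ_pos
  have hv : s * √(b.Λ / 3) ≠ 0 := by
    refine mul_ne_zero ?_ (Real.sqrt_pos.2 (by positivity)).ne'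
    rintro rfl
    norm_num at hs
  obtain ⟨S, hS, hSe⟩ := b.isI_rowR (s * √(b.Λ / 3)) (b.rem0_mem h) h.momentum_mem
  obtain ⟨Y, hY, hYe⟩ := exists_implicit (b.analyticAt_rowL (k := k) (s * √(b.Λ / 3))) hS
    (b.rowL_nilpotent (s * √(b.Λ / 3)))
  refine ⟨s * √(b.Λ / 3), m, Y, S, h.m_mem, hY, hS, ?_⟩
  have hT := tendsto_solPt hY
  filter_upwards [hYe, hT.eventually hSe, hT.eventually (h.eventually_constraints P hL hK hr ht ht1 hb hs)]
    with p h1 h2 h3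
  refine ⟨h1, fun hε hρ => ?_⟩
  -- The operator equation holds for every argument; with the argument equal to the data part of ζ
  -- it is the fixed point equation itself.
  have hrow : (solPt Y p).2.2.2 = b.rowL k (s * √(b.Λ / 3)) (solPt Y p).1 (solPt Y p).2.2 +
      b.rowR (s * √(b.Λ / 3)) (b.rem0 m θ H v)
        (fun i => b.eqn m θ H v i.succ) (solPt Y p) := by
    rw [h2]
    exact h1 p.2.2
  have hm := b.momentum_of_row hv hrow
  have he := b.energy_of_row hrow
  exact h3 hε hρ hm he

end Background

end

section

open Filter Topology

/-! ### Families that are linear in the data with analytic bounded coefficients. -/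

section Families

variable {E F F' : Type*} [NormedAddCommGroup E] [NormedSpace ℝ E] [NormedAddCommGroup F] [NormedSpace ℝ F]
  [NormedAddCommGroup F'] [NormedSpace ℝ F'] {D : Set (ℝ × E)}

/-- Analytic and bounded maps on `D`. -/
def AnBdd (D : Set (ℝ × E)) (f : ℝ × E → F) : Prop :=
  AnalyticOnNhd ℝ f D ∧ ∃ C, ∀ q ∈ D, ‖f q‖ ≤ C

/-- Maps of the form `(ε, d) ↦ T(ε, d) d` with `T` analytic and bounded on `D`. -/
def IsLinFam (D : Set (ℝ × E)) (f : ℝ × E → F) : Prop :=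
  ∃ T : ℝ × E → E →L[ℝ] F, AnBdd D T ∧ ∀ q, f q = T q q.2

theorem anBdd_const (c : F) : AnBdd D (fun _ => c) := ⟨fun _ _ => analyticAt_const, ‖c‖, fun _ _ => le_rfl⟩

theorem IsLinFam.analyticOnNhd {f : ℝ × E → F} (h : IsLinFam D f) : AnalyticOnNhd ℝ f D := by
  obtain ⟨T, ⟨hT, -⟩, h1⟩ := h
  rw [funext h1]
  exact fun q hq => analyticAt_clm_apply (hT q hq) analyticAt_snd

theorem IsLinFam.apply_zero {f : ℝ × E → F} (h : IsLinFam D f) (ε : ℝ) : f (ε, 0) = 0 := by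
  obtain ⟨T, -, h1⟩ := h
  rw [h1, map_zero]

theorem IsLinFam.bound {f : ℝ × E → F} (h : IsLinFam D f) : ∃ C, ∀ q ∈ D, ‖f q‖ ≤ C * ‖q.2‖ := by
  obtain ⟨T, ⟨-, C, hC⟩, h1⟩ := h
  refine ⟨C, fun q hq => ?_⟩
  rw [h1]
  exact (T q).le_of_opNorm_le (hC q hq) _

theorem IsLinFam.anBdd {f : ℝ × E → F} (h : IsLinFam D f) {M : ℝ} (hM : ∀ q ∈ D, ‖q.2‖ ≤ M) : AnBdd D f := by
  refine ⟨h.analyticOnNhd, ?_⟩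
  obtain ⟨C, hC⟩ := h.bound
  refine ⟨|C| * M, fun q hq => (hC q hq).trans ?_⟩
  exact mul_le_mul (le_abs_self C) (hM q hq) (norm_nonneg _) (abs_nonneg C)

theorem AnBdd.isLinFam {A : ℝ × E → F →L[ℝ] F'} (hA : AnBdd D A) {f : ℝ × E → F} (hf : IsLinFam D f) :
    IsLinFam D (fun q => A q (f q)) := by
  obtain ⟨T, ⟨hT, C, hC⟩, h1⟩ := hf
  obtain ⟨hA1, C', hC'⟩ := hA
  refine ⟨fun q => (A q).comp (T q), ⟨fun q hq => analyticAt_clm_comp (hA1 q hq) (hT q hq), C' * C,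
    fun q hq => ((A q).opNorm_comp_le _).trans ?_⟩, fun q => ?_⟩
  · exact mul_le_mul (hC' q hq) (hC q hq) (norm_nonneg _) ((norm_nonneg _).trans (hC' q hq))
  · beta_reduce
    rw [h1]
    rfl

theorem IsLinFam.clm {f : ℝ × E → F} (hf : IsLinFam D f) (A : F →L[ℝ] F') : IsLinFam D (fun q => A (f q)) :=
  (anBdd_const A).isLinFam hf

theorem IsLinFam.fst_smul {f : ℝ × E → F} (hf : IsLinFam D f) {M : ℝ} (hM : ∀ q ∈ D, |q.1| ≤ M) :
    IsLinFam D (fun q => q.1 • f q) := by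
  have h : AnBdd D (fun q : ℝ × E => q.1 • ContinuousLinearMap.id ℝ F) := by
    refine ⟨fun q _ => analyticAt_fst.fun_smul analyticAt_const, M, fun q hq => ?_⟩
    rw [norm_smul]
    refine (mul_le_mul_of_nonneg_left ContinuousLinearMap.norm_id_le (norm_nonneg _)).trans ?_
    rw [mul_one]
    exact hM q hq
  exact h.isLinFam hf

theorem isLinFam_snd (A : E →L[ℝ] F) : IsLinFam D (fun q => A q.2) := ⟨fun _ => A, anBdd_const A, fun _ => rfl⟩

theorem IsLinFam.add {f g : ℝ × E → F} (hf : IsLinFam D f) (hg : IsLinFam D g) :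
    IsLinFam D (fun q => f q + g q) := by
  obtain ⟨T, ⟨hT, C, hC⟩, h1⟩ := hf
  obtain ⟨T', ⟨hT', C', hC'⟩, h2⟩ := hg
  refine ⟨fun q => T q + T' q, ⟨fun q hq => (hT q hq).add (hT' q hq), C + C',
    fun q hq => (norm_add_le _ _).trans (add_le_add (hC q hq) (hC' q hq))⟩, fun q => ?_⟩
  beta_reduce
  rw [h1, h2]
  rfl

theorem IsLinFam.prodMk {f : ℝ × E → F} {g : ℝ × E → F'} (hf : IsLinFam D f) (hg : IsLinFam D g) :
    IsLinFam D (fun q => (f q, g q)) := by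
  have h := (hf.clm (ContinuousLinearMap.inl ℝ F F')).add (hg.clm (ContinuousLinearMap.inr ℝ F F'))
  simpa using h

theorem AnBdd.one_prod_apply {G : Type*} [NormedAddCommGroup G] [NormedSpace ℝ G] {A : ℝ × E → (ℝ × F) →L[ℝ] G}
    (hA : AnBdd D A) {f : ℝ × E → F} (hf : AnBdd D f) : AnBdd D (fun q => A q (1, f q)) := by
  obtain ⟨hA1, C, hC⟩ := hA
  obtain ⟨hf1, C', hC'⟩ := hf
  refine ⟨fun q hq => analyticAt_clm_apply (hA1 q hq) (analyticAt_const.prod (hf1 q hq)), C * max 1 C', fun q hq => ?_⟩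
  refine (A q).le_of_opNorm_le_of_le (hC q hq) ?_
  rw [Prod.norm_def, norm_one]
  exact max_le_max le_rfl (hC' q hq)

theorem eventually_analyticAt_norm_le [CompleteSpace F] {f : E → F} {x : E} (hf : AnalyticAt ℝ f x) :
    ∀ᶠ y in 𝓝 x, AnalyticAt ℝ f y ∧ ‖f y‖ ≤ ‖f x‖ + 1 := by
  have h1 : ∀ᶠ y in 𝓝 x, ‖f y‖ < ‖f x‖ + 1 := hf.continuousAt.norm.eventually_lt_const (lt_add_one _)
  filter_upwards [hf.eventually_analyticAt, h1] with y a c using ⟨a, c.le⟩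

/-- This homogeneity extracts the factor ε from the remainder and produces the analytic coefficient
of ε in the expansions. -/
theorem apply_fst_smul (A : (ℝ × F) →L[ℝ] F') (ε : ℝ) (w : F) : A (ε, ε • w) = ε • A (1, w) := by
  rw [← map_smul, Prod.smul_mk, smul_eq_mul, mul_one]

theorem completeSpace_clm [CompleteSpace F] : CompleteSpace (E →L[ℝ] F) := inferInstance

end Families

variable {k : ℕ} [Fact (2 ≤ k)]

namespace Background

instance : CompleteSpace (UnkSp k) := inferInstance

instance : CompleteSpace (DatSp k →L[ℝ] UnkSp k) := completeSpace_clm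

instance : CompleteSpace ((ℝ × VSp k) →L[ℝ] VSp k →L[ℝ] UnkSp k) :=
  @completeSpace_clm _ _ _ _ _ _ completeSpace_clm

variable {E : Type*} [NormedAddCommGroup E] [NormedSpace ℝ E]

/-- The parameters of the fixed point equation determined by `ε` and the free data. -/
def dataPt (π : E →L[ℝ] ParSp k) (Z : E →L[ℝ] DatSp k) (q : ℝ × E) : ℝ × ParSp k × DatSp k :=
  (q.1, π q.2, q.1 • Z q.2)

theorem analyticAt_dataPt (π : E →L[ℝ] ParSp k) (Z : E →L[ℝ] DatSp k) (q : ℝ × E) :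
    AnalyticAt ℝ (dataPt π Z) q :=
  analyticAt_fst.prod ((analyticAt_clm π analyticAt_snd).prod
    (analyticAt_fst.fun_smul (analyticAt_clm Z analyticAt_snd)))

theorem analyticAt_solPt {Y : ℝ × ParSp k × DatSp k → DatSp k →L[ℝ] UnkSp k} {p : ℝ × ParSp k × DatSp k}
    (hY : AnalyticAt ℝ Y p) : AnalyticAt ℝ (solPt Y) p :=
  analyticAt_fst.prod ((analyticAt_fst.fun_comp analyticAt_snd).prod
    ((analyticAt_snd.fun_comp analyticAt_snd).prod
      (analyticAt_clm_apply hY (analyticAt_snd.fun_comp analyticAt_snd))))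

theorem anBdd_comp_dataPt {W : Type*} [NormedAddCommGroup W] [NormedSpace ℝ W] {D : Set (ℝ × E)}
    {π : E →L[ℝ] ParSp k} {Z : E →L[ℝ] DatSp k} {Y : ℝ × ParSp k × DatSp k → W} {C : ℝ}
    (h : ∀ q ∈ D, AnalyticAt ℝ Y (dataPt π Z q) ∧ ‖Y (dataPt π Z q)‖ ≤ C) :
    AnBdd D (fun q => Y (dataPt π Z q)) :=
  ⟨fun q hq => AnalyticAt.fun_comp (h q hq).1 (analyticAt_dataPt π Z q), C, fun q hq => (h q hq).2⟩

/-- Analytic families near the background, along a family of solutions. -/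
theorem eventually_comp_solPt {W : Type*} [NormedAddCommGroup W] [NormedSpace ℝ W] [CompleteSpace W]
    {Y : ℝ × ParSp k × DatSp k → DatSp k →L[ℝ] UnkSp k} (hY : AnalyticAt ℝ Y 0)
    {T : ℝ × ParSp k × VSp k → W} (hT : AnalyticAt ℝ T 0) :
    ∀ᶠ p in 𝓝 0, AnalyticAt ℝ (fun p => T (solPt Y p)) p ∧ ‖T (solPt Y p)‖ ≤ ‖T 0‖ + 1 := by
  filter_upwards [hY.eventually_analyticAt, (tendsto_solPt hY).eventually (eventually_analyticAt_norm_le hT)]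
    with p h1 h2 using ⟨AnalyticAt.fun_comp h2.1 (analyticAt_solPt h1), h2.2⟩

theorem eventually_idealZ {𝔸 : Type*} [NormedCommRing 𝔸] [NormedAlgebra ℝ 𝔸] [CompleteSpace 𝔸]
    {Y : ℝ × ParSp k × DatSp k → DatSp k →L[ℝ] UnkSp k} (hY : AnalyticAt ℝ Y 0)
    {f : AnAlg (ParSp k) (VSp k) 𝔸} (hf : f ∈ idealZ (ParSp k) (VSp k) 𝔸) :
    ∃ (T : ℝ × ParSp k × DatSp k → VSp k →L[ℝ] 𝔸) (C : ℝ), ∀ᶠ p in 𝓝 0, (AnalyticAt ℝ T p ∧ ‖T p‖ ≤ C) ∧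
      evalAn (solPt Y p) f = T p (solPt Y p).2.2 := by
  obtain ⟨T, hT, h1⟩ := hf
  have hc : CompleteSpace (VSp k →L[ℝ] 𝔸) := completeSpace_clm
  refine ⟨fun p => T (solPt Y p), ‖T 0‖ + 1, ?_⟩
  filter_upwards [eventually_comp_solPt hY hT, (tendsto_solPt hY).eventually h1] with p a c using ⟨a, c⟩

/-- The solution of the constraints as a family in the free data. -/
theorem exists_solution_families (P : Params) {T₀ : ℝ} (hL : 0 < P.Lam) (hK : 0 ≤ P.K) (hr : 0 < P.rho1)
    (ht : 0 < T₀) (ht1 : T₀ ≤ 1) {s : ℝ} (hs : s ^ 2 = 1) (b : Background)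
    (hb : b = ofParams P hL hK hr ht ht1) (π : E →L[ℝ] ParSp k) (Z : E →L[ℝ] DatSp k)
    (hπ : ∀ d (ε : ℝ) (X : UnkSp k), zRho ((ε • Z d, X) : VSp k) = ε • incHs (π d)) :
    ∃ (v : ℝ) (m : OB k) (δ : ℝ), 0 < δ ∧ ∀ D : Set (ℝ × E), (∃ M, ∀ q ∈ D, ‖q.2‖ ≤ M) →
      (∀ q ∈ D, |q.1| < δ ∧ ‖π q.2‖ < δ ∧ ‖q.1 • Z q.2‖ < δ) →
      ∃ (X g : ℝ × E → UnkSp k) (tv : ℝ × E → Alg (k + 1)) (tc : Fin 3 → ℝ × E → Alg (k + 1)),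
        IsLinFam D X ∧ IsLinFam D g ∧ IsLinFam D tv ∧ (∀ i, IsLinFam D (tc i)) ∧
        ∀ q ∈ D, X q = b.rowL k v q.1 (Z q.2, X q) + q.1 • g q ∧
          evalAn (q.1, π q.2, q.1 • (Z q.2, X q)) (b.vB m) = q.1 • tv q ∧
          (∀ i, evalAn (q.1, π q.2, q.1 • (Z q.2, X q)) (b.cB i) = q.1 • tc i q) ∧
          (q.1 ≠ 0 → ∀ x, b.SolvesAt P T₀ s m (q.1, π q.2, q.1 • (Z q.2, X q)) x) := by
  obtain ⟨v, m, Y, S, hm, hY, hS, hsol⟩ := exists_solution (k := k) P hL hK hr ht ht1 hs b hb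
  obtain ⟨Tv, Cv, hTv⟩ := eventually_idealZ hY (b.vB_mem hm)
  choose Tc Cc hTc using fun i => eventually_idealZ hY (b.cB_mem (k := k) i)
  have hev := hsol.and ((eventually_analyticAt_norm_le hY).and ((eventually_comp_solPt hY hS).and
    (hTv.and (eventually_all.2 hTc))))
  obtain ⟨δ, hδ, hball⟩ := Metric.eventually_nhds_iff.1 hev
  refine ⟨v, m, δ, hδ, fun D ⟨M, hM⟩ hD => ?_⟩
  -- One radius δ makes all statements near the origin valid at the points (ε, ρ̆₀, εz).
  have hp : ∀ q ∈ D, _ := fun q hq => hball (y := dataPt π Z q) (by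
    rw [dist_zero_right, dataPt, Prod.norm_def, Prod.norm_def]
    obtain ⟨h1, h2, h3⟩ := hD q hq
    exact max_lt h1 (max_lt h2 h3))
  have hX : IsLinFam D (fun q => Y (dataPt π Z q) (Z q.2)) :=
    (anBdd_comp_dataPt fun q hq => (hp q hq).2.1).isLinFam (isLinFam_snd Z)
  have hV : IsLinFam D (fun q => (Z q.2, Y (dataPt π Z q) (Z q.2))) := (isLinFam_snd Z).prodMk hX
  have hS' := anBdd_comp_dataPt (Y := fun p => S (solPt Y p)) fun q hq => (hp q hq).2.2.1
  -- By linearity of Y, the solution for the data εz is ε times the solution for z.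
  have hQ : ∀ q, solPt Y (dataPt π Z q) = (q.1, π q.2, q.1 • (Z q.2, Y (dataPt π Z q) (Z q.2))) := fun q => by
    rw [solPt, dataPt, map_smul]
    rfl
  -- The family g is S applied to (1, (z, x)) and then to (z, x). The time derivatives are given by
  -- the coefficient operators of elements of the first ideal, applied to (z, x) instead of ε(z, x).
  refine ⟨_, _, _, fun i => _, hX, (hS'.one_prod_apply (hV.anBdd hM)).isLinFam hV,
    (anBdd_comp_dataPt fun q hq => (hp q hq).2.2.2.1.1).isLinFam hV,
    fun i => (anBdd_comp_dataPt fun q hq => ((hp q hq).2.2.2.2 i).1).isLinFam hV, fun q hq => ?_⟩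
  obtain ⟨⟨h1, h2⟩, -, -, h4, h5⟩ := hp q hq
  refine ⟨?_, ?_, fun i => ?_, fun hε => ?_⟩
  · refine (h1 (Z q.2)).trans ?_
    rw [hQ]
    exact congrArg (b.rowL k v q.1 (Z q.2, Y (dataPt π Z q) (Z q.2)) + ·)
      (congrArg (fun A : VSp k →L[ℝ] UnkSp k => A (Z q.2, Y (dataPt π Z q) (Z q.2))) (apply_fst_smul _ q.1 _))
  · have h6 := h4.2
    rw [hQ] at h6
    exact h6.trans (map_smul _ _ _)
  · have h6 := (h5 i).2
    rw [hQ] at h6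
    exact h6.trans (map_smul _ _ _)
  · rw [← hQ]
    exact h2 hε (by rw [hQ]; exact hπ _ _ _)

end Background

end

section

open Filter Topology

/-! ### Components of vector and matrix valued Sobolev functions and their jets almost everywhere.
-/

section Components

variable {j : ℕ} {V : Type*} [NormedAddCommGroup V] [InnerProductSpace ℝ V]

theorem weakD_add (u v : Hs j V) (α : Fin 3 → ℕ) :
    weakD (u + v) α =ᵐ[torusMeasure] fun x => weakD u α x + weakD v α x := by
  by_cases hα : α ∈ multiIdx j
  · rw [weakD_of_mem _ hα, weakD_of_mem _ hα, weakD_of_mem _ hα]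
    exact Lp.coeFn_add _ _
  · simp only [weakD, hα, dif_neg, not_false_eq_true, Pi.zero_apply, add_zero]
    rfl

theorem weakD_smul (c : ℝ) (u : Hs j V) (α : Fin 3 → ℕ) :
    weakD (c • u) α =ᵐ[torusMeasure] fun x => c • weakD u α x := by
  by_cases hα : α ∈ multiIdx j
  · rw [weakD_of_mem _ hα, weakD_of_mem _ hα]
    exact Lp.coeFn_smul _ _
  · simp only [weakD, hα, dif_neg, not_false_eq_true, Pi.zero_apply, smul_zero]
    rfl

instance : CompleteSpace Sym3 := inferInstanceAs (CompleteSpace symSubmodule)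

/-- The entries of symmetric matrices. -/
def symCoord (i l : Fin 3) : Sym3 →L[ℝ] ℝ :=
  (EuclideanSpace.proj (𝕜 := ℝ) (i, l) : EuclideanSpace ℝ (Fin 3 × Fin 3) →L[ℝ] ℝ) ∘L symSubmodule.subtypeL

theorem symCoord_comm (i l : Fin 3) : symCoord i l = symCoord l i :=
  ContinuousLinearMap.ext fun c => c.2 i l

/-- The coordinates of vectors. -/
def coord (i : Fin 3) : R3 →L[ℝ] ℝ := EuclideanSpace.proj i

theorem weakD_coord (u : Hs j R3) (α : Fin 3 → ℕ) :
    ∀ᵐ x ∂torusMeasure, ∀ i, weakD (mapHs (coord i) j u) α x = weakD u α x i :=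
  eventually_all.2 fun i => weakD_mapHs (coord i) u α

/-- The inclusion of a coordinate axis. -/
def axis (i : Fin 3) : ℝ →L[ℝ] R3 := ContinuousLinearMap.toSpanSingleton ℝ (EuclideanSpace.single i (1 : ℝ))

theorem sum_axis_apply (c : Fin 3 → ℝ) (i : Fin 3) : (∑ l, axis l (c l)) i = c i := by
  simp [axis, Fin.sum_univ_three, PiLp.add_apply]
  fin_cases i <;> simp

/-- The vector field with given components. -/
def packHs (j : ℕ) : (Fin 3 → Hs j ℝ) →L[ℝ] Hs j R3 :=
  ∑ i, mapHs (axis i) j ∘L ContinuousLinearMap.proj i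

def packBar (j : ℕ) : (Fin 3 → HsBar j ℝ) →L[ℝ] HsBar j R3 :=
  ∑ i, mapHsBar (axis i) j ∘L ContinuousLinearMap.proj i

theorem packBar_val (w : Fin 3 → HsBar j ℝ) : (packBar j w).1 = packHs j (fun i => (w i).1) := by
  simp only [packBar, packHs, Fin.sum_univ_three]
  rfl

theorem weakD_packHs (w : Fin 3 → Hs j ℝ) (α : Fin 3 → ℕ) :
    ∀ᵐ x ∂torusMeasure, ∀ i, weakD (packHs j w) α x i = weakD (w i) α x := by
  have e : packHs j w = mapHs (axis 0) j (w 0) + mapHs (axis 1) j (w 1) + mapHs (axis 2) j (w 2) := by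
    simp only [packHs, Fin.sum_univ_three]
    rfl
  filter_upwards [weakD_add (mapHs (axis 0) j (w 0) + mapHs (axis 1) j (w 1)) (mapHs (axis 2) j (w 2)) α,
    weakD_add (mapHs (axis 0) j (w 0)) (mapHs (axis 1) j (w 1)) α, weakD_mapHs (axis 0) (w 0) α,
    weakD_mapHs (axis 1) (w 1) α, weakD_mapHs (axis 2) (w 2) α] with x h1 h2 h3 h4 h5 i
  rw [e, h1, h2, h3, h4, h5, ← sum_axis_apply (fun i => weakD (w i) α x) i, Fin.sum_univ_three]

end Components

section Symbols

theorem symMat_eq (a : ℝ) (b : R3) (c : Sym3) : symMat a b c = symM a b fun i j => c.1 (i, j) := by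
  ext μ ν
  refine Fin.cases ?_ (fun i => ?_) μ <;> refine Fin.cases ?_ (fun j => ?_) ν <;> rfl

theorem symMat_transpose (a : ℝ) (b : R3) (c : Sym3) : (symMat a b c).transpose = symMat a b c := by
  rw [symMat_eq]
  exact symM_transpose c.2

theorem smul_symM (ε a : ℝ) (b : Fin 3 → ℝ) (c : Fin 3 → Fin 3 → ℝ) :
    ε • symM a b c = symM (ε * a) (fun i => ε * b i) fun i j => ε * c i j := by
  ext μ ν
  refine Fin.cases ?_ (fun i => ?_) μ <;> refine Fin.cases ?_ (fun j => ?_) ν <;> rfl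

theorem symM_add (a a' : ℝ) (b b' : Fin 3 → ℝ) (c c' : Fin 3 → Fin 3 → ℝ) :
    symM a b c + symM a' b' c' = symM (a + a') (b + b') (c + c') := by
  ext μ ν
  refine Fin.cases ?_ (fun i => ?_) μ <;> refine Fin.cases ?_ (fun j => ?_) ν <;> rfl

end Symbols

variable {k : ℕ} [Fact (2 ≤ k)]

theorem ae_jet_one {j : ℕ} (h : k + 1 ≤ j) (u : Hs j ℝ) : ∀ᵐ x ∂torusMeasure,
    weakD u 0 x = evalAlg x (d0 (n := k) (by omega) u) ∧
    ∀ l, weakD u (unitIdx l) x = evalAlg x (d1 (n := k) l h u) := by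
  filter_upwards [weakD_dOp (n := k) 0 (by simp; omega) u,
    eventually_all.2 fun l => weakD_dOp (n := k) (unitIdx l) (by rw [sum_unitIdx]; exact h) u] with x h1 h2 using ⟨h1, h2⟩

theorem ae_jet_two {j : ℕ} (h : k + 2 ≤ j) (u : Hs j ℝ) : ∀ᵐ x ∂torusMeasure,
    ∀ l n, weakD u (unitIdx l + unitIdx n) x = evalAlg x (d2 (n := k) l n h u) :=
  eventually_all.2 fun l => eventually_all.2 fun n => weakD_dOp (n := k) (unitIdx l + unitIdx n) _ u

namespace Background

variable {b : Background} (m : OB k) (q : ℝ × ParSp k × VSp k) (x : T3)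

theorem evx_inc (f : OB k) : evx q x (inc f) = evalAlg x (algIncl (evalAn q f)) := rfl

theorem map_FJ_N : ((b.FJ m).map (evx q x)).N = symM (evalAlg x (d0 (n := k) (by omega) (zU q.2.2)))
    (fun i => q.1 * evalAlg x (d0 (n := k) (by omega) (zW i q.2.2)))
    fun i j => q.1 * evalAlg x (d0 (n := k) (by omega) (zA i j q.2.2)) := by
  have h1 : ((b.FJ m).map (evx q x)).N = ((N (k := k)).map inc).map (evx q x) := rfl
  rw [h1, N, symM_map, symM_map]
  simp only [inc_eps, inc_el0, map_mul, evx_eps, evx_el]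

theorem map_FJ_N1 (l : Fin 3) : ((b.FJ m).map (evx q x)).N1 l = symM (evalAlg x (d1 (n := k) l (by omega) (zU q.2.2)))
    (fun i => q.1 * evalAlg x (d1 (n := k) l (by omega) (zW i q.2.2)))
    fun i j => q.1 * evalAlg x (d1 (n := k) l (by omega) (zA i j q.2.2)) := by
  refine (symM_map _ _ _ _).trans ?_
  simp only [map_mul, evx_eps, evx_el]

theorem map_FJ_S2 (l n : Fin 3) : ((b.FJ m).map (evx q x)).S2 l n = symM 0
    (fun i => evalAlg x (d2 (n := k) l n le_rfl (zW i q.2.2)))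
    fun i j => evalAlg x (d2 (n := k) l n le_rfl (zA i j q.2.2)) := by
  refine (symM_map _ _ _ _).trans ?_
  simp only [map_zero, evx_el]

theorem map_FJ_B : ((b.FJ m).map (evx q x)).B = symM (evalAlg x (algIncl (evalAn q (b.vB m))))
    (fun i => evalAlg x (algIncl (evalAn q (b.cB i))))
    fun i j => evalAlg x (d0 (n := k) (by omega) (zB i j q.2.2)) := by
  refine (symM_map _ _ _ _).trans ?_
  simp only [evx_inc, evx_el]

theorem map_FJ_B1 (l : Fin 3) : ((b.FJ m).map (evx q x)).B1 l = symM (evalAlg x (algD l (evalAn q (b.vB m))))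
    (fun i => evalAlg x (algD l (evalAn q (b.cB i))))
    fun i j => evalAlg x (d1 (n := k) l le_rfl (zB i j q.2.2)) := by
  refine (symM_map _ _ _ _).trans ?_
  simp only [evx_el]
  rfl

end Background

/-- The coordinates of the free data. -/
def freeCoord (k : ℕ) : FreeData (k + 1) →L[ℝ] DatSp k :=
  (ContinuousLinearMap.pi fun i => ContinuousLinearMap.pi fun l =>
      mapHs (symCoord i l) (k + 2) ∘L ContinuousLinearMap.fst ℝ _ _).prod
    ((ContinuousLinearMap.pi fun i => ContinuousLinearMap.pi fun l =>
      mapHs (symCoord i l) (k + 1) ∘L ContinuousLinearMap.fst ℝ _ _ ∘L ContinuousLinearMap.snd ℝ _ _).prod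
    ((ContinuousLinearMap.fst ℝ _ _ ∘L ContinuousLinearMap.snd ℝ _ _ ∘L ContinuousLinearMap.snd ℝ _ _).prod
    (ContinuousLinearMap.pi fun i => mapHsBar (coord i) (k + 1) ∘L
      ContinuousLinearMap.snd ℝ _ _ ∘L ContinuousLinearMap.snd ℝ _ _ ∘L ContinuousLinearMap.snd ℝ _ _)))

variable (d : FreeData (k + 1)) (X : UnkSp k)

theorem zA_freeCoord (i l : Fin 3) :
    zA i l ((freeCoord k d, X) : VSp k) = mapHs (symCoord i l) (k + 2) d.1 := by
  have h : zA i l ((freeCoord k d, X) : VSp k) = (1 / 2 : ℝ) • (mapHs (symCoord i l) (k + 2) d.1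
    + mapHs (symCoord l i) (k + 2) d.1) := rfl
  rw [h, symCoord_comm l i, ← two_smul ℝ, smul_smul]
  norm_num

theorem zB_freeCoord (i l : Fin 3) :
    zB i l ((freeCoord k d, X) : VSp k) = mapHs (symCoord i l) (k + 1) d.2.1 := by
  have h : zB i l ((freeCoord k d, X) : VSp k) = (1 / 2 : ℝ) • (mapHs (symCoord i l) (k + 1) d.2.1
    + mapHs (symCoord l i) (k + 1) d.2.1) := rfl
  rw [h, symCoord_comm l i, ← two_smul ℝ, smul_smul]
  norm_num

theorem zNu_freeCoord (i : Fin 3) :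
    zNu i ((freeCoord k d, X) : VSp k) = mapHs (coord i) (k + 1) d.2.2.2.1 := rfl

end

/-! ### The actual Sobolev fields solve the constraints. -/

section

open Filter Topology

variable {k : ℕ} [Fact (2 ≤ k)]

theorem ae_symMat {j : ℕ} (u : Hs j ℝ) (w : Fin 3 → Hs j ℝ) (c : Hs j Sym3) : ∀ᵐ x ∂torusMeasure, ∀ α,
    symMat (weakD u α x) (weakD (packHs j w) α x) (weakD c α x) = symM (weakD u α x)
      (fun i => weakD (w i) α x) fun i l => weakD (mapHs (symCoord i l) j c) α x := by
  have h1 : ∀ᵐ x ∂torusMeasure, ∀ α i l, weakD (mapHs (symCoord i l) j c) α x = symCoord i l (weakD c α x) :=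
    ae_all_iff.2 fun α => ae_all_iff.2 fun i => ae_all_iff.2 fun l => weakD_mapHs _ _ _
  filter_upwards [ae_all_iff.2 fun α => weakD_packHs w α, h1] with x h2 h3 α
  rw [symMat_eq]
  congr 1
  · exact funext (h2 α)
  · exact funext fun i => funext fun l => (h3 α i l).symm

theorem ae_symMat_smul {j : ℕ} (ε : ℝ) (u : Hs j ℝ) (w : Fin 3 → Hs j ℝ) (c : Hs j Sym3) :
    ∀ᵐ x ∂torusMeasure, ∀ α,
    symMat (weakD u α x) (weakD (ε • packHs j w) α x) (ε • weakD c α x) = symM (weakD u α x)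
      (fun i => ε * weakD (w i) α x) fun i l => ε * weakD (mapHs (symCoord i l) j c) α x := by
  have h1 : ∀ᵐ x ∂torusMeasure, ∀ α i l, weakD (mapHs (symCoord i l) j c) α x = symCoord i l (weakD c α x) :=
    ae_all_iff.2 fun α => ae_all_iff.2 fun i => ae_all_iff.2 fun l => weakD_mapHs _ _ _
  have h4 : ∀ᵐ x ∂torusMeasure, ∀ α, weakD (ε • packHs j w) α x = ε • weakD (packHs j w) α x :=
    ae_all_iff.2 fun α => weakD_smul ε (packHs j w) α
  filter_upwards [ae_all_iff.2 fun α => weakD_packHs w α, h1, h4] with x h2 h3 h5 α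
  rw [symMat_eq, h5]
  congr 1
  · funext i
    rw [← h2 α i]
    rfl
  · funext i l
    rw [h3 α i l, ← smul_eq_mul, ← map_smul]
    rfl

namespace Background

variable {b : Background}

/-- The fields built from a solution of the fixed point equation solve the constraints. -/
theorem solvesConstraints (P : Params) {T₀ : ℝ} (hL : 0 < P.Lam) (hK : 0 ≤ P.K) (hr : 0 < P.rho1)
    (ht : 0 < T₀) (ht1 : T₀ ≤ 1) (hb : b = ofParams P hL hK hr ht ht1) {s : ℝ} (m : OB k)
    (d : FreeData (k + 1)) (X : UnkSp k) {ε : ℝ} (hε : ε ≠ 0) (tv : Alg (k + 1)) (tc : Fin 3 → Alg (k + 1))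
    {Q : ℝ × ParSp k × VSp k} (hQ : Q = (ε, d.2.2.1, ε • (freeCoord k d, X)))
    (hv : evalAn Q (b.vB m) = ε • tv) (hc : ∀ i, evalAn Q (b.cB i) = ε • tc i)
    (h : ∀ x, b.SolvesAt P T₀ s m Q x) :
    SolvesConstraints P T₀ ε s X.1.1 (ε • packBar (k + 2) X.2.1).1 d.1 (algEquiv tv)
      (packHs (k + 1) fun i => algEquiv (tc i)) d.2.1
      (fun x => rhoH P ε T₀ + weakD d.2.2.1.1 0 x + ε * X.2.2.1)
      (fun x => (rhoH P ε T₀ + weakD d.2.2.1.1 0 x + ε * X.2.2.1)⁻¹ •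
        (weakD d.2.2.2.1 0 x + WithLp.toLp 2 X.2.2.2)) := by
  -- Every coordinate of ζ is ε times the corresponding field.
  have hzU : zU Q.2.2 = ε • X.1.1 := by rw [hQ, map_smul]; rfl
  have hzW : ∀ i, zW i Q.2.2 = ε • (X.2.1 i).1 := fun i => by rw [hQ, map_smul]; rfl
  have hzA : ∀ i l, zA i l Q.2.2 = ε • mapHs (symCoord i l) (k + 2) d.1 := fun i l => by
    rw [hQ, map_smul, zA_freeCoord]
  have hzB : ∀ i l, zB i l Q.2.2 = ε • mapHs (symCoord i l) (k + 1) d.2.1 := fun i l => by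
    rw [hQ, map_smul, zB_freeCoord]
  have hzN : ∀ i, zNu i Q.2.2 = ε • mapHs (coord i) (k + 1) d.2.2.2.1 := fun i => by
    rw [hQ, map_smul, zNu_freeCoord]
  have hQ1 : Q.1 = ε := by rw [hQ]
  have hw : (ε • packBar (k + 2) X.2.1).1 = ε • packHs (k + 2) (fun i => (X.2.1 i).1) := by
    rw [← packBar_val]; rfl
  rw [hw]
  filter_upwards [ae_symMat_smul ε X.1.1 (fun i => (X.2.1 i).1) d.1,
    ae_symMat (algEquiv tv) (fun i => algEquiv (tc i)) d.2.1,
    ae_jet_one (k := k) (by omega) X.1.1, ae_jet_two (k := k) le_rfl X.1.1,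
    eventually_all.2 fun i => ae_jet_one (k := k) (by omega) (X.2.1 i).1,
    eventually_all.2 fun i => ae_jet_two (k := k) le_rfl (X.2.1 i).1,
    eventually_all.2 fun i => eventually_all.2 fun l =>
      ae_jet_one (k := k) (by omega) (mapHs (symCoord i l) (k + 2) d.1),
    eventually_all.2 fun i => eventually_all.2 fun l =>
      ae_jet_two (k := k) le_rfl (mapHs (symCoord i l) (k + 2) d.1),
    eventually_all.2 fun i => eventually_all.2 fun l =>
      ae_jet_one (k := k) le_rfl (mapHs (symCoord i l) (k + 1) d.2.1),
    ae_jet_one (k := k) le_rfl (algEquiv tv), eventually_all.2 fun i => ae_jet_one (k := k) le_rfl (algEquiv (tc i)),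
    ae_jet_one (k := k) le_rfl d.2.2.1.1,
    eventually_all.2 fun i => ae_jet_one (k := k) le_rfl (mapHs (coord i) (k + 1) d.2.2.2.1),
    weakD_coord d.2.2.2.1 0]
    with x hA hB hU hU2 hW hW2 hc1 hc2 hd hv1 hc3 hρ hν hν'
  obtain ⟨hpos, vt, hvt, hsol⟩ := h x
  have hρx : evx Q x b.rho = rhoH P ε T₀ + weakD d.2.2.1.1 0 x + ε * X.2.2.1 := by
    rw [hρ.1, rho, map_add, map_add, evx_scal, evx_par, evx_lin, hQ1]
    congr 1
    · congr 1
      · rw [hb]; rfl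
      · rw [hQ]; rfl
    · have h2 : zPhi Q.2.2 = ε * X.2.2.1 := by rw [hQ, map_smul]; rfl
      rw [ContinuousLinearMap.comp_apply, h2]
      exact evalAlg_const x _
  have hmom : ∀ i, evx Q x (mom i) = ε * (weakD d.2.2.2.1 0 x + WithLp.toLp 2 X.2.2.2) i := fun i => by
    have h2 : zPsi i Q.2.2 = ε * X.2.2.2 i := by rw [hQ, map_smul]; rfl
    have h3 : evalAlg x (algebraMapCLM ℝ (Alg k) (zPsi i Q.2.2)) = zPsi i Q.2.2 := evalAlg_const x _
    have h4 : weakD (mapHs (coord i) (k + 1) d.2.2.2.1) 0 x = weakD d.2.2.2.1 0 x i := hν' i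
    rw [mom, map_add, evx_el, evx_lin, ContinuousLinearMap.comp_apply, h3, h2, hzN, map_smul, map_smul,
      ← (hν i).1, h4, PiLp.add_apply, smul_eq_mul]
    ring
  rw [hρx] at hpos hsol
  refine ⟨hpos, vt, hvt, fun W hW0 => ?_⟩
  rw [hQ1] at hsol
  refine hsol _ _ W (fun α => symMat_transpose _ _ _) (fun α => symMat_transpose _ _ _) hW0 ?_ (fun l => ?_) ?_
    (fun l => ?_) (fun l n => ?_) _ ?_
  · rw [hA, map_FJ_N, smul_symM]
    simp only [hzU, hzW, hzA, hQ1, map_smul, smul_eq_mul, hU.1, (hW _).1, (hc1 _ _).1]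
  · rw [hA, map_FJ_N1, smul_symM]
    simp only [hzU, hzW, hzA, hQ1, map_smul, smul_eq_mul, hU.2, (hW _).2, (hc1 _ _).2]
  · rw [hB, map_FJ_B, smul_symM]
    simp only [hzB, hv, hc, map_smul, smul_eq_mul, hv1.1, (hc3 _).1, (hd _ _).1, algIncl_apply]
  · rw [hB, map_FJ_B1, smul_symM]
    simp only [hzB, hv, hc, map_smul, smul_eq_mul, hv1.2, (hc3 _).2, (hd _ _).2]
    rfl
  -- The 00 entry, absent from `S2`, is restored by the diagonal term, in which ε⁻¹ cancels the
  -- factor ε of `zU`.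
  · rw [hA, map_FJ_S2, ← symM_zero, symM_add]
    simp only [hzU, hzW, hzA, map_smul, smul_eq_mul, hU2, hW2, hc2, add_zero, zero_add, inv_mul_cancel_left₀ hε]
  · congr 1
    funext i
    rw [hmom, PiLp.smul_apply, smul_eq_mul]
    ring

end Background

end

/-! ### Bounds in terms of the size of the free data, and the assembly of the theorem. -/

section

open Filter Topology

theorem norm_le_freeSize {s : ℕ} (d : FreeData s) : ‖d‖ ≤ freeSize d := by
  have h1 := norm_nonneg d.1
  have h2 := norm_nonneg d.2.1
  have h3 := norm_nonneg d.2.2.1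
  have h4 := norm_nonneg d.2.2.2
  rw [Prod.norm_def, Prod.norm_def, Prod.norm_def, freeSize]
  exact max_le (by linarith) (max_le (by linarith) (max_le (by linarith) (by linarith)))

theorem IsLinFam.le_freeSize {s : ℕ} {F : Type*} [NormedAddCommGroup F] [NormedSpace ℝ F]
    {D : Set (ℝ × FreeData s)} {f : ℝ × FreeData s → F} (h : IsLinFam D f) :
    ∃ C, ∀ q ∈ D, ‖f q‖ ≤ C * freeSize q.2 := by
  obtain ⟨C, hC⟩ := h.bound
  refine ⟨|C|, fun q hq => (hC q hq).trans ?_⟩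
  exact mul_le_mul (le_abs_self C) (norm_le_freeSize _) (norm_nonneg _) (abs_nonneg C)

theorem norm_lt_of_mem_dataDomain {s : ℕ} {ε₀ r R : ℝ} (hr : 0 < r) (hR : 0 < R) {q : ℝ × FreeData s}
    (hq : q ∈ dataDomain s ε₀ r R) : ‖q.2‖ < r + R := by
  obtain ⟨-, h1, h2, h3, h4⟩ := hq
  rw [Prod.norm_def, Prod.norm_def, Prod.norm_def]
  exact max_lt (by linarith) (max_lt (by linarith) (max_lt (by linarith) (by linarith)))

variable {k : ℕ} [Fact (2 ≤ k)]

/-- The density component of the free data. -/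
def densityPart (k : ℕ) : FreeData (k + 1) →L[ℝ] ParSp k :=
  ContinuousLinearMap.fst ℝ _ _ ∘L ContinuousLinearMap.snd ℝ _ _ ∘L ContinuousLinearMap.snd ℝ _ _

theorem IsLinFam.packHs {E : Type*} [NormedAddCommGroup E] [NormedSpace ℝ E] {D : Set (ℝ × E)} {j : ℕ}
    {f : Fin 3 → ℝ × E → Hs j ℝ} (h : ∀ i, IsLinFam D (f i)) :
    IsLinFam D (fun q => NewtonCosmo.packHs j fun i => f i q) := by
  have e : (fun q => NewtonCosmo.packHs j fun i => f i q) = fun q =>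
      mapHs (axis 0) j (f 0 q) + mapHs (axis 1) j (f 1 q) + mapHs (axis 2) j (f 2 q) := by
    funext q
    simp only [NewtonCosmo.packHs, Fin.sum_univ_three]
    rfl
  rw [e]
  exact (((h 0).clm _).add ((h 1).clm _)).add ((h 2).clm _)

theorem isInvLaplacian_algInvLap (f : HsBar (k + 1) ℝ) :
    IsInvLaplacian (algInvLap (d0 (n := k) (Nat.le_succ k) (incHs f))) f := by
  have h := isInvLaplacian_invLap (Nat.le_succ k) f
  have e : algInvLap (d0 (n := k) (Nat.le_succ k) (incHs f)) = invLap k (derivOp 0 (by simp) f.1) :=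
    congrArg (invLap k) ((algEquiv (k := k)).apply_symm_apply _)
  rw [e]
  exact h

end

end

end NewtonCosmo

theorem theorem6p1 (s : ℕ) (hs : (3 : ℝ) / 2 + 1 < s) (P : Params)
    (hLam : 0 < P.Lam) (hK : 0 < P.K) (hK' : P.K ≤ 1 / 3) (hrho : 0 < P.rho1)
    (T₀ : ℝ) (hT₀ : 0 < T₀) (hT₀' : T₀ ≤ 1) (τ : ℝ) (hτ : τ = 1 ∨ τ = -1) :
    ∃ r₀ > 0, ∀ r, 0 < r → r ≤ r₀ → ∀ R > 0, ∃ ε₀ > 0,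
      ∃ (φ : ℝ × FreeData s → ℝ) (ψ : ℝ × FreeData s → R3)
        (u00 : ℝ × FreeData s → HsBar (s + 1) ℝ) (u0 : ℝ × FreeData s → HsBar (s + 1) R3)
        (v00 : ℝ × FreeData s → Hs s ℝ) (v0 : ℝ × FreeData s → Hs s R3),
        -- analyticity
        (AnalyticMap ε₀ r R φ ∧ AnalyticMap ε₀ r R ψ ∧
          AnalyticMap ε₀ r R u00 ∧ AnalyticMap ε₀ r R u0 ∧
          AnalyticMap ε₀ r R v00 ∧
          AnalyticMap ε₀ r R v0) ∧
        -- vanishing for trivial free data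
        (∀ ε : ℝ, |ε| < ε₀ → φ (ε, 0) = 0 ∧ ψ (ε, 0) = 0 ∧ u00 (ε, 0) = 0 ∧ u0 (ε, 0) = 0 ∧
          v00 (ε, 0) = 0 ∧ v0 (ε, 0) = 0) ∧
        -- the constraints
        (∀ (ε : ℝ) (uij : Hs (s + 1) Sym3) (vij : Hs s Sym3) (ρ₀ : HsBar s ℝ) (ν : HsBar s R3),
          (ε, uij, vij, ρ₀, ν) ∈ dataDomain s ε₀ r R → ε ≠ 0 →
          let q : ℝ × FreeData s := (ε, uij, vij, ρ₀, ν)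
          let ρ : T3 → ℝ := fun x => rhoH P ε T₀ + weakD ρ₀.1 0 x + ε * φ q
          let z : T3 → R3 := fun x => (ρ x)⁻¹ • (weakD ν.1 0 x + ψ q)
          SolvesConstraints P T₀ ε τ (u00 q).1 (u0 q).1 uij (v00 q) (v0 q) vij ρ z) ∧
        -- the uniform linear estimate
        (∃ C : ℝ, ∀ q ∈ dataDomain s ε₀ r R,
          |φ q| + ‖ψ q‖ + (‖u00 q‖ + ‖u0 q‖) + (‖v00 q‖ + ‖v0 q‖) ≤ C * freeSize q.2) ∧
        -- the expansions
        (∃ (Sφ : ℝ × FreeData s → ℝ) (Sψ : ℝ × FreeData s → R3)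
          (S00 : ℝ × FreeData s → HsBar (s + 1) ℝ) (S0 : ℝ × FreeData s → HsBar (s + 1) R3),
          (AnalyticMap ε₀ r R Sφ ∧ AnalyticMap ε₀ r R Sψ ∧
            AnalyticMap ε₀ r R S00 ∧
            AnalyticMap ε₀ r R S0) ∧
          (∀ ε : ℝ, |ε| < ε₀ →
            Sφ (ε, 0) = 0 ∧ Sψ (ε, 0) = 0 ∧ S00 (ε, 0) = 0 ∧ S0 (ε, 0) = 0) ∧
          ∀ q ∈ dataDomain s ε₀ r R,
            φ q = q.1 * Sφ q ∧ ψ q = q.1 • Sψ q ∧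
            (∃ w : HsBar (s + 1) ℝ, IsInvLaplacian w q.2.2.2.1 ∧
              u00 q = (2 * P.Lam / (3 * T₀ ^ 2) * Efac P q.1 T₀ ^ 2) • w + q.1 • S00 q) ∧
            u0 q = q.1 • S0 q) := by
  -- With s = k + 1 the fields lie in H^{k+2}, their time derivatives and the densities in H^{k+1},
  -- and the equations in H^k. The bound s > 5/2 gives k ≥ 2, so that H^k is an algebra.
  obtain ⟨k, rfl⟩ : ∃ k, s = k + 1 := ⟨s - 1, by
    have : 2 < s := by
      have h1 : (2 : ℝ) < s := by linarith
      exact_mod_cast h1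
    omega⟩
  have hfact : Fact (2 ≤ k) := ⟨by
    push_cast at hs
    have h1 : (1 : ℝ) < k := by linarith
    exact_mod_cast h1⟩
  have hτ2 : τ ^ 2 = 1 := by rcases hτ with h | h <;> rw [h] <;> norm_num
  obtain ⟨v, m, δ, hδ, hmain⟩ := Background.exists_solution_families (k := k) P hLam hK.le hrho hT₀ hT₀' hτ2 _ rfl
    (densityPart k) (freeCoord k) (fun d ε X => map_smul incHs ε d.2.2.1)
  set b := Background.ofParams P hLam hK.le hrho hT₀ hT₀' with hb
  -- The density is the unscaled parameter of the fixed point equation, so its radius must stay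
  -- below δ, independently of R.
  refine ⟨δ, hδ, fun r hr hrδ R hR => ?_⟩
  have hZ : 0 < (‖freeCoord k‖ + 1) * (r + R) := by positivity
  -- The second bound ensures that ε times the coordinates of the data has norm below δ; the 1 keeps
  -- the denominator positive.
  refine ⟨min δ (δ / ((‖freeCoord k‖ + 1) * (r + R))), lt_min hδ (div_pos hδ hZ), ?_⟩
  set ε₀ := min δ (δ / ((‖freeCoord k‖ + 1) * (r + R))) with hε₀
  set D := dataDomain (k + 1) ε₀ r R
  have hDε : ∀ q ∈ D, |q.1| < δ := fun q hq => hq.1.trans_le (min_le_left _ _)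
  have hDn : ∀ q ∈ D, ‖q.2‖ ≤ r + R := fun q hq => (norm_lt_of_mem_dataDomain hr hR hq).le
  obtain ⟨X, g, tv, tc, hX, hg, htv, htc, hsol⟩ := hmain D ⟨_, hDn⟩ (fun q hq => by
    refine ⟨hDε q hq, hq.2.2.2.1.trans_le hrδ, ?_⟩
    have h1 : ‖freeCoord k q.2‖ ≤ (‖freeCoord k‖ + 1) * (r + R) :=
      (freeCoord k).le_of_opNorm_le_of_le (le_add_of_nonneg_right zero_le_one) (hDn q hq)
    have h2 : |q.1| < δ / ((‖freeCoord k‖ + 1) * (r + R)) := hq.1.trans_le (min_le_right _ _)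
    rw [norm_smul]
    calc |q.1| * ‖freeCoord k q.2‖ ≤ |q.1| * ((‖freeCoord k‖ + 1) * (r + R)) := by gcongr
      _ < δ := (lt_div_iff₀ hZ).1 h2)
  have hDε' : ∀ q ∈ D, |q.1| ≤ δ := fun q hq => (hDε q hq).le
  have cφ : ∀ Y : ℝ × FreeData (k + 1) → UnkSp k, IsLinFam D Y → IsLinFam D (fun q => (Y q).2.2.1) := fun Y hY =>
    hY.clm (ContinuousLinearMap.fst ℝ _ _ ∘L ContinuousLinearMap.snd ℝ _ _ ∘L ContinuousLinearMap.snd ℝ _ _)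
  have cψ : ∀ Y : ℝ × FreeData (k + 1) → UnkSp k, IsLinFam D Y →
      IsLinFam D (fun q => (WithLp.toLp 2 (Y q).2.2.2 : R3)) := fun Y hY =>
    hY.clm ((PiLp.continuousLinearEquiv 2 ℝ fun _ : Fin 3 => ℝ).symm.toContinuousLinearMap ∘L
      ContinuousLinearMap.snd ℝ _ _ ∘L ContinuousLinearMap.snd ℝ _ _ ∘L ContinuousLinearMap.snd ℝ _ _)
  have cu : ∀ Y : ℝ × FreeData (k + 1) → UnkSp k, IsLinFam D Y → IsLinFam D (fun q => (Y q).1) := fun Y hY =>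
    hY.clm (ContinuousLinearMap.fst ℝ _ _)
  have hS0 : IsLinFam D (fun q => packBar (k + 2) (X q).2.1) :=
    hX.clm (packBar (k + 2) ∘L ContinuousLinearMap.fst ℝ _ _ ∘L ContinuousLinearMap.snd ℝ _ _)
  have hu0 := hS0.fst_smul hDε'
  have hv00 : IsLinFam D (fun q => algEquiv (tv q)) := htv.clm (algEquiv (k := k + 1)).toContinuousLinearMap
  have hv0 : IsLinFam D (fun q => packHs (k + 1) fun i => algEquiv (tc i q)) :=
    IsLinFam.packHs fun i => (htc i).clm (algEquiv (k := k + 1)).toContinuousLinearMap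
  -- The unknown w is multiplied by ε to give u^{0i}, which is already its expansion with w as the
  -- coefficient.
  refine ⟨fun q => (X q).2.2.1, fun q => WithLp.toLp 2 (X q).2.2.2, fun q => (X q).1,
    fun q => q.1 • packBar (k + 2) (X q).2.1, fun q => algEquiv (tv q),
    fun q => packHs (k + 1) fun i => algEquiv (tc i q), ?_, ?_, ?_, ?_, ?_⟩
  · exact ⟨(cφ X hX).analyticOnNhd, (cψ X hX).analyticOnNhd, (cu X hX).analyticOnNhd, hu0.analyticOnNhd,
      hv00.analyticOnNhd, hv0.analyticOnNhd⟩
  · exact fun ε _ => ⟨(cφ X hX).apply_zero ε, (cψ X hX).apply_zero ε, (cu X hX).apply_zero ε, hu0.apply_zero ε,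
      hv00.apply_zero ε, hv0.apply_zero ε⟩
  · intro ε uij vij ρ₀ ν hq hε
    obtain ⟨-, h2, h3, h4⟩ := hsol _ hq
    exact Background.solvesConstraints P hLam hK.le hrho hT₀ hT₀' hb m (uij, vij, ρ₀, ν) _ hε _ _ rfl h2 h3 (h4 hε)
  · obtain ⟨C1, h1⟩ := (cφ X hX).le_freeSize
    obtain ⟨C2, h2⟩ := (cψ X hX).le_freeSize
    obtain ⟨C3, h3⟩ := (cu X hX).le_freeSize
    obtain ⟨C4, h4⟩ := hu0.le_freeSize
    obtain ⟨C5, h5⟩ := hv00.le_freeSize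
    obtain ⟨C6, h6⟩ := hv0.le_freeSize
    refine ⟨C1 + C2 + (C3 + C4) + (C5 + C6), fun q hq => ?_⟩
    simp only [add_mul]
    exact add_le_add (add_le_add (add_le_add (h1 q hq) (h2 q hq)) (add_le_add (h3 q hq) (h4 q hq)))
      (add_le_add (h5 q hq) (h6 q hq))
  · refine ⟨fun q => (g q).2.2.1, fun q => WithLp.toLp 2 (g q).2.2.2, fun q => (g q).1,
      fun q => packBar (k + 2) (X q).2.1, ⟨(cφ g hg).analyticOnNhd, (cψ g hg).analyticOnNhd,
        (cu g hg).analyticOnNhd, hS0.analyticOnNhd⟩, fun ε _ => ⟨(cφ g hg).apply_zero ε, (cψ g hg).apply_zero ε,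
        (cu g hg).apply_zero ε, hS0.apply_zero ε⟩, fun q hq => ?_⟩
    have h1 := (hsol q hq).1
    -- The operator L has zero φ and ψ rows, and its u^{00} row is the multiple of Δ⁻¹ρ̆₀;
    -- everything else in these rows is ε times g.
    rw [Background.rowL_apply] at h1
    refine ⟨?_, ?_, ⟨_, isInvLaplacian_algInvLap q.2.2.2.1, ?_⟩, rfl⟩
    · exact (congrArg (fun Y : UnkSp k => Y.2.2.1) h1).trans (zero_add _)
    · exact congrArg (WithLp.toLp 2) ((congrArg (fun Y : UnkSp k => Y.2.2.2) h1).trans (zero_add _))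
    · refine (congrArg (fun Y : UnkSp k => Y.1) h1).trans ?_
      refine congrArg (· + q.1 • (g q).1) ?_
      have e1 : 2 * P.Lam / 3 * T₀⁻¹ ^ 2 * Efac P q.1 T₀ ^ 2 = 2 * P.Lam / (3 * T₀ ^ 2) * Efac P q.1 T₀ ^ 2 := by
        field_simp
      exact congrArg (· • algInvLap (d0 (n := k) (Nat.le_succ k) (incHs q.2.2.2.1))) e1
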